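/- Let $\mathbb T=\{w\in\mathbb C:|w|=1\}$, $\theta>0$ and $d\ge 1$. For each $n$ let $\sigma\in S_n$ be a random permutation with the Ewens distribution of parameter $\theta$, i.e. $P(\sigma)=\theta^{l_\sigma}/(\theta(\theta+1)\cdots(\theta+n-1))$, where $l_\sigma$ is the number of cycles of $\sigma$, and let $C_m$ be the number of cycles of length $m$ of $\sigma$. Let $f_1,\dots,f_d:\mathbb T\to\mathbb C$ be real analytic and not identically zero, let $z=(z_1,\dots,z_d)$ be a $\mathbb T^d$-valued random variable, and let $x_j=e^{2\pi i\varphi_j}$ with $\varphi_j\in\mathbb R$ be such that $1,\varphi_1,\dots,\varphi_d$ are linearly independent over $\mathbb Z$. Let $T^{(m,k)}=(T^{(m,k)}_1,\dots,T^{(m,k)}_d)$, $m,k\ge1$, be independent random vectors, independent of $\sigma$, such that $T^{(m,k)}$ is distributed as the componentwise product of $m$ i.i.d. copies of $z$. Put $$w^{2,n}(f_j)(x_j)=\sum_{m=1}^n\sum_{k=1}^{C_m}\log f_j\bigl(x_j^mT^{(m,k)}_j\bigr),$$ where $\log$ is the principal branch, with $\log(-y)=\log y+i\pi$ for $y>0$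 (and any fixed value at $0$), and let $\arg$ be its imaginary part. A vector $\psi\in\mathbb R^2$ is of finite type if there are $K>0$ and $\gamma\ge1$ with $\operatorname{dist}(q\cdot\psi,\mathbb Z)\ge K/\|q\|_\infty^{\gamma}$ for all $q\in\mathbb Z^2\setminus\{0\}$; $x_1,\dots,x_d$ are pairwise of finite type if $(\varphi_j,\varphi_\ell)$ is of finite type for all $j\ne\ell$. Suppose that one of the following conditions holds: (i) $z_1,\dots,z_d$ are independent and uniformly distributed on $\mathbb T$; (ii) $d\ge2$ and, for all $j\neq\ell$, the joint law of $(z_j,z_\ell)$ is absolutely continuous, with a density with respect to Lebesgue measure in the coordinates $(\phi_j,\phi_\ell)\in[0,1]^2$, $(z_j,z_\ell)=(e^{2\pi i\phi_j},e^{2\pi i\phi_\ell})$, of the form $g_{j,\ell}(\phi_j,\phi_\ell)=\sum_{a,b\in\mathbb Z}c_{a,b}e^{2\pi i(a\phi_j+b\phi_\ell)}$ with $\sum_{a,b}|c_{a,b}|<\infty$ (the $c_{a,b}$ may depend on $j,\ell$); (iii) $d\ge2$, $z_j\equiv1$ almost surely and all zeros of $f_j$ are roots of unity for every $j$, and $x_1,\dots,x_d$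 are pairwise of finite type; (iv) $d\ge2$, all zeros of $f_j$ are roots of unity for every $j$, $x_1,\dots,x_d$ are pairwise of finite type, and there are integers $\rho_j\ge1$ such that $z_j^{\rho_j}=1$ almost surely and, for all $j\ne\ell$ and all integers $0\le k_1<\rho_j$, $0\le k_2<\rho_\ell$, $$P\bigl(z_j=e^{2\pi ik_1/\rho_j},\,z_\ell=e^{2\pi ik_2/\rho_\ell}\bigr)=\frac1{\rho_j\rho_\ell}\sum_{a=0}^{\rho_j-1}\sum_{b=0}^{\rho_\ell-1}c_{a,b}\,e^{2\pi i(ak_1/\rho_j+bk_2/\rho_\ell)},$$ where the $c_{a,b}$ (which may depend on $j,\ell$) satisfy $\sum_{a=0}^{\rho_j-1}|c_{a,b}|<1$ for every $b\ne0$ and $\sum_{b=0}^{\rho_\ell-1}|c_{a,b}|<1$ for every $a\neq0$. Then, as $n\to\infty$, $$\left(\frac{w^{2,n}(f_j)(x_j)}{\sqrt{\log n}}-\theta\sqrt{\log n}\;m(f_j)\right)_{1\le j\le d}\ \xrightarrow{\ d\ }\ N=(N_1,\dots,N_d),\qquad m(f)=\int_0^1\log f(e^{2\pi iu})\,du,$$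 where $N$ is a centred $d$-variate complex normal vector (all real and imaginary parts are jointly Gaussian) with, for $j\ne\ell$, $$\operatorname{Cov}(\Re N_j,\Re N_\ell)=\theta\int_{[0,1]^2}\log|f_j(e^{2\pi iu})|\,\log|f_\ell(e^{2\pi iv})|\,du\,dv,$$ $$\operatorname{Cov}(\Re N_j,\Im N_\ell)=\theta\int_{[0,1]^2}\log|f_j(e^{2\pi iu})|\,\arg f_\ell(e^{2\pi iv})\,du\,dv,$$ $$\operatorname{Cov}(\Im N_j,\Im N_\ell)=\theta\int_{[0,1]^2}\arg f_j(e^{2\pi iu})\,\arg f_\ell(e^{2\pi iv})\,du\,dv,$$ and, for each $j$, $$\operatorname{Var}(\Re N_j)=\theta\int_0^1\log^2|f_j(e^{2\pi iu})|\,du,\qquad \operatorname{Var}(\Im N_j)=\theta\int_0^1\arg^2 f_j(e^{2\pi iu})\,du,$$ $$\operatorname{Cov}(\Re N_j,\Im N_j)=\theta\int_0^1\log|f_j(e^{2\pi iu})|\,\arg f_j(e^{2\pi iu})\,du.$$ -/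

import Mathlib

open MeasureTheory ProbabilityTheory Filter Real

noncomputable section

/-- The Borel σ-algebra on the unit circle `𝕋`. -/
instance circleMeasurableSpace : MeasurableSpace Circle := borel Circle

instance circleBorelSpace : BorelSpace Circle := ⟨rfl⟩

/-- The discrete σ-algebra on the symmetric group `S_n`. -/
instance permMeasurableSpace (n : ℕ) : MeasurableSpace (Equiv.Perm (Fin n)) := ⊤

/-- The point `e^{2πit}` of the unit circle. -/
def circlePoint (t : ℝ) : Circle := Circle.exp (2 * π * t)

/-- `C_m(σ)`: the number of cycles of length `m` of `σ` (fixed points are cycles of length `1`). -/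
def cycleCount {n : ℕ} (σ : Equiv.Perm (Fin n)) (m : ℕ) : ℕ := σ.partition.parts.count m

/-- The total number of cycles of `σ`, fixed points included. -/
def totalCycles {n : ℕ} (σ : Equiv.Perm (Fin n)) : ℕ := Multiset.card σ.partition.parts

/-- The Ewens distribution with parameter `θ` on `S_n`, giving `σ` the mass
`θ ^ totalCycles σ / (θ (θ + 1) ⋯ (θ + n - 1))`. -/
def ewensMeasure (θ : ℝ) (n : ℕ) : Measure (Equiv.Perm (Fin n)) :=
  ∑ σ : Equiv.Perm (Fin n),
    ENNReal.ofReal (θ ^ totalCycles σ / ∏ i ∈ Finset.range n, (θ + i)) • Measure.dirac σ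

/-- The uniform distribution on the unit circle: the law of `e^{2πiU}`, `U` uniform on `[0,1]`. -/
def uniformCircle : Measure Circle :=
  (volume.restrict (Set.Icc (0 : ℝ) 1)).map circlePoint

/-- The law of `(∏_{i ≤ m} z_1^{(i)}, …, ∏_{i ≤ m} z_d^{(i)})`, where
`z^{(1)}, …, z^{(m)}` are i.i.d. random vectors with law `ν` on `𝕋^d`. -/
def productLaw {d : ℕ} (ν : Measure (Fin d → Circle)) (m : ℕ) : Measure (Fin d → Circle) :=
  (Measure.pi (fun _ : Fin m => ν)).map (fun z j => ∏ i, z i j)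

/-- `f : 𝕋 → ℂ` is real analytic: `t ↦ f (e^{2πit})` is a real analytic function on `ℝ`. -/
def IsRealAnalyticOnCircle (f : Circle → ℂ) : Prop :=
  ∀ t : ℝ, AnalyticAt ℝ (fun s : ℝ => f (circlePoint s)) t

/-- All zeros of `f : 𝕋 → ℂ` are roots of unity. -/
def ZerosAreRootsOfUnity (f : Circle → ℂ) : Prop :=
  ∀ w : Circle, f w = 0 → ∃ k : ℕ, 0 < k ∧ w ^ k = 1

/-- `w^{2,n}(f)(x)`, the logarithm of the second multiplicative class function
`∏_{m ≤ n} ∏_{k ≤ C_m} f (x^m T_{m,k})`, with the principal branch of the logarithm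
(`log (-y) = log y + iπ` for `y > 0`) in each factor.
For each `m` the variables `T_{m,k}` are numbered from `k = 0`. -/
def w2 {n : ℕ} (f : Circle → ℂ) (x : Circle) (σ : Equiv.Perm (Fin n))
    (T : ℕ → ℕ → Circle) : ℂ :=
  ∑ m ∈ Finset.Icc 1 n, ∑ k ∈ Finset.range (cycleCount σ m), Complex.log (f (x ^ m * T m k))

/-- `m(f) = ∫_0^1 log f(e^{2πit}) dt`. -/
def meanLog (f : Circle → ℂ) : ℂ := ∫ t in (0 : ℝ)..1, Complex.log (f (circlePoint t))

/-- `log |f(e^{2πit})|`. -/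
def logAbs (f : Circle → ℂ) (t : ℝ) : ℝ := Real.log ‖f (circlePoint t)‖

/-- `arg f(e^{2πit})`, the principal argument. -/
def argOf (f : Circle → ℂ) (t : ℝ) : ℝ := Complex.arg (f (circlePoint t))

/-- `φ` is of finite type: `‖q · φ‖ ≥ K / |q|_∞ ^ γ` for all nonzero integer vectors `q`, where
`‖·‖` is the distance to the nearest integer. -/
def IsFiniteType {d : ℕ} (φ : Fin d → ℝ) : Prop :=
  ∃ K : ℝ, 0 < K ∧ ∃ γ : ℝ, 1 ≤ γ ∧ ∀ q : Fin d → ℤ, q ≠ 0 →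
    K / ‖q‖ ^ γ ≤ |∑ i, (q i : ℝ) * φ i - round (∑ i, (q i : ℝ) * φ i)|

/-- `φ_1, …, φ_d` are pairwise of finite type. -/
def PairwiseFiniteType {d : ℕ} (φ : Fin d → ℝ) : Prop :=
  ∀ j l : Fin d, j ≠ l → IsFiniteType ![φ j, φ l]

section Conditions

variable {d : ℕ} {Ω₀ : Type*} [MeasurableSpace Ω₀]

/-- `z_1, …, z_d` are independent and uniformly distributed on `𝕋`. -/
def IndependentUniform (Q : Measure Ω₀) (z : Ω₀ → Fin d → Circle) : Prop :=
  (∀ j, HasLaw (fun ω => z ω j) uniformCircle Q) ∧ iIndepFun (fun j ω => z ω j) Q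

/-- For `j ≠ l` the pair `(z_j, z_l)` has a density on `[0,1]²` (in the coordinates
`(u, v) ↦ (e^{2πiu}, e^{2πiv})`) that is an absolutely convergent Fourier series. -/
def PairwiseSummableDensity (Q : Measure Ω₀) (z : Ω₀ → Fin d → Circle) : Prop :=
  ∀ j l : Fin d, j ≠ l → ∃ (g : ℝ × ℝ → NNReal) (c : ℤ × ℤ → ℂ),
    (Summable fun q => ‖c q‖) ∧
    (∀ u v : ℝ, ((g (u, v) : ℝ) : ℂ) =
      ∑' q : ℤ × ℤ, c q * Complex.exp (2 * π * Complex.I * (q.1 * u + q.2 * v))) ∧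
    Q.map (fun ω => (z ω j, z ω l)) =
      ((volume.restrict (Set.Icc (0 : ℝ) 1 ×ˢ Set.Icc (0 : ℝ) 1)).withDensity
        (fun p => (g p : ENNReal))).map (fun p => (circlePoint p.1, circlePoint p.2))

/-- Each `z_j` is almost surely a `ρ_j`-th root of unity, and for `j ≠ l` the discrete Fourier
coefficients `c_{a,b}` of the joint law of `(z_j, z_l)` satisfy `∑_a |c_{a,b}| < 1` for `b ≠ 0` and
`∑_b |c_{a,b}| < 1` for `a ≠ 0`. -/
def DiscreteFourierCondition (Q : Measure Ω₀) (z : Ω₀ → Fin d → Circle) : Prop :=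
  ∃ ρ : Fin d → ℕ, (∀ j, 0 < ρ j) ∧ (∀ j, ∀ᵐ ω ∂Q, z ω j ^ ρ j = 1) ∧
    ∀ j l : Fin d, j ≠ l → ∃ c : ℕ → ℕ → ℂ,
      (∀ k₁ < ρ j, ∀ k₂ < ρ l,
        ((Q.real {ω | z ω j = circlePoint (k₁ / ρ j) ∧ z ω l = circlePoint (k₂ / ρ l)} : ℝ) : ℂ) =
          1 / (ρ j * ρ l) * ∑ a ∈ Finset.range (ρ j), ∑ b ∈ Finset.range (ρ l),
            c a b * Complex.exp (2 * π * Complex.I * (a * k₁ / ρ j + b * k₂ / ρ l))) ∧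
      (∀ b < ρ l, b ≠ 0 → ∑ a ∈ Finset.range (ρ j), ‖c a b‖ < 1) ∧
      (∀ a < ρ j, a ≠ 0 → ∑ b ∈ Finset.range (ρ l), ‖c a b‖ < 1)

/-- The four alternative hypotheses; the last three, which constrain pairs of distinct
points, are for `d ≥ 2`. -/
def CLTCondition (Q : Measure Ω₀) (z : Ω₀ → Fin d → Circle) (f : Fin d → Circle → ℂ)
    (φ : Fin d → ℝ) : Prop :=
  IndependentUniform Q z ∨
  (2 ≤ d ∧ PairwiseSummableDensity Q z) ∨
  (2 ≤ d ∧ (∀ j, ∀ᵐ ω ∂Q, z ω j = 1) ∧ (∀ j, ZerosAreRootsOfUnity (f j)) ∧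
    PairwiseFiniteType φ) ∨
  (2 ≤ d ∧ DiscreteFourierCondition Q z ∧ (∀ j, ZerosAreRootsOfUnity (f j)) ∧
    PairwiseFiniteType φ)

end Conditions

/-- `N` is the centred `d`-variate complex Gaussian law (jointly Gaussian real and imaginary parts)
with the limiting covariances. -/
def IsLimitLaw {d : ℕ} (θ : ℝ) (f : Fin d → Circle → ℂ) (N : Measure (Fin d → ℂ)) : Prop :=
  IsGaussian N ∧ (∀ j, ∫ y, y j ∂N = 0) ∧
  (∀ j l, j ≠ l →
    cov[fun y => (y j).re, fun y => (y l).re; N] =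
      θ * ∫ u in (0 : ℝ)..1, ∫ v in (0 : ℝ)..1, logAbs (f j) u * logAbs (f l) v) ∧
  (∀ j l, j ≠ l →
    cov[fun y => (y j).re, fun y => (y l).im; N] =
      θ * ∫ u in (0 : ℝ)..1, ∫ v in (0 : ℝ)..1, logAbs (f j) u * argOf (f l) v) ∧
  (∀ j l, j ≠ l →
    cov[fun y => (y j).im, fun y => (y l).im; N] =
      θ * ∫ u in (0 : ℝ)..1, ∫ v in (0 : ℝ)..1, argOf (f j) u * argOf (f l) v) ∧
  (∀ j, Var[fun y => (y j).re; N] = θ * ∫ u in (0 : ℝ)..1, logAbs (f j) u ^ 2) ∧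
  (∀ j, Var[fun y => (y j).im; N] = θ * ∫ u in (0 : ℝ)..1, argOf (f j) u ^ 2) ∧
  (∀ j, cov[fun y => (y j).re, fun y => (y j).im; N] =
      θ * ∫ u in (0 : ℝ)..1, logAbs (f j) u * argOf (f j) u)

end

/-!
The sum over the cycles of an Ewens permutation is treated through its characteristic function, and
the only facts needed about the contribution of a cycle of length `m` concern averages over `m`.

*Cycle index.* Given the permutation, the marks are independent, so the characteristic function of a
real linear combination of the `w^{2,n}(f_j)(x_j)` is the mean over the Ewens distribution of a
product over cycles, `h_n / w_n`, where `h_n` satisfies `n h_n = θ ∑_m r_m h_{n-m}`, `w_n` is the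
same with all `r_m = 1`, and `r_m` is the characteristic function of the contribution of one cycle
of length `m` (`integral_exp_w2_eq`, `natCast_mul_ewensIndex`). The generating function is
`∑ h_n z^n = exp (θ ∑ r_m z^m / m)` (`IsEwensIndex.tsum_eq_exp`). The recursion says that `h_n / w_n`
nearly averages its predecessors, so it varies slowly with `n`, and may be replaced by its mean over
a negative binomially distributed size, which is the exponential
`exp (θ ∑ (r_m - 1) z^m / m)` at `z = 1 - 1 / n` (`IsEwensIndex.norm_div_sub_exp_le`). Since
`∑ z^m / m = log n` there, a Taylor expansion of the `r_m` and Abel summation give the Gaussian limit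
under the conditions collected in `CesaroMoments`: bounded averages of all absolute moments, averages
of the first moments converging with a power rate, and convergent averages of the second moments
(`CesaroMoments.tendsto_charFun`). Lévy's theorem then yields the joint limit
(`tendstoInDistribution_w2`).

*Moments.* Let `μ_m` be the law of `(x_j^m T^{(m)}_j)_j`. A character of the torus integrates to
`lam ^ m` against `μ_m`, where `lam` is its value at `x` times its mean under `z`. If `lam ≠ 1` for
the nontrivial characters of pairs, pairs of coordinates are equidistributed in the mean over `m`; if
`|1 - lam|` decays at most polynomially in the frequency for single coordinates, continuously
differentiable functions are integrated with a power rate (`exists_equidistribution_rate`). The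
functions `log |f_j|` and `arg f_j` are approximated by smooth ones, the error being controlled by
negative moments of `|f_j|` for the logarithm and by equidistribution itself for the bounded argument
(`smoothlyApproximable_logPart`). This gives `CesaroMoments` with the second moments of
independent uniform points as limits (`cesaroMoments_sum`).

*Arithmetic.* It remains to check `EquidistributionHypotheses` under each of the four conditions.
Independent uniform coordinates, and coordinates with a density that has an absolutely convergent
Fourier series, have bounded marginal densities and summable Fourier coefficients, and the claims
follow from rotation invariance (`EquidistributionHypotheses.of_summable`). If the `z_j` are
roots of unity, the finite type condition bounds the `|1 - lam|` from below, and also the number of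
`m ≤ n` for which `x_j^m` is close to a root of unity of given order; as the zeros of `f_j` are roots
of unity, this bounds its negative moments (`EquidistributionHypotheses.of_pow_eq_one`).
-/

noncomputable section

/-! ### The cycle index of the Ewens distribution -/

/-- The weight `∏_m x_m ^ {c_m} / c_m!` of a multiset of parts, where `c_m` is the multiplicity of
`m`. -/
def partsWeight (x : ℕ → ℂ) (s : Multiset ℕ) : ℂ :=
  ∏ m ∈ s.toFinset, x m ^ s.count m / (s.count m).factorial

lemma partsWeight_eq_prod (x : ℕ → ℂ) {s : Multiset ℕ} {A : Finset ℕ} (h : s.toFinset ⊆ A) :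
    partsWeight x s = ∏ m ∈ A, x m ^ s.count m / (s.count m).factorial := by
  refine Finset.prod_subset h fun m _ hm => ?_
  have : s.count m = 0 := by simpa using hm
  simp [this]

lemma count_mul_partsWeight_cons (x : ℕ → ℂ) (m : ℕ) (s : Multiset ℕ) :
    ((m ::ₘ s).count m : ℂ) * partsWeight x (m ::ₘ s) = x m * partsWeight x s := by
  have hA : s.toFinset ⊆ (m ::ₘ s).toFinset := by
    intro a ha; simp at ha ⊢; exact Or.inr ha
  have hm : m ∈ (m ::ₘ s).toFinset := by simp
  rw [partsWeight_eq_prod x hA, partsWeight, ← Finset.mul_prod_erase _ _ hm,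
    ← Finset.mul_prod_erase _ _ hm]
  have : ∀ a ∈ (m ::ₘ s).toFinset.erase m, x a ^ (m ::ₘ s).count a / ((m ::ₘ s).count a).factorial
      = x a ^ s.count a / (s.count a).factorial := by
    intro a ha
    rw [Multiset.count_cons_of_ne (Finset.ne_of_mem_erase ha)]
  rw [Finset.prod_congr rfl this, Multiset.count_cons_self, Nat.factorial_succ]
  have h1 : ((s.count m).factorial : ℂ) ≠ 0 := by exact_mod_cast Nat.factorial_ne_zero _
  have h2 : ((s.count m : ℂ) + 1) ≠ 0 := Nat.cast_add_one_ne_zero _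
  push_cast
  field_simp
  ring

/-- The sum of the weights of all partitions of `n`. -/
def partitionSum (x : ℕ → ℂ) (n : ℕ) : ℂ := ∑ p : n.Partition, partsWeight x p.parts

lemma sum_count_mul_partsWeight (x : ℕ → ℂ) {n m : ℕ} (hm : m ∈ Finset.Icc 1 n) :
    ∑ p : n.Partition, (p.parts.count m : ℂ) * partsWeight x p.parts
      = x m * partitionSum x (n - m) := by
  rw [Finset.mem_Icc] at hm
  have h0 : ∑ p : n.Partition, (p.parts.count m : ℂ) * partsWeight x p.parts
      = ∑ p : n.Partition with m ∈ p.parts, (p.parts.count m : ℂ) * partsWeight x p.parts := by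
    rw [Finset.sum_filter]
    refine Finset.sum_congr rfl fun p _ => ?_
    split_ifs with h
    · rfl
    · simp [Multiset.count_eq_zero_of_notMem h]
  rw [h0, partitionSum, Finset.mul_sum]
  refine Finset.sum_bij' (M := ℂ)
    (i := fun (p : n.Partition) hp => (⟨p.parts.erase m, fun h => p.parts_pos (Multiset.mem_of_mem_erase h), by
        have h1 := Multiset.cons_erase (Finset.mem_filter.1 hp).2
        have h2 := congrArg Multiset.sum h1
        rw [Multiset.sum_cons, p.parts_sum] at h2
        omega⟩ : (n - m).Partition))
    (j := fun (q : (n - m).Partition) _ => (⟨m ::ₘ q.parts, by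
        intro i hi
        rcases Multiset.mem_cons.1 hi with rfl | h
        · omega
        · exact q.parts_pos h, by
        rw [Multiset.sum_cons, q.parts_sum]; omega⟩ : n.Partition)) ?_ ?_ ?_ ?_ ?_
  · intros; simp
  · intros; simp
  · intro p hp
    ext1
    exact Multiset.cons_erase (Finset.mem_filter.1 hp).2
  · intro q _
    ext1
    exact Multiset.erase_cons_head _ _
  · intro p hp
    have h1 := Multiset.cons_erase (Finset.mem_filter.1 hp).2
    have := count_mul_partsWeight_cons x m (p.parts.erase m)
    rw [h1] at this
    exact this

/-- Euler's recursion for the partition sums, from counting each partition of `n` once for every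
unit of its size. -/
lemma natCast_mul_partitionSum (x : ℕ → ℂ) (n : ℕ) :
    (n : ℂ) * partitionSum x n = ∑ m ∈ Finset.Icc 1 n, m * x m * partitionSum x (n - m) := by
  have h : ∀ m ∈ Finset.Icc 1 n, (m : ℂ) * x m * partitionSum x (n - m)
      = ∑ p : n.Partition, (m : ℂ) * ((p.parts.count m : ℂ) * partsWeight x p.parts) := by
    intro m hm
    rw [← Finset.mul_sum, sum_count_mul_partsWeight x hm, mul_assoc]
  rw [Finset.sum_congr rfl h, Finset.sum_comm, partitionSum, Finset.mul_sum]
  refine Finset.sum_congr rfl fun p _ => ?_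
  simp_rw [← mul_assoc]
  rw [← Finset.sum_mul]
  congr 1
  have hs : p.parts.toFinset ⊆ Finset.Icc 1 n := by
    intro a ha
    rw [Multiset.mem_toFinset] at ha
    exact Finset.mem_Icc.2 ⟨p.parts_pos ha, p.parts_sum ▸ Multiset.le_sum_of_mem ha⟩
  have := Finset.sum_multiset_count_of_subset p.parts _ hs
  rw [p.parts_sum] at this
  conv_lhs => rw [this]
  push_cast
  refine Finset.sum_congr rfl fun m _ => ?_
  simp [mul_comm]

lemma mul_prod_factorial_card_partition_eq {n : ℕ} (p : n.Partition) {A : Finset ℕ}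
    (hA : p.parts.toFinset ⊆ A) :
    (Finset.univ.filter fun σ : Equiv.Perm (Fin n) => σ.partition.parts = p.parts).card *
      ∏ m ∈ A, (m ^ p.parts.count m * (p.parts.count m).factorial) = n.factorial := by
  classical
  have hsub : ∏ m ∈ A, (m ^ p.parts.count m * (p.parts.count m).factorial)
      = p.parts.prod * ∏ m ∈ p.parts.toFinset, (p.parts.count m).factorial := by
    rw [Finset.prod_multiset_count, ← Finset.prod_mul_distrib]
    symm
    refine Finset.prod_subset hA fun m _ hm => ?_
    have : p.parts.count m = 0 := by simpa using hm
    simp [this]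
  rw [hsub]
  set s := p.parts.filter fun k => 2 ≤ k with hs
  set c := p.parts.count 1 with hc
  have hp : p.parts = s + Multiset.replicate c 1 := by
    have h1 := Multiset.filter_add_not (fun k => 2 ≤ k) p.parts
    rw [← h1]
    congr 1
    rw [hc, ← Multiset.filter_eq']
    refine Multiset.filter_congr fun k hk => ?_
    have := p.parts_pos hk
    omega
  have hsum : s.sum + c = n := by
    have := congrArg Multiset.sum hp
    rw [p.parts_sum] at this
    simpa using this.symm
  have hprod : p.parts.prod = s.prod := by
    have := congrArg Multiset.prod hp
    simpa using this
  have h2 : ∀ a ∈ s, 2 ≤ a := fun a ha => (Multiset.mem_filter.1 ha).2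
  have key := Equiv.Perm.card_of_cycleType_mul_eq (Fin n) s
  rw [if_pos ⟨by rw [Fintype.card_fin]; omega, h2⟩, Fintype.card_fin] at key
  have hfilter : (Finset.univ.filter fun σ : Equiv.Perm (Fin n) => σ.partition.parts = p.parts)
      = Finset.univ.filter fun σ : Equiv.Perm (Fin n) => σ.cycleType = s := by
    refine Finset.filter_congr fun σ _ => ⟨fun h => ?_, fun h => ?_⟩
    · rw [← Equiv.Perm.filter_parts_partition_eq_cycleType, h]
    · rw [Equiv.Perm.parts_partition, ← Equiv.Perm.sum_cycleType, h, hp, Fintype.card_fin]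
      congr 2
      omega
  have hfact : ∏ m ∈ p.parts.toFinset, (p.parts.count m).factorial
      = (n - s.sum).factorial * ∏ m ∈ s.toFinset, (s.count m).factorial := by
    have h1s : 1 ∉ s.toFinset := by
      intro h; have := h2 1 (Multiset.mem_toFinset.1 h); omega
    have hB : p.parts.toFinset ⊆ insert 1 s.toFinset := by
      intro a ha
      rw [Multiset.mem_toFinset, hp, Multiset.mem_add] at ha
      rcases ha with ha | ha
      · exact Finset.mem_insert_of_mem (Multiset.mem_toFinset.2 ha)
      · rw [Multiset.eq_of_mem_replicate ha]; exact Finset.mem_insert_self _ _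
    rw [Finset.prod_subset hB (fun m _ hm => by
      have : p.parts.count m = 0 := by simpa using hm
      simp [this]), Finset.prod_insert h1s]
    congr 1
    · congr 1; omega
    · refine Finset.prod_congr rfl fun m hm => ?_
      have hm1 : m ≠ 1 := fun h => h1s (h ▸ hm)
      rw [hp, Multiset.count_add, Multiset.count_replicate, if_neg (Ne.symm hm1), add_zero]
  rw [hfilter, hfact, hprod, ← key]
  ring

/-- The weighted cycle index `(1/n!) ∑_σ θ^{l_σ} ∏_m r_m^{C_m}` of the symmetric group. -/
def ewensIndex (θ : ℝ) (r : ℕ → ℂ) (n : ℕ) : ℂ :=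
  (n.factorial : ℂ)⁻¹ * ∑ σ : Equiv.Perm (Fin n),
    (θ : ℂ) ^ totalCycles σ * ∏ m ∈ Finset.Icc 1 n, r m ^ cycleCount σ m

lemma ewensIndex_eq_partitionSum (θ : ℝ) (r : ℕ → ℂ) (n : ℕ) :
    ewensIndex θ r n = partitionSum (fun m => θ * r m / m) n := by
  classical
  let e : Equiv.Perm (Fin n) → n.Partition := fun σ =>
    ⟨σ.partition.parts, σ.partition.parts_pos, by rw [σ.partition.parts_sum, Fintype.card_fin]⟩
  rw [ewensIndex, partitionSum, ← Finset.sum_fiberwise (s := Finset.univ) (g := e), Finset.mul_sum]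
  refine Finset.sum_congr rfl fun p _ => ?_
  have hs : p.parts.toFinset ⊆ Finset.Icc 1 n := by
    intro a ha
    rw [Multiset.mem_toFinset] at ha
    exact Finset.mem_Icc.2 ⟨p.parts_pos ha, p.parts_sum ▸ Multiset.le_sum_of_mem ha⟩
  have hconst : ∀ σ ∈ Finset.univ.filter (fun σ => e σ = p),
      (θ : ℂ) ^ totalCycles σ * ∏ m ∈ Finset.Icc 1 n, r m ^ cycleCount σ m
      = ∏ m ∈ Finset.Icc 1 n, (θ * r m) ^ p.parts.count m := by
    intro σ hσ
    have h : σ.partition.parts = p.parts := congrArg Nat.Partition.parts (Finset.mem_filter.1 hσ).2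
    have hcard := Multiset.toFinset_sum_count_eq p.parts
    rw [Finset.sum_subset hs (fun m _ hm => by simpa using hm)] at hcard
    simp only [totalCycles, cycleCount, h, mul_pow]
    rw [Finset.prod_mul_distrib, Finset.prod_pow_eq_pow_sum, hcard]
  rw [Finset.sum_congr rfl hconst, Finset.sum_const, nsmul_eq_mul, partsWeight_eq_prod _ hs]
  have hcount := mul_prod_factorial_card_partition_eq p hs
  have hset : (Finset.univ.filter fun σ : Equiv.Perm (Fin n) => σ.partition.parts = p.parts)
      = Finset.univ.filter (fun σ => e σ = p) := by
    refine Finset.filter_congr fun σ _ => ⟨fun h => Nat.Partition.ext h, fun h => ?_⟩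
    exact congrArg Nat.Partition.parts h
  rw [hset] at hcount
  have hcount' := congrArg (Nat.cast : ℕ → ℂ) hcount
  push_cast at hcount'
  have hP : ∏ m ∈ Finset.Icc 1 n, ((m : ℂ) ^ p.parts.count m * ((p.parts.count m).factorial : ℂ)) ≠ 0 := by
    refine Finset.prod_ne_zero_iff.2 fun m hm => ?_
    have : (m : ℂ) ≠ 0 := by
      have := (Finset.mem_Icc.1 hm).1
      exact_mod_cast (by omega : m ≠ 0)
    have h1 : ((p.parts.count m).factorial : ℂ) ≠ 0 := by exact_mod_cast Nat.factorial_ne_zero _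
    positivity
  have hfac : (n.factorial : ℂ) ≠ 0 := by exact_mod_cast Nat.factorial_ne_zero _
  have hR : ∏ m ∈ Finset.Icc 1 n, ((θ * r m / m) ^ p.parts.count m / ((p.parts.count m).factorial : ℂ))
      = (∏ m ∈ Finset.Icc 1 n, (θ * r m) ^ p.parts.count m) /
        ∏ m ∈ Finset.Icc 1 n, ((m : ℂ) ^ p.parts.count m * ((p.parts.count m).factorial : ℂ)) := by
    rw [← Finset.prod_div_distrib]
    refine Finset.prod_congr rfl fun m _ => ?_
    rw [div_pow, div_div]
  rw [hR, eq_div_iff hP, ← hcount']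
  rw [← hcount'] at hfac
  have := left_ne_zero_of_mul hfac
  field_simp

/-- The recursion `n h_n = θ ∑_m r_m h_{n-m}` for the weighted cycle index. -/
lemma natCast_mul_ewensIndex (θ : ℝ) (r : ℕ → ℂ) (n : ℕ) :
    (n : ℂ) * ewensIndex θ r n = θ * ∑ m ∈ Finset.Icc 1 n, r m * ewensIndex θ r (n - m) := by
  simp_rw [ewensIndex_eq_partitionSum]
  rw [natCast_mul_partitionSum, Finset.mul_sum]
  refine Finset.sum_congr rfl fun m hm => ?_
  have : (m : ℂ) ≠ 0 := by
    have := (Finset.mem_Icc.1 hm).1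
    exact_mod_cast (by omega : m ≠ 0)
  field_simp

lemma ewensIndex_zero (θ : ℝ) (r : ℕ → ℂ) : ewensIndex θ r 0 = 1 := by
  have : ∀ σ : Equiv.Perm (Fin 0), totalCycles σ = 0 := by
    intro σ
    have := σ.partition.parts_sum
    rw [totalCycles, Multiset.card_eq_zero]
    by_contra h
    obtain ⟨a, ha⟩ := Multiset.exists_mem_of_ne_zero h
    have h1 := σ.partition.parts_pos ha
    have h2 := Multiset.le_sum_of_mem ha
    simp only [Fintype.card_fin] at this
    omega
  simp [ewensIndex, this]

/-! ### Cycle indices with bounded weights -/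

/-- `θ (θ + 1) ⋯ (θ + n - 1) / n!`, the coefficient of `z ^ n` in `(1 - z) ^ (-θ)`. -/
def ewensCoeff (θ : ℝ) (n : ℕ) : ℝ := (∏ i ∈ Finset.range n, (θ + i)) / n.factorial

lemma ewensCoeff_zero (θ : ℝ) : ewensCoeff θ 0 = 1 := by simp [ewensCoeff]

lemma ewensCoeff_pos {θ : ℝ} (hθ : 0 < θ) (n : ℕ) : 0 < ewensCoeff θ n :=
  div_pos (Finset.prod_pos fun i _ => by positivity) (by positivity)

lemma succ_mul_ewensCoeff_succ (θ : ℝ) (n : ℕ) :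
    ((n : ℝ) + 1) * ewensCoeff θ (n + 1) = (θ + n) * ewensCoeff θ n := by
  rw [ewensCoeff, ewensCoeff, Finset.prod_range_succ, Nat.factorial_succ]
  have : (n.factorial : ℝ) ≠ 0 := by positivity
  push_cast
  field_simp

lemma natCast_mul_ewensCoeff (θ : ℝ) (n : ℕ) :
    (n : ℝ) * ewensCoeff θ n = θ * ∑ j ∈ Finset.range n, ewensCoeff θ j := by
  induction n with
  | zero => simp
  | succ n ih =>
    rw [Finset.sum_range_succ, mul_add, ← ih]
    push_cast
    rw [succ_mul_ewensCoeff_succ]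
    ring

lemma succ_mul_ewensCoeff_succ' (θ : ℝ) (n : ℕ) :
    ((n : ℝ) + 1) * ewensCoeff θ (n + 1) = θ * ewensCoeff (θ + 1) n := by
  rw [ewensCoeff, ewensCoeff, Finset.prod_range_succ', Nat.factorial_succ]
  have : (n.factorial : ℝ) ≠ 0 := by positivity
  have h : ∀ i ∈ Finset.range n, θ + ((i + 1 : ℕ) : ℝ) = θ + 1 + i := by
    intro i _; push_cast; ring
  rw [Finset.prod_congr rfl h]
  push_cast
  field_simp
  simp [mul_comm]

lemma summable_ewensCoeff_mul_pow {θ : ℝ} (hθ : 0 < θ) {z : ℝ} (hz0 : 0 ≤ z) (hz : z < 1) :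
    Summable fun n => ewensCoeff θ n * z ^ n := by
  rcases hz0.eq_or_lt with rfl | hz0
  · refine summable_of_ne_finset_zero (s := {0}) fun n hn => ?_
    have : n ≠ 0 := by simpa using hn
    simp [this]
  refine summable_of_ratio_test_tendsto_lt_one hz
    (Eventually.of_forall fun n => (mul_pos (ewensCoeff_pos hθ n) (pow_pos hz0 n)).ne') ?_
  have h1 : ∀ n : ℕ, ‖ewensCoeff θ (n + 1) * z ^ (n + 1)‖ / ‖ewensCoeff θ n * z ^ n‖
      = (1 + (θ - 1) * (1 / ((n : ℝ) + 1))) * z := by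
    intro n
    have hw := ewensCoeff_pos hθ n
    have hw' := ewensCoeff_pos hθ (n + 1)
    have := succ_mul_ewensCoeff_succ θ n
    rw [Real.norm_of_nonneg (by positivity), Real.norm_of_nonneg (by positivity), pow_succ]
    have hn : (n : ℝ) + 1 ≠ 0 := by positivity
    have h2 : ewensCoeff θ (n + 1) = (θ + n) / (n + 1) * ewensCoeff θ n := by
      field_simp; linarith
    rw [h2]
    field_simp
    ring
  simp_rw [h1]
  have := ((tendsto_one_div_add_atTop_nhds_zero_nat (𝕜 := ℝ)).const_mul (θ - 1)).const_add 1
  simpa using this.mul_const z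

/-- The data of a weighted cycle index: a sequence `h` with `h_0 = 1` and
`n h_n = θ ∑_{m=1}^n r_m h_{n-m}`, for weights `r_m` in the closed unit disc. -/
structure IsEwensIndex (θ : ℝ) (r h : ℕ → ℂ) : Prop where
  norm_le : ∀ m, ‖r m‖ ≤ 1
  zero : h 0 = 1
  succ : ∀ n : ℕ, ((n : ℂ) + 1) * h (n + 1)
    = θ * ∑ i ∈ Finset.range (n + 1), r (i + 1) * h (n - i)

lemma isEwensIndex_ewensIndex (θ : ℝ) {r : ℕ → ℂ} (hr : ∀ m, ‖r m‖ ≤ 1) :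
    IsEwensIndex θ r (ewensIndex θ r) where
  norm_le := hr
  zero := ewensIndex_zero θ r
  succ n := by
    have := natCast_mul_ewensIndex θ r (n + 1)
    push_cast at this
    have hI : Finset.Icc 1 (n + 1) = Finset.Ico (0 + 1) (n + 1 + 1) := by ext; simp
    rw [this, hI, ← Finset.sum_Ico_add' (fun m => r m * ewensIndex θ r (n + 1 - m)) 0 (n + 1) 1,
      ← Finset.range_eq_Ico]
    congr 1
    refine Finset.sum_congr rfl fun i _ => ?_
    simp

lemma isEwensIndex_ewensCoeff (θ : ℝ) :
    IsEwensIndex θ (fun _ => 1) (fun n => (ewensCoeff θ n : ℂ)) where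
  norm_le := by simp
  zero := by simp [ewensCoeff_zero]
  succ n := by
    have := natCast_mul_ewensCoeff θ (n + 1)
    rw [← Finset.sum_range_reflect] at this
    simp only [one_mul]
    exact_mod_cast this

namespace IsEwensIndex

variable {θ : ℝ} {r h : ℕ → ℂ}

lemma norm_le_ewensCoeff (H : IsEwensIndex θ r h) (hθ : 0 < θ) (n : ℕ) :
    ‖h n‖ ≤ ewensCoeff θ n := by
  induction n using Nat.strong_induction_on with
  | _ n ih =>
  cases n with
  | zero => simp [H.zero, ewensCoeff_zero]
  | succ n =>
    have h1 := congrArg norm (H.succ n)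
    have h2 := natCast_mul_ewensCoeff θ (n + 1)
    rw [← Finset.sum_range_reflect] at h2
    rw [norm_mul, norm_mul, Complex.norm_real, Real.norm_of_nonneg hθ.le] at h1
    have h3 : ‖(n : ℂ) + 1‖ = (n : ℝ) + 1 := by
      rw [show (n : ℂ) + 1 = ((n + 1 : ℕ) : ℂ) by push_cast; ring, Complex.norm_natCast]
      push_cast; ring
    rw [h3] at h1
    have h4 : ‖∑ i ∈ Finset.range (n + 1), r (i + 1) * h (n - i)‖
        ≤ ∑ i ∈ Finset.range (n + 1), ewensCoeff θ (n - i) := by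
      refine (norm_sum_le _ _).trans (Finset.sum_le_sum fun i _ => ?_)
      rw [norm_mul]
      calc ‖r (i + 1)‖ * ‖h (n - i)‖ ≤ 1 * ewensCoeff θ (n - i) :=
            mul_le_mul (H.norm_le _) (ih _ (by omega)) (norm_nonneg _) zero_le_one
        _ = _ := one_mul _
    have h5 : ((n : ℝ) + 1) * ‖h (n + 1)‖ ≤ ((n : ℝ) + 1) * ewensCoeff θ (n + 1) := by
      rw [h1]
      push_cast at h2
      rw [h2]
      exact mul_le_mul_of_nonneg_left (by simpa using h4) hθ.le
    exact le_of_mul_le_mul_left h5 (by positivity)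

lemma summable_norm_mul_pow (H : IsEwensIndex θ r h) (hθ : 0 < θ) {z : ℝ} (hz0 : 0 ≤ z)
    (hz : z < 1) : Summable fun n => ‖h n * (z : ℂ) ^ n‖ := by
  refine Summable.of_nonneg_of_le (fun _ => norm_nonneg _) (fun n => ?_)
    (summable_ewensCoeff_mul_pow hθ hz0 hz)
  rw [norm_mul, norm_pow, Complex.norm_real, Real.norm_of_nonneg hz0]
  exact mul_le_mul_of_nonneg_right (H.norm_le_ewensCoeff hθ n) (by positivity)

lemma hasDerivAt_tsum (H : IsEwensIndex θ r h) (hθ : 0 < θ) {z : ℝ} (hz : |z| < 1) :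
    HasDerivAt (fun y : ℝ => ∑' n, h n * (y : ℂ) ^ n)
      (∑' n : ℕ, ((n : ℂ) + 1) * h (n + 1) * (z : ℂ) ^ n) z := by
  obtain ⟨ρ, hzρ, hρ⟩ := exists_between hz
  have hρ0 : 0 < ρ := (abs_nonneg z).trans_lt hzρ
  have hu : Summable fun n => (θ * (ewensCoeff (θ + 1) n * ρ ^ n)) :=
    (summable_ewensCoeff_mul_pow (by positivity) hρ0.le hρ).mul_left θ
  have key := hasDerivAt_tsum_of_isPreconnected (𝕜 := ℝ) (F := ℂ)
    (g := fun n (y : ℝ) => h (n + 1) * (y : ℂ) ^ (n + 1))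
    (g' := fun n (y : ℝ) => ((n : ℂ) + 1) * h (n + 1) * (y : ℂ) ^ n)
    (t := Set.Ioo (-ρ) ρ) (y₀ := 0) (y := z) hu isOpen_Ioo isPreconnected_Ioo
    (fun n y _ => by
      have h1 : HasDerivAt (fun y : ℝ => (y : ℂ)) 1 y := Complex.ofRealCLM.hasDerivAt
      have := (h1.pow (n + 1)).const_mul (h (n + 1))
      refine this.congr_deriv ?_
      push_cast; simp; ring)
    (fun n y hy => by
      have h3 : ‖(n : ℂ) + 1‖ = (n : ℝ) + 1 := by
        rw [show (n : ℂ) + 1 = ((n + 1 : ℕ) : ℂ) by push_cast; ring, Complex.norm_natCast]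
        push_cast; ring
      rw [norm_mul, norm_mul, norm_pow, h3, Complex.norm_real, ← mul_assoc,
        ← succ_mul_ewensCoeff_succ']
      have hy' : ‖y‖ ≤ ρ := abs_le.2 ⟨hy.1.le, hy.2.le⟩
      have := H.norm_le_ewensCoeff hθ (n + 1)
      have := ewensCoeff_pos hθ (n + 1)
      gcongr)
    ⟨by linarith, hρ0⟩ (by
      refine summable_of_ne_finset_zero (s := ∅) fun n _ => by simp) (abs_lt.1 hzρ)
  have heq : (fun y : ℝ => ∑' n, h n * (y : ℂ) ^ n) =ᶠ[nhds z]
      fun y : ℝ => h 0 + ∑' n, h (n + 1) * (y : ℂ) ^ (n + 1) := by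
    have : ∀ᶠ y in nhds z, |y| < 1 := (continuous_abs.tendsto z).eventually (gt_mem_nhds hz)
    filter_upwards [this] with y hy
    have hs : Summable fun n => h n * (y : ℂ) ^ n := by
      have := H.summable_norm_mul_pow hθ (abs_nonneg y) hy
      refine Summable.of_norm (this.congr fun n => ?_)
      simp
    rw [hs.tsum_eq_zero_add]
    simp
  exact (key.const_add (h 0)).congr_of_eventuallyEq heq

lemma summable_weights (H : IsEwensIndex θ r h) {z : ℝ} (hz : |z| < 1) :
    Summable fun i => ‖r (i + 1) * (z : ℂ) ^ i‖ := by
  refine Summable.of_nonneg_of_le (fun _ => norm_nonneg _) (fun n => ?_)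
    (summable_geometric_of_lt_one (abs_nonneg z) hz)
  rw [norm_mul, norm_pow, Complex.norm_real, Real.norm_eq_abs]
  exact mul_le_of_le_one_left (by positivity) (H.norm_le _)

lemma hasDerivAt_weights (H : IsEwensIndex θ r h) {z : ℝ} (hz : |z| < 1) :
    HasDerivAt (fun y : ℝ => ∑' i : ℕ, r (i + 1) * (y : ℂ) ^ (i + 1) / (i + 1))
      (∑' i, r (i + 1) * (z : ℂ) ^ i) z := by
  obtain ⟨ρ, hzρ, hρ⟩ := exists_between hz
  have hρ0 : 0 < ρ := (abs_nonneg z).trans_lt hzρ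
  have hu := summable_geometric_of_lt_one hρ0.le hρ
  refine hasDerivAt_tsum_of_isPreconnected (𝕜 := ℝ) (F := ℂ)
    (g := fun n (y : ℝ) => r (n + 1) * (y : ℂ) ^ (n + 1) / (n + 1))
    (g' := fun n (y : ℝ) => r (n + 1) * (y : ℂ) ^ n)
    (t := Set.Ioo (-ρ) ρ) (y₀ := 0) (y := z) hu isOpen_Ioo isPreconnected_Ioo
    (fun n y _ => ?_) (fun n y hy => ?_)
    ⟨by linarith, hρ0⟩ (by
      refine summable_of_ne_finset_zero (s := ∅) fun n _ => by simp) (abs_lt.1 hzρ)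
  · have h1 : HasDerivAt (fun y : ℝ => (y : ℂ)) 1 y := Complex.ofRealCLM.hasDerivAt
    have := ((h1.pow (n + 1)).const_mul (r (n + 1))).div_const ((n : ℂ) + 1)
    refine this.congr_deriv ?_
    have : (n : ℂ) + 1 ≠ 0 := Nat.cast_add_one_ne_zero _
    push_cast; field_simp
  · have hy' : ‖y‖ ≤ ρ := abs_le.2 ⟨hy.1.le, hy.2.le⟩
    rw [norm_mul, norm_pow, Complex.norm_real]
    calc _ ≤ 1 * ρ ^ n := mul_le_mul (H.norm_le _) (by gcongr) (by positivity) zero_le_one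
      _ = _ := one_mul _

/-- The generating function `∑ h_n z^n = exp (θ ∑ r_m z^m / m)`: both sides solve the same linear
differential equation. -/
lemma tsum_eq_exp (H : IsEwensIndex θ r h) (hθ : 0 < θ) {z : ℝ} (hz0 : 0 ≤ z) (hz : z < 1) :
    ∑' n, h n * (z : ℂ) ^ n
      = Complex.exp (θ * ∑' i : ℕ, r (i + 1) * (z : ℂ) ^ (i + 1) / (i + 1)) := by
  set F : ℝ → ℂ := fun y => ∑' n, h n * (y : ℂ) ^ n with hF
  set R : ℝ → ℂ := fun y => ∑' i : ℕ, r (i + 1) * (y : ℂ) ^ (i + 1) / (i + 1) with hR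
  have hder : ∀ y : ℝ, |y| < 1 → HasDerivAt (fun y => F y * Complex.exp (-(θ * R y))) 0 y := by
    intro y hy
    have h1 := H.hasDerivAt_tsum hθ hy
    have h2 := H.hasDerivAt_weights hy
    have h3 := h1.mul ((h2.const_mul (θ : ℂ)).neg.cexp)
    refine h3.congr_deriv ?_
    have hprod : ∑' n : ℕ, ((n : ℂ) + 1) * h (n + 1) * (y : ℂ) ^ n
        = θ * ((∑' i, r (i + 1) * (y : ℂ) ^ i) * F y) := by
      have hs : Summable fun n => ‖h n * (y : ℂ) ^ n‖ := by
        refine (H.summable_norm_mul_pow hθ (abs_nonneg y) hy).congr fun n => ?_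
        simp
      rw [hF, tsum_mul_tsum_eq_tsum_sum_range_of_summable_norm (H.summable_weights hy) hs,
        ← tsum_mul_left]
      refine tsum_congr fun n => ?_
      rw [H.succ, mul_assoc, Finset.sum_mul]
      congr 1
      refine Finset.sum_congr rfl fun i hi => ?_
      have : i ≤ n := Nat.lt_succ_iff.1 (Finset.mem_range.1 hi)
      rw [show (y : ℂ) ^ n = (y : ℂ) ^ i * (y : ℂ) ^ (n - i) by rw [← pow_add]; congr 1; omega]
      ring
    rw [hprod]
    simp only [hF]
    ring
  have hconst := constant_of_has_deriv_right_zero (a := 0) (b := z)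
    (f := fun y => F y * Complex.exp (-(θ * R y)))
    (fun y hy => ((hder y (abs_lt.2 ⟨by linarith [hy.1], by linarith [hy.2]⟩)).continuousAt).continuousWithinAt)
    (fun y hy => (hder y (abs_lt.2 ⟨by linarith [hy.1], by linarith [hy.2]⟩)).hasDerivWithinAt)
    z ⟨hz0, le_rfl⟩
  have hF0 : F 0 = 1 := by
    simp only [hF]
    rw [tsum_eq_single 0 (fun n hn => by simp [hn])]
    simp [H.zero]
  have hR0 : R 0 = 0 := by simp [hR]
  simp only [hF0, hR0, mul_zero, neg_zero, Complex.exp_zero, mul_one] at hconst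
  rw [Complex.exp_neg] at hconst
  have := Complex.exp_ne_zero (θ * R z)
  field_simp at hconst
  exact hconst

end IsEwensIndex

lemma hasSum_pow_succ_div {z : ℝ} (hz0 : 0 ≤ z) (hz : z < 1) :
    HasSum (fun i : ℕ => z ^ (i + 1) / ((i : ℝ) + 1)) (-Real.log (1 - z)) :=
  Real.hasSum_pow_div_log_of_abs_lt_one (abs_lt.2 ⟨by linarith, hz⟩)

lemma tsum_ewensCoeff_mul_pow {θ : ℝ} (hθ : 0 < θ) {z : ℝ} (hz0 : 0 ≤ z) (hz : z < 1) :
    ∑' n, ewensCoeff θ n * z ^ n = (1 - z) ^ (-θ) := by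
  have h1 := (isEwensIndex_ewensCoeff θ).tsum_eq_exp hθ hz0 hz
  have h2 : ∑' i : ℕ, (1 : ℂ) * (z : ℂ) ^ (i + 1) / (i + 1) = ((-Real.log (1 - z) : ℝ) : ℂ) := by
    rw [← (hasSum_pow_succ_div hz0 hz).tsum_eq, Complex.ofReal_tsum]
    refine tsum_congr fun i => ?_
    push_cast; ring
  rw [h2] at h1
  have h3 : ((∑' n, ewensCoeff θ n * z ^ n : ℝ) : ℂ) = ((1 - z) ^ (-θ) : ℝ) := by
    rw [Complex.ofReal_tsum, Real.rpow_def_of_pos (by linarith), Complex.ofReal_exp]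
    push_cast at h1 ⊢
    rw [h1]
    congr 1
    ring
  exact_mod_cast h3

/-! ### Slow variation in the size of the permutation -/

namespace IsEwensIndex

variable {θ : ℝ} {r h : ℕ → ℂ} {e : ℝ}

lemma sum_ewensCoeff_pos (hθ : 0 < θ) (n : ℕ) :
    0 < ∑ j ∈ Finset.range (n + 1), ewensCoeff θ j :=
  Finset.sum_pos (fun _ _ => ewensCoeff_pos hθ _) (by simp)

/-- By the recursion, `h_{n+1} / w_{n+1}` is an average of its predecessors up to the deviation of the
weights `r_m` from `1`. -/
lemma norm_div_sub_mean_le (H : IsEwensIndex θ r h) (hθ : 0 < θ) {n : ℕ}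
    (he : θ * ∑ i ∈ Finset.range (n + 1), ‖r (i + 1) - 1‖ * ewensCoeff θ (n - i)
      ≤ e * (((n : ℝ) + 1) * ewensCoeff θ (n + 1))) :
    ‖h (n + 1) / ewensCoeff θ (n + 1) - (∑ j ∈ Finset.range (n + 1), h j) /
      ((∑ j ∈ Finset.range (n + 1), ewensCoeff θ j : ℝ) : ℂ)‖ ≤ e := by
  have hW := sum_ewensCoeff_pos hθ n
  have hw := ewensCoeff_pos hθ (n + 1)
  have h1 := natCast_mul_ewensCoeff θ (n + 1)
  push_cast at h1
  set W := ∑ j ∈ Finset.range (n + 1), ewensCoeff θ j with hWdef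
  have hWc : (W : ℂ) ≠ 0 := by exact_mod_cast hW.ne'
  have hwc : (ewensCoeff θ (n + 1) : ℂ) ≠ 0 := by exact_mod_cast hw.ne'
  have hn : (n : ℂ) + 1 ≠ 0 := Nat.cast_add_one_ne_zero _
  have hθc : (θ : ℂ) ≠ 0 := by exact_mod_cast hθ.ne'
  have h1c : ((n : ℂ) + 1) * ewensCoeff θ (n + 1) = θ * W := by exact_mod_cast h1
  have h2 : h (n + 1) / ewensCoeff θ (n + 1)
      = (∑ i ∈ Finset.range (n + 1), r (i + 1) * h (n - i)) / W := by
    rw [div_eq_div_iff hwc hWc]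
    have h3 : ((n : ℂ) + 1) * θ ≠ 0 := mul_ne_zero hn hθc
    apply mul_left_cancel₀ h3
    linear_combination (W : ℂ) * θ * H.succ n - θ * (∑ i ∈ Finset.range (n + 1), r (i + 1) * h (n - i)) * h1c
  rw [h2, ← Finset.sum_range_reflect h, ← sub_div, ← Finset.sum_sub_distrib, norm_div,
    Complex.norm_real, Real.norm_of_nonneg hW.le, div_le_iff₀ hW]
  refine le_of_mul_le_mul_left ?_ hθ
  calc θ * ‖∑ i ∈ Finset.range (n + 1), (r (i + 1) * h (n - i) - h (n + 1 - 1 - i))‖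
      ≤ θ * ∑ i ∈ Finset.range (n + 1), ‖r (i + 1) - 1‖ * ewensCoeff θ (n - i) := by
        refine mul_le_mul_of_nonneg_left ((norm_sum_le _ _).trans (Finset.sum_le_sum fun i _ => ?_)) hθ.le
        rw [show n + 1 - 1 - i = n - i by omega, show r (i + 1) * h (n - i) - h (n - i)
          = (r (i + 1) - 1) * h (n - i) by ring, norm_mul]
        exact mul_le_mul_of_nonneg_left (H.norm_le_ewensCoeff hθ _) (norm_nonneg _)
    _ ≤ e * (((n : ℝ) + 1) * ewensCoeff θ (n + 1)) := he
    _ = _ := by rw [h1]; ring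

lemma norm_mean_succ_sub_mean_le (H : IsEwensIndex θ r h) (hθ : 0 < θ) {n : ℕ}
    (he : θ * ∑ i ∈ Finset.range (n + 1), ‖r (i + 1) - 1‖ * ewensCoeff θ (n - i)
      ≤ e * (((n : ℝ) + 1) * ewensCoeff θ (n + 1))) :
    ‖(∑ j ∈ Finset.range (n + 2), h j) / ((∑ j ∈ Finset.range (n + 2), ewensCoeff θ j : ℝ) : ℂ)
      - (∑ j ∈ Finset.range (n + 1), h j) /
        ((∑ j ∈ Finset.range (n + 1), ewensCoeff θ j : ℝ) : ℂ)‖ ≤ θ * e / (n + 1) := by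
  have key := H.norm_div_sub_mean_le hθ he
  have hW := sum_ewensCoeff_pos hθ n
  have hW' := sum_ewensCoeff_pos hθ (n + 1)
  have hw := ewensCoeff_pos hθ (n + 1)
  have hwle : ewensCoeff θ (n + 1) / ∑ j ∈ Finset.range (n + 2), ewensCoeff θ j ≤ θ / (n + 1) := by
    have h1 := natCast_mul_ewensCoeff θ (n + 2)
    have h2 := succ_mul_ewensCoeff_succ θ (n + 1)
    push_cast at h1 h2
    have h3 : θ * ∑ j ∈ Finset.range (n + 2), ewensCoeff θ j = (θ + (n + 1)) * ewensCoeff θ (n + 1) := by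
      rw [← h1, ← h2]; ring_nf
    rw [div_le_div_iff₀ hW' (by positivity), h3]
    nlinarith [mul_pos hθ hw]
  rw [Finset.sum_range_succ h (n + 1), Finset.sum_range_succ (ewensCoeff θ) (n + 1)] at *
  set W := ∑ j ∈ Finset.range (n + 1), ewensCoeff θ j with hWdef
  set S := ∑ j ∈ Finset.range (n + 1), h j
  set w := ewensCoeff θ (n + 1)
  have hWc : (W : ℂ) ≠ 0 := by exact_mod_cast hW.ne'
  have hwc : (w : ℂ) ≠ 0 := by exact_mod_cast hw.ne'
  have hWc' : ((W : ℂ) + w) ≠ 0 := by exact_mod_cast hW'.ne'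
  have heq : (S + h (n + 1)) / ((W + w : ℝ) : ℂ) - S / W
      = ((w / (W + w) : ℝ) : ℂ) * (h (n + 1) / w - S / W) := by
    push_cast
    field_simp
    ring
  rw [heq, norm_mul, Complex.norm_real, Real.norm_of_nonneg (by positivity)]
  calc _ ≤ θ / (n + 1) * e := mul_le_mul hwle key (norm_nonneg _) (by positivity)
    _ = _ := by ring

/-- Slow variation: the mean `h_n / w_n` changes little when `n` changes by a bounded factor. It
is close to the average of its predecessors, and averages change slowly. -/
lemma norm_div_sub_div_le (H : IsEwensIndex θ r h) (hθ : 0 < θ)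
    (he : ∀ n : ℕ, θ * ∑ i ∈ Finset.range (n + 1), ‖r (i + 1) - 1‖ * ewensCoeff θ (n - i)
      ≤ e * (((n : ℝ) + 1) * ewensCoeff θ (n + 1))) (he0 : 0 ≤ e) {a b : ℕ} (ha : 1 ≤ a)
    (hab : a ≤ b) :
    ‖h b / ewensCoeff θ b - h a / ewensCoeff θ a‖ ≤ e * (2 + θ * (b / a)) := by
  set M : ℕ → ℂ := fun n => (∑ j ∈ Finset.range n, h j) /
    ((∑ j ∈ Finset.range n, ewensCoeff θ j : ℝ) : ℂ) with hM
  have ha0 : (0 : ℝ) < a := by exact_mod_cast ha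
  have hMM : ∀ b, a ≤ b → ‖M b - M a‖ ≤ θ * e / a * (b - a) := by
    intro b hb
    induction b, hb using Nat.le_induction with
    | base => simp
    | succ b hb ih =>
      obtain ⟨c, rfl⟩ : ∃ c, b = c + 1 := ⟨b - 1, by omega⟩
      have h1 := H.norm_mean_succ_sub_mean_le hθ (he c)
      have h2 : θ * e / ((c : ℝ) + 1) ≤ θ * e / a := by
        have : (a : ℝ) ≤ c + 1 := by exact_mod_cast hb
        gcongr
      calc ‖M (c + 1 + 1) - M a‖ ≤ ‖M (c + 1 + 1) - M (c + 1)‖ + ‖M (c + 1) - M a‖ :=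
            norm_sub_le_norm_sub_add_norm_sub _ _ _
        _ ≤ θ * e / a + θ * e / a * (((c + 1 : ℕ) : ℝ) - a) := add_le_add (h1.trans h2) ih
        _ = _ := by push_cast; ring
  have hQ : ∀ n, 1 ≤ n → ‖h n / ewensCoeff θ n - M n‖ ≤ e := by
    intro n hn
    obtain ⟨c, rfl⟩ : ∃ c, n = c + 1 := ⟨n - 1, by omega⟩
    exact H.norm_div_sub_mean_le hθ (he c)
  have h1 := hQ a ha
  have h2 := hQ b (ha.trans hab)
  have h3 := hMM b hab
  have h4 : θ * e / a * (b - a) ≤ e * (θ * (b / a)) := by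
    have : θ * e / a * (b - a) = e * (θ * (b / a)) - θ * e := by field_simp
    rw [this]; nlinarith
  calc ‖h b / ewensCoeff θ b - h a / ewensCoeff θ a‖
      = ‖(h b / ewensCoeff θ b - M b) + (M b - M a) - (h a / ewensCoeff θ a - M a)‖ := by
        congr 1; ring
    _ ≤ ‖h b / ewensCoeff θ b - M b‖ + ‖M b - M a‖ + ‖h a / ewensCoeff θ a - M a‖ :=
        (norm_sub_le _ _).trans (add_le_add_left (norm_add_le _ _) _)
    _ ≤ e + e * (θ * (b / a)) + e := by gcongr; exact h3.trans h4
    _ = _ := by ring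

lemma norm_div_le_one (H : IsEwensIndex θ r h) (hθ : 0 < θ) (n : ℕ) :
    ‖h n / ewensCoeff θ n‖ ≤ 1 := by
  have := ewensCoeff_pos hθ n
  rw [norm_div, Complex.norm_real, Real.norm_of_nonneg this.le, div_le_one this]
  exact H.norm_le_ewensCoeff hθ n

lemma tsum_natCast_mul_ewensCoeff_mul_pow (hθ : 0 < θ) {z : ℝ} (hz0 : 0 ≤ z) (hz : z < 1) :
    HasSum (fun n : ℕ => (n : ℝ) * (ewensCoeff θ n * z ^ n)) (θ * z * (1 - z) ^ (-(θ + 1))) := by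
  have h1 := (summable_ewensCoeff_mul_pow (θ := θ + 1) (by positivity) hz0 hz).hasSum
  rw [tsum_ewensCoeff_mul_pow (by positivity) hz0 hz] at h1
  have h2 := h1.mul_left (θ * z)
  refine (hasSum_nat_add_iff' 1).1 ?_
  simp only [Finset.sum_range_one, Nat.cast_zero, zero_mul, sub_zero]
  refine h2.congr_fun ?_ |> id
  intro n
  have := succ_mul_ewensCoeff_succ' θ n
  push_cast
  rw [← mul_assoc, this]
  ring

/-- Comparison of the fixed size `N` with a negative binomially distributed random size, for which
the cycle counts are independent Poisson variables, so that the mean is an exponential. The random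
size is of order `N`: outside `[N / (2K), K N]` the trivial bound `2` is used, with the Laplace
transform for the lower tail and Markov's inequality for the upper one; inside, the mean varies
slowly. -/
lemma norm_div_sub_exp_le (H : IsEwensIndex θ r h) (hθ : 0 < θ)
    (he : ∀ n : ℕ, θ * ∑ i ∈ Finset.range (n + 1), ‖r (i + 1) - 1‖ * ewensCoeff θ (n - i)
      ≤ e * (((n : ℝ) + 1) * ewensCoeff θ (n + 1))) (he0 : 0 ≤ e) {K N : ℕ} (hK : 1 ≤ K)
    (hN : 2 * K ≤ N) :
    ‖h N / ewensCoeff θ N - Complex.exp (θ * ∑' i : ℕ, (r (i + 1) - 1) *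
        ((1 - 1 / (N : ℝ) : ℝ) : ℂ) ^ (i + 1) / (i + 1))‖
      ≤ e * (2 + 2 * θ * K ^ 2) + 4 * (K : ℝ) ^ (-θ) + 2 * θ / K := by
  have hN0 : (0 : ℝ) < N := by exact_mod_cast (by omega : 0 < N)
  have hK0 : (0 : ℝ) < K := by exact_mod_cast (by omega : 0 < K)
  have hKN : 2 * (K : ℝ) ≤ N := by exact_mod_cast hN
  have hK1 : (1 : ℝ) ≤ K := by exact_mod_cast hK
  set z : ℝ := 1 - 1 / (N : ℝ) with hz
  have hz1 : z < 1 := by rw [hz]; have : 0 < 1 / (N : ℝ) := by positivity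
                         linarith
  have hz0 : 0 ≤ z := by
    rw [hz, sub_nonneg, div_le_one hN0]; linarith
  have h1z : 1 - z = 1 / N := by rw [hz]; ring
  set p : ℕ → ℝ := fun n => (1 - z) ^ θ * (ewensCoeff θ n * z ^ n) with hp
  have hp0 : ∀ n, 0 ≤ p n := fun n => by
    have := ewensCoeff_pos hθ n
    have : 0 ≤ (1 - z) ^ θ := Real.rpow_nonneg (by linarith) _
    positivity
  have hzpos : 0 < 1 - z := by linarith
  have hsum : HasSum p 1 := by
    have := ((summable_ewensCoeff_mul_pow hθ hz0 hz1).hasSum).mul_left ((1 - z) ^ θ)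
    rw [tsum_ewensCoeff_mul_pow hθ hz0 hz1, ← Real.rpow_add hzpos] at this
    simpa using this
  -- the generating function at `z`
  have hA : HasSum (fun n => (p n : ℂ) * (h n / ewensCoeff θ n)) (Complex.exp (θ * ∑' i : ℕ,
      (r (i + 1) - 1) * (z : ℂ) ^ (i + 1) / (i + 1))) := by
    have hs := (H.summable_norm_mul_pow hθ hz0 hz1).of_norm.hasSum
    rw [H.tsum_eq_exp hθ hz0 hz1] at hs
    have h2 := hs.mul_left (((1 - z) ^ θ : ℝ) : ℂ)
    have h3 : (((1 - z) ^ θ : ℝ) : ℂ) * Complex.exp (θ * ∑' i : ℕ, r (i + 1) * (z : ℂ) ^ (i + 1) / (i + 1))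
        = Complex.exp (θ * ∑' i : ℕ, (r (i + 1) - 1) * (z : ℂ) ^ (i + 1) / (i + 1)) := by
      have hl := (hasSum_pow_succ_div hz0 hz1)
      have hlc : HasSum (fun i : ℕ => ((z ^ (i + 1) / ((i : ℝ) + 1) : ℝ) : ℂ)) ((-Real.log (1 - z) : ℝ) : ℂ) :=
        Complex.hasSum_ofReal.2 hl
      have hr : Summable fun i : ℕ => r (i + 1) * (z : ℂ) ^ (i + 1) / (i + 1) := by
        refine Summable.of_norm_bounded hl.summable fun i => ?_
        rw [norm_div, norm_mul, norm_pow, Complex.norm_real, Real.norm_of_nonneg hz0,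
          show (i : ℂ) + 1 = ((i + 1 : ℕ) : ℂ) by push_cast; ring, Complex.norm_natCast]
        push_cast
        have := H.norm_le (i + 1)
        gcongr
        exact mul_le_of_le_one_left (by positivity) this
      have h4 := hr.hasSum.sub hlc
      have h5 : (fun i : ℕ => r (i + 1) * (z : ℂ) ^ (i + 1) / (i + 1) - ((z ^ (i + 1) / ((i : ℝ) + 1) : ℝ) : ℂ))
          = fun i : ℕ => (r (i + 1) - 1) * (z : ℂ) ^ (i + 1) / (i + 1) := by
        ext i; push_cast; ring
      rw [h5] at h4
      rw [h4.tsum_eq, Real.rpow_def_of_pos hzpos, Complex.ofReal_exp, ← Complex.exp_add]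
      congr 1
      push_cast; ring
    rw [h3] at h2
    refine h2.congr_fun fun n => ?_
    have : (ewensCoeff θ n : ℂ) ≠ 0 := by exact_mod_cast (ewensCoeff_pos hθ n).ne'
    simp only [hp]
    push_cast
    field_simp
  -- the two tails of the negative binomial distribution
  set s : ℝ := 1 - K / N with hs
  have hKN1 : (K : ℝ) / N ≤ 1 / 2 := by rw [div_le_iff₀ hN0]; linarith
  have hKNpos : (0 : ℝ) < K / N := by positivity
  have hs0 : 0 ≤ s := by rw [hs]; linarith
  have hs1 : s < 1 := by rw [hs]; linarith
  have hlow : ∃ B, HasSum (fun n => p n * s ^ n) B ∧ B ≤ (K : ℝ) ^ (-θ) := by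
    have hzs0 : 0 ≤ z * s := mul_nonneg hz0 hs0
    have hzs : z * s ≤ s := mul_le_of_le_one_left hs0 hz1.le
    have h1 := ((summable_ewensCoeff_mul_pow hθ hzs0 (hzs.trans_lt hs1)).hasSum).mul_left ((1 - z) ^ θ)
    rw [tsum_ewensCoeff_mul_pow hθ hzs0 (hzs.trans_lt hs1)] at h1
    refine ⟨_, h1.congr_fun fun n => by simp only [hp]; rw [mul_pow]; ring, ?_⟩
    have h2 : (1 - z * s) ^ (-θ) ≤ ((K : ℝ) / N) ^ (-θ) := by
      refine Real.rpow_le_rpow_of_nonpos hKNpos ?_ (by linarith)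
      rw [hs] at hzs; linarith
    calc (1 - z) ^ θ * (1 - z * s) ^ (-θ) ≤ (1 / (N : ℝ)) ^ θ * ((K : ℝ) / N) ^ (-θ) := by
          rw [h1z]; gcongr
      _ = (K : ℝ) ^ (-θ) := by
          rw [Real.div_rpow zero_le_one hN0.le, Real.div_rpow hK0.le hN0.le, Real.one_rpow,
            Real.rpow_neg hN0.le, Real.rpow_neg hK0.le]
          have : (N : ℝ) ^ θ ≠ 0 := (Real.rpow_pos_of_pos hN0 _).ne'
          field_simp
  obtain ⟨B, hB, hBle⟩ := hlow
  have hupp : HasSum (fun n : ℕ => p n * (n / (K * N))) (θ * z / K) := by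
    have h1 := (tsum_natCast_mul_ewensCoeff_mul_pow hθ hz0 hz1).mul_left ((1 - z) ^ θ / (K * N))
    have h2 : (1 - z) ^ θ / (K * N) * (θ * z * (1 - z) ^ (-(θ + 1))) = θ * z / K := by
      have : (1 - z) ^ (-(θ + 1)) = ((1 - z) ^ θ)⁻¹ * N := by
        rw [neg_add, Real.rpow_add hzpos, Real.rpow_neg hzpos.le, Real.rpow_neg_one, h1z]
        simp
      rw [this]
      have : (1 - z) ^ θ ≠ 0 := (Real.rpow_pos_of_pos hzpos _).ne'
      field_simp
    rw [h2] at h1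
    refine h1.congr_fun fun n => by simp only [hp]; ring
  set c := e * (2 + 2 * θ * (K : ℝ) ^ 2) with hc
  have hc0 : 0 ≤ c := by positivity
  have hpt : ∀ n, ‖h N / ewensCoeff θ N - h n / ewensCoeff θ n‖
      ≤ c + 4 * s ^ n + 2 * (n / (K * N)) := by
    intro n
    have hsn : 0 ≤ s ^ n := pow_nonneg hs0 n
    have hnn : (0 : ℝ) ≤ n / (K * N) := by positivity
    have htriv : ‖h N / ewensCoeff θ N - h n / ewensCoeff θ n‖ ≤ 2 :=
      (norm_sub_le _ _).trans (by linarith [H.norm_div_le_one hθ N, H.norm_div_le_one hθ n])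
    by_cases hn1 : (n : ℝ) * (2 * K) < N
    · -- Bernoulli's inequality: `s ^ n ≥ 1/2`
      have hbern := one_add_mul_le_pow (a := -((K : ℝ) / N)) (by linarith) n
      have h2 : (n : ℝ) * (K / N) ≤ 1 / 2 := by
        rw [mul_div_assoc', div_le_iff₀ hN0]; linarith
      have h3 : (1 : ℝ) / 2 ≤ s ^ n := by
        rw [hs, sub_eq_add_neg]; refine le_trans ?_ hbern; linarith
      linarith
    -- above `K N` the term from Markov's inequality exceeds the trivial bound
    by_cases hn2 : (K : ℝ) * N < n
    · have : 1 ≤ (n : ℝ) / (K * N) := by rw [le_div_iff₀ (by positivity)]; linarith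
      linarith
    rw [not_lt] at hn1 hn2
    have hn0 : (0 : ℝ) < n := by
      by_contra hcon
      have : (n : ℝ) * (2 * K) ≤ 0 := mul_nonpos_of_nonpos_of_nonneg (not_lt.1 hcon) (by positivity)
      linarith
    have hn1' : 1 ≤ n := by exact_mod_cast hn0
    -- in the bulk, slow variation
    have hmain : ‖h N / ewensCoeff θ N - h n / ewensCoeff θ n‖ ≤ c := by
      rcases le_total n N with hle | hle
      · refine (H.norm_div_sub_div_le hθ he he0 hn1' hle).trans ?_
        have : (N : ℝ) / n ≤ 2 * K ^ 2 := by
          rw [div_le_iff₀ hn0]; nlinarith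
        rw [hc]
        refine mul_le_mul_of_nonneg_left ?_ he0
        nlinarith
      · rw [norm_sub_rev]
        refine (H.norm_div_sub_div_le hθ he he0 (by omega) hle).trans ?_
        have : (n : ℝ) / N ≤ 2 * K ^ 2 := by
          rw [div_le_iff₀ hN0]; nlinarith
        rw [hc]
        refine mul_le_mul_of_nonneg_left ?_ he0
        nlinarith
    linarith
  have hdiff : HasSum (fun n => (p n : ℂ) * (h N / ewensCoeff θ N - h n / ewensCoeff θ n))
      (h N / ewensCoeff θ N - Complex.exp (θ * ∑' i : ℕ,
        (r (i + 1) - 1) * (z : ℂ) ^ (i + 1) / (i + 1))) := by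
    have h1 := (Complex.hasSum_ofReal.2 hsum).mul_right (h N / ewensCoeff θ N)
    have h2 := h1.sub hA
    rw [Complex.ofReal_one, one_mul] at h2
    refine h2.congr_fun fun n => by ring
  have hbound : HasSum (fun n => c * p n + 4 * (p n * s ^ n) + 2 * (p n * (n / (K * N))))
      (c * 1 + 4 * B + 2 * (θ * z / K)) :=
    ((hsum.mul_left c).add (hB.mul_left 4)).add (hupp.mul_left 2)
  rw [← hdiff.tsum_eq]
  refine (tsum_of_norm_bounded hbound fun n => ?_).trans ?_
  · rw [norm_mul, Complex.norm_real, Real.norm_of_nonneg (hp0 n)]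
    calc _ ≤ p n * (c + 4 * s ^ n + 2 * (n / (K * N))) := mul_le_mul_of_nonneg_left (hpt n) (hp0 n)
      _ = _ := by ring
  · have : θ * z / K ≤ θ / K := by
      gcongr; exact mul_le_of_le_one_right hθ.le hz1.le
    have e1 : 2 * θ / K = 2 * (θ / K) := by ring
    rw [e1]
    linarith

end IsEwensIndex

/-! ### Size-biased averages -/

lemma sum_rpow_neg_le {β : ℝ} (hβ0 : 0 ≤ β) (hβ : β < 1) (n : ℕ) :
    ∑ j ∈ Finset.range n, ((j : ℝ) + 1) ^ (-β) ≤ (n : ℝ) ^ (1 - β) / (1 - β) := by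
  induction n with
  | zero => simp [Real.zero_rpow (by linarith : 1 - β ≠ 0)]
  | succ n ih =>
    rw [Finset.sum_range_succ]
    have hn : (0 : ℝ) < n + 1 := by positivity
    have h1 := rpow_one_add_le_one_add_mul_self (s := -(1 / ((n : ℝ) + 1))) (p := 1 - β)
      (by rw [neg_le_neg_iff, div_le_one hn]; linarith [Nat.cast_nonneg (α := ℝ) n])
      (by linarith) (by linarith)
    have h2 : (n : ℝ) = (n + 1) * (1 + -(1 / ((n : ℝ) + 1))) := by field_simp; ring
    have h3 : (n : ℝ) ^ (1 - β) ≤ (n + 1 : ℝ) ^ (1 - β) - (1 - β) * (n + 1 : ℝ) ^ (-β) := by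
      have h0 : (0 : ℝ) ≤ 1 + -(1 / ((n : ℝ) + 1)) := by
        have : 1 / ((n : ℝ) + 1) ≤ 1 := by
          rw [div_le_one hn]; linarith [Nat.cast_nonneg (α := ℝ) n]
        linarith
      have h4 : (n + 1 : ℝ) ^ (-β) = (n + 1 : ℝ) ^ (1 - β) * (1 / (n + 1)) := by
        rw [show -β = (1 - β) + (-1) by ring, Real.rpow_add hn, Real.rpow_neg_one]; simp
      calc (n : ℝ) ^ (1 - β) = (n + 1 : ℝ) ^ (1 - β) * (1 + -(1 / ((n : ℝ) + 1))) ^ (1 - β) := by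
            rw [← Real.mul_rpow hn.le h0, ← h2]
        _ ≤ (n + 1 : ℝ) ^ (1 - β) * (1 + (1 - β) * -(1 / ((n : ℝ) + 1))) :=
            mul_le_mul_of_nonneg_left h1 (by positivity)
        _ = _ := by rw [h4]; ring
    have h5 : (0 : ℝ) < 1 - β := by linarith
    rw [le_div_iff₀ h5] at ih ⊢
    push_cast
    nlinarith

/-- The sequence `ewensCoeff θ n * n ^ (1 - min θ 1)` is nondecreasing, by Bernoulli's inequality. The
shift to `j + 1` and the constant make room for `j = 0`. -/
lemma ewensCoeff_div_le {θ : ℝ} (hθ : 0 < θ) {j n : ℕ} (hjn : j < n) :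
    ewensCoeff θ j / ewensCoeff θ n
      ≤ 2 * max 1 (1 / θ) * ((n : ℝ) / ((j : ℝ) + 1)) ^ (1 - min θ 1) := by
  set α := 1 - min θ 1 with hα
  have hα0 : 0 ≤ α := by rw [hα]; linarith [min_le_right θ 1]
  have hα1 : α ≤ 1 := by rw [hα]; linarith [lt_min hθ one_pos]
  have hmono : ∀ j n : ℕ, 1 ≤ j → j ≤ n → ewensCoeff θ j * (j : ℝ) ^ α ≤ ewensCoeff θ n * (n : ℝ) ^ α := by
    intro j n hj hn
    induction n, hn using Nat.le_induction with
    | base => exact le_rfl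
    | succ n hn ih =>
      refine ih.trans ?_
      have hn0 : (0 : ℝ) < n := by exact_mod_cast (hj.trans hn)
      have hn1 : (0 : ℝ) < n + 1 := by positivity
      have h1 := rpow_one_add_le_one_add_mul_self (s := -(1 / ((n : ℝ) + 1))) (p := α)
        (by rw [neg_le_neg_iff, div_le_one hn1]; linarith) hα0 hα1
      have h2 : 1 + -(1 / ((n : ℝ) + 1)) = n / (n + 1) := by field_simp; ring
      rw [h2, Real.div_rpow hn0.le hn1.le, div_le_iff₀ (by positivity)] at h1
      have h3 := succ_mul_ewensCoeff_succ θ n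
      have hw := ewensCoeff_pos hθ n
      have h4 : ewensCoeff θ (n + 1) = (θ + n) / (n + 1) * ewensCoeff θ n := by
        field_simp; linarith
      have h5 : 1 + α * -(1 / ((n : ℝ) + 1)) ≤ (θ + n) / (n + 1) := by
        have : 1 + α * -(1 / ((n : ℝ) + 1)) = (n + 1 - α) / (n + 1) := by field_simp; ring
        rw [this]
        gcongr
        rw [hα]; linarith [min_le_left θ 1]
      have hp : (0 : ℝ) < ((n : ℝ) + 1) ^ α := by positivity
      rw [h4]
      push_cast
      calc ewensCoeff θ n * (n : ℝ) ^ α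
          ≤ ewensCoeff θ n * ((θ + n) / (n + 1) * ((n : ℝ) + 1) ^ α) := by
            gcongr; exact h1.trans (by gcongr)
        _ = _ := by ring
  have hwn := ewensCoeff_pos hθ n
  have hn0 : (0 : ℝ) < n := by exact_mod_cast (by omega : 0 < n)
  have hC1 : (1 : ℝ) ≤ max 1 (1 / θ) := le_max_left _ _
  rcases Nat.eq_zero_or_pos j with rfl | hj
  · have h1 := hmono 1 n le_rfl (by omega)
    have hw1 : ewensCoeff θ 1 = θ := by simp [ewensCoeff]
    rw [hw1] at h1
    simp only [Nat.cast_one, Real.one_rpow, mul_one] at h1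
    rw [ewensCoeff_zero, div_le_iff₀ hwn]
    simp only [Nat.cast_zero, zero_add, div_one]
    have h2 : 1 / θ * (ewensCoeff θ n * (n : ℝ) ^ α) ≥ 1 := by
      rw [ge_iff_le, one_div, ← div_eq_inv_mul, le_div_iff₀ hθ]; linarith
    have h3 : 0 < ewensCoeff θ n * (n : ℝ) ^ α := by positivity
    nlinarith [le_max_right 1 (1 / θ)]
  · have h1 := hmono j n hj hjn.le
    have hj0 : (0 : ℝ) < j := by exact_mod_cast hj
    have hjp : (0 : ℝ) < (j : ℝ) ^ α := by positivity
    have h2 : ewensCoeff θ j / ewensCoeff θ n ≤ ((n : ℝ) / j) ^ α := by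
      rw [Real.div_rpow hn0.le hj0.le, div_le_div_iff₀ hwn hjp]; linarith
    have h3 : ((n : ℝ) / j) ^ α ≤ 2 * ((n : ℝ) / (j + 1)) ^ α := by
      have h4 : (n : ℝ) / j ≤ 2 * (n / (j + 1)) := by
        have : (1 : ℝ) ≤ j := by exact_mod_cast hj
        rw [div_le_iff₀ hj0]
        have : 2 * ((n : ℝ) / (j + 1)) * j = n * (2 * j / (j + 1)) := by field_simp
        rw [this]
        refine le_mul_of_one_le_right hn0.le ?_
        rw [le_div_iff₀ (by positivity)]; linarith
      calc ((n : ℝ) / j) ^ α ≤ (2 * (n / (j + 1))) ^ α := by gcongr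
        _ = 2 ^ α * ((n : ℝ) / (j + 1)) ^ α := Real.mul_rpow (by norm_num) (by positivity)
        _ ≤ 2 * ((n : ℝ) / (j + 1)) ^ α := by
            gcongr
            calc (2 : ℝ) ^ α ≤ 2 ^ (1 : ℝ) := by gcongr; norm_num
              _ = 2 := by simp
    refine h2.trans (h3.trans ?_)
    gcongr
    linarith

/-- Averages of a sequence along the length of the cycle containing a given point are bounded when
the Cesàro means of a high enough power are. For `θ < 1` that length has an unbounded
(normalised) density near the maximal length, which is why the first powers do not suffice.
The first condition on `a` and `b` is Young's inequality when `a` and `b` are the means of a variable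
and of its `p`-th power. -/
lemma exists_sizeBiased_mean_le {θ : ℝ} (hθ : 0 < θ) : ∃ p : ℕ, 2 ≤ p ∧ ∀ C : ℝ, ∃ C' : ℝ,
    0 ≤ C' ∧ ∀ a b : ℕ → ℝ,
      (∀ i, ∀ u : ℝ, 0 ≤ u → a i * u ≤ b i + u ^ (Real.conjExponent p)) →
      (∀ n : ℕ, ∑ i ∈ Finset.range n, b (i + 1) ≤ C * n) →
      ∀ n : ℕ, θ * ∑ i ∈ Finset.range (n + 1), a (i + 1) * ewensCoeff θ (n - i)
        ≤ C' * (((n : ℝ) + 1) * ewensCoeff θ (n + 1)) := by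
  -- for `p > 1 / θ` the conjugate exponent `q` satisfies `(1 - min θ 1) q < 1`, so that the `q`-th
  -- power of the density is integrable
  obtain ⟨p₀, hp₀⟩ := exists_nat_gt (1 / θ)
  set p : ℕ := max p₀ 2 with hp
  have hp2 : 2 ≤ p := le_max_right _ _
  have hp2' : (2 : ℝ) ≤ p := by exact_mod_cast hp2
  have hpθ : 1 / θ < p := hp₀.trans_le (by exact_mod_cast le_max_left _ _)
  set q := Real.conjExponent p with hq
  have hqv : q = p / (p - 1) := rfl
  have hq0 : 0 < q := by rw [hqv]; apply div_pos <;> linarith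
  set α := 1 - min θ 1 with hα
  have hα0 : 0 ≤ α := by rw [hα]; linarith [min_le_right θ 1]
  have hβ : α * q < 1 := by
    rw [hqv, mul_div_assoc', div_lt_one (by linarith)]
    rw [div_lt_iff₀ hθ] at hpθ
    rcases min_choice θ 1 with h | h <;> rw [hα, h] <;> nlinarith
  have hβ0 : 0 ≤ α * q := by positivity
  set D := 2 * max 1 (1 / θ) with hD
  have hD0 : 0 < D := by rw [hD]; have : (1 : ℝ) ≤ max 1 (1 / θ) := le_max_left _ _
                         linarith
  refine ⟨p, hp2, fun C => ⟨θ * (max C 0 + D ^ q / (1 - α * q)), ?_, fun a b hab hb n => ?_⟩⟩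
  · have : 0 ≤ D ^ q / (1 - α * q) := div_nonneg (by positivity) (by linarith)
    have := le_max_right C 0
    positivity
  have hw := ewensCoeff_pos hθ (n + 1)
  have hN : (0 : ℝ) < n + 1 := by positivity
  have h1 : ∀ i ∈ Finset.range (n + 1), a (i + 1) * ewensCoeff θ (n - i)
      ≤ ewensCoeff θ (n + 1) * (b (i + 1)
        + D ^ q * ((n : ℝ) + 1) ^ (α * q) * (((n - i : ℕ) : ℝ) + 1) ^ (-(α * q))) := by
    intro i hi
    have hi' : i ≤ n := Nat.lt_succ_iff.1 (Finset.mem_range.1 hi)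
    have h2 := ewensCoeff_div_le hθ (j := n - i) (n := n + 1) (by omega)
    have hwi := ewensCoeff_pos hθ (n - i)
    have hu0 : 0 ≤ ewensCoeff θ (n - i) / ewensCoeff θ (n + 1) := by positivity
    have h3 := hab (i + 1) _ hu0
    have h4 : (ewensCoeff θ (n - i) / ewensCoeff θ (n + 1)) ^ q
        ≤ D ^ q * ((n : ℝ) + 1) ^ (α * q) * (((n - i : ℕ) : ℝ) + 1) ^ (-(α * q)) := by
      have hj : (0 : ℝ) < ((n - i : ℕ) : ℝ) + 1 := by positivity
      calc _ ≤ (D * ((((n + 1 : ℕ) : ℝ)) / (((n - i : ℕ) : ℝ) + 1)) ^ α) ^ q := by gcongr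
        _ = _ := by
          push_cast
          rw [Real.mul_rpow hD0.le (by positivity), ← Real.rpow_mul (by positivity),
            Real.div_rpow hN.le hj.le, Real.rpow_neg hj.le, div_eq_mul_inv, mul_assoc]
    have h5 : a (i + 1) * ewensCoeff θ (n - i)
        = ewensCoeff θ (n + 1) * (a (i + 1) * (ewensCoeff θ (n - i) / ewensCoeff θ (n + 1))) := by
      field_simp
    rw [h5]
    gcongr
    exact h3.trans (by gcongr)
  have h6 : ∑ i ∈ Finset.range (n + 1), (((n - i : ℕ) : ℝ) + 1) ^ (-(α * q))
      ≤ ((n : ℝ) + 1) ^ (1 - α * q) / (1 - α * q) := by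
    have := sum_rpow_neg_le hβ0 hβ (n + 1)
    rw [← Finset.sum_range_reflect] at this
    push_cast at this
    simpa using this
  have h7 := hb (n + 1)
  push_cast at h7
  calc θ * ∑ i ∈ Finset.range (n + 1), a (i + 1) * ewensCoeff θ (n - i)
      ≤ θ * ∑ i ∈ Finset.range (n + 1), ewensCoeff θ (n + 1) * (b (i + 1)
        + D ^ q * ((n : ℝ) + 1) ^ (α * q) * (((n - i : ℕ) : ℝ) + 1) ^ (-(α * q))) := by
        exact mul_le_mul_of_nonneg_left (Finset.sum_le_sum h1) hθ.le
    _ = θ * (ewensCoeff θ (n + 1) * (∑ i ∈ Finset.range (n + 1), b (i + 1) +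
        D ^ q * ((n : ℝ) + 1) ^ (α * q) *
          ∑ i ∈ Finset.range (n + 1), (((n - i : ℕ) : ℝ) + 1) ^ (-(α * q)))) := by
        rw [← Finset.mul_sum, Finset.sum_add_distrib, ← Finset.mul_sum]
    _ ≤ θ * (ewensCoeff θ (n + 1) * (max C 0 * (n + 1) +
        D ^ q * ((n : ℝ) + 1) ^ (α * q) * (((n : ℝ) + 1) ^ (1 - α * q) / (1 - α * q)))) := by
        gcongr
        exact h7.trans (by gcongr; exact le_max_left _ _)
    _ = _ := by
        have h8 : ((n : ℝ) + 1) ^ (α * q) * ((n : ℝ) + 1) ^ (1 - α * q) = n + 1 := by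
          rw [← Real.rpow_add hN]; simp
        have h9 : 1 - α * q ≠ 0 := by linarith
        field_simp
        linear_combination D ^ q * h8

/-! ### Abel summation against `z ^ m / m` -/

lemma sum_mul_nonneg_of_antitone {d v : ℕ → ℝ} (hd : ∀ n, 0 ≤ ∑ i ∈ Finset.range n, d i)
    (hv : Antitone v) (hv0 : ∀ n, 0 ≤ v n) (n : ℕ) :
    0 ≤ ∑ i ∈ Finset.range n, d i * v i := by
  -- by parts, the sum dominates the last partial sum times the last weight
  have key : ∀ n, (∑ i ∈ Finset.range n, d i) * v n ≤ ∑ i ∈ Finset.range n, d i * v i := by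
    intro n
    induction n with
    | zero => simp
    | succ n ih =>
      have h1 : (∑ i ∈ Finset.range (n + 1), d i) * v (n + 1)
          ≤ (∑ i ∈ Finset.range (n + 1), d i) * v n :=
        mul_le_mul_of_nonneg_left (hv (Nat.le_succ n)) (hd _)
      rw [Finset.sum_range_succ] at h1 ⊢
      rw [Finset.sum_range_succ]
      linarith
  exact (mul_nonneg (hd n) (hv0 n)).trans (key n)

lemma abs_tsum_mul_le_tsum_mul {c b v : ℕ → ℝ}
    (h : ∀ n, |∑ i ∈ Finset.range n, c i| ≤ ∑ i ∈ Finset.range n, b i)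
    (hv : Antitone v) (hv0 : ∀ n, 0 ≤ v n) (hc : Summable fun i => c i * v i)
    (hb : Summable fun i => b i * v i) :
    |∑' i, c i * v i| ≤ ∑' i, b i * v i := by
  have h1 : ∀ n, 0 ≤ ∑ i ∈ Finset.range n, (b i - c i) * v i :=
    sum_mul_nonneg_of_antitone (fun n => by
      rw [Finset.sum_sub_distrib]; linarith [abs_le.1 (h n)]) hv hv0
  have h2 : ∀ n, 0 ≤ ∑ i ∈ Finset.range n, (b i + c i) * v i :=
    sum_mul_nonneg_of_antitone (fun n => by
      rw [Finset.sum_add_distrib]; linarith [abs_le.1 (h n)]) hv hv0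
  have h3 := (hb.hasSum.sub hc.hasSum).tendsto_sum_nat
  have h4 := (hb.hasSum.add hc.hasSum).tendsto_sum_nat
  have h5 := ge_of_tendsto' h3 fun n => by
    simpa only [sub_mul] using h1 n
  have h6 := ge_of_tendsto' h4 fun n => by
    simpa only [add_mul] using h2 n
  rw [abs_le]
  constructor <;> linarith

lemma antitone_pow_succ_div {z : ℝ} (hz0 : 0 ≤ z) (hz : z ≤ 1) :
    Antitone fun i : ℕ => z ^ (i + 1) / ((i : ℝ) + 1) := by
  refine antitone_nat_of_succ_le fun n => ?_
  have : z ^ (n + 1 + 1) ≤ z ^ (n + 1) := pow_le_pow_of_le_one hz0 hz (by omega)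
  push_cast
  gcongr
  linarith

lemma summable_mul_pow_succ_div {c : ℕ → ℝ} {C z : ℝ} (hz0 : 0 ≤ z) (hz : z < 1)
    (hc0 : ∀ i, 0 ≤ c i) (hc : ∀ n : ℕ, ∑ i ∈ Finset.range n, c i ≤ C * n) :
    Summable fun i : ℕ => c i * (z ^ (i + 1) / ((i : ℝ) + 1)) := by
  refine Summable.of_nonneg_of_le (fun i => mul_nonneg (hc0 i) (by positivity)) (fun i => ?_)
    ((summable_geometric_of_lt_one hz0 hz).mul_left (C * z))
  have h1 : c i ≤ C * (i + 1) := by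
    have := hc (i + 1)
    rw [Finset.sum_range_succ] at this
    push_cast at this
    linarith [Finset.sum_nonneg fun j (_ : j ∈ Finset.range i) => hc0 j]
  calc c i * (z ^ (i + 1) / ((i : ℝ) + 1)) ≤ C * (i + 1) * (z ^ (i + 1) / ((i : ℝ) + 1)) := by
        gcongr
    _ = C * z * z ^ i := by field_simp; ring

/-! ### The characteristic function of a sum over the cycles -/

/-- The moment conditions on the contributions `X` of the cycles, under which the sum over the
cycles of an Ewens permutation is asymptotically normal. A cycle of length `m` contributes a
variable with the law of `X` under `μ m`. -/
structure CesaroMoments {E : Type*} [MeasurableSpace E] (μ : ℕ → Measure E) (X : E → ℝ)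
    (mean V : ℝ) : Prop where
  measurable : Measurable X
  integrable : ∀ p i : ℕ, Integrable (fun x => |X x| ^ p) (μ (i + 1))
  moment_le : ∀ p : ℕ, ∃ C : ℝ, ∀ n : ℕ, ∑ i ∈ Finset.range n, ∫ x, |X x| ^ p ∂μ (i + 1) ≤ C * n
  mean_le : ∃ C s : ℝ, 0 < s ∧ s < 1 ∧ ∀ n : ℕ,
    |∑ i ∈ Finset.range n, (∫ x, X x ∂μ (i + 1) - mean)| ≤ C * (n : ℝ) ^ (1 - s)
  tendsto : Tendsto (fun n : ℕ => (∑ i ∈ Finset.range n, ∫ x, X x ^ 2 ∂μ (i + 1)) / n) atTop (nhds V)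

/-- The characteristic function at `s` of the contribution of a cycle of length `m`. -/
def cycleCharFun {E : Type*} [MeasurableSpace E] (μ : ℕ → Measure E) (X : E → ℝ) (s : ℝ) (m : ℕ) :
    ℂ := ∫ x, Complex.exp (Complex.I * ((s * X x : ℝ) : ℂ)) ∂μ m

lemma norm_exp_sub_taylor_le (x : ℝ) :
    ‖Complex.exp (Complex.I * x) - 1 - Complex.I * x + (x : ℂ) ^ 2 / 2‖ ≤ 4 * |x| ^ 3 := by
  have hnx : ‖Complex.I * (x : ℂ)‖ = |x| := by simp
  rcases le_or_gt |x| 1 with hx | hx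
  · have h := Complex.exp_bound (x := Complex.I * x) (by rw [hnx]; exact hx) (n := 3) (by norm_num)
    rw [hnx] at h
    have h2 : Complex.exp (Complex.I * x) - 1 - Complex.I * x + (x : ℂ) ^ 2 / 2
        = Complex.exp (Complex.I * x) - ∑ m ∈ Finset.range 3, (Complex.I * x) ^ m / m.factorial := by
      simp [Finset.sum_range_succ, mul_pow, Nat.factorial]
      ring
    rw [h2]
    refine h.trans ?_
    rw [mul_comm]
    refine mul_le_mul_of_nonneg_right ?_ (by positivity)
    norm_num [Nat.factorial]
  · have h1 : ‖Complex.exp (Complex.I * x) - 1 - Complex.I * x + (x : ℂ) ^ 2 / 2‖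
        ≤ 1 + 1 + |x| + |x| ^ 2 / 2 := by
      refine (norm_add_le _ _).trans (add_le_add ((norm_sub_le _ _).trans
        (add_le_add ((norm_sub_le _ _).trans (add_le_add ?_ ?_)) ?_)) ?_)
      · rw [mul_comm, Complex.norm_exp_ofReal_mul_I]
      · simp
      · simp
      · simp
    refine h1.trans ?_
    nlinarith [mul_pos (sub_pos.2 hx) (sub_pos.2 hx), abs_nonneg x, pow_pos (lt_trans one_pos hx) 2]

namespace CesaroMoments

variable {E : Type*} [MeasurableSpace E] {μ : ℕ → Measure E} {X : E → ℝ} {mean V : ℝ}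

lemma integrable_self (H : CesaroMoments μ X mean V) (i : ℕ) : Integrable X (μ (i + 1)) := by
  have := H.integrable 1 i
  simp only [pow_one] at this
  exact (integrable_norm_iff H.measurable.aestronglyMeasurable).1 this

lemma integrable_sq (H : CesaroMoments μ X mean V) (i : ℕ) :
    Integrable (fun x => X x ^ 2) (μ (i + 1)) := by
  simpa using H.integrable 2 i

variable [∀ m, IsProbabilityMeasure (μ m)]

lemma norm_cycleCharFun_le (s : ℝ) (m : ℕ) : ‖cycleCharFun μ X s m‖ ≤ 1 := by
  refine (norm_integral_le_of_norm_le_const (C := 1) (ae_of_all _ fun x => ?_)).trans (by simp)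
  rw [mul_comm, Complex.norm_exp_ofReal_mul_I]

lemma integrable_exp (H : CesaroMoments μ X mean V) (s : ℝ) (m : ℕ) :
    Integrable (fun x => Complex.exp (Complex.I * ((s * X x : ℝ) : ℂ))) (μ m) := by
  have := H.measurable
  refine (integrable_const (1 : ℝ)).mono' (by fun_prop) (ae_of_all _ fun x => ?_)
  rw [mul_comm, Complex.norm_exp_ofReal_mul_I]

lemma norm_cycleCharFun_sub_one_le (H : CesaroMoments μ X mean V) {s : ℝ} (hs : 0 ≤ s) (i : ℕ) :
    ‖cycleCharFun μ X s (i + 1) - 1‖ ≤ s * ∫ x, |X x| ∂μ (i + 1) := by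
  have h1 : cycleCharFun μ X s (i + 1) - 1
      = ∫ x, (Complex.exp (Complex.I * ((s * X x : ℝ) : ℂ)) - 1) ∂μ (i + 1) := by
    rw [integral_sub (H.integrable_exp s _) (integrable_const _), cycleCharFun]
    simp
  rw [h1, ← integral_const_mul]
  have hi : Integrable (fun x => s * |X x|) (μ (i + 1)) := by
    simpa using (H.integrable 1 i).const_mul s
  refine norm_integral_le_of_norm_le hi (ae_of_all _ fun x => ?_)
  refine Real.norm_exp_I_mul_ofReal_sub_one_le.trans ?_
  rw [Real.norm_eq_abs, abs_mul, abs_of_nonneg hs]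

lemma norm_cycleCharFun_sub_taylor_le (H : CesaroMoments μ X mean V) {s : ℝ} (hs : 0 ≤ s) (i : ℕ) :
    ‖cycleCharFun μ X s (i + 1) - 1 - Complex.I * s * (∫ x, X x ∂μ (i + 1) : ℝ)
      + (s : ℂ) ^ 2 / 2 * (∫ x, X x ^ 2 ∂μ (i + 1) : ℝ)‖
      ≤ 4 * s ^ 3 * ∫ x, |X x| ^ 3 ∂μ (i + 1) := by
  have i1 : Integrable (fun x => Complex.I * s * (X x : ℂ)) (μ (i + 1)) :=
    (H.integrable_self i).ofReal.const_mul _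
  have i2 : Integrable (fun x => (s : ℂ) ^ 2 / 2 * ((X x ^ 2 : ℝ) : ℂ)) (μ (i + 1)) :=
    (H.integrable_sq i).ofReal.const_mul _
  have h1 : cycleCharFun μ X s (i + 1) - 1 - Complex.I * s * (∫ x, X x ∂μ (i + 1) : ℝ)
      + (s : ℂ) ^ 2 / 2 * (∫ x, X x ^ 2 ∂μ (i + 1) : ℝ)
      = ∫ x, (Complex.exp (Complex.I * ((s * X x : ℝ) : ℂ)) - 1 - Complex.I * s * X x
        + (s : ℂ) ^ 2 / 2 * ((X x ^ 2 : ℝ) : ℂ)) ∂μ (i + 1) := by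
    have i3 : Integrable (fun x => Complex.exp (Complex.I * ((s * X x : ℝ) : ℂ)) - 1) (μ (i + 1)) :=
      (H.integrable_exp s _).sub (integrable_const _)
    have i4 : Integrable (fun x => Complex.exp (Complex.I * ((s * X x : ℝ) : ℂ)) - 1
        - Complex.I * s * X x) (μ (i + 1)) := i3.sub i1
    rw [integral_add i4 i2, integral_sub i3 i1,
      integral_sub (H.integrable_exp s _) (integrable_const _), cycleCharFun,
      integral_const_mul, integral_const_mul, integral_complex_ofReal, integral_complex_ofReal]
    simp
  rw [h1, ← integral_const_mul]
  refine norm_integral_le_of_norm_le ((H.integrable 3 i).const_mul _) (ae_of_all _ fun x => ?_)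
  have := norm_exp_sub_taylor_le (s * X x)
  rw [abs_mul, abs_of_nonneg hs, mul_pow, ← mul_assoc] at this
  refine le_trans (le_of_eq ?_) this
  congr 1
  push_cast
  ring

/-- Replacing the mean over permutations of size `N` by the exponential formula costs `o(1)`. -/
lemma tendsto_sub_exp (H : CesaroMoments μ X mean V) {θ : ℝ} (hθ : 0 < θ) {s : ℕ → ℝ}
    (hs0 : ∀ n, 0 ≤ s n) (hs : Tendsto s atTop (nhds 0)) :
    Tendsto (fun N : ℕ => ewensIndex θ (cycleCharFun μ X (s N)) N / ewensCoeff θ N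
      - Complex.exp (θ * ∑' i : ℕ, (cycleCharFun μ X (s N) (i + 1) - 1) *
        ((1 - 1 / (N : ℝ) : ℝ) : ℂ) ^ (i + 1) / (i + 1))) atTop (nhds 0) := by
  obtain ⟨p, hp2, hp⟩ := exists_sizeBiased_mean_le hθ
  obtain ⟨C, hC⟩ := H.moment_le p
  obtain ⟨C', hC'0, hC'⟩ := hp C
  have hp1 : (1 : ℝ) < p := by exact_mod_cast (by omega : 1 < p)
  have hconj := Real.HolderConjugate.conjExponent hp1
  -- the size-biased average of the first moments is bounded, by Young's inequality
  have key := hC' (fun m => if m = 0 then 0 else ∫ x, |X x| ∂μ m)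
    (fun m => if m = 0 then 0 else ∫ x, |X x| ^ p ∂μ m) (fun m u hu => by
      rcases m with _ | m
      · simp; positivity
      simp only [Nat.add_eq_zero_iff, one_ne_zero, and_false, if_false]
      have hint : Integrable (fun x => |X x|) (μ (m + 1)) := (H.integrable_self m).abs
      rw [← integral_mul_const]
      have : ∫ x, |X x| ^ p ∂μ (m + 1) + u ^ (Real.conjExponent p)
          = ∫ x, (|X x| ^ p + u ^ (Real.conjExponent p)) ∂μ (m + 1) := by
        rw [integral_add (H.integrable p m) (integrable_const _)]; simp
      rw [this]
      refine integral_mono (hint.mul_const _) ((H.integrable p m).add (integrable_const _)) fun x => ?_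
      have hy := Real.young_inequality_of_nonneg (abs_nonneg (X x)) hu hconj
      rw [Real.rpow_natCast] at hy
      refine hy.trans (add_le_add (div_le_self (by positivity) hp1.le)
        (div_le_self (by positivity) hconj.symm.lt.le))) (by simpa using hC)
  have he : ∀ N n : ℕ, θ * ∑ i ∈ Finset.range (n + 1), ‖cycleCharFun μ X (s N) (i + 1) - 1‖ *
      ewensCoeff θ (n - i) ≤ (s N * C') * (((n : ℝ) + 1) * ewensCoeff θ (n + 1)) := by
    intro N n
    have h1 := key n
    simp only [Nat.add_eq_zero_iff, one_ne_zero, and_false, if_false] at h1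
    calc _ ≤ θ * ∑ i ∈ Finset.range (n + 1), (s N * ∫ x, |X x| ∂μ (i + 1)) * ewensCoeff θ (n - i) := by
          refine mul_le_mul_of_nonneg_left (Finset.sum_le_sum fun i _ => ?_) hθ.le
          exact mul_le_mul_of_nonneg_right (H.norm_cycleCharFun_sub_one_le (hs0 N) i)
            (ewensCoeff_pos hθ _).le
      _ = s N * (θ * ∑ i ∈ Finset.range (n + 1), (∫ x, |X x| ∂μ (i + 1)) * ewensCoeff θ (n - i)) := by
          simp_rw [mul_assoc]; rw [← Finset.mul_sum]; ring
      _ ≤ s N * (C' * (((n : ℝ) + 1) * ewensCoeff θ (n + 1))) := mul_le_mul_of_nonneg_left h1 (hs0 N)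
      _ = _ := by ring
  rw [tendsto_zero_iff_norm_tendsto_zero, Metric.tendsto_atTop]
  intro ε hε
  have hK : Tendsto (fun K : ℕ => 4 * (K : ℝ) ^ (-θ) + 2 * θ / K) atTop (nhds 0) := by
    have h1 := ((tendsto_rpow_neg_atTop hθ).comp tendsto_natCast_atTop_atTop).const_mul (4 : ℝ)
    have h2 : Tendsto (fun K : ℕ => 2 * θ / (K : ℝ)) atTop (nhds 0) :=
      tendsto_const_div_atTop_nhds_zero_nat _
    simpa using h1.add h2
  obtain ⟨K, hK1, hK2⟩ := ((hK.eventually (gt_mem_nhds (half_pos hε))).and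
    (eventually_ge_atTop 1)).exists
  have hsN : Tendsto (fun N => (s N * C') * (2 + 2 * θ * (K : ℝ) ^ 2)) atTop (nhds 0) := by
    simpa using (hs.mul_const C').mul_const (2 + 2 * θ * (K : ℝ) ^ 2)
  obtain ⟨N₀, hN₀⟩ := eventually_atTop.1 ((hsN.eventually (gt_mem_nhds (half_pos hε))).and
    (eventually_ge_atTop (2 * K)))
  refine ⟨N₀, fun N hN => ?_⟩
  obtain ⟨h1, h2⟩ := hN₀ N hN
  have := (isEwensIndex_ewensIndex θ (norm_cycleCharFun_le (μ := μ) (X := X) (s N))).norm_div_sub_exp_le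
    hθ (he N) (mul_nonneg (hs0 N) hC'0) hK2 h2
  rw [Real.dist_eq, sub_zero, abs_of_nonneg (norm_nonneg _)]
  linarith

/-- The exponent of the exponential formula: with `s = 1 / √(log N)` and the weights `z ^ m / m`,
`z = 1 - 1 / N`, of total mass exactly `log N`, a Taylor expansion of the characteristic functions
leaves the weighted sums of the first three moments, which are evaluated by Abel summation. -/
lemma tendsto_exponent (H : CesaroMoments μ X mean V) (θ : ℝ) :
    Tendsto (fun N : ℕ => (θ : ℂ) * ∑' i : ℕ, (cycleCharFun μ X (1 / √(Real.log N)) (i + 1) - 1) *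
        ((1 - 1 / (N : ℝ) : ℝ) : ℂ) ^ (i + 1) / (i + 1)
        - Complex.I * ((θ * √(Real.log N) * mean : ℝ) : ℂ)) atTop
      (nhds (((-(θ * V / 2) : ℝ)) : ℂ)) := by
  obtain ⟨C₁, σ, hσ, hσ1, h1⟩ := H.mean_le
  obtain ⟨C₂, h2⟩ := H.moment_le 2
  obtain ⟨C₃, h3⟩ := H.moment_le 3
  obtain ⟨C₀, h0⟩ := H.moment_le 1
  simp only [pow_one] at h0
  simp only [sq_abs] at h2
  have hC₁ : 0 ≤ C₁ := by have := (abs_nonneg _).trans (h1 1); simpa using this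
  set B₁ := ∑' i : ℕ, C₁ * ((i : ℝ) + 1) ^ (-(1 + σ)) with hB₁
  have hsummB : Summable fun i : ℕ => C₁ * ((i : ℝ) + 1) ^ (-(1 + σ)) := by
    have := (Real.summable_nat_rpow (p := -(1 + σ))).2 (by linarith)
    have := ((summable_nat_add_iff 1).2 this).mul_left C₁
    simpa using this
  have hlog : Tendsto (fun N : ℕ => √(Real.log N)) atTop atTop :=
    tendsto_sqrt_atTop.comp (Real.tendsto_log_atTop.comp tendsto_natCast_atTop_atTop)
  have hsto : Tendsto (fun N : ℕ => 1 / √(Real.log N)) atTop (nhds 0) := by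
    exact hlog.inv_tendsto_atTop.congr fun N => by simp
  rw [tendsto_iff_norm_sub_tendsto_zero, Metric.tendsto_atTop]
  intro ε hε
  -- the tolerance in the Cesàro limit of the second moments
  set η := ε / (|θ| + 1) with hη
  have hηpos : 0 < η := by positivity
  obtain ⟨n₀, hn₀⟩ := Metric.tendsto_atTop.1 H.tendsto η hηpos
  -- `B₂` accounts for the finitely many partial sums before the Cesàro limit sets in; it is carried
  -- by the term `i = 0`
  have hB2 : ∃ B₂ : ℝ, 0 ≤ B₂ ∧ ∀ n : ℕ, |∑ i ∈ Finset.range n, (∫ x, X x ^ 2 ∂μ (i + 1) - V)|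
      ≤ ∑ i ∈ Finset.range n, (η + if i = 0 then B₂ else 0) := by
    refine ⟨∑ k ∈ Finset.range n₀, |∑ i ∈ Finset.range k, (∫ x, X x ^ 2 ∂μ (i + 1) - V)|,
      Finset.sum_nonneg fun _ _ => abs_nonneg _, fun n => ?_⟩
    rcases Nat.eq_zero_or_pos n with rfl | hnpos
    · simp
    rw [Finset.sum_add_distrib, Finset.sum_ite_eq' (Finset.range n) 0]
    simp only [Finset.sum_const, Finset.card_range, nsmul_eq_mul, Finset.mem_range, hnpos, if_true]
    have hn' : (0 : ℝ) < n := by exact_mod_cast hnpos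
    rcases lt_or_ge n n₀ with hlt | hge
    · have := Finset.single_le_sum (f := fun k => |∑ i ∈ Finset.range k, (∫ x, X x ^ 2 ∂μ (i + 1) - V)|)
        (fun _ _ => abs_nonneg _) (Finset.mem_range.2 hlt)
      have h4 : 0 ≤ (n : ℝ) * η := by positivity
      linarith
    · have h4 := (hn₀ n hge).le
      rw [Real.dist_eq, div_sub' hn'.ne', abs_div, abs_of_pos hn', div_le_iff₀ hn'] at h4
      rw [Finset.sum_sub_distrib]
      simp only [Finset.sum_const, Finset.card_range, nsmul_eq_mul]
      have h5 : 0 ≤ ∑ k ∈ Finset.range n₀, |∑ i ∈ Finset.range k, (∫ x, X x ^ 2 ∂μ (i + 1) - V)| :=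
        Finset.sum_nonneg fun _ _ => abs_nonneg _
      linarith
  obtain ⟨B₂, hB₂0, hB₂⟩ := hB2
  have hlim : Tendsto (fun N : ℕ => |θ| * (1 / √(Real.log N) * B₁ + (η / 2 + (1 / √(Real.log N)) ^ 2 / 2 * B₂)
      + 4 * C₃ * (1 / √(Real.log N)))) atTop (nhds (|θ| * (0 * B₁ + (η / 2 + 0 ^ 2 / 2 * B₂) + 4 * C₃ * 0))) :=
    (((hsto.mul_const B₁).add ((((hsto.pow 2).div_const 2).mul_const B₂).const_add (η / 2))).add
      (hsto.const_mul (4 * C₃))).const_mul |θ|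
  have hlt : |θ| * (0 * B₁ + (η / 2 + 0 ^ 2 / 2 * B₂) + 4 * C₃ * 0) < ε := by
    have : |θ| * (0 * B₁ + (η / 2 + 0 ^ 2 / 2 * B₂) + 4 * C₃ * 0) = |θ| * η / 2 := by ring
    rw [this, hη]
    have h4 : |θ| * (ε / (|θ| + 1)) ≤ ε := by
      rw [mul_div_assoc', div_le_iff₀ (by positivity)]
      nlinarith [abs_nonneg θ]
    linarith
  obtain ⟨N₀, hN₀⟩ := eventually_atTop.1 ((hlim.eventually (gt_mem_nhds hlt)).and (eventually_ge_atTop 2))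
  refine ⟨N₀, fun N hN => ?_⟩
  obtain ⟨hN1, hN2⟩ := hN₀ N hN
  rw [Real.dist_eq, sub_zero, abs_of_nonneg (norm_nonneg _)]
  refine lt_of_le_of_lt ?_ hN1
  clear hN1 hlim hlt hN₀
  have hNr : (2 : ℝ) ≤ N := by exact_mod_cast hN2
  set L := Real.log N with hL
  have hLpos : 0 < L := Real.log_pos (by linarith)
  have hsq : √L ^ 2 = L := Real.sq_sqrt hLpos.le
  have hsL : 0 < √L := Real.sqrt_pos.2 hLpos
  set s := 1 / √L with hs
  have hs0 : 0 < s := by positivity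
  have hsL1 : s * L = √L := by rw [hs]; field_simp; exact hsq.symm
  have hs2L : s ^ 2 * L = 1 := by rw [hs]; field_simp; exact hsq.symm
  set z : ℝ := 1 - 1 / (N : ℝ) with hz
  have hz1 : z < 1 := by
    have : 0 < 1 / (N : ℝ) := by positivity
    linarith
  have hz0 : 0 ≤ z := by rw [hz, sub_nonneg, div_le_one (by linarith)]; linarith
  set v : ℕ → ℝ := fun i => z ^ (i + 1) / ((i : ℝ) + 1) with hv
  have hv0 : ∀ i, 0 ≤ v i := fun i => by positivity
  have hvanti : Antitone v := antitone_pow_succ_div hz0 hz1.le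
  have hvsum : HasSum v L := by
    have := hasSum_pow_succ_div hz0 hz1
    rwa [show -Real.log (1 - z) = L by
      rw [hz, hL, show 1 - (1 - 1 / (N : ℝ)) = (N : ℝ)⁻¹ by rw [one_div]; ring, Real.log_inv, neg_neg]] at this
  have sX : Summable fun i => (∫ x, X x ∂μ (i + 1)) * v i := by
    refine Summable.of_norm_bounded (summable_mul_pow_succ_div hz0 hz1
      (c := fun i => ∫ x, |X x| ∂μ (i + 1)) (fun i => integral_nonneg fun x => abs_nonneg _) h0) fun i => ?_
    rw [norm_mul, Real.norm_of_nonneg (hv0 i)]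
    exact mul_le_mul_of_nonneg_right (norm_integral_le_integral_norm _) (hv0 i)
  have sX2 : Summable fun i => (∫ x, X x ^ 2 ∂μ (i + 1)) * v i :=
    summable_mul_pow_succ_div hz0 hz1 (fun i => integral_nonneg fun x => sq_nonneg _) h2
  have sX3 : Summable fun i => (∫ x, |X x| ^ 3 ∂μ (i + 1)) * v i :=
    summable_mul_pow_succ_div hz0 hz1 (fun i => integral_nonneg fun x => by positivity) h3
  have sX1' : Summable fun i => (∫ x, X x ∂μ (i + 1) - mean) * v i := by
    simpa only [sub_mul] using sX.sub (hvsum.summable.mul_left mean)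
  have sX2' : Summable fun i => (∫ x, X x ^ 2 ∂μ (i + 1) - V) * v i := by
    simpa only [sub_mul] using sX2.sub (hvsum.summable.mul_left V)
  -- the mean, the variance and the remainder
  have hS1 : |∑' i, (∫ x, X x ∂μ (i + 1) - mean) * v i| ≤ B₁ := by
    have hle : ∀ i : ℕ, C₁ * ((i : ℝ) + 1) ^ (-σ) * v i ≤ C₁ * ((i : ℝ) + 1) ^ (-(1 + σ)) := by
      intro i
      have hi : (0 : ℝ) < i + 1 := by positivity
      have : v i ≤ ((i : ℝ) + 1) ^ (-1 : ℝ) := by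
        rw [hv, Real.rpow_neg_one, ← one_div]
        simp only
        gcongr
        exact pow_le_one₀ hz0 hz1.le
      rw [show -(1 + σ) = -σ + (-1) by ring, Real.rpow_add hi, ← mul_assoc]
      gcongr
    have hsb : Summable fun i : ℕ => C₁ * ((i : ℝ) + 1) ^ (-σ) * v i :=
      Summable.of_nonneg_of_le (fun i => mul_nonneg (by positivity) (hv0 i)) hle hsummB
    refine (abs_tsum_mul_le_tsum_mul (b := fun i => C₁ * ((i : ℝ) + 1) ^ (-σ)) (fun n => ?_) hvanti hv0
      sX1' hsb).trans (hsb.tsum_le_tsum hle hsummB)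
    refine (h1 n).trans ?_
    rw [← Finset.mul_sum]
    refine mul_le_mul_of_nonneg_left ?_ hC₁
    rcases Nat.eq_zero_or_pos n with rfl | hnpos
    · simp only [Nat.cast_zero, Finset.range_zero, Finset.sum_empty]
      rw [Real.zero_rpow (by linarith)]
    have hn' : (0 : ℝ) < n := by exact_mod_cast hnpos
    calc (n : ℝ) ^ (1 - σ) = ∑ i ∈ Finset.range n, (n : ℝ) ^ (-σ) := by
          rw [Finset.sum_const, Finset.card_range, nsmul_eq_mul, sub_eq_add_neg, Real.rpow_add hn',
            Real.rpow_one]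
      _ ≤ _ := Finset.sum_le_sum fun i hi => by
          refine Real.rpow_le_rpow_of_nonpos (by positivity) ?_ (by linarith)
          exact_mod_cast Finset.mem_range.1 hi
  have hS2 : |∑' i, (∫ x, X x ^ 2 ∂μ (i + 1) - V) * v i| ≤ η * L + B₂ := by
    have hb : HasSum (fun i => (η + if i = 0 then B₂ else 0) * v i) (η * L + B₂ * v 0) := by
      have := (hvsum.mul_left η).add (hasSum_ite_eq 0 (B₂ * v 0))
      refine this.congr_fun fun i => ?_
      split_ifs with h
      · rw [h]; ring
      · ring
    refine (abs_tsum_mul_le_tsum_mul hB₂ hvanti hv0 sX2' hb.summable).trans ?_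
    rw [hb.tsum_eq]
    have : v 0 ≤ 1 := by simp [hv, hz1.le]
    nlinarith
  set ρ : ℕ → ℂ := fun i => cycleCharFun μ X s (i + 1) - 1 - Complex.I * s * (∫ x, X x ∂μ (i + 1) : ℝ)
      + (s : ℂ) ^ 2 / 2 * (∫ x, X x ^ 2 ∂μ (i + 1) : ℝ) with hρ
  have hρle : ∀ i, ‖ρ i * v i‖ ≤ 4 * s ^ 3 * ((∫ x, |X x| ^ 3 ∂μ (i + 1)) * v i) := by
    intro i
    rw [norm_mul, Complex.norm_real, Real.norm_of_nonneg (hv0 i), ← mul_assoc]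
    exact mul_le_mul_of_nonneg_right (H.norm_cycleCharFun_sub_taylor_le hs0.le i) (hv0 i)
  have sρ : Summable fun i => ρ i * (v i : ℂ) := Summable.of_norm_bounded (sX3.mul_left _) hρle
  have hS3 : ‖∑' i, ρ i * (v i : ℂ)‖ ≤ 4 * C₃ * s := by
    refine (tsum_of_norm_bounded (sX3.mul_left _).hasSum hρle).trans ?_
    rw [tsum_mul_left]
    have h4 : |∑' i, (∫ x, |X x| ^ 3 ∂μ (i + 1)) * v i| ≤ ∑' i, C₃ * v i := by
      refine abs_tsum_mul_le_tsum_mul (b := fun _ => C₃) (fun n => ?_) hvanti hv0 sX3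
        (hvsum.summable.mul_left _)
      rw [abs_of_nonneg (Finset.sum_nonneg fun i _ => integral_nonneg fun x => by positivity)]
      simpa [mul_comm] using h3 n
    rw [tsum_mul_left, hvsum.tsum_eq] at h4
    calc 4 * s ^ 3 * ∑' i, (∫ x, |X x| ^ 3 ∂μ (i + 1)) * v i ≤ 4 * s ^ 3 * (C₃ * L) := by
          gcongr; exact (le_abs_self _).trans h4
      _ = 4 * C₃ * s * (s ^ 2 * L) := by ring
      _ = _ := by rw [hs2L, mul_one]
  have hdecomp : (∑' i : ℕ, (cycleCharFun μ X s (i + 1) - 1) * (z : ℂ) ^ (i + 1) / (i + 1))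
      = Complex.I * s * ((∑' i, (∫ x, X x ∂μ (i + 1) - mean) * v i + mean * L : ℝ) : ℂ)
        - (s : ℂ) ^ 2 / 2 * ((∑' i, (∫ x, X x ^ 2 ∂μ (i + 1) - V) * v i + V * L : ℝ) : ℂ)
        + ∑' i, ρ i * (v i : ℂ) := by
    have e1 := (Complex.hasSum_ofReal.2 (sX1'.hasSum.add (hvsum.mul_left mean))).mul_left (Complex.I * s)
    have e2 := (Complex.hasSum_ofReal.2 (sX2'.hasSum.add (hvsum.mul_left V))).mul_left ((s : ℂ) ^ 2 / 2)
    have e3 := (e1.sub e2).add sρ.hasSum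
    rw [← e3.tsum_eq]
    refine tsum_congr fun i => ?_
    simp only [hρ, hv]
    push_cast
    ring
  rw [hdecomp]
  set S1 := ∑' i, (∫ x, X x ∂μ (i + 1) - mean) * v i
  set S2 := ∑' i, (∫ x, X x ^ 2 ∂μ (i + 1) - V) * v i
  set S3 := ∑' i, ρ i * (v i : ℂ)
  have hfin : (θ : ℂ) * (Complex.I * s * ((S1 + mean * L : ℝ) : ℂ)
        - (s : ℂ) ^ 2 / 2 * ((S2 + V * L : ℝ) : ℂ) + S3)
        - Complex.I * ((θ * √L * mean : ℝ) : ℂ) - ((-(θ * V / 2) : ℝ) : ℂ)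
      = θ * (Complex.I * ((s * S1 : ℝ) : ℂ) - ((s ^ 2 / 2 * S2 : ℝ) : ℂ) + S3) := by
    rw [← hsL1]
    have : ((s ^ 2 * L : ℝ) : ℂ) = 1 := by rw [hs2L]; simp
    push_cast at this ⊢
    linear_combination (-(θ : ℂ) * V / 2) * this
  rw [hfin, norm_mul, Complex.norm_real, Real.norm_eq_abs]
  refine mul_le_mul_of_nonneg_left ?_ (abs_nonneg _)
  refine (norm_add_le _ _).trans (add_le_add ((norm_sub_le _ _).trans (add_le_add ?_ ?_)) hS3)
  · rw [norm_mul, Complex.norm_I, one_mul, Complex.norm_real, Real.norm_eq_abs, abs_mul, abs_of_pos hs0]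
    gcongr
  · rw [Complex.norm_real, Real.norm_eq_abs, abs_mul, abs_of_nonneg (by positivity)]
    calc s ^ 2 / 2 * |S2| ≤ s ^ 2 / 2 * (η * L + B₂) := by gcongr
      _ = η / 2 * (s ^ 2 * L) + s ^ 2 / 2 * B₂ := by ring
      _ = _ := by rw [hs2L, mul_one]

/-- The characteristic function of the normalised and centred sum over the cycles converges to that
of a centred Gaussian variable of variance `θ V`. -/
theorem tendsto_charFun (H : CesaroMoments μ X mean V) {θ : ℝ} (hθ : 0 < θ) :
    Tendsto (fun N : ℕ => Complex.exp (-(Complex.I * ((θ * √(Real.log N) * mean : ℝ) : ℂ))) *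
      (ewensIndex θ (cycleCharFun μ X (1 / √(Real.log N))) N / ewensCoeff θ N)) atTop
      (nhds (Complex.exp ((-(θ * V / 2) : ℝ) : ℂ))) := by
  have hlog : Tendsto (fun N : ℕ => √(Real.log N)) atTop atTop :=
    tendsto_sqrt_atTop.comp (Real.tendsto_log_atTop.comp tendsto_natCast_atTop_atTop)
  have hsto : Tendsto (fun N : ℕ => 1 / √(Real.log N)) atTop (nhds 0) := by
    exact hlog.inv_tendsto_atTop.congr fun N => by simp
  have h1 := H.tendsto_sub_exp hθ (fun N => by positivity) hsto
  have h2 := (Complex.continuous_exp.tendsto _).comp (H.tendsto_exponent θ)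
  have h3 : Tendsto (fun N : ℕ => Complex.exp (-(Complex.I * ((θ * √(Real.log N) * mean : ℝ) : ℂ))) *
      (ewensIndex θ (cycleCharFun μ X (1 / √(Real.log N))) N / ewensCoeff θ N
      - Complex.exp (θ * ∑' i : ℕ, (cycleCharFun μ X (1 / √(Real.log N)) (i + 1) - 1) *
        ((1 - 1 / (N : ℝ) : ℝ) : ℂ) ^ (i + 1) / (i + 1)))) atTop (nhds 0) := by
    rw [tendsto_zero_iff_norm_tendsto_zero] at h1 ⊢
    refine h1.congr fun N => ?_
    rw [norm_mul, ← mul_neg, ← Complex.ofReal_neg, mul_comm Complex.I, Complex.norm_exp_ofReal_mul_I, one_mul]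
  have h4 := h3.add h2
  rw [zero_add] at h4
  refine h4.congr fun N => ?_
  simp only [Function.comp]
  rw [Complex.exp_sub, Complex.exp_neg]
  ring

end CesaroMoments

/-! ### Class functions of an Ewens permutation with independent marks on its cycles -/

lemma integral_ewensMeasure (θ : ℝ) (hθ : 0 < θ) (n : ℕ) (g : Equiv.Perm (Fin n) → ℂ) :
    ∫ τ, g τ ∂(ewensMeasure θ n)
      = ∑ τ, ((θ ^ totalCycles τ / ∏ i ∈ Finset.range n, (θ + i) : ℝ) : ℂ) * g τ := by
  rw [ewensMeasure, integral_finsetSum_measure (fun τ _ => .smul_measure (by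
    have : MeasurableSingletonClass (Equiv.Perm (Fin n)) := ⟨fun _ => trivial⟩
    exact integrable_dirac (by simp [enorm_lt_top])) (by simp))]
  refine Finset.sum_congr rfl fun τ _ => ?_
  have : MeasurableSingletonClass (Equiv.Perm (Fin n)) := ⟨fun _ => trivial⟩
  rw [integral_smul_measure, integral_dirac, ENNReal.toReal_ofReal
    (div_nonneg (by positivity) (Finset.prod_nonneg fun i _ => by positivity)), Complex.real_smul]

lemma sum_ewens_mul_prod_eq (θ : ℝ) (n : ℕ) (r : ℕ → ℂ) :
    ∑ τ : Equiv.Perm (Fin n), ((θ ^ totalCycles τ / ∏ i ∈ Finset.range n, (θ + i) : ℝ) : ℂ) *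
      ∏ m ∈ Finset.Icc 1 n, r m ^ cycleCount τ m = ewensIndex θ r n / ewensCoeff θ n := by
  rw [ewensIndex, ewensCoeff, Finset.mul_sum, Finset.sum_div]
  refine Finset.sum_congr rfl fun τ _ => ?_
  have : (n.factorial : ℂ) ≠ 0 := by exact_mod_cast Nat.factorial_ne_zero _
  push_cast
  field_simp

section Marks

variable {E Ω : Type*} [MeasurableSpace E] [MeasurableSpace Ω] {P : Measure Ω}
  {n : ℕ}

lemma integral_prod_marks_eq {T : ℕ → ℕ → Ω → E} {ρ : ℕ → Measure E}
    (hT : ∀ m k, HasLaw (T m k) (ρ m) P) (hind : iIndepFun (fun (p : ℕ × ℕ) => T p.1 p.2) P)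
    {Φ : ℕ → E → ℂ} (hΦ : ∀ m, Measurable (Φ m)) (c : ℕ → ℕ) (n : ℕ) :
    ∫ ω, ∏ m ∈ Finset.Icc 1 n, ∏ k ∈ Finset.range (c m), Φ m (T m k ω) ∂P
      = ∏ m ∈ Finset.Icc 1 n, (∫ x, Φ m x ∂ρ m) ^ c m := by
  let J := Σ m : Finset.Icc 1 n, Fin (c m)
  let e : J → ℕ × ℕ := fun j => (j.1, j.2)
  have he : e.Injective := by
    rintro ⟨⟨a, ha⟩, ⟨b, hb⟩⟩ ⟨⟨a', ha'⟩, ⟨b', hb'⟩⟩ h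
    simp only [e, Prod.mk.injEq] at h
    obtain ⟨rfl, rfl⟩ := h
    rfl
  have h1 := (hind.precomp he).integral_fun_prod_comp (𝕜 := ℂ)
    (f := fun j : J => Φ j.1) (fun j => (hT _ _).aemeasurable)
    (fun j => (hΦ _).aestronglyMeasurable)
  have h2 : ∀ ω, ∏ m ∈ Finset.Icc 1 n, ∏ k ∈ Finset.range (c m), Φ m (T m k ω)
      = ∏ j : J, Φ j.1 (T (e j).1 (e j).2 ω) := by
    intro ω
    rw [Fintype.prod_sigma, ← Finset.prod_coe_sort (Finset.Icc 1 n)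
      (fun m => ∏ k ∈ Finset.range (c m), Φ m (T m k ω))]
    exact Finset.prod_congr rfl fun m _ => Finset.prod_range _
  simp_rw [h2]
  rw [h1, Fintype.prod_sigma, ← Finset.prod_coe_sort (Finset.Icc 1 n)
    (fun m => (∫ x, Φ m x ∂ρ m) ^ c m)]
  refine Finset.prod_congr rfl fun m _ => ?_
  have h3 : ∀ k : Fin (c m), ∫ ω, Φ m (T m k ω) ∂P = ∫ x, Φ m x ∂ρ m := fun k =>
    (hT m k).integral_comp (f := Φ m) (hΦ m).aestronglyMeasurable
  calc ∏ k : Fin (c m), ∫ ω, Φ m (T m k ω) ∂P = ∏ _k : Fin (c m), ∫ x, Φ m x ∂ρ m :=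
        Finset.prod_congr rfl fun k _ => h3 k
    _ = _ := by simp

variable [IsProbabilityMeasure P]

/-- Conditioning on a permutation that is independent of a process. -/
lemma integral_comp_perm_eq {F : Type*} [MeasurableSpace F] {θ : ℝ} (hθ : 0 < θ)
    {σ : Ω → Equiv.Perm (Fin n)} {T : Ω → F}
    (hσ : HasLaw σ (ewensMeasure θ n) P) (hT : AEMeasurable T P) (hσT : IndepFun σ T P)
    {g : Equiv.Perm (Fin n) → F → ℂ} (hg : ∀ τ, Measurable (g τ)) (hg1 : ∀ τ x, ‖g τ x‖ ≤ 1) :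
    ∫ ω, g (σ ω) (T ω) ∂P
      = ∑ τ, ((θ ^ totalCycles τ / ∏ i ∈ Finset.range n, (θ + i) : ℝ) : ℂ) * ∫ ω, g τ (T ω) ∂P := by
  classical
  have hind : ∀ τ : Equiv.Perm (Fin n), Measurable fun τ' => if τ' = τ then (1 : ℂ) else 0 :=
    fun τ => fun _ _ => trivial
  have h1 : ∀ ω, g (σ ω) (T ω) = ∑ τ, (if σ ω = τ then (1 : ℂ) else 0) * g τ (T ω) := by
    intro ω; simp
  simp_rw [h1]
  have hgT : ∀ τ, AEStronglyMeasurable (fun ω => g τ (T ω)) P := fun τ =>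
    ((hg τ).comp_aemeasurable hT).aestronglyMeasurable
  have hsm : ∀ τ, AEStronglyMeasurable (fun ω => if σ ω = τ then (1 : ℂ) else 0) P := fun τ =>
    ((hind τ).comp_aemeasurable hσ.aemeasurable).aestronglyMeasurable
  rw [integral_finsetSum]
  · have h2 : ∀ τ : Equiv.Perm (Fin n), ∫ ω, (if σ ω = τ then (1 : ℂ) else 0) * g τ (T ω) ∂P
        = (∫ ω, (if σ ω = τ then (1 : ℂ) else 0) ∂P) * ∫ ω, g τ (T ω) ∂P := fun τ =>
      (hσT.comp (hind τ) (hg τ)).integral_fun_mul_eq_mul_integral (hsm τ) (hgT τ)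
    refine Finset.sum_congr rfl fun τ _ => ?_
    rw [h2]
    congr 1
    have h3 := hσ.integral_comp (f := fun τ' => if τ' = τ then (1 : ℂ) else 0)
      (Measurable.aestronglyMeasurable (hind τ))
    refine h3.trans ?_
    rw [integral_ewensMeasure θ hθ]
    simp
  · intro τ _
    refine (integrable_const (1 : ℝ)).mono' ((hsm τ).mul (hgT τ)) (ae_of_all _ fun ω => ?_)
    rw [norm_mul]
    have := hg1 τ (T ω)
    split_ifs <;> simp [this]

/-- The mean of a multiplicative functional of the marked cycles is a weighted cycle index. -/
lemma integral_marked_cycles_eq {θ : ℝ} (hθ : 0 < θ) {σ : Ω → Equiv.Perm (Fin n)}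
    {T : ℕ → ℕ → Ω → E} {ρ : ℕ → Measure E}
    (hσ : HasLaw σ (ewensMeasure θ n) P) (hT : ∀ m k, HasLaw (T m k) (ρ m) P)
    (hind : iIndepFun (fun (p : ℕ × ℕ) => T p.1 p.2) P)
    (hσT : IndepFun σ (fun ω (p : ℕ × ℕ) => T p.1 p.2 ω) P)
    {Φ : ℕ → E → ℂ} (hΦ : ∀ m, Measurable (Φ m)) (hΦ1 : ∀ m x, ‖Φ m x‖ ≤ 1) :
    ∫ ω, ∏ m ∈ Finset.Icc 1 n, ∏ k ∈ Finset.range (cycleCount (σ ω) m), Φ m (T m k ω) ∂P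
      = ewensIndex θ (fun m => ∫ x, Φ m x ∂ρ m) n / ewensCoeff θ n := by
  have h := integral_comp_perm_eq hθ hσ
    (aemeasurable_pi_lambda (fun ω (p : ℕ × ℕ) => T p.1 p.2 ω) fun p => (hT p.1 p.2).aemeasurable) hσT
    (g := fun τ T => ∏ m ∈ Finset.Icc 1 n, ∏ k ∈ Finset.range (cycleCount τ m), Φ m (T (m, k)))
    (fun τ => Finset.measurable_fun_prod _ fun m _ => Finset.measurable_fun_prod _ fun k _ =>
      (hΦ m).comp (measurable_pi_apply _))
    (fun τ T => by
      rw [norm_prod]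
      refine Finset.prod_le_one (fun _ _ => norm_nonneg _) fun m _ => ?_
      rw [norm_prod]
      exact Finset.prod_le_one (fun _ _ => norm_nonneg _) fun k _ => hΦ1 _ _)
  rw [← sum_ewens_mul_prod_eq]
  refine h.trans (Finset.sum_congr rfl fun τ _ => ?_)
  rw [integral_prod_marks_eq hT hind hΦ]

end Marks

/-- The law of `(x_1^m T_1, …, x_d^m T_d)`, where `x_j = e^{2πiφ_j}` and `T` is a product of `m`
independent vectors with law `ν`. -/
def rotatedLaw {d : ℕ} (φ : Fin d → ℝ) (ν : Measure (Fin d → Circle)) (m : ℕ) :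
    Measure (Fin d → Circle) :=
  (productLaw ν m).map fun t j => circlePoint (φ j) ^ m * t j

/-- The real (`k = 0`) and imaginary (`k = 1`) parts of `log f`. -/
def logPart (f : Circle → ℂ) (k : Fin 2) (w : Circle) : ℝ :=
  if k = 0 then Real.log ‖f w‖ else (f w).arg

/-- The linear combination `∑ t_{j,k} log f_j(w_j)_k` of the real and imaginary parts of the
`log f_j(w_j)`. -/
def logCombination {d : ℕ} (f : Fin d → Circle → ℂ) (t : Fin d × Fin 2 → ℝ) (w : Fin d → Circle) :
    ℝ := ∑ a, t a * logPart (f a.1) a.2 (w a.1)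

instance circleSecondCountable : SecondCountableTopology Circle :=
  inferInstanceAs (SecondCountableTopology (Submonoid.unitSphere ℂ))

lemma measurable_rotate {d : ℕ} (φ : Fin d → ℝ) (m : ℕ) :
    Measurable fun (t : Fin d → Circle) j => circlePoint (φ j) ^ m * t j := by
  fun_prop

lemma measurable_prodCircle {d m : ℕ} :
    Measurable fun (z : Fin m → Fin d → Circle) j => ∏ i, z i j := by
  fun_prop

instance {d : ℕ} (ν : Measure (Fin d → Circle)) [IsProbabilityMeasure ν] (m : ℕ) :
    IsProbabilityMeasure (productLaw ν m) :=
  Measure.isProbabilityMeasure_map measurable_prodCircle.aemeasurable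

instance {d : ℕ} (φ : Fin d → ℝ) (ν : Measure (Fin d → Circle)) [IsProbabilityMeasure ν] (m : ℕ) :
    IsProbabilityMeasure (rotatedLaw φ ν m) :=
  Measure.isProbabilityMeasure_map (measurable_rotate φ m).aemeasurable

lemma measurable_logPart {f : Circle → ℂ} (hf : Measurable f) (k : Fin 2) :
    Measurable (logPart f k) := by
  unfold logPart
  split_ifs <;> fun_prop

lemma measurable_logCombination {d : ℕ} {f : Fin d → Circle → ℂ} (hf : ∀ j, Measurable (f j))
    (t : Fin d × Fin 2 → ℝ) : Measurable (logCombination f t) := by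
  refine Finset.measurable_fun_sum _ fun a _ => ?_
  exact ((measurable_logPart (hf a.1) a.2).comp (measurable_pi_apply a.1)).const_mul _

/-- The characteristic function of the linear statistics of the `w^{2,n}(f_j)(x_j)`. -/
lemma integral_exp_w2_eq {d n : ℕ} {θ : ℝ} (hθ : 0 < θ) {f : Fin d → Circle → ℂ}
    (hf : ∀ j, Measurable (f j)) (φ : Fin d → ℝ) (ν : Measure (Fin d → Circle))
    {Ω : Type*} [MeasurableSpace Ω] {P : Measure Ω} [IsProbabilityMeasure P]
    {σ : Ω → Equiv.Perm (Fin n)} {T : ℕ → ℕ → Ω → Fin d → Circle}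
    (hσ : HasLaw σ (ewensMeasure θ n) P) (hT : ∀ m k, HasLaw (T m k) (productLaw ν m) P)
    (hind : iIndepFun (fun (p : ℕ × ℕ) => T p.1 p.2) P)
    (hσT : IndepFun σ (fun ω (p : ℕ × ℕ) => T p.1 p.2 ω) P) (t : Fin d × Fin 2 → ℝ) (s : ℝ) :
    ∫ ω, Complex.exp (Complex.I * ((s * ∑ j,
        (t (j, 0) * (w2 (f j) (circlePoint (φ j)) (σ ω) fun m k => T m k ω j).re
          + t (j, 1) * (w2 (f j) (circlePoint (φ j)) (σ ω) fun m k => T m k ω j).im) : ℝ) : ℂ)) ∂P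
      = ewensIndex θ (cycleCharFun (rotatedLaw φ ν) (logCombination f t) s) n / ewensCoeff θ n := by
  set Φ : ℕ → (Fin d → Circle) → ℂ := fun m x => Complex.exp (Complex.I *
    ((s * logCombination f t (fun j => circlePoint (φ j) ^ m * x j) : ℝ) : ℂ)) with hΦ
  have hmeas := measurable_logCombination hf t
  have hΦm : ∀ m, Measurable (Φ m) := fun m => by
    have := hmeas.comp (measurable_rotate φ m)
    have h2 : Measurable fun x : Fin d → Circle =>
      logCombination f t (fun j => circlePoint (φ j) ^ m * x j) := this
    fun_prop
  have h := integral_marked_cycles_eq hθ hσ hT hind hσT hΦm (fun m x => by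
    rw [hΦ]; simp only; rw [mul_comm, Complex.norm_exp_ofReal_mul_I])
  have h2 : (fun m => ∫ x, Φ m x ∂productLaw ν m)
      = cycleCharFun (rotatedLaw φ ν) (logCombination f t) s := by
    ext m
    rw [cycleCharFun, rotatedLaw, integral_map (measurable_rotate φ m).aemeasurable]
    exact Measurable.aestronglyMeasurable (by fun_prop)
  rw [h2] at h
  rw [← h]
  refine integral_congr_ae (ae_of_all _ fun ω => ?_)
  simp only [hΦ]
  simp_rw [← Complex.exp_sum]
  congr 1
  simp_rw [← Finset.mul_sum, ← Complex.ofReal_sum]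
  congr 2
  simp_rw [← Finset.mul_sum]
  congr 1
  simp only [w2, Complex.re_sum, Complex.im_sum, Complex.log_re, Complex.log_im, logCombination,
    Fintype.sum_prod_type, Fin.sum_univ_two, logPart]
  simp only [if_true, one_ne_zero, if_false]
  simp_rw [Finset.mul_sum, ← Finset.sum_add_distrib]
  rw [Finset.sum_comm]
  refine Finset.sum_congr rfl fun m _ => ?_
  rw [Finset.sum_comm]

/-! ### The Gaussian limit -/

/-- The vector of complex numbers with given real (`k = 0`) and imaginary (`k = 1`) parts. -/
def toComplexVector (d : ℕ) : EuclideanSpace ℝ (Fin d × Fin 2) →L[ℝ] (Fin d → ℂ) :=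
  ContinuousLinearMap.pi fun j =>
    Complex.ofRealCLM.comp (EuclideanSpace.proj (j, 0)) +
      (Complex.I • Complex.ofRealCLM).comp (EuclideanSpace.proj (j, 1))

lemma toComplexVector_apply {d : ℕ} (x : EuclideanSpace ℝ (Fin d × Fin 2)) (j : Fin d) :
    toComplexVector d x j = x (j, 0) + Complex.I * x (j, 1) := by
  simp [toComplexVector]

lemma toComplexVector_re {d : ℕ} (x : EuclideanSpace ℝ (Fin d × Fin 2)) (j : Fin d) :
    (toComplexVector d x j).re = x (j, 0) := by
  simp [toComplexVector_apply]

lemma toComplexVector_im {d : ℕ} (x : EuclideanSpace ℝ (Fin d × Fin 2)) (j : Fin d) :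
    (toComplexVector d x j).im = x (j, 1) := by
  simp [toComplexVector_apply]

section Covariance

variable {d : ℕ} {S : Matrix (Fin d × Fin 2) (Fin d × Fin 2) ℝ}

lemma covariance_map_toComplexVector (G : Measure (EuclideanSpace ℝ (Fin d × Fin 2)))
    {g h : (Fin d → ℂ) → ℝ} (hg : Measurable g) (hh : Measurable h) :
    cov[g, h; G.map (toComplexVector d)]
      = cov[fun x => g (toComplexVector d x), fun x => h (toComplexVector d x); G] :=
  covariance_map_fun hg.aestronglyMeasurable hh.aestronglyMeasurable
    (toComplexVector d).continuous.aemeasurable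

lemma covariance_re_re (hS : S.PosSemidef) (j l : Fin d) :
    cov[fun y => (y j).re, fun y => (y l).re; (multivariateGaussian 0 S).map (toComplexVector d)]
      = S (j, 0) (l, 0) := by
  rw [covariance_map_toComplexVector _ (by fun_prop) (by fun_prop)]
  simp_rw [toComplexVector_re]
  exact covariance_eval_multivariateGaussian hS _ _

lemma covariance_re_im (hS : S.PosSemidef) (j l : Fin d) :
    cov[fun y => (y j).re, fun y => (y l).im; (multivariateGaussian 0 S).map (toComplexVector d)]
      = S (j, 0) (l, 1) := by
  rw [covariance_map_toComplexVector _ (by fun_prop) (by fun_prop)]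
  simp_rw [toComplexVector_re, toComplexVector_im]
  exact covariance_eval_multivariateGaussian hS _ _

lemma covariance_im_im (hS : S.PosSemidef) (j l : Fin d) :
    cov[fun y => (y j).im, fun y => (y l).im; (multivariateGaussian 0 S).map (toComplexVector d)]
      = S (j, 1) (l, 1) := by
  rw [covariance_map_toComplexVector _ (by fun_prop) (by fun_prop)]
  simp_rw [toComplexVector_im]
  exact covariance_eval_multivariateGaussian hS _ _

lemma integral_eval_map_toComplexVector (j : Fin d) :
    ∫ y, y j ∂((multivariateGaussian 0 S).map (toComplexVector d)) = 0 := by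
  rw [integral_map (toComplexVector d).continuous.aemeasurable
    (measurable_pi_apply j).aestronglyMeasurable]
  have h := ((ContinuousLinearMap.proj (R := ℝ) (φ := fun _ : Fin d => ℂ) j).comp
    (toComplexVector d)).integral_comp_comm (μ := multivariateGaussian 0 S) (φ := fun x => x)
      IsGaussian.integrable_fun_id
  rw [integral_id_multivariateGaussian, map_zero] at h
  exact h

end Covariance

/-- A centred Gaussian law on `ℂ^d` is a limit law once its covariances are the prescribed ones. -/
lemma isLimitLaw_map_multivariateGaussian {d : ℕ} {θ : ℝ} {f : Fin d → Circle → ℂ}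
    {S : Matrix (Fin d × Fin 2) (Fin d × Fin 2) ℝ} (hS : S.PosSemidef)
    (hne : ∀ a b, a.1 ≠ b.1 → S a b = θ * ((∫ u in (0 : ℝ)..1, logPart (f a.1) a.2 (circlePoint u)) *
      ∫ v in (0 : ℝ)..1, logPart (f b.1) b.2 (circlePoint v)))
    (heq : ∀ j k k', S (j, k) (j, k') = θ * ∫ u in (0 : ℝ)..1,
      logPart (f j) k (circlePoint u) * logPart (f j) k' (circlePoint u)) :
    IsLimitLaw θ f ((multivariateGaussian 0 S).map (toComplexVector d)) := by
  have hre : ∀ (g : Circle → ℂ) (u : ℝ), logPart g 0 (circlePoint u) = logAbs g u := fun _ _ => rfl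
  have him : ∀ (g : Circle → ℂ) (u : ℝ), logPart g 1 (circlePoint u) = argOf g u := fun _ _ => by
    simp [logPart, argOf]
  refine ⟨inferInstance, fun j => integral_eval_map_toComplexVector j, fun j l hjl => ?_,
    fun j l hjl => ?_, fun j l hjl => ?_, fun j => ?_, fun j => ?_, fun j => ?_⟩
  · rw [covariance_re_re hS, hne _ _ hjl]
    simp_rw [hre, intervalIntegral.integral_const_mul, intervalIntegral.integral_mul_const]
  · rw [covariance_re_im hS, hne _ _ hjl]
    simp_rw [hre, him, intervalIntegral.integral_const_mul, intervalIntegral.integral_mul_const]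
  · rw [covariance_im_im hS, hne _ _ hjl]
    simp_rw [him, intervalIntegral.integral_const_mul, intervalIntegral.integral_mul_const]
  · rw [← covariance_self (X := fun y : Fin d → ℂ => (y j).re)
      (Complex.measurable_re.comp (measurable_pi_apply j)).aemeasurable,
      covariance_re_re hS, heq]
    simp_rw [hre, sq]
  · rw [← covariance_self (X := fun y : Fin d → ℂ => (y j).im)
      (Complex.measurable_im.comp (measurable_pi_apply j)).aemeasurable,
      covariance_im_im hS, heq]
    simp_rw [him, sq]
  · rw [covariance_re_im hS, heq]
    simp_rw [hre, him]

/-- Lévy's theorem in coordinates. -/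
lemma tendstoInDistribution_multivariateGaussian {ι : Type*} [Fintype ι] [DecidableEq ι]
    {Ω : ℕ → Type*} [∀ n, MeasurableSpace (Ω n)] {P : ∀ n, Measure (Ω n)}
    [∀ n, IsProbabilityMeasure (P n)] {Y : ∀ n, Ω n → EuclideanSpace ℝ ι}
    (hY : ∀ n, AEMeasurable (Y n) (P n)) {S : Matrix ι ι ℝ} (hS : S.PosSemidef)
    (h : ∀ t : EuclideanSpace ℝ ι, Tendsto (fun n =>
      ∫ ω, Complex.exp (Complex.I * ((∑ a, t a * Y n ω a : ℝ) : ℂ)) ∂P n) atTop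
      (nhds (Complex.exp ((-(dotProduct (t : ι → ℝ) (S.mulVec t) / 2) : ℝ) : ℂ)))) :
    TendstoInDistribution Y atTop (fun y => y) P (multivariateGaussian 0 S) := by
  refine ⟨hY, aemeasurable_id, ?_⟩
  refine ProbabilityMeasure.tendsto_iff_tendsto_charFun.2 fun t => ?_
  have hG : charFun (Measure.map (fun y => y) (multivariateGaussian 0 S)) t
      = Complex.exp ((-(dotProduct (t : ι → ℝ) (S.mulVec t) / 2) : ℝ) : ℂ) := by
    rw [Measure.map_id', charFun_multivariateGaussian hS]
    simp only [inner_zero_right, Complex.ofReal_zero, zero_mul, zero_sub]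
    congr 1
    push_cast
    ring
  simp only [ProbabilityMeasure.coe_mk]
  rw [hG]
  refine (h t).congr fun n => ?_
  rw [charFun_apply, integral_map (hY n) (by fun_prop)]
  refine integral_congr_ae (ae_of_all _ fun ω => ?_)
  simp only [PiLp.inner_apply, RCLike.inner_apply, conj_trivial]
  rw [mul_comm]

lemma measurable_w2 {d n : ℕ} {f : Circle → ℂ} (hf : Measurable f) (x : Circle) (j : Fin d) :
    Measurable fun q : Equiv.Perm (Fin n) × (ℕ × ℕ → Fin d → Circle) =>
      w2 f x q.1 (fun m k => q.2 (m, k) j) := by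
  have : MeasurableSingletonClass (Equiv.Perm (Fin n)) := ⟨fun _ => trivial⟩
  refine measurable_from_prod_countable_right fun τ => ?_
  simp only [w2]
  refine Finset.measurable_fun_sum _ fun m _ => Finset.measurable_fun_sum _ fun k _ => ?_
  have h3 : Measurable fun q : ℕ × ℕ → Fin d → Circle => x ^ m * q (m, k) j := by
    fun_prop
  exact Complex.measurable_log.comp (hf.comp h3)

lemma aemeasurable_w2 {d n : ℕ} {f : Circle → ℂ} (hf : Measurable f) (x : Circle) (j : Fin d)
    {Ω : Type*} [MeasurableSpace Ω] {P : Measure Ω} {σ : Ω → Equiv.Perm (Fin n)}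
    {T : ℕ → ℕ → Ω → Fin d → Circle} (hσ : AEMeasurable σ P) (hT : ∀ m k, AEMeasurable (T m k) P) :
    AEMeasurable (fun ω => w2 f x (σ ω) fun m k => T m k ω j) P := by
  have h1 : AEMeasurable (fun ω => (σ ω, fun p : ℕ × ℕ => T p.1 p.2 ω)) P :=
    hσ.prodMk (aemeasurable_pi_lambda _ fun p => hT p.1 p.2)
  have h2 := measurable_w2 (n := n) hf x j
  revert h2
  generalize hg : (fun q : Equiv.Perm (Fin n) × (ℕ × ℕ → Fin d → Circle) =>
      w2 f x q.1 (fun m k => q.2 (m, k) j)) = g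
  intro h2
  refine (h2.comp_aemeasurable h1).congr (ae_of_all _ fun ω => ?_)
  rw [← hg]
  rfl

/-- Convergence in distribution of the linear statistics, by Lévy's theorem. -/
lemma tendstoInDistribution_w2 {d : ℕ} {θ : ℝ} (hθ : 0 < θ) {f : Fin d → Circle → ℂ}
    (hf : ∀ j, Measurable (f j)) (φ : Fin d → ℝ) (ν : Measure (Fin d → Circle))
    [IsProbabilityMeasure ν] {S : Matrix (Fin d × Fin 2) (Fin d × Fin 2) ℝ} (hS : S.PosSemidef)
    (H : ∀ t : Fin d × Fin 2 → ℝ, CesaroMoments (rotatedLaw φ ν) (logCombination f t)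
      (∑ j, (t (j, 0) * (meanLog (f j)).re + t (j, 1) * (meanLog (f j)).im))
      (dotProduct t (S.mulVec t)))
    {Ω : ℕ → Type*} [∀ n, MeasurableSpace (Ω n)] (P : ∀ n, Measure (Ω n))
    [∀ n, IsProbabilityMeasure (P n)]
    (σ : ∀ n, Ω n → Equiv.Perm (Fin n)) (T : ∀ n, ℕ → ℕ → Ω n → Fin d → Circle)
    (hσ : ∀ n, HasLaw (σ n) (ewensMeasure θ n) (P n))
    (hT : ∀ n m k, HasLaw (T n m k) (productLaw ν m) (P n))
    (hTindep : ∀ n, iIndepFun (fun (p : ℕ × ℕ) => T n p.1 p.2) (P n))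
    (hTσ : ∀ n, IndepFun (σ n) (fun ω (p : ℕ × ℕ) => T n p.1 p.2 ω) (P n)) :
    TendstoInDistribution
      (fun (n : ℕ) (ω : Ω n) (j : Fin d) =>
        w2 (f j) (circlePoint (φ j)) (σ n ω) (fun m k => T n m k ω j) / (√(Real.log n) : ℂ)
          - θ * √(Real.log n) * meanLog (f j))
      atTop (fun y => y) P ((multivariateGaussian 0 (θ • S)).map (toComplexVector d)) := by
  set W : ∀ n, Ω n → Fin d → ℂ := fun n ω j =>
    w2 (f j) (circlePoint (φ j)) (σ n ω) (fun m k => T n m k ω j) with hW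
  have hWm : ∀ n j, AEMeasurable (fun ω => W n ω j) (P n) := by
    exact fun n j => aemeasurable_w2 (hf j) _ j (hσ n).aemeasurable fun m k => (hT n m k).aemeasurable
  -- the same variables in real coordinates
  set Y : ∀ n, Ω n → EuclideanSpace ℝ (Fin d × Fin 2) := fun n ω => WithLp.toLp 2 fun a =>
    if a.2 = 0 then (W n ω a.1 / (√(Real.log n) : ℂ) - θ * √(Real.log n) * meanLog (f a.1)).re
    else (W n ω a.1 / (√(Real.log n) : ℂ) - θ * √(Real.log n) * meanLog (f a.1)).im with hY
  have hYm : ∀ n, AEMeasurable (Y n) (P n) := by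
    intro n
    refine (WithLp.measurable_toLp 2 _).comp_aemeasurable (aemeasurable_pi_lambda _ fun a => ?_)
    have := hWm n a.1
    split_ifs
    · exact Complex.measurable_re.comp_aemeasurable ((this.div_const _).sub_const _)
    · exact Complex.measurable_im.comp_aemeasurable ((this.div_const _).sub_const _)
  have hconv : TendstoInDistribution Y atTop (fun y => y) P (multivariateGaussian 0 (θ • S)) := by
    refine tendstoInDistribution_multivariateGaussian hYm (hS.smul hθ.le) fun t => ?_
    have hlim := (H t).tendsto_charFun hθ
    have hG : (-(θ * dotProduct (t : Fin d × Fin 2 → ℝ) (S.mulVec t) / 2) : ℝ)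
        = -(dotProduct (t : Fin d × Fin 2 → ℝ) ((θ • S).mulVec t) / 2) := by
      rw [Matrix.smul_mulVec, dotProduct_smul, smul_eq_mul]
    rw [hG] at hlim
    refine hlim.congr fun n => ?_
    rw [← integral_exp_w2_eq hθ hf φ ν (hσ n) (hT n) (hTindep n) (hTσ n), ← integral_const_mul]
    refine integral_congr_ae (ae_of_all _ fun ω => ?_)
    simp only
    rw [← Complex.exp_add, ← mul_neg, ← Complex.ofReal_neg, ← mul_add, ← Complex.ofReal_add]
    congr 3
    rw [Fintype.sum_prod_type, Finset.mul_sum, Finset.mul_sum, ← Finset.sum_neg_distrib,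
      ← Finset.sum_add_distrib]
    refine Finset.sum_congr rfl fun j _ => ?_
    rw [Fin.sum_univ_two]
    simp only [hY, hW, if_true, one_ne_zero, if_false, Complex.sub_re, Complex.sub_im,
      ← Complex.ofReal_mul, Complex.div_ofReal_re, Complex.div_ofReal_im, Complex.re_ofReal_mul,
      Complex.im_ofReal_mul]
    ring
  have hfin := hconv.continuous_comp (toComplexVector d).continuous
  have hcomp : (fun n => toComplexVector d ∘ Y n) = fun (n : ℕ) (ω : Ω n) (j : Fin d) =>
      W n ω j / (√(Real.log n) : ℂ) - θ * √(Real.log n) * meanLog (f j) := by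
    funext n ω j
    rw [Function.comp_apply, toComplexVector_apply, mul_comm]
    simp only [hY, if_true, one_ne_zero, if_false]
    exact Complex.re_add_im _
  rw [hcomp] at hfin
  refine ⟨hfin.forall_aemeasurable, aemeasurable_id, ?_⟩
  have hmap : (multivariateGaussian 0 (θ • S)).map (toComplexVector d ∘ fun y => y)
      = ((multivariateGaussian 0 (θ • S)).map (toComplexVector d)).map fun y => y := by
    rw [Measure.map_id']; rfl
  have := hfin.tendsto
  simp only [hmap] at this
  exact this

/-! ### Fourier series on the circle -/

lemma toCircle_eq_circlePoint (t : ℝ) : AddCircle.toCircle (t : UnitAddCircle) = circlePoint t := by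
  rw [AddCircle.toCircle_apply_mk, circlePoint, div_one]

lemma exists_circlePoint_eq (w : Circle) : ∃ t : ℝ, circlePoint t = w := by
  obtain ⟨x, hx⟩ := (AddCircle.homeomorphCircle (T := 1) one_ne_zero).surjective w
  obtain ⟨t, rfl⟩ := QuotientAddGroup.mk_surjective x
  exact ⟨t, by rw [← hx, AddCircle.homeomorphCircle_apply]; exact (toCircle_eq_circlePoint t).symm⟩

lemma continuous_circlePoint : Continuous circlePoint := by
  unfold circlePoint; fun_prop

lemma circlePoint_add (s t : ℝ) : circlePoint (s + t) = circlePoint s * circlePoint t := by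
  simp [circlePoint, mul_add, Circle.exp_add]

lemma circlePoint_zero : circlePoint 0 = 1 := by simp [circlePoint]

lemma circlePoint_one : circlePoint 1 = 1 := by simp [circlePoint]

lemma coe_circlePoint (t : ℝ) : (circlePoint t : ℂ) = Complex.exp (2 * π * Complex.I * t) := by
  rw [circlePoint, Circle.coe_exp]
  push_cast
  ring_nf

lemma circlePoint_zpow (t : ℝ) (a : ℤ) : circlePoint t ^ a = circlePoint (a * t) := by
  rw [circlePoint, circlePoint, ← Circle.exp_zsmul]
  congr 1
  rw [zsmul_eq_mul]
  ring

lemma circlePoint_pow (t : ℝ) (a : ℕ) : circlePoint t ^ a = circlePoint (a * t) := by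
  exact_mod_cast circlePoint_zpow t a

/-- The circle carries the quotient topology of the line. -/
lemma continuous_of_comp_circlePoint {Y : Type*} [TopologicalSpace Y] {G : Circle → Y}
    (h : Continuous fun t => G (circlePoint t)) : Continuous G := by
  have h1 : Continuous fun x : UnitAddCircle => G (AddCircle.toCircle x) := by
    refine isQuotientMap_quotient_mk'.continuous_iff.2 ?_
    refine h.congr fun t => ?_
    exact congrArg G (toCircle_eq_circlePoint t).symm
  have h2 : G = (fun x : UnitAddCircle => G (AddCircle.toCircle x)) ∘
      (AddCircle.homeomorphCircle (T := 1) one_ne_zero).symm := by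
    ext w
    rw [Function.comp_apply, ← AddCircle.homeomorphCircle_apply one_ne_zero,
      Homeomorph.apply_symm_apply]
  rw [h2]
  exact h1.comp (Homeomorph.continuous _)

lemma uniformCircle_eq_map :
    uniformCircle = (volume : Measure UnitAddCircle).map AddCircle.toCircle := by
  have h := UnitAddCircle.measurePreserving_mk 0
  rw [← h.map_eq, Measure.map_map AddCircle.continuous_toCircle.measurable h.measurable, zero_add,
    uniformCircle, restrict_Ioc_eq_restrict_Icc]
  congr 1
  ext t
  exact congrArg _ (toCircle_eq_circlePoint t).symm

instance : IsProbabilityMeasure uniformCircle := by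
  have : IsProbabilityMeasure (volume.restrict (Set.Icc (0 : ℝ) 1)) := ⟨by simp⟩
  exact Measure.isProbabilityMeasure_map continuous_circlePoint.measurable.aemeasurable

lemma map_mul_left_uniformCircle (x : Circle) :
    uniformCircle.map (fun w => x * w) = uniformCircle := by
  obtain ⟨y, rfl⟩ := exists_circlePoint_eq x
  rw [uniformCircle_eq_map, Measure.map_map (by fun_prop) AddCircle.continuous_toCircle.measurable]
  have : (fun w => circlePoint y * w) ∘ AddCircle.toCircle (T := 1)
      = AddCircle.toCircle ∘ fun t => (y : UnitAddCircle) + t := by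
    ext t
    simp [AddCircle.toCircle_add, toCircle_eq_circlePoint]
  rw [this, ← Measure.map_map AddCircle.continuous_toCircle.measurable (by fun_prop),
    map_add_left_eq_self]

lemma integral_uniformCircle {E : Type*} [NormedAddCommGroup E] [NormedSpace ℝ E]
    {G : Circle → E} (hG : AEStronglyMeasurable G uniformCircle) :
    ∫ w, G w ∂uniformCircle = ∫ u in (0 : ℝ)..1, G (circlePoint u) := by
  rw [uniformCircle, integral_map continuous_circlePoint.measurable.aemeasurable hG,
    intervalIntegral.integral_of_le zero_le_one, integral_Icc_eq_integral_Ioc]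

lemma lintegral_uniformCircle {G : Circle → ENNReal} (hG : Measurable G) :
    ∫⁻ w, G w ∂uniformCircle = ∫⁻ u in Set.Icc (0 : ℝ) 1, G (circlePoint u) := by
  rw [uniformCircle, lintegral_map hG continuous_circlePoint.measurable]

lemma continuous_zpow_circle (a : ℤ) : Continuous fun w : Circle => ((w ^ a : Circle) : ℂ) := by
  simp only [Circle.coe_zpow]
  exact Continuous.zpow₀ (by fun_prop) a fun w => .inl w.coe_ne_zero

lemma measurable_zpow_circle (a : ℤ) : Measurable fun w : Circle => ((w ^ a : Circle) : ℂ) :=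
  (continuous_zpow_circle a).measurable

lemma integral_zpow_uniformCircle {a : ℤ} (ha : a ≠ 0) :
    ∫ w, ((w ^ a : Circle) : ℂ) ∂uniformCircle = 0 := by
  rw [integral_uniformCircle (measurable_zpow_circle a).aestronglyMeasurable]
  simp_rw [circlePoint_zpow, coe_circlePoint]
  have h : ∀ u : ℝ, Complex.exp (2 * π * Complex.I * ((a * u : ℝ) : ℂ))
      = Complex.exp ((2 * π * Complex.I * a) * u) := fun u => by push_cast; ring_nf
  simp_rw [h]
  rw [integral_exp_mul_complex (by simp [ha, Real.pi_ne_zero])]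
  have : Complex.exp (2 * π * Complex.I * a * ((1 : ℝ) : ℂ)) = 1 := by
    rw [Complex.ofReal_one, mul_one, mul_comm]
    exact Complex.exp_int_mul_two_pi_mul_I a
  rw [this]
  simp

/-- `G` is continuously differentiable on the circle, and the derivative of `t ↦ G (e^{2πit})` is
bounded by `D`. -/
def HasDerivBoundOnCircle (G : Circle → ℝ) (D : ℝ) : Prop :=
  ∃ g' : ℝ → ℝ, (∀ t, HasDerivAt (fun t => G (circlePoint t)) (g' t) t) ∧ Continuous g' ∧
    ∀ t, |g' t| ≤ D

lemma HasDerivBoundOnCircle.continuous {G : Circle → ℝ} {D : ℝ} (h : HasDerivBoundOnCircle G D) :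
    Continuous G := by
  obtain ⟨g', h1, -, -⟩ := h
  exact continuous_of_comp_circlePoint
    (continuous_iff_continuousAt.2 fun t => (h1 t).continuousAt)

lemma norm_fourierCoeffOn_mul_le {g g' : ℝ → ℝ} (h1 : ∀ t, HasDerivAt g (g' t) t)
    (hc : Continuous g') (hper : g 0 = g 1) {a : ℤ} (ha : a ≠ 0) :
    ‖fourierCoeffOn zero_lt_one (fun t => (g t : ℂ)) a‖ * |(a : ℝ)|
      ≤ ‖fourierCoeffOn zero_lt_one (fun t => (g' t : ℂ)) a‖ := by
  rw [fourierCoeffOn_of_hasDerivAt zero_lt_one ha (f' := fun t => (g' t : ℂ))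
    (fun t _ => (h1 t).ofReal_comp)
    ((Complex.continuous_ofReal.comp hc).intervalIntegrable _ _)]
  rw [hper, sub_self, mul_zero, zero_sub, norm_mul, norm_neg, norm_mul]
  have h2 : ‖((1 : ℝ) : ℂ) - ((0 : ℝ) : ℂ)‖ = 1 := by simp
  rw [h2, one_mul]
  have ha' : (0 : ℝ) < |(a : ℝ)| := abs_pos.2 (by exact_mod_cast ha)
  have h3 : ‖1 / (-2 * (π : ℂ) * Complex.I * a)‖ = 1 / (2 * π * |(a : ℝ)|) := by
    simp [abs_of_pos Real.pi_pos]
  rw [h3]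
  set X := ‖fourierCoeffOn zero_lt_one (fun t => (g' t : ℂ)) a‖
  have hX : 0 ≤ X := norm_nonneg _
  have : 1 / (2 * π * |(a : ℝ)|) * X * |(a : ℝ)| = X / (2 * π) := by
    field_simp
  rw [this]
  refine div_le_self hX ?_
  linarith [Real.pi_gt_three]

/-- The constant in the bound for weighted sums of Fourier coefficients. -/
def fourierConst : ℝ := 1 + ∑' a : ℤ, |(a : ℝ)| ^ (-(3 / 2) : ℝ)

lemma fourierConst_pos : 0 < fourierConst :=
  add_pos_of_pos_of_nonneg one_pos (tsum_nonneg fun _ => by positivity)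

/-- A continuously differentiable function is the sum of its Fourier series, whose coefficients are
summable with the weights `|a| ^ (1/4)`. -/
lemma HasDerivBoundOnCircle.exists_fourier {G : Circle → ℝ} {D : ℝ} (hD : 0 < D)
    (h : HasDerivBoundOnCircle G D) :
    ∃ c : ℤ → ℂ, (Summable fun a => ‖c a‖) ∧
      (∀ w : Circle, HasSum (fun a => c a * ((w ^ a : Circle) : ℂ)) (G w : ℂ)) ∧
      c 0 = ∫ w, G w ∂uniformCircle ∧
      (Summable fun a : ℤ => ‖c a‖ * |(a : ℝ)| ^ (1 / 4 : ℝ)) ∧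
      ∑' a : ℤ, ‖c a‖ * |(a : ℝ)| ^ (1 / 4 : ℝ) ≤ fourierConst * D := by
  have hG := h.continuous
  obtain ⟨g', h1, hc, hb⟩ := h
  let F : C(AddCircle (1 : ℝ), ℂ) :=
    ⟨fun x => (G (AddCircle.toCircle x) : ℂ),
      Complex.continuous_ofReal.comp (hG.comp AddCircle.continuous_toCircle)⟩
  have hF : ∀ a, fourierCoeff F a
      = ∫ u in (0 : ℝ)..1, ((circlePoint u ^ (-a) : Circle) : ℂ) * (G (circlePoint u) : ℂ) := by
    intro a
    rw [fourierCoeff_eq_intervalIntegral _ _ 0]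
    simp only [div_one, one_smul, zero_add]
    refine intervalIntegral.integral_congr fun u _ => ?_
    simp only [smul_eq_mul, F, ContinuousMap.coe_mk]
    rw [toCircle_eq_circlePoint, fourier_coe_apply, circlePoint_zpow, coe_circlePoint]
    congr 2
    push_cast
    ring
  have hFon : ∀ a, fourierCoeff F a
      = fourierCoeffOn zero_lt_one (fun t => (G (circlePoint t) : ℂ)) a := by
    intro a
    rw [hF, fourierCoeffOn_eq_integral]
    simp only [sub_zero, div_one, one_smul]
    refine intervalIntegral.integral_congr fun u _ => ?_
    simp only [smul_eq_mul]
    rw [fourier_coe_apply, circlePoint_zpow, coe_circlePoint]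
    congr 2
    push_cast
    simp only [sub_zero]
    ring
  have hbound : ∀ a : ℤ, a ≠ 0 → ‖fourierCoeff F a‖ * |(a : ℝ)|
      ≤ ‖fourierCoeffOn zero_lt_one (fun t => (g' t : ℂ)) a‖ := by
    intro a ha
    rw [hFon]
    exact norm_fourierCoeffOn_mul_le h1 hc (by rw [circlePoint_zero, circlePoint_one]) ha
  have hL2 : MemLp (fun t => (g' t : ℂ)) 2 (volume.restrict (Set.Ioc 0 1)) := by
    refine MemLp.of_bound (Complex.continuous_ofReal.comp hc).aestronglyMeasurable D
      (ae_of_all _ fun t => ?_)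
    rw [Complex.norm_real]
    exact hb t
  have hbes := hasSum_sq_fourierCoeffOn zero_lt_one hL2
  have hbes2 : ∑' a, ‖fourierCoeffOn zero_lt_one (fun t => (g' t : ℂ)) a‖ ^ 2 ≤ D ^ 2 := by
    rw [hbes.tsum_eq]
    simp only [sub_zero, inv_one, one_smul]
    calc ∫ x in (0 : ℝ)..1, ‖(g' x : ℂ)‖ ^ 2 ≤ ∫ x in (0 : ℝ)..1, D ^ 2 := by
          refine intervalIntegral.integral_mono_on zero_le_one ?_ (by simp) fun x _ => ?_
          · exact ((Complex.continuous_ofReal.comp hc).norm.pow 2).intervalIntegrable _ _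
          · rw [Complex.norm_real]
            exact pow_le_pow_left₀ (norm_nonneg _) (hb x) 2
      _ = D ^ 2 := by simp
  have hs32 : Summable fun a : ℤ => |(a : ℝ)| ^ (-(3 / 2) : ℝ) :=
    Real.summable_abs_int_rpow (by norm_num)
  -- `|c_a| |a| ^ (1/4) = (|c_a| |a|) |a| ^ (-3/4)`: Parseval for `g'` in the first factor,
  -- summability of `|a| ^ (-3/2)` for the square of the second
  have hmaj : ∀ a : ℤ, ‖fourierCoeff F a‖ * |(a : ℝ)| ^ (1 / 4 : ℝ)
      ≤ ‖fourierCoeffOn zero_lt_one (fun t => (g' t : ℂ)) a‖ ^ 2 * D⁻¹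
        + |(a : ℝ)| ^ (-(3 / 2) : ℝ) * D := by
    intro a
    rcases eq_or_ne a 0 with rfl | ha
    · have : (0 : ℝ) ^ (1 / 4 : ℝ) = 0 := Real.zero_rpow (by norm_num)
      simp only [Int.cast_zero, abs_zero, this, mul_zero]
      positivity
    · have ha' : (0 : ℝ) < |(a : ℝ)| := abs_pos.2 (by exact_mod_cast ha)
      have e1 : |(a : ℝ)| ^ (1 / 4 : ℝ) = |(a : ℝ)| * |(a : ℝ)| ^ (-(3 / 4) : ℝ) := by
        nth_rewrite 2 [← Real.rpow_one |(a : ℝ)|]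
        rw [← Real.rpow_add ha']; norm_num
      have e2 : |(a : ℝ)| ^ (-(3 / 2) : ℝ) = (|(a : ℝ)| ^ (-(3 / 4) : ℝ)) ^ 2 := by
        rw [← Real.rpow_natCast, ← Real.rpow_mul ha'.le]; norm_num
      rw [e1, e2, ← mul_assoc]
      refine (mul_le_mul_of_nonneg_right (hbound a ha) (by positivity)).trans ?_
      set x := ‖fourierCoeffOn zero_lt_one (fun t => (g' t : ℂ)) a‖
      set y := |(a : ℝ)| ^ (-(3 / 4) : ℝ)
      have hD2 : x ^ 2 * D⁻¹ + y ^ 2 * D - x * y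
          = (x - y * D / 2) ^ 2 * D⁻¹ + 3 / 4 * y ^ 2 * D := by field_simp; ring
      have : 0 ≤ (x - y * D / 2) ^ 2 * D⁻¹ + 3 / 4 * y ^ 2 * D := by positivity
      linarith
  have hsmaj := (hbes.summable.mul_right D⁻¹).add (hs32.mul_right D)
  have hs : Summable fun a : ℤ => ‖fourierCoeff F a‖ * |(a : ℝ)| ^ (1 / 4 : ℝ) :=
    Summable.of_nonneg_of_le (fun _ => by positivity) hmaj hsmaj
  have hs1 : Summable fun a : ℤ => ‖fourierCoeff F a‖ := by
    refine Summable.of_nonneg_of_le (fun _ => norm_nonneg _) (fun a => ?_)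
      (hs.add (summable_of_ne_finset_zero (s := {0})
        (f := fun a : ℤ => if a = 0 then ‖fourierCoeff F 0‖ else 0) fun a ha => by simp_all))
    rcases eq_or_ne a 0 with rfl | ha
    · rw [if_pos rfl]
      have : (0 : ℝ) ≤ ‖fourierCoeff F 0‖ * |((0 : ℤ) : ℝ)| ^ (1 / 4 : ℝ) := by positivity
      linarith
    · rw [if_neg ha, add_zero]
      refine le_mul_of_one_le_right (norm_nonneg _) (Real.one_le_rpow ?_ (by norm_num))
      exact_mod_cast Int.one_le_abs ha
  refine ⟨fourierCoeff F, hs1, fun w => ?_, ?_, hs, ?_⟩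
  · obtain ⟨t, rfl⟩ := exists_circlePoint_eq w
    have := has_pointwise_sum_fourier_series_of_summable (f := F) hs1.of_norm (t : AddCircle (1 : ℝ))
    have e : F (t : AddCircle (1 : ℝ)) = (G (circlePoint t) : ℂ) := by
      simp only [F, ContinuousMap.coe_mk, toCircle_eq_circlePoint]
    rw [e] at this
    refine this.congr_fun fun a => ?_
    rw [smul_eq_mul, fourier_coe_apply, circlePoint_zpow, coe_circlePoint]
    congr 2
    push_cast
    ring
  · rw [hF, integral_uniformCircle hG.aestronglyMeasurable, ← intervalIntegral.integral_ofReal]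
    simp
  · refine (hs.tsum_le_tsum hmaj hsmaj).trans ?_
    rw [(hbes.summable.mul_right D⁻¹).tsum_add (hs32.mul_right D), tsum_mul_right, tsum_mul_right,
      fourierConst, add_mul, one_mul]
    gcongr
    calc _ ≤ D ^ 2 * D⁻¹ := by gcongr
      _ = D := by field_simp

/-! ### Equidistribution of the rotated points -/

/-- The characters of the torus integrate to powers against the laws of `x^m T^{(m)}`. -/
lemma integral_rotatedLaw_eq_pow {d : ℕ} (φ : Fin d → ℝ) (ν : Measure (Fin d → Circle))
    [IsProbabilityMeasure ν] (χ : (Fin d → Circle) →* Circle) (hχ : Measurable χ) (m : ℕ) :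
    ∫ w, (χ w : ℂ) ∂rotatedLaw φ ν m
      = ((χ fun j => circlePoint (φ j) : ℂ) * ∫ w, (χ w : ℂ) ∂ν) ^ m := by
  have hm : Measurable fun w => (χ w : ℂ) := by fun_prop
  have h0 : ∫ w, (χ w : ℂ) ∂rotatedLaw φ ν m = ∫ z : Fin m → Fin d → Circle,
      (χ (fun j => circlePoint (φ j) ^ m * ∏ i, z i j) : ℂ) ∂Measure.pi fun _ => ν :=
    (integral_map (measurable_rotate φ m).aemeasurable hm.aestronglyMeasurable).trans
      (integral_map measurable_prodCircle.aemeasurable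
        (Measurable.aestronglyMeasurable (hm.comp (measurable_rotate φ m))))
  rw [h0]
  have h1 : ∀ z : Fin m → Fin d → Circle,
      (χ (fun j => circlePoint (φ j) ^ m * ∏ i, z i j) : ℂ)
        = (χ (fun j => circlePoint (φ j)) : ℂ) ^ m * ∏ i, (χ (z i) : ℂ) := by
    intro z
    have : (fun j => circlePoint (φ j) ^ m * ∏ i, z i j)
        = (fun j => circlePoint (φ j)) ^ m * ∏ i, z i := by
      ext j; simp
    rw [this, map_mul, map_pow, map_prod]
    rw [Circle.coe_mul, Circle.coe_pow]
    congr 1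
    exact map_prod Circle.coeHom (fun i => χ (z i)) _
  simp_rw [h1]
  rw [integral_const_mul, integral_fintype_prod_eq_prod (μ := fun _ : Fin m => ν)
    (fun _ w => (χ w : ℂ)), mul_pow]
  simp

/-- The distances of the `lam a` from `1` decay at most polynomially in `a`. -/
def HasPolynomialGap (lam : ℤ → ℂ) : Prop :=
  ∃ c γ : ℝ, 0 < c ∧ 1 ≤ γ ∧ ∀ a : ℤ, a ≠ 0 → c * |(a : ℝ)| ^ (-γ) ≤ ‖1 - lam a‖

lemma norm_sum_pow_succ_le {l : ℂ} (hl : ‖l‖ ≤ 1) (n : ℕ) :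
    ‖∑ i ∈ Finset.range n, l ^ (i + 1)‖ ≤ n := by
  refine (norm_sum_le _ _).trans ?_
  calc _ ≤ ∑ i ∈ Finset.range n, (1 : ℝ) :=
        Finset.sum_le_sum fun i _ => by rw [norm_pow]; exact pow_le_one₀ (norm_nonneg _) hl
    _ = n := by simp

lemma norm_sum_pow_succ_mul_le {l : ℂ} (hl : ‖l‖ ≤ 1) (n : ℕ) :
    ‖∑ i ∈ Finset.range n, l ^ (i + 1)‖ * ‖1 - l‖ ≤ 2 := by
  have h : (∑ i ∈ Finset.range n, l ^ (i + 1)) * (1 - l) = l * (1 - l ^ n) := by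
    have := geom_sum_mul l n
    simp_rw [pow_succ', ← Finset.mul_sum]
    linear_combination -l * this
  rw [← norm_mul, h, norm_mul]
  calc ‖l‖ * ‖1 - l ^ n‖ ≤ 1 * (1 + 1) := by
        refine mul_le_mul hl ((norm_sub_le _ _).trans ?_) (norm_nonneg _) zero_le_one
        rw [norm_one, norm_pow]
        exact add_le_add_right (pow_le_one₀ (norm_nonneg _) hl) 1
    _ = 2 := by norm_num

/-- Cesàro means of the powers of a number `l ≠ 1` in the unit disc vanish in the limit. -/
lemma tendsto_cesaro_pow_succ {l : ℂ} (hl : ‖l‖ ≤ 1) (h1 : l ≠ 1) :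
    Tendsto (fun n : ℕ => (∑ i ∈ Finset.range n, l ^ (i + 1)) / n) atTop (nhds 0) := by
  have hpos : 0 < ‖1 - l‖ := norm_pos_iff.2 (sub_ne_zero.2 h1.symm)
  refine squeeze_zero_norm (a := fun n : ℕ => (2 / ‖1 - l‖) / n) (fun n => ?_)
    (tendsto_const_div_atTop_nhds_zero_nat _)
  rw [norm_div, Complex.norm_natCast]
  gcongr
  exact (le_div_iff₀ hpos).2 (norm_sum_pow_succ_mul_le hl n)

/-- Interpolation between the trivial bound and the geometric series bound. -/
lemma norm_sum_pow_succ_le_rpow {l : ℂ} (hl : ‖l‖ ≤ 1) (n : ℕ) {c A γ : ℝ} (hc : 0 < c)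
    (hA : 0 < A) (hγ : 1 ≤ γ) (h : c * A ^ (-γ) ≤ ‖1 - l‖) :
    ‖∑ i ∈ Finset.range n, l ^ (i + 1)‖
      ≤ (2 / c) ^ (1 / (4 * γ)) * A ^ (1 / 4 : ℝ) * (n : ℝ) ^ (1 - 1 / (4 * γ)) := by
  set S := ‖∑ i ∈ Finset.range n, l ^ (i + 1)‖
  have hS : 0 ≤ S := norm_nonneg _
  have hγ0 : 0 < γ := by linarith
  set s := 1 / (4 * γ) with hs
  have hs0 : 0 < s := by positivity
  have hs1 : s < 1 := by rw [hs, div_lt_one (by positivity)]; linarith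
  have hp : 0 < A ^ (-γ) := Real.rpow_pos_of_pos hA _
  have h1 : S ≤ 2 / c * A ^ γ := by
    have h2 := norm_sum_pow_succ_mul_le hl n
    have h3 : S * (c * A ^ (-γ)) ≤ 2 := (mul_le_mul_of_nonneg_left h hS).trans h2
    rw [Real.rpow_neg hA.le] at h3 hp
    have hq : 0 < A ^ γ := Real.rpow_pos_of_pos hA _
    rw [div_mul_eq_mul_div, le_div_iff₀ hc]
    have : S * (c * (A ^ γ)⁻¹) * A ^ γ ≤ 2 * A ^ γ := mul_le_mul_of_nonneg_right h3 hq.le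
    calc S * c = S * (c * (A ^ γ)⁻¹) * A ^ γ := by field_simp
      _ ≤ _ := this
  calc S = S ^ s * S ^ (1 - s) := by
        rw [← Real.rpow_add' hS (by simp)]; simp
    _ ≤ (2 / c * A ^ γ) ^ s * (n : ℝ) ^ (1 - s) := by
        gcongr
        exact norm_sum_pow_succ_le hl n
    _ = _ := by
        rw [Real.mul_rpow (by positivity) (by positivity), ← Real.rpow_mul hA.le]
        congr 3
        rw [hs]; field_simp

section Rate

variable {η : ℕ → Measure Circle} [∀ m, IsProbabilityMeasure (η m)] {lam : ℤ → ℂ}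

lemma norm_le_one_of_integral_zpow (hη : ∀ (a : ℤ) (m : ℕ), ∫ w, ((w ^ a : Circle) : ℂ) ∂η m = lam a ^ m)
    (a : ℤ) : ‖lam a‖ ≤ 1 := by
  have h := hη a 1
  rw [pow_one] at h
  rw [← h]
  refine (norm_integral_le_of_norm_le_const (C := 1) (ae_of_all _ fun w => (Circle.norm_coe _).le)).trans ?_
  simp

lemma hasSum_integral_fourier (μ : Measure Circle) [IsProbabilityMeasure μ] {c : ℤ → ℂ}
    (hc : Summable fun a => ‖c a‖) {G : Circle → ℝ}
    (hG : ∀ w : Circle, HasSum (fun a => c a * ((w ^ a : Circle) : ℂ)) (G w : ℂ)) :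
    HasSum (fun a => c a * ∫ w, ((w ^ a : Circle) : ℂ) ∂μ) ((∫ w, G w ∂μ : ℝ) : ℂ) := by
  have hn : ∀ (a : ℤ) (w : Circle), ‖c a * ((w ^ a : Circle) : ℂ)‖ = ‖c a‖ := fun a w => by
    rw [norm_mul, Circle.norm_coe, mul_one]
  have h := hasSum_integral_of_summable_integral_norm (μ := μ)
    (F := fun a (w : Circle) => c a * ((w ^ a : Circle) : ℂ)) (fun a => ?_) ?_
  · simp_rw [integral_const_mul] at h
    convert! h using 1
    refine integral_ofReal.symm.trans ?_
    exact integral_congr_ae (ae_of_all _ fun w => (hG w).tsum_eq.symm)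
  · refine (integrable_const ‖c a‖).mono'
      ((measurable_zpow_circle a).const_mul _).aestronglyMeasurable (ae_of_all _ fun w => (hn a w).le)
  · simp_rw [hn]
    simpa using hc

/-- Quantitative equidistribution of the laws `η m`, in the mean over `m`, for continuously
differentiable test functions. -/
lemma exists_equidistribution_rate
    (hη : ∀ (a : ℤ) (m : ℕ), ∫ w, ((w ^ a : Circle) : ℂ) ∂η m = lam a ^ m)
    (hgap : HasPolynomialGap lam) :
    ∃ C s : ℝ, 0 < C ∧ 0 < s ∧ s < 1 ∧ ∀ (G : Circle → ℝ) (D : ℝ), 0 < D → HasDerivBoundOnCircle G D →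
      ∀ n : ℕ, |∑ i ∈ Finset.range n, (∫ w, G w ∂η (i + 1) - ∫ w, G w ∂uniformCircle)|
        ≤ C * D * (n : ℝ) ^ (1 - s) := by
  obtain ⟨c, γ, hc, hγ, hgap⟩ := hgap
  have hγ0 : 0 < γ := by linarith
  refine ⟨(2 / c) ^ (1 / (4 * γ)) * fourierConst, 1 / (4 * γ),
    mul_pos (by positivity) fourierConst_pos, by positivity, ?_, fun G D hD hG n => ?_⟩
  · rw [div_lt_one (by positivity)]; linarith
  have hl := norm_le_one_of_integral_zpow hη
  obtain ⟨k, hk, hsum, h0, hkw, hkD⟩ := hG.exists_fourier hD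
  have h1 : ∀ i : ℕ, HasSum (fun a : ℤ => if a = 0 then 0 else k a * lam a ^ (i + 1))
      ((∫ w, G w ∂η (i + 1) - ∫ w, G w ∂uniformCircle : ℝ) : ℂ) := by
    intro i
    have h2 := hasSum_integral_fourier (η (i + 1)) hk hsum
    have h3 := hasSum_integral_fourier uniformCircle hk hsum
    have h4 := h2.sub h3
    rw [← Complex.ofReal_sub] at h4
    refine h4.congr_fun fun a => ?_
    rcases eq_or_ne a 0 with rfl | ha
    · simp
    · rw [if_neg ha, hη, integral_zpow_uniformCircle ha]; simp
  have h2 := hasSum_sum (s := Finset.range n) fun i _ => h1 i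
  have hle : ∀ a : ℤ, ‖∑ i ∈ Finset.range n, if a = 0 then 0 else k a * lam a ^ (i + 1)‖
      ≤ ((2 / c) ^ (1 / (4 * γ)) * (n : ℝ) ^ (1 - 1 / (4 * γ))) *
        (‖k a‖ * |(a : ℝ)| ^ (1 / 4 : ℝ)) := by
    intro a
    rcases eq_or_ne a 0 with rfl | ha
    · simp only [if_true, Finset.sum_const_zero, norm_zero]
      positivity
    · simp only [if_neg ha]
      rw [← Finset.mul_sum, norm_mul]
      have := norm_sum_pow_succ_le_rpow (hl a) n hc (abs_pos.2 (Int.cast_ne_zero.2 ha)) hγ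
        (hgap a ha)
      calc _ ≤ ‖k a‖ * _ := mul_le_mul_of_nonneg_left this (norm_nonneg _)
        _ = _ := by ring
  have h3 := tsum_of_norm_bounded (hkw.mul_left _).hasSum hle
  rw [h2.tsum_eq, ← Complex.ofReal_sum, Complex.norm_real, Real.norm_eq_abs, tsum_mul_left] at h3
  refine h3.trans ?_
  calc _ ≤ ((2 / c) ^ (1 / (4 * γ)) * (n : ℝ) ^ (1 - 1 / (4 * γ))) * (fourierConst * D) := by
        gcongr
    _ = _ := by ring

end Rate

/-! ### Negative moments of real analytic functions -/

lemma ofReal_le_mul_enorm_rpow_neg {E : Type*} [NormedAddCommGroup E] {C κ X : ℝ} (hC : 0 < C)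
    (hκ : 0 < κ) {v : E} (h : v ≠ 0 → X ≤ C * ‖v‖ ^ (-κ)) :
    ENNReal.ofReal X ≤ ENNReal.ofReal C * ‖v‖ₑ ^ (-κ) := by
  rcases eq_or_ne v 0 with rfl | hv
  · rw [enorm_zero, ENNReal.zero_rpow_of_neg (by linarith), ENNReal.mul_top (by simpa using hC)]
    exact le_top
  · rw [← ofReal_norm, ENNReal.ofReal_rpow_of_pos (norm_pos_iff.2 hv),
      ← ENNReal.ofReal_mul hC.le]
    exact ENNReal.ofReal_le_ofReal (h hv)

lemma enorm_rpow_neg_le {E : Type*} [NormedAddCommGroup E] {κ c : ℝ} (hκ : 0 < κ) (hc : 0 < c)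
    {v : E} (h : c ≤ ‖v‖) : ‖v‖ₑ ^ (-κ) ≤ ENNReal.ofReal (c ^ (-κ)) := by
  rw [← ofReal_norm, ENNReal.ofReal_rpow_of_pos (hc.trans_le h)]
  exact ENNReal.ofReal_le_ofReal (Real.rpow_le_rpow_of_nonpos hc h (by linarith))

section Analytic

variable {E : Type*} [NormedAddCommGroup E] [NormedSpace ℝ E] {h : ℝ → E}

/-- A real analytic function vanishes to finite order at each point. -/
lemma exists_mul_abs_sub_pow_le (hh : ∀ t, AnalyticAt ℝ h t) (h0 : h ≠ 0) (t₀ : ℝ) :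
    ∃ (K : ℕ) (c : ℝ), 0 < c ∧ ∀ᶠ t in nhds t₀, c * |t - t₀| ^ K ≤ ‖h t‖ := by
  have hne : ¬ ∀ᶠ t in nhds t₀, h t = 0 := by
    intro hz
    refine h0 (funext fun t => ?_)
    exact AnalyticOnNhd.eqOn_zero_of_preconnected_of_eventuallyEq_zero (U := Set.univ)
      (fun t _ => hh t) isPreconnected_univ (Set.mem_univ t₀) hz (Set.mem_univ t)
  obtain ⟨K, g, hg, hg0, hgh⟩ := (hh t₀).exists_eventuallyEq_pow_smul_nonzero_iff.2 hne
  refine ⟨K, ‖g t₀‖ / 2, by positivity, ?_⟩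
  have h1 : ∀ᶠ t in nhds t₀, ‖g t₀‖ / 2 < ‖g t‖ :=
    hg.continuousAt.norm.eventually_const_lt (half_lt_self (norm_pos_iff.2 hg0))
  filter_upwards [hgh, h1] with t ht1 ht2
  rw [ht1, norm_smul, norm_pow, Real.norm_eq_abs, mul_comm]
  gcongr

lemma intervalIntegrable_abs_sub_rpow {r : ℝ} (hr : -1 < r) (t₀ a b : ℝ) :
    IntervalIntegrable (fun t => |t - t₀| ^ r) volume a b := by
  have h1 : IntervalIntegrable (fun t : ℝ => |t| ^ r) volume (a - t₀) (b - t₀) := by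
    refine intervalIntegrable_of_even (fun x => by rw [abs_neg]) fun x hx => ?_
    refine (intervalIntegral.intervalIntegrable_rpow' hr (a := 0) (b := x)).congr ?_
    intro t ht
    rw [Set.uIoc_of_le hx.le] at ht
    simp only [abs_of_pos ht.1]
  simpa using h1.comp_sub_right t₀

lemma exists_lintegral_enorm_rpow_neg_lt_top (hh : ∀ t, AnalyticAt ℝ h t) (h0 : h ≠ 0) :
    ∃ κ₀ : ℝ, 0 < κ₀ ∧ ∀ κ, 0 < κ → κ ≤ κ₀ →
      ∫⁻ t in Set.Icc (0 : ℝ) 1, ‖h t‖ₑ ^ (-κ) < ⊤ := by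
  refine isCompact_Icc.induction_on (p := fun s => ∃ κ₀ : ℝ, 0 < κ₀ ∧ ∀ κ, 0 < κ → κ ≤ κ₀ →
      ∫⁻ t in s, ‖h t‖ₑ ^ (-κ) < ⊤) ⟨1, one_pos, by simp⟩ ?_ ?_ ?_
  · rintro s t hst ⟨κ₀, hκ₀, H⟩
    exact ⟨κ₀, hκ₀, fun κ h1 h2 => (lintegral_mono_set hst).trans_lt (H κ h1 h2)⟩
  · rintro s t ⟨κ₀, hκ₀, H⟩ ⟨κ₁, hκ₁, H'⟩
    refine ⟨min κ₀ κ₁, lt_min hκ₀ hκ₁, fun κ h1 h2 => ?_⟩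
    exact (lintegral_union_le _ _ _).trans_lt (ENNReal.add_lt_top.2
      ⟨H κ h1 (h2.trans (min_le_left _ _)), H' κ h1 (h2.trans (min_le_right _ _))⟩)
  · intro t₀ _
    obtain ⟨K, c, hc, hK⟩ := exists_mul_abs_sub_pow_le hh h0 t₀
    obtain ⟨r, hr, hball⟩ := Metric.eventually_nhds_iff_ball.1 hK
    refine ⟨Metric.ball t₀ r, mem_nhdsWithin_of_mem_nhds (Metric.ball_mem_nhds t₀ hr),
      1 / (2 * (K + 1)), by positivity, fun κ h1 h2 => ?_⟩
    have hKκ : K * κ < 1 := by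
      have h3 : K * κ ≤ K * (1 / (2 * (K + 1))) := by gcongr
      refine h3.trans_lt ?_
      rw [mul_one_div, div_lt_one (by positivity)]
      have : (0 : ℝ) ≤ K := Nat.cast_nonneg K
      linarith
    have hint := (((intervalIntegrable_abs_sub_rpow (r := -(K * κ)) (by linarith) t₀
      (t₀ - r) (t₀ + r)).const_mul (c ^ (-κ))).1).lintegral_lt_top
    refine lt_of_le_of_lt ?_ hint
    rw [Real.ball_eq_Ioo, Measure.restrict_congr_set Ioo_ae_eq_Ioc]
    refine lintegral_mono_ae ?_
    have hne : ∀ᵐ t : ℝ, t ≠ t₀ := by simp [ae_iff]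
    have hrne : ∀ᵐ t : ℝ, t ≠ t₀ + r := by simp [ae_iff]
    refine (ae_restrict_iff' measurableSet_Ioc).2 ?_
    filter_upwards [hne, hrne] with t ht1 ht2 ht3
    have hpos : 0 < |t - t₀| := abs_pos.2 (sub_ne_zero.2 ht1)
    have h4 := hball t (by
      rw [Real.ball_eq_Ioo]; exact ⟨ht3.1, lt_of_le_of_ne ht3.2 ht2⟩)
    refine (enorm_rpow_neg_le h1 (by positivity) h4).trans (ENNReal.ofReal_le_ofReal (le_of_eq ?_))
    rw [Real.mul_rpow hc.le (by positivity), ← Real.rpow_natCast, ← Real.rpow_mul hpos.le, mul_neg]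

end Analytic

lemma exists_lintegral_uniformCircle_lt_top {E : Type*} [NormedAddCommGroup E] [NormedSpace ℝ E]
    {h : Circle → E} (hh : ∀ t, AnalyticAt ℝ (fun s => h (circlePoint s)) t) (h0 : h ≠ 0) :
    ∃ κ₀ : ℝ, 0 < κ₀ ∧ ∀ κ, 0 < κ → κ ≤ κ₀ → ∫⁻ w, ‖h w‖ₑ ^ (-κ) ∂uniformCircle < ⊤ := by
  have hcont : Continuous h := continuous_of_comp_circlePoint
    (continuous_iff_continuousAt.2 fun t => (hh t).continuousAt)
  have hne : (fun s => h (circlePoint s)) ≠ 0 := by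
    intro hz
    refine h0 (funext fun w => ?_)
    obtain ⟨t, rfl⟩ := exists_circlePoint_eq w
    exact congrFun hz t
  obtain ⟨κ₀, hκ₀, H⟩ := exists_lintegral_enorm_rpow_neg_lt_top hh hne
  refine ⟨κ₀, hκ₀, fun κ h1 h2 => ?_⟩
  rw [lintegral_uniformCircle]
  · exact H κ h1 h2
  · exact hcont.enorm.measurable.pow_const _

/-! ### Continuously differentiable functions on the circle -/

lemma exists_hasDerivBoundOnCircle {h : Circle → ℝ}
    (hh : ∀ t, AnalyticAt ℝ (fun s => h (circlePoint s)) t) :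
    ∃ M : ℝ, 0 < M ∧ (∀ w, |h w| ≤ M) ∧ HasDerivBoundOnCircle h M := by
  set g : ℝ → ℝ := fun s => h (circlePoint s) with hg
  have hcg : Continuous g := continuous_iff_continuousAt.2 fun t => (hh t).continuousAt
  have hcd : Continuous (deriv g) := continuous_iff_continuousAt.2 fun t => (hh t).deriv.continuousAt
  have hper : Function.Periodic g 1 := fun t => by
    simp only [hg, circlePoint_add, circlePoint_one, mul_one]
  have hperd : Function.Periodic (deriv g) 1 := fun t => by
    rw [← deriv_comp_add_const]
    congr 1
    exact funext hper
  obtain ⟨M₁, hM₁⟩ := (hper.isBounded_of_continuous one_ne_zero hcg).exists_norm_le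
  obtain ⟨M₂, hM₂⟩ := (hperd.isBounded_of_continuous one_ne_zero hcd).exists_norm_le
  refine ⟨max 1 (max M₁ M₂), lt_max_of_lt_left one_pos, fun w => ?_, deriv g,
    fun t => (hh t).differentiableAt.hasDerivAt, hcd, fun t => ?_⟩
  · obtain ⟨t, rfl⟩ := exists_circlePoint_eq w
    exact (hM₁ _ (Set.mem_range_self t)).trans ((le_max_left _ _).trans (le_max_right _ _))
  · exact (hM₂ _ (Set.mem_range_self t)).trans ((le_max_right _ _).trans (le_max_right _ _))

namespace HasDerivBoundOnCircle

variable {G G₁ G₂ : Circle → ℝ} {D D₁ D₂ : ℝ}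

lemma mono (h : HasDerivBoundOnCircle G D₁) (hD : D₁ ≤ D₂) : HasDerivBoundOnCircle G D₂ := by
  obtain ⟨g', h1, h2, h3⟩ := h
  exact ⟨g', h1, h2, fun t => (h3 t).trans hD⟩

lemma nonneg (h : HasDerivBoundOnCircle G D) : 0 ≤ D := by
  obtain ⟨g', -, -, h3⟩ := h
  exact (abs_nonneg _).trans (h3 0)

lemma add (h₁ : HasDerivBoundOnCircle G₁ D₁) (h₂ : HasDerivBoundOnCircle G₂ D₂) :
    HasDerivBoundOnCircle (fun w => G₁ w + G₂ w) (D₁ + D₂) := by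
  obtain ⟨g₁, a1, a2, a3⟩ := h₁
  obtain ⟨g₂, b1, b2, b3⟩ := h₂
  exact ⟨fun t => g₁ t + g₂ t, fun t => (a1 t).add (b1 t), a2.add b2,
    fun t => (abs_add_le _ _).trans (add_le_add (a3 t) (b3 t))⟩

lemma sub (h₁ : HasDerivBoundOnCircle G₁ D₁) (h₂ : HasDerivBoundOnCircle G₂ D₂) :
    HasDerivBoundOnCircle (fun w => G₁ w - G₂ w) (D₁ + D₂) := by
  obtain ⟨g₁, a1, a2, a3⟩ := h₁
  obtain ⟨g₂, b1, b2, b3⟩ := h₂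
  exact ⟨fun t => g₁ t - g₂ t, fun t => (a1 t).sub (b1 t), a2.sub b2,
    fun t => (abs_sub _ _).trans (add_le_add (a3 t) (b3 t))⟩

lemma mul (h₁ : HasDerivBoundOnCircle G₁ D₁) (h₂ : HasDerivBoundOnCircle G₂ D₂) {M₁ M₂ : ℝ}
    (hM₁ : ∀ w, |G₁ w| ≤ M₁) (hM₂ : ∀ w, |G₂ w| ≤ M₂) :
    HasDerivBoundOnCircle (fun w => G₁ w * G₂ w) (D₁ * M₂ + M₁ * D₂) := by
  have hD₁ := h₁.nonneg
  have hM₁' : 0 ≤ M₁ := (abs_nonneg _).trans (hM₁ 1)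
  have c1 := h₁.continuous.comp continuous_circlePoint
  have c2 := h₂.continuous.comp continuous_circlePoint
  obtain ⟨g₁, a1, a2, a3⟩ := h₁
  obtain ⟨g₂, b1, b2, b3⟩ := h₂
  refine ⟨_, fun t => (a1 t).mul (b1 t), (a2.mul c2).add (c1.mul b2), fun t => ?_⟩
  refine (abs_add_le _ _).trans ?_
  rw [abs_mul, abs_mul]
  exact add_le_add (mul_le_mul (a3 t) (hM₂ _) (abs_nonneg _) hD₁)
    (mul_le_mul (hM₁ _) (b3 t) (abs_nonneg _) hM₁')

lemma comp {Φ Φ' : ℝ → ℝ} {L : ℝ} (h : HasDerivBoundOnCircle G D)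
    (hΦ : ∀ w, HasDerivAt Φ (Φ' (G w)) (G w)) (hc : Continuous fun w => Φ' (G w))
    (hL : ∀ w, |Φ' (G w)| ≤ L) : HasDerivBoundOnCircle (fun w => Φ (G w)) (L * D) := by
  obtain ⟨g', a1, a2, a3⟩ := h
  refine ⟨fun t => Φ' (G (circlePoint t)) * g' t, fun t => (hΦ _).comp t (a1 t),
    (hc.comp continuous_circlePoint).mul a2, fun t => ?_⟩
  rw [abs_mul]
  exact mul_le_mul (hL _) (a3 t) (abs_nonneg _) ((abs_nonneg _).trans (hL 1))

end HasDerivBoundOnCircle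

/-! ### Smooth approximation of the logarithm and of the argument -/

/-- `F` has all moments under the laws `η m`, in the mean over `m`, and can be approximated in mean
square by continuously differentiable functions whose derivatives grow polynomially in the inverse
of the precision. -/
structure SmoothlyApproximable (η : ℕ → Measure Circle) (F : Circle → ℝ) : Prop where
  measurable : Measurable F
  moment_le : ∀ p : ℕ, ∃ C : ℝ, ∀ n : ℕ,
    ∑ i ∈ Finset.range n, ∫⁻ w, ENNReal.ofReal (|F w| ^ p) ∂η (i + 1) ≤ ENNReal.ofReal (C * n)
  moment_uniform : ∀ p : ℕ, ∫⁻ w, ENNReal.ofReal (|F w| ^ p) ∂uniformCircle < ⊤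
  approx : ∃ C q κ s : ℝ, 0 < C ∧ 0 < q ∧ 0 < κ ∧ 0 < s ∧ s < 1 ∧ ∀ ε : ℝ, 0 < ε → ε ≤ 1 →
    ∃ G : Circle → ℝ, HasDerivBoundOnCircle G (C * ε ^ (-q)) ∧
      ∫⁻ w, ENNReal.ofReal ((F w - G w) ^ 2) ∂uniformCircle ≤ ENNReal.ofReal (C * ε ^ κ) ∧
      ∀ n : ℕ, ∑ i ∈ Finset.range n, ∫⁻ w, ENNReal.ofReal ((F w - G w) ^ 2) ∂η (i + 1)
        ≤ ENNReal.ofReal (C * (ε ^ κ * n + ε ^ (-q) * (n : ℝ) ^ (1 - s)))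

lemma abs_log_pow_le {κ B r : ℝ} (hκ : 0 < κ) (hB : 0 < B) (hr : 0 < r) (hrB : r ≤ B) (p : ℕ) :
    |Real.log r| ^ p ≤ (((p + 1) / κ) ^ p + B ^ p) * (r ^ (-κ) + 1) := by
  have hpos : 0 < r ^ (-κ) := Real.rpow_pos_of_pos hr _
  rcases le_total r 1 with h1 | h1
  · set t := κ / (p + 1) with ht
    have ht0 : 0 < t := by positivity
    have h2 := (Real.abs_log_mul_self_rpow_lt r t hr h1 ht0).le
    rw [abs_mul, abs_of_pos (Real.rpow_pos_of_pos hr t)] at h2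
    have h3 : |Real.log r| ≤ (p + 1) / κ * r ^ (-t) := by
      rw [Real.rpow_neg hr.le, ← div_eq_mul_inv, le_div_iff₀ (Real.rpow_pos_of_pos hr t)]
      refine h2.trans (le_of_eq ?_)
      rw [ht]; field_simp
    have h4 : (r ^ (-t)) ^ p ≤ r ^ (-κ) := by
      rw [← Real.rpow_natCast, ← Real.rpow_mul hr.le]
      refine Real.rpow_le_rpow_of_exponent_ge hr h1 ?_
      have : t * p ≤ κ := by
        rw [ht, div_mul_eq_mul_div, div_le_iff₀ (by positivity)]
        nlinarith
      linarith
    calc |Real.log r| ^ p ≤ ((p + 1) / κ * r ^ (-t)) ^ p := by gcongr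
      _ = ((p + 1) / κ) ^ p * (r ^ (-t)) ^ p := mul_pow _ _ _
      _ ≤ ((p + 1) / κ) ^ p * r ^ (-κ) := by gcongr
      _ ≤ _ := by
        refine mul_le_mul (le_add_of_nonneg_right (by positivity)) (by linarith) hpos.le
          (by positivity)
  · have h2 : |Real.log r| ≤ B := by
      rw [abs_of_nonneg (Real.log_nonneg h1)]
      exact (Real.log_le_self hr.le).trans hrB
    calc |Real.log r| ^ p ≤ B ^ p := by gcongr
      _ ≤ (((p + 1) / κ) ^ p + B ^ p) * 1 := by
        rw [mul_one]; exact le_add_of_nonneg_left (by positivity)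
      _ ≤ _ := by
        refine mul_le_mul_of_nonneg_left (by linarith) (by positivity)

/-- The error of the smoothing `log (r ^ 2 + ε ^ 2) / 2` of `log r`. -/
lemma sq_log_sub_log_le {κ ε r : ℝ} (hκ : 0 < κ) (hκ1 : κ ≤ 1) (hε : 0 < ε) (hr : 0 < r) :
    (Real.log r - 1 / 2 * Real.log (r ^ 2 + ε ^ 2)) ^ 2 ≤ 4 / κ ^ 2 * ε ^ κ * r ^ (-κ) := by
  set u := (ε / r) ^ 2 with hu
  have hu0 : 0 < u := by positivity
  have h1 : Real.log r - 1 / 2 * Real.log (r ^ 2 + ε ^ 2) = -(1 / 2 * Real.log (1 + u)) := by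
    have : r ^ 2 + ε ^ 2 = r ^ 2 * (1 + u) := by rw [hu]; field_simp
    rw [this, Real.log_mul (by positivity) (by positivity), Real.log_pow]
    push_cast; ring
  have h2 : Real.log (1 + u) ≤ 4 / κ * u ^ (κ / 4) := by
    have h3 : (1 + u) ^ (κ / 4) ≤ 1 + u ^ (κ / 4) := by
      have := Real.rpow_add_le_add_rpow zero_le_one hu0.le (p := κ / 4) (by positivity) (by linarith)
      simpa using this
    have h4 := Real.add_one_le_exp (Real.log (1 + u) * (κ / 4))
    rw [← Real.rpow_def_of_pos (by positivity)] at h4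
    have h5 : Real.log (1 + u) * (κ / 4) ≤ u ^ (κ / 4) := by linarith
    calc Real.log (1 + u) = 4 / κ * (Real.log (1 + u) * (κ / 4)) := by field_simp
      _ ≤ _ := by gcongr
  have h3 : 0 ≤ Real.log (1 + u) := Real.log_nonneg (by linarith)
  have h4 : (u ^ (κ / 4)) ^ 2 = ε ^ κ * r ^ (-κ) := by
    rw [hu, ← Real.rpow_natCast, ← Real.rpow_natCast, ← Real.rpow_mul (by positivity),
      ← Real.rpow_mul (by positivity), Real.div_rpow hε.le hr.le, Real.rpow_neg hr.le,
      div_eq_mul_inv]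
    push_cast
    congr 3 <;> ring
  calc (Real.log r - 1 / 2 * Real.log (r ^ 2 + ε ^ 2)) ^ 2 = 1 / 4 * Real.log (1 + u) ^ 2 := by
        rw [h1]; ring
    _ ≤ 1 / 4 * (4 / κ * u ^ (κ / 4)) ^ 2 := by gcongr
    _ = 4 / κ ^ 2 * ε ^ κ * r ^ (-κ) := by rw [mul_pow, h4]; ring

lemma abs_arctan_sub_arctan_le (x y : ℝ) : |Real.arctan x - Real.arctan y| ≤ |x - y| := by
  have := Convex.norm_image_sub_le_of_norm_deriv_le (f := Real.arctan) (C := 1) (s := Set.univ)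
    (x := y) (y := x) (fun t _ => Real.differentiableAt_arctan t) (fun t _ => by
      rw [Real.deriv_arctan, Real.norm_eq_abs, abs_of_nonneg (by positivity),
        div_le_one (by positivity)]
      nlinarith [sq_nonneg t]) convex_univ (Set.mem_univ _) (Set.mem_univ _)
  simpa using this

lemma abs_arctan_le_pi_div_two (x : ℝ) : |Real.arctan x| ≤ π / 2 :=
  abs_le.2 ⟨(Real.neg_pi_div_two_lt_arctan x).le, (Real.arctan_lt_pi_div_two x).le⟩

/-- The argument off the real axis. -/
lemma arg_add_arctan_div_of_im_ne_zero {w : ℂ} (h : w.im ≠ 0) :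
    w.arg + Real.arctan (w.re / w.im) = if 0 < w.im then π / 2 else -(π / 2) := by
  have hn : ‖w‖ = |w.im| * √(1 + (w.re / w.im) ^ 2) := by
    rw [Complex.norm_eq_sqrt_sq_add_sq, ← Real.sqrt_sq_eq_abs, ← Real.sqrt_mul (sq_nonneg _)]
    congr 1
    field_simp
    ring
  rw [Real.arctan_eq_arcsin]
  rcases lt_or_gt_of_ne h with h1 | h1
  · rw [if_neg (by linarith), Complex.arg_of_im_neg h1, hn, abs_of_neg h1]
    have : w.re / w.im / √(1 + (w.re / w.im) ^ 2) = -(w.re / (-w.im * √(1 + (w.re / w.im) ^ 2))) := by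
      field_simp
    rw [this, Real.arcsin_neg, Real.arccos]
    ring
  · rw [if_pos h1, Complex.arg_of_im_pos h1, hn, abs_of_pos h1, div_div, Real.arccos]
    ring

lemma arctan_add_arctan_inv {u : ℝ} (h : u ≠ 0) :
    Real.arctan u + Real.arctan u⁻¹ = if 0 < u then π / 2 else -(π / 2) := by
  rcases lt_or_gt_of_ne h with h1 | h1
  · rw [if_neg (by linarith), Real.arctan_inv_of_neg h1]; ring
  · rw [if_pos h1, Real.arctan_inv_of_pos h1]; ring

/-- From a bound decaying like `ε / |y|`, and a uniform bound, to a bound by a smooth function. -/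
lemma sq_le_of_abs_le_div {A B ε y e : ℝ} (hε : 0 < ε) (hA : |e| ≤ A)
    (hB : ε ≤ |y| → |e| ≤ B * (ε / |y|)) :
    e ^ 2 ≤ 2 * (A ^ 2 + B ^ 2) * (ε ^ 2 / (ε ^ 2 + y ^ 2)) := by
  have hA0 : 0 ≤ A := (abs_nonneg _).trans hA
  rw [← sq_abs e, ← sq_abs y, mul_div_assoc', le_div_iff₀ (by positivity)]
  rcases le_total ε |y| with h | h
  · have hy : 0 < |y| := hε.trans_le h
    have h2 : |e| * |y| ≤ B * ε := by
      have := hB h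
      rw [mul_div_assoc', le_div_iff₀ hy] at this
      exact this
    have h3 : (|e| * |y|) ^ 2 ≤ (B * ε) ^ 2 := by gcongr
    have h4 : |e| ^ 2 * ε ^ 2 ≤ (|e| * |y|) ^ 2 := by rw [mul_pow]; gcongr
    nlinarith [mul_nonneg (sq_nonneg A) (sq_nonneg ε)]
  · have h3 : |e| ^ 2 ≤ A ^ 2 := by gcongr
    have h4 : |y| ^ 2 ≤ ε ^ 2 := by gcongr
    have h5 : |e| ^ 2 * (ε ^ 2 + |y| ^ 2) ≤ A ^ 2 * (ε ^ 2 + ε ^ 2) := by gcongr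
    nlinarith [mul_nonneg (sq_nonneg B) (sq_nonneg ε)]

/-- Smoothing of the argument near the real axis. Off the axis `arg w` is `± π / 2 - arctan (x / y)`;
the jump of the constant and that of the arctangent at `y = 0` are smoothed on the scales `ε` and
`ε ^ 3`, the latter small enough for the error to be `O(ε / |y|)`. -/
lemma sq_arg_sub_arctan_le {M ε : ℝ} (hε : 0 < ε) {w : ℂ} (hM : |w.re| ≤ M) :
    (w.arg - (Real.arctan (w.im / ε) - Real.arctan (w.re * (w.im / (w.im ^ 2 + ε ^ 3))))) ^ 2
      ≤ 2 * ((2 * π) ^ 2 + (1 + M) ^ 2) * (ε ^ 2 / (ε ^ 2 + w.im ^ 2)) := by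
  refine sq_le_of_abs_le_div hε ?_ fun h => ?_
  · have h1 := Complex.abs_arg_le_pi w
    have h2 := abs_arctan_le_pi_div_two (w.im / ε)
    have h3 := abs_arctan_le_pi_div_two (w.re * (w.im / (w.im ^ 2 + ε ^ 3)))
    rw [abs_le] at *
    constructor <;> linarith
  · have hy : 0 < |w.im| := hε.trans_le h
    have hy0 : w.im ≠ 0 := abs_pos.1 hy
    have h1 := arg_add_arctan_div_of_im_ne_zero hy0
    have h2 := arctan_add_arctan_inv (u := w.im / ε) (by positivity)
    have h3 : (0 < w.im / ε) = (0 < w.im) := by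
      rw [div_pos_iff_of_pos_right hε]
    simp only [h3] at h2
    rw [← h2] at h1
    have h4 : w.arg - (Real.arctan (w.im / ε) - Real.arctan (w.re * (w.im / (w.im ^ 2 + ε ^ 3))))
        = (Real.arctan (w.im / ε)⁻¹ - Real.arctan 0)
          + (Real.arctan (w.re * (w.im / (w.im ^ 2 + ε ^ 3))) - Real.arctan (w.re / w.im)) := by
      rw [Real.arctan_zero]; linarith
    rw [h4]
    have h5 : |Real.arctan (w.im / ε)⁻¹ - Real.arctan 0| ≤ ε / |w.im| := by
      refine (abs_arctan_sub_arctan_le _ _).trans (le_of_eq ?_)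
      rw [sub_zero, inv_div, abs_div, abs_of_pos hε]
    have h6 : |Real.arctan (w.re * (w.im / (w.im ^ 2 + ε ^ 3))) - Real.arctan (w.re / w.im)|
        ≤ M * (ε / |w.im|) := by
      refine (abs_arctan_sub_arctan_le _ _).trans ?_
      have h7 : w.re * (w.im / (w.im ^ 2 + ε ^ 3)) - w.re / w.im
          = -(w.re * (ε ^ 3 / (w.im * (w.im ^ 2 + ε ^ 3)))) := by
        have : w.im ^ 2 + ε ^ 3 ≠ 0 := by positivity
        field_simp
        ring
      rw [h7, abs_neg, abs_mul, abs_div, abs_mul, abs_of_pos (a := ε ^ 3) (by positivity),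
        abs_of_pos (a := w.im ^ 2 + ε ^ 3) (by positivity)]
      have h8 : ε ^ 3 / (|w.im| * (w.im ^ 2 + ε ^ 3)) ≤ ε / |w.im| := by
        rw [div_le_div_iff₀ (by positivity) hy]
        have h9 : ε ^ 2 ≤ w.im ^ 2 := by rw [← sq_abs w.im]; gcongr
        have : ε ^ 3 ≤ ε * (w.im ^ 2 + ε ^ 3) := by nlinarith [pow_pos hε 3, pow_pos hε 4]
        nlinarith
      exact mul_le_mul hM h8 (by positivity) ((abs_nonneg _).trans hM)
    calc _ ≤ ε / |w.im| + M * (ε / |w.im|) := (abs_add_le _ _).trans (add_le_add h5 h6)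
      _ = (1 + M) * (ε / |w.im|) := by ring

/-- Smoothing of the argument on the real axis. -/
lemma sq_arg_ofReal_sub_arctan_le {ε : ℝ} (hε : 0 < ε) (x : ℝ) :
    ((x : ℂ).arg - (π / 2 - Real.arctan (x / ε))) ^ 2
      ≤ 2 * ((2 * π) ^ 2 + 1 ^ 2) * (ε ^ 2 / (ε ^ 2 + x ^ 2)) := by
  refine sq_le_of_abs_le_div hε ?_ fun h => ?_
  · have h1 := Complex.abs_arg_le_pi x
    have h2 := abs_arctan_le_pi_div_two (x / ε)
    rw [abs_le] at *
    constructor <;> linarith [Real.pi_pos]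
  · have hy : 0 < |x| := hε.trans_le h
    have hy0 : x ≠ 0 := abs_pos.1 hy
    have h2 := arctan_add_arctan_inv (u := x / ε) (by positivity)
    have h4 : (x : ℂ).arg - (π / 2 - Real.arctan (x / ε))
        = -(Real.arctan (x / ε)⁻¹ - Real.arctan 0) := by
      rw [Real.arctan_zero]
      rcases lt_or_gt_of_ne hy0 with h1 | h1
      · rw [if_neg (not_lt.2 (div_neg_of_neg_of_pos h1 hε).le)] at h2
        rw [Complex.arg_ofReal_of_neg h1]; linarith
      · rw [if_pos (by positivity)] at h2
        rw [Complex.arg_ofReal_of_nonneg h1.le]; linarith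
    rw [h4, abs_neg, one_mul]
    refine (abs_arctan_sub_arctan_le _ _).trans (le_of_eq ?_)
    rw [sub_zero, inv_div, abs_div, abs_of_pos hε]

/-- The negative moments of small order of `|f|` under the laws `η m` are bounded in the mean over
`m`. -/
def HasNegativeMoments (η : ℕ → Measure Circle) (f : Circle → ℂ) : Prop :=
  ∃ κ₀ : ℝ, 0 < κ₀ ∧ ∀ κ, 0 < κ → κ ≤ κ₀ → ∃ C : ℝ, 0 < C ∧ ∀ n : ℕ,
    ∑ i ∈ Finset.range n, ∫⁻ w, ‖f w‖ₑ ^ (-κ) ∂η (i + 1) ≤ ENNReal.ofReal (C * n)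

section Approximation

variable {η : ℕ → Measure Circle} {f : Circle → ℂ} {M : ℝ}

lemma sum_lintegral_const_mul_le {g : Circle → ENNReal} (hg : Measurable g) {C A : ℝ} (hA : 0 ≤ A)
    {n : ℕ} (h : ∑ i ∈ Finset.range n, ∫⁻ w, g w ∂η (i + 1) ≤ ENNReal.ofReal (C * n)) :
    ∑ i ∈ Finset.range n, ∫⁻ w, ENNReal.ofReal A * g w ∂η (i + 1)
      ≤ ENNReal.ofReal (A * C * n) := by
  simp_rw [lintegral_const_mul _ hg]
  rw [← Finset.mul_sum, mul_assoc, ENNReal.ofReal_mul hA]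
  gcongr

lemma hasDerivBoundOnCircle_log_smoothing
    (hre : HasDerivBoundOnCircle (fun w => (f w).re) M) (him : HasDerivBoundOnCircle (fun w => (f w).im) M)
    (hreM : ∀ w, |(f w).re| ≤ M) (himM : ∀ w, |(f w).im| ≤ M) {ε : ℝ} (hε : 0 < ε) :
    HasDerivBoundOnCircle (fun w => 1 / 2 * Real.log (‖f w‖ ^ 2 + ε ^ 2))
      (2 * M ^ 2 * ε ^ (-2 : ℝ)) := by
  have h1 := (hre.mul hre hreM hreM).add (him.mul him himM himM)
  have hpos : ∀ w, 0 < (f w).re * (f w).re + (f w).im * (f w).im + ε ^ 2 := fun w => by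
    nlinarith [mul_self_nonneg (f w).re, mul_self_nonneg (f w).im, pow_pos hε 2]
  have h2 := h1.comp (Φ := fun v => 1 / 2 * Real.log (v + ε ^ 2))
    (Φ' := fun v => 1 / 2 * (v + ε ^ 2)⁻¹) (L := 1 / (2 * ε ^ 2)) (fun w => ?_) ?_ fun w => ?_
  · have e : ∀ w, ‖f w‖ ^ 2 = (f w).re * (f w).re + (f w).im * (f w).im := fun w => by
      rw [Complex.sq_norm, Complex.normSq_apply]
    simp_rw [e]
    refine h2.mono (le_of_eq ?_)
    rw [Real.rpow_neg hε.le, Real.rpow_two]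
    field_simp
    ring
  · have := (((hasDerivAt_id ((f w).re * (f w).re + (f w).im * (f w).im)).add_const (ε ^ 2)).log
      (hpos w).ne').const_mul (1 / 2)
    simpa using this
  · have := h1.continuous
    exact continuous_const.mul ((this.add continuous_const).inv₀ fun w => (hpos w).ne')
  · rw [abs_of_pos (mul_pos one_half_pos (inv_pos.2 (hpos w))), one_div, one_div, mul_inv]
    gcongr
    nlinarith [mul_self_nonneg (f w).re, mul_self_nonneg (f w).im]

/-- The approximation of `log |f|` by `log (|f| ^ 2 + ε ^ 2) / 2`, whose error is controlled by the
negative moments of `|f|`. -/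
lemma smoothlyApproximable_log_norm [∀ m, IsProbabilityMeasure (η m)] (hM : 0 < M)
    (hre : HasDerivBoundOnCircle (fun w => (f w).re) M) (him : HasDerivBoundOnCircle (fun w => (f w).im) M)
    (hreM : ∀ w, |(f w).re| ≤ M) (himM : ∀ w, |(f w).im| ≤ M) {κ C : ℝ} (hκ : 0 < κ) (hκ1 : κ ≤ 1)
    (hC : 0 < C) (hη : ∀ n : ℕ, ∑ i ∈ Finset.range n, ∫⁻ w, ‖f w‖ₑ ^ (-κ) ∂η (i + 1)
      ≤ ENNReal.ofReal (C * n))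
    (hu : ∫⁻ w, ‖f w‖ₑ ^ (-κ) ∂uniformCircle < ⊤) :
    SmoothlyApproximable η (fun w => Real.log ‖f w‖) := by
  have hf : Measurable f := by
    have h1 : Measurable fun w => (((f w).re : ℝ) : ℂ) + ((f w).im : ℝ) * Complex.I :=
      (Complex.measurable_ofReal.comp hre.continuous.measurable).add
        ((Complex.measurable_ofReal.comp him.continuous.measurable).mul_const _)
    simpa only [Complex.re_add_im] using h1
  have hnm : Measurable fun w => ‖f w‖ₑ ^ (-κ) := hf.enorm.pow_const _
  have hB : ∀ w, ‖f w‖ ≤ 2 * M := fun w =>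
    (Complex.norm_le_abs_re_add_abs_im _).trans (by linarith [hreM w, himM w])
  have hmom : ∀ (p : ℕ) (w : Circle), ENNReal.ofReal (|Real.log ‖f w‖| ^ p)
      ≤ ENNReal.ofReal (((p + 1) / κ) ^ p + (2 * M) ^ p) * (‖f w‖ₑ ^ (-κ) + 1) := by
    intro p w
    have hp : 0 < ((p + 1) / κ) ^ p + (2 * M) ^ p := by positivity
    rcases eq_or_ne (f w) 0 with h0 | h0
    · rw [h0, enorm_zero, ENNReal.zero_rpow_of_neg (by linarith), top_add,
        ENNReal.mul_top (by simpa using hp)]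
      exact le_top
    · have hpos := norm_pos_iff.2 h0
      rw [← ofReal_norm, ENNReal.ofReal_rpow_of_pos hpos, ← ENNReal.ofReal_one,
        ← ENNReal.ofReal_add (by positivity) zero_le_one, ← ENNReal.ofReal_mul hp.le]
      exact ENNReal.ofReal_le_ofReal (abs_log_pow_le hκ (by positivity) hpos (hB w) p)
  have hsq : ∀ ε : ℝ, 0 < ε → ∀ w, ENNReal.ofReal
      ((Real.log ‖f w‖ - 1 / 2 * Real.log (‖f w‖ ^ 2 + ε ^ 2)) ^ 2)
      ≤ ENNReal.ofReal (4 / κ ^ 2 * ε ^ κ) * ‖f w‖ₑ ^ (-κ) := fun ε hε w =>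
    ofReal_le_mul_enorm_rpow_neg (by positivity) hκ fun h0 =>
      sq_log_sub_log_le hκ hκ1 hε (norm_pos_iff.2 h0)
  set Cu := (∫⁻ w, ‖f w‖ₑ ^ (-κ) ∂uniformCircle).toReal with hCu
  have hCu0 : 0 ≤ Cu := ENNReal.toReal_nonneg
  have hCu' : ∫⁻ w, ‖f w‖ₑ ^ (-κ) ∂uniformCircle = ENNReal.ofReal Cu :=
    (ENNReal.ofReal_toReal hu.ne).symm
  refine ⟨Real.measurable_log.comp hf.norm, fun p => ?_, fun p => ?_, ?_⟩
  · refine ⟨(((p + 1) / κ) ^ p + (2 * M) ^ p) * (C + 1), fun n => ?_⟩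
    refine (Finset.sum_le_sum fun i _ => lintegral_mono (hmom p)).trans ?_
    refine sum_lintegral_const_mul_le (hnm.add_const 1) (by positivity) ?_
    simp_rw [lintegral_add_left hnm, Finset.sum_add_distrib]
    rw [add_mul, ENNReal.ofReal_add (by positivity) (by positivity)]
    refine add_le_add (hη n) (le_of_eq ?_)
    simp
  · refine (lintegral_mono (hmom p)).trans_lt ?_
    rw [lintegral_const_mul _ (hnm.add_const 1), lintegral_add_left hnm]
    refine ENNReal.mul_lt_top ENNReal.ofReal_lt_top (ENNReal.add_lt_top.2 ⟨hu, ?_⟩)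
    simp
  · refine ⟨2 * M ^ 2 + 4 / κ ^ 2 * (C + Cu), 2, κ, 1 / 2, by positivity, two_pos, hκ, by norm_num,
      by norm_num, fun ε hε hε1 => ⟨_, ?_, (lintegral_mono (hsq ε hε)).trans ?_, fun n =>
        (Finset.sum_le_sum fun i _ => lintegral_mono (hsq ε hε)).trans ?_⟩⟩
    · refine (hasDerivBoundOnCircle_log_smoothing hre him hreM himM hε).mono ?_
      gcongr
      exact le_add_of_nonneg_right (by positivity)
    · rw [lintegral_const_mul _ hnm, hCu', ← ENNReal.ofReal_mul (by positivity)]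
      refine ENNReal.ofReal_le_ofReal ?_
      have h1 : 0 ≤ (2 * M ^ 2 + 4 / κ ^ 2 * C) * ε ^ κ := by positivity
      calc 4 / κ ^ 2 * ε ^ κ * Cu
          ≤ 4 / κ ^ 2 * ε ^ κ * Cu + (2 * M ^ 2 + 4 / κ ^ 2 * C) * ε ^ κ := by linarith
        _ = _ := by ring
    · refine (sum_lintegral_const_mul_le hnm (by positivity) (hη n)).trans
        (ENNReal.ofReal_le_ofReal ?_)
      have h1 : 0 ≤ (2 * M ^ 2 + 4 / κ ^ 2 * Cu) * (ε ^ κ * n) := by positivity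
      have h2 : 0 ≤ (2 * M ^ 2 + 4 / κ ^ 2 * (C + Cu)) * (ε ^ (-2 : ℝ) * (n : ℝ) ^ (1 - 1 / 2 : ℝ)) := by
        positivity
      calc 4 / κ ^ 2 * ε ^ κ * C * n
          ≤ 4 / κ ^ 2 * ε ^ κ * C * n + (2 * M ^ 2 + 4 / κ ^ 2 * Cu) * (ε ^ κ * n)
            + (2 * M ^ 2 + 4 / κ ^ 2 * (C + Cu)) * (ε ^ (-2 : ℝ) * (n : ℝ) ^ (1 - 1 / 2 : ℝ)) := by
            linarith
        _ = _ := by ring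

lemma hasDerivBoundOnCircle_bump {y : Circle → ℝ} (hy : HasDerivBoundOnCircle y M) {ε : ℝ}
    (hε : 0 < ε) :
    HasDerivBoundOnCircle (fun w => ε ^ 2 / (ε ^ 2 + y w ^ 2)) (1 / ε * M) := by
  have hpos : ∀ t : ℝ, 0 < ε ^ 2 + t ^ 2 := fun t => by positivity
  refine hy.comp (Φ := fun t => ε ^ 2 / (ε ^ 2 + t ^ 2))
    (Φ' := fun t => -(ε ^ 2 * (2 * t)) / (ε ^ 2 + t ^ 2) ^ 2) (fun w => ?_) ?_ fun w => ?_
  · have h := (hasDerivAt_const (y w) (ε ^ 2)).div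
      (((hasDerivAt_id (y w)).pow 2).const_add (ε ^ 2)) (hpos _).ne'
    refine h.congr_deriv ?_
    simp
  · have := hy.continuous
    exact Continuous.div (by fun_prop) (by fun_prop) fun w => (pow_pos (hpos _) 2).ne'
  · rw [abs_div, abs_neg, abs_mul, abs_mul, abs_of_pos (pow_pos (hpos _) 2),
      abs_of_pos (pow_pos hε 2), abs_two, div_le_div_iff₀ (pow_pos (hpos _) 2) hε, one_mul]
    rw [← sq_abs (y w)]
    set t := |y w|
    have ht : 0 ≤ t := abs_nonneg _
    have h1 : 2 * (ε * t) ≤ ε ^ 2 + t ^ 2 := by nlinarith [sq_nonneg (ε - t)]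
    have h2 : ε ^ 2 ≤ ε ^ 2 + t ^ 2 := by nlinarith
    calc ε ^ 2 * (2 * t) * ε = 2 * (ε * t) * ε ^ 2 := by ring
      _ ≤ (ε ^ 2 + t ^ 2) * (ε ^ 2 + t ^ 2) := by gcongr
      _ = _ := by ring

lemma bump_le_rpow {κ ε t : ℝ} (hκ : 0 < κ) (hκ1 : κ ≤ 1) (hε : 0 < ε) (ht : t ≠ 0) :
    ε ^ 2 / (ε ^ 2 + t ^ 2) ≤ ε ^ κ * ‖t‖ ^ (-κ) := by
  rw [Real.norm_eq_abs, ← sq_abs t]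
  have ht' : 0 < |t| := abs_pos.2 ht
  rw [Real.rpow_neg ht'.le, ← div_eq_mul_inv, ← Real.div_rpow hε.le ht'.le]
  have hr : 0 < ε / |t| := by positivity
  rcases le_total ε |t| with h | h
  · have hr1 : ε / |t| ≤ 1 := (div_le_one ht').2 h
    calc ε ^ 2 / (ε ^ 2 + |t| ^ 2) ≤ ε ^ 2 / |t| ^ 2 := by
          gcongr; nlinarith [sq_nonneg ε]
      _ = (ε / |t|) ^ (2 : ℝ) := by rw [Real.rpow_two, div_pow]
      _ ≤ _ := Real.rpow_le_rpow_of_exponent_ge hr hr1 (by linarith)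
  · calc ε ^ 2 / (ε ^ 2 + |t| ^ 2) ≤ 1 := by
          rw [div_le_one (by positivity)]; nlinarith
      _ ≤ _ := Real.one_le_rpow ((one_le_div ht').2 h) hκ.le

/-- A bounded function that is smooth up to a bump around the zeros of a continuously differentiable
function `y` can be approximated, because equidistribution applies to the bump. -/
lemma smoothlyApproximable_of_bump [∀ m, IsProbabilityMeasure (η m)] {F y : Circle → ℝ}
    {A B C q s κ E : ℝ} (hF : Measurable F) (hA : ∀ w, |F w| ≤ A) (hB : 0 < B) (hC : 0 < C)
    (hq : 1 ≤ q) (hs : 0 < s) (hs1 : s < 1) (hκ : 0 < κ) (hκ1 : κ ≤ 1) (hE : 0 < E) (hM : 0 < M)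
    (hy : HasDerivBoundOnCircle y M) (hu : ∫⁻ w, ‖y w‖ₑ ^ (-κ) ∂uniformCircle < ⊤)
    (hEQ : ∀ (G : Circle → ℝ) (D : ℝ), 0 < D → HasDerivBoundOnCircle G D →
      ∀ n : ℕ, |∑ i ∈ Finset.range n, (∫ w, G w ∂η (i + 1) - ∫ w, G w ∂uniformCircle)|
        ≤ E * D * (n : ℝ) ^ (1 - s))
    (happ : ∀ ε : ℝ, 0 < ε → ε ≤ 1 → ∃ G : Circle → ℝ, HasDerivBoundOnCircle G (C * ε ^ (-q)) ∧
      ∀ w, (F w - G w) ^ 2 ≤ B * (ε ^ 2 / (ε ^ 2 + y w ^ 2))) :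
    SmoothlyApproximable η F := by
  have hA0 : 0 ≤ A := (abs_nonneg _).trans (hA 1)
  have hp : ∀ (p : ℕ) w, ENNReal.ofReal (|F w| ^ p) ≤ ENNReal.ofReal (A ^ p) := fun p w =>
    ENNReal.ofReal_le_ofReal (pow_le_pow_left₀ (abs_nonneg _) (hA w) p)
  refine ⟨hF, fun p => ⟨A ^ p, fun n => ?_⟩, fun p => ?_, ?_⟩
  · refine (Finset.sum_le_sum fun i _ => lintegral_mono (hp p)).trans (le_of_eq ?_)
    simp only [lintegral_const, measure_univ, mul_one, Finset.sum_const, Finset.card_range,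
      nsmul_eq_mul]
    rw [mul_comm, ENNReal.ofReal_mul (by positivity), ENNReal.ofReal_natCast]
  · refine (lintegral_mono (hp p)).trans_lt ?_
    simp
  set Cu := (∫⁻ w, ‖y w‖ₑ ^ (-κ) ∂uniformCircle).toReal with hCu
  have hCu0 : 0 ≤ Cu := ENNReal.toReal_nonneg
  have hCu' : ∫⁻ w, ‖y w‖ₑ ^ (-κ) ∂uniformCircle = ENNReal.ofReal Cu :=
    (ENNReal.ofReal_toReal hu.ne).symm
  refine ⟨C + B * (Cu + E * M), q, κ, s, by positivity, by linarith, hκ, hs, hs1, fun ε hε hε1 => ?_⟩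
  obtain ⟨G, hG, hFG⟩ := happ ε hε hε1
  set U : Circle → ℝ := fun w => ε ^ 2 / (ε ^ 2 + y w ^ 2) with hU
  have hUd : HasDerivBoundOnCircle U (1 / ε * M) := hasDerivBoundOnCircle_bump hy hε
  have hUnn : ∀ w, 0 ≤ U w := fun w => by positivity
  have hU1 : ∀ w, U w ≤ 1 := fun w => by
    rw [hU]; simp only; rw [div_le_one (by positivity)]; nlinarith [sq_nonneg (y w)]
  have hUint : ∀ μ : Measure Circle, IsProbabilityMeasure μ → Integrable U μ := fun μ _ =>
    (integrable_const (1 : ℝ)).mono' hUd.continuous.aestronglyMeasurable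
      (ae_of_all _ fun w => by rw [Real.norm_eq_abs, abs_of_nonneg (hUnn w)]; exact hU1 w)
  have hUu : ∫ w, U w ∂uniformCircle ≤ ε ^ κ * Cu := by
    rw [integral_eq_lintegral_of_nonneg_ae (ae_of_all _ hUnn) hUd.continuous.aestronglyMeasurable]
    refine ENNReal.toReal_le_of_le_ofReal (by positivity) ?_
    calc ∫⁻ w, ENNReal.ofReal (U w) ∂uniformCircle
        ≤ ∫⁻ w, ENNReal.ofReal (ε ^ κ) * ‖y w‖ₑ ^ (-κ) ∂uniformCircle :=
          lintegral_mono fun w => ofReal_le_mul_enorm_rpow_neg (by positivity) hκ fun h0 =>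
            bump_le_rpow hκ hκ1 hε h0
      _ = _ := by
        rw [lintegral_const_mul _ (hy.continuous.measurable.enorm.pow_const _), hCu',
          ← ENNReal.ofReal_mul (by positivity)]
  have hlin : ∀ μ : Measure Circle, IsProbabilityMeasure μ →
      ∫⁻ w, ENNReal.ofReal ((F w - G w) ^ 2) ∂μ ≤ ENNReal.ofReal (B * ∫ w, U w ∂μ) := by
    intro μ hμ
    rw [← integral_const_mul, ofReal_integral_eq_lintegral_ofReal ((hUint μ hμ).const_mul B)
      (ae_of_all _ fun w => mul_nonneg hB.le (hUnn w))]
    exact lintegral_mono fun w => ENNReal.ofReal_le_ofReal (hFG w)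
  refine ⟨G, hG.mono ?_, (hlin _ inferInstance).trans (ENNReal.ofReal_le_ofReal ?_), fun n => ?_⟩
  · gcongr
    exact le_add_of_nonneg_right (by positivity)
  · have h1 : 0 ≤ (C + B * (E * M)) * ε ^ κ := by positivity
    calc B * ∫ w, U w ∂uniformCircle ≤ B * (ε ^ κ * Cu) := by gcongr
      _ ≤ B * (ε ^ κ * Cu) + (C + B * (E * M)) * ε ^ κ := by linarith
      _ = _ := by ring
  · refine (Finset.sum_le_sum fun i _ => hlin _ inferInstance).trans ?_
    rw [← ENNReal.ofReal_sum_of_nonneg fun i _ => mul_nonneg hB.le (integral_nonneg hUnn)]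
    refine ENNReal.ofReal_le_ofReal ?_
    have h1 := (le_abs_self _).trans (hEQ U (1 / ε * M) (by positivity) hUd n)
    rw [Finset.sum_sub_distrib, Finset.sum_const, Finset.card_range, nsmul_eq_mul] at h1
    have h2 : (n : ℝ) * ∫ w, U w ∂uniformCircle ≤ n * (ε ^ κ * Cu) := by gcongr
    have h3 : 1 / ε ≤ ε ^ (-q) := by
      rw [one_div, ← Real.rpow_neg_one]
      exact Real.rpow_le_rpow_of_exponent_ge hε hε1 (by linarith)
    have h4 : E * (1 / ε * M) * (n : ℝ) ^ (1 - s) ≤ E * (ε ^ (-q) * M) * (n : ℝ) ^ (1 - s) := by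
      gcongr
    rw [← Finset.mul_sum]
    have h5 : 0 ≤ (C + B * (E * M)) * (ε ^ κ * n) + (C + B * Cu) * (ε ^ (-q) * (n : ℝ) ^ (1 - s)) := by
      positivity
    calc B * ∑ i ∈ Finset.range n, ∫ w, U w ∂η (i + 1)
        ≤ B * (n * (ε ^ κ * Cu) + E * (ε ^ (-q) * M) * (n : ℝ) ^ (1 - s)) := by
          gcongr; linarith
      _ ≤ B * (n * (ε ^ κ * Cu) + E * (ε ^ (-q) * M) * (n : ℝ) ^ (1 - s))
          + ((C + B * (E * M)) * (ε ^ κ * n) + (C + B * Cu) * (ε ^ (-q) * (n : ℝ) ^ (1 - s))) := by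
          linarith
      _ = _ := by ring

lemma HasDerivBoundOnCircle.arctan_div {y : Circle → ℝ} (hy : HasDerivBoundOnCircle y M) {ε : ℝ}
    (hε : 0 < ε) : HasDerivBoundOnCircle (fun w => Real.arctan (y w / ε)) (1 / ε * M) := by
  refine hy.comp (Φ := fun t => Real.arctan (t / ε))
    (Φ' := fun t => 1 / (1 + (t / ε) ^ 2) * (1 / ε)) (fun w => ?_) ?_ fun w => ?_
  · exact ((hasDerivAt_id (y w)).div_const ε).arctan
  · have := hy.continuous
    exact (Continuous.div (by fun_prop) (by fun_prop) fun w => by positivity).mul continuous_const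
  · rw [abs_of_nonneg (by positivity)]
    refine mul_le_of_le_one_left (by positivity) ?_
    rw [div_le_one (by positivity)]
    nlinarith [sq_nonneg (y w / ε)]

lemma HasDerivBoundOnCircle.arctan_smoothing {x y : Circle → ℝ} (hM : 0 < M)
    (hx : HasDerivBoundOnCircle x M) (hy : HasDerivBoundOnCircle y M) (hxM : ∀ w, |x w| ≤ M)
    (hyM : ∀ w, |y w| ≤ M) {e : ℝ} (he : 0 < e) :
    HasDerivBoundOnCircle (fun w => Real.arctan (x w * (y w / (y w ^ 2 + e)))) (2 * M ^ 2 / e) := by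
  have hpos : ∀ t : ℝ, 0 < t ^ 2 + e := fun t => by positivity
  have h1 : HasDerivBoundOnCircle (fun w => y w / (y w ^ 2 + e)) (1 / e * M) := by
    refine hy.comp (Φ := fun t => t / (t ^ 2 + e))
      (Φ' := fun t => (1 * (t ^ 2 + e) - t * (2 * t)) / (t ^ 2 + e) ^ 2) (fun w => ?_) ?_ fun w => ?_
    · have h := (hasDerivAt_id (y w)).div (((hasDerivAt_id (y w)).pow 2).add_const e) (hpos _).ne'
      refine h.congr_deriv ?_
      simp
    · have := hy.continuous
      exact Continuous.div (by fun_prop) (by fun_prop) fun w => (pow_pos (hpos _) 2).ne'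
    · rw [abs_div, abs_of_pos (pow_pos (hpos _) 2), div_le_div_iff₀ (pow_pos (hpos _) 2) he, one_mul]
      set t := y w
      have h2 : |1 * (t ^ 2 + e) - t * (2 * t)| ≤ t ^ 2 + e := by
        rw [abs_le]; constructor <;> nlinarith [sq_nonneg t]
      have h3 : e ≤ t ^ 2 + e := by nlinarith [sq_nonneg t]
      rw [one_mul] at h2
      calc _ ≤ (t ^ 2 + e) * (t ^ 2 + e) := mul_le_mul h2 h3 he.le (hpos t).le
        _ = 1 * (t ^ 2 + e) ^ 2 := by ring
  have h2 : ∀ w, |y w / (y w ^ 2 + e)| ≤ 1 / e * M := by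
    intro w
    rw [abs_div, abs_of_pos (hpos _), div_le_iff₀ (hpos _)]
    have h3 : 1 ≤ 1 / e * (y w ^ 2 + e) := by
      rw [mul_add, one_div_mul_cancel he.ne']
      have : 0 ≤ 1 / e * y w ^ 2 := by positivity
      linarith
    calc |y w| ≤ M := hyM w
      _ ≤ M * (1 / e * (y w ^ 2 + e)) := le_mul_of_one_le_right hM.le h3
      _ = _ := by ring
  have h3 := hx.mul h1 hxM h2
  have h4 := h3.comp (Φ := Real.arctan) (Φ' := fun t => 1 / (1 + t ^ 2)) (L := 1)
    (fun w => Real.hasDerivAt_arctan _) ?_ fun w => ?_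
  · refine h4.mono (le_of_eq ?_)
    field_simp
    ring
  · have := h3.continuous
    exact Continuous.div (by fun_prop) (by fun_prop) fun w => by positivity
  · rw [abs_of_nonneg (by positivity), div_le_one (by positivity)]
    nlinarith [sq_nonneg (x w * (y w / (y w ^ 2 + e)))]

/-- The real and imaginary parts of `log f`, for a real analytic `f`, can be approximated. -/
lemma smoothlyApproximable_logPart [∀ m, IsProbabilityMeasure (η m)]
    (hf : IsRealAnalyticOnCircle f) (hf0 : f ≠ 0) {lam : ℤ → ℂ}
    (hη : ∀ (a : ℤ) (m : ℕ), ∫ w, ((w ^ a : Circle) : ℂ) ∂η m = lam a ^ m)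
    (hgap : HasPolynomialGap lam) (hneg : HasNegativeMoments η f) (k : Fin 2) :
    SmoothlyApproximable η (logPart f k) := by
  have hare : ∀ t, AnalyticAt ℝ (fun s => (f (circlePoint s)).re) t := fun t =>
    (Complex.reCLM.analyticAt _).comp (hf t)
  have haim : ∀ t, AnalyticAt ℝ (fun s => (f (circlePoint s)).im) t := fun t =>
    (Complex.imCLM.analyticAt _).comp (hf t)
  obtain ⟨M₁, hM₁, hre1, hre1'⟩ := exists_hasDerivBoundOnCircle (h := fun w => (f w).re) hare
  obtain ⟨M₂, hM₂, him1, him1'⟩ := exists_hasDerivBoundOnCircle (h := fun w => (f w).im) haim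
  set M := max M₁ M₂
  have hM : 0 < M := lt_max_of_lt_left hM₁
  have hreM : ∀ w, |(f w).re| ≤ M := fun w => (hre1 w).trans (le_max_left _ _)
  have himM : ∀ w, |(f w).im| ≤ M := fun w => (him1 w).trans (le_max_right _ _)
  have hre := hre1'.mono (le_max_left M₁ M₂)
  have him := him1'.mono (le_max_right M₁ M₂)
  have hfc : Continuous f := continuous_of_comp_circlePoint
    (continuous_iff_continuousAt.2 fun t => (hf t).continuousAt)
  obtain ⟨E, s, hE, hs, hs1, hEQ⟩ := exists_equidistribution_rate hη hgap
  fin_cases k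
  · obtain ⟨κ₀, hκ₀, h1⟩ := hneg
    obtain ⟨κ₁, hκ₁, h2⟩ := exists_lintegral_uniformCircle_lt_top hf hf0
    set κ := min 1 (min κ₀ κ₁)
    have hκ : 0 < κ := lt_min one_pos (lt_min hκ₀ hκ₁)
    obtain ⟨C, hC, h1⟩ := h1 κ hκ ((min_le_right _ _).trans (min_le_left _ _))
    exact smoothlyApproximable_log_norm hM hre him hreM himM hκ (min_le_left _ _) hC h1
      (h2 κ hκ ((min_le_right _ _).trans (min_le_right _ _)))
  · have hlog : logPart f 1 = fun w => (f w).arg := by ext w; simp [logPart]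
    have hmeas : Measurable fun w => (f w).arg := Complex.measurable_arg.comp hfc.measurable
    change SmoothlyApproximable η (logPart f 1)
    rw [hlog]
    -- for a real `f` the argument jumps at the zeros of the real part, otherwise at those of the
    -- imaginary part
    by_cases him0 : (fun w => (f w).im) = 0
    · have hre0 : (fun w => (f w).re) ≠ 0 := fun h => hf0 (funext fun w =>
        Complex.ext (congrFun h w) (congrFun him0 w))
      obtain ⟨κ₁, hκ₁, h2⟩ := exists_lintegral_uniformCircle_lt_top
        (h := fun w => (f w).re) hare hre0
      refine smoothlyApproximable_of_bump (q := 1) (C := M) (B := 2 * ((2 * π) ^ 2 + 1 ^ 2))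
        hmeas (fun w => Complex.abs_arg_le_pi _)
        (by positivity) hM le_rfl hs hs1 (lt_min one_pos hκ₁) (min_le_left _ _) hE hM hre
        (h2 _ (lt_min one_pos hκ₁) (min_le_right 1 κ₁)) hEQ fun ε hε hε1 =>
          ⟨fun w => π / 2 - Real.arctan ((f w).re / ε), ?_, fun w => ?_⟩
      · have hc : HasDerivBoundOnCircle (fun _ => π / 2) 0 :=
          ⟨fun _ => 0, fun t => hasDerivAt_const _ _, continuous_const, by simp⟩
        refine (hc.sub (hre.arctan_div hε)).mono (le_of_eq ?_)
        rw [Real.rpow_neg_one]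
        ring
      · have hw : f w = ((f w).re : ℂ) := Complex.ext rfl (by simpa using congrFun him0 w)
        have := sq_arg_ofReal_sub_arctan_le hε (f w).re
        rwa [← hw] at this
    · obtain ⟨κ₁, hκ₁, h2⟩ := exists_lintegral_uniformCircle_lt_top
        (h := fun w => (f w).im) haim him0
      refine smoothlyApproximable_of_bump (q := 3) (C := M + 2 * M ^ 2)
        (B := 2 * ((2 * π) ^ 2 + (1 + M) ^ 2)) hmeas (fun w => Complex.abs_arg_le_pi _)
        (by positivity) (by positivity) (by norm_num) hs hs1 (lt_min one_pos hκ₁) (min_le_left _ _)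
        hE hM him (h2 _ (lt_min one_pos hκ₁) (min_le_right 1 κ₁)) hEQ fun ε hε hε1 =>
          ⟨fun w => Real.arctan ((f w).im / ε)
            - Real.arctan ((f w).re * ((f w).im / ((f w).im ^ 2 + ε ^ 3))), ?_, fun w =>
            sq_arg_sub_arctan_le hε (hreM w)⟩
      refine ((him.arctan_div hε).sub (HasDerivBoundOnCircle.arctan_smoothing hM hre him hreM himM
        (pow_pos hε 3))).mono ?_
      have h3 : ε ^ (-3 : ℝ) = 1 / ε ^ 3 := by
        rw [Real.rpow_neg hε.le, one_div]; norm_cast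
      rw [h3]
      have h4 : 1 / ε ≤ 1 / ε ^ 3 := by
        gcongr
        calc ε ^ 3 = ε * ε ^ 2 := by ring
          _ ≤ ε * 1 := by gcongr; exact pow_le_one₀ hε.le hε1
          _ = ε := mul_one _
      calc 1 / ε * M + 2 * M ^ 2 / ε ^ 3 ≤ 1 / ε ^ 3 * M + 2 * M ^ 2 / ε ^ 3 := by gcongr
        _ = _ := by ring

end Approximation

/-! ### Cesàro limits of means and of second moments -/

lemma integrable_of_lintegral_ofReal_lt_top {E : Type*} [MeasurableSpace E] {μ : Measure E}
    {g : E → ℝ} (hg : Measurable g) (h0 : ∀ x, 0 ≤ g x) (h : ∫⁻ x, ENNReal.ofReal (g x) ∂μ < ⊤) :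
    Integrable g μ :=
  ⟨hg.aestronglyMeasurable, (hasFiniteIntegral_iff_ofReal (ae_of_all _ h0)).2 h⟩

lemma integral_le_of_lintegral_ofReal_le {E : Type*} [MeasurableSpace E] {μ : Measure E}
    {g : E → ℝ} (hg : Measurable g) (h0 : ∀ x, 0 ≤ g x) {X : ℝ} (hX : 0 ≤ X)
    (h : ∫⁻ x, ENNReal.ofReal (g x) ∂μ ≤ ENNReal.ofReal X) : ∫ x, g x ∂μ ≤ X := by
  rw [integral_eq_lintegral_of_nonneg_ae (ae_of_all _ h0) hg.aestronglyMeasurable]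
  exact ENNReal.toReal_le_of_le_ofReal hX h

section Sums

variable {E : Type*} [MeasurableSpace E] {μ : ℕ → Measure E} {g : E → ℝ} {n : ℕ} {X : ℝ}

lemma lintegral_lt_top_of_sum_le
    (h : ∑ i ∈ Finset.range n, ∫⁻ x, ENNReal.ofReal (g x) ∂μ (i + 1) ≤ ENNReal.ofReal X) {i : ℕ}
    (hi : i < n) : ∫⁻ x, ENNReal.ofReal (g x) ∂μ (i + 1) < ⊤ :=
  (Finset.single_le_sum (f := fun i => ∫⁻ x, ENNReal.ofReal (g x) ∂μ (i + 1))
    (fun _ _ => zero_le) (Finset.mem_range.2 hi)).trans_lt (h.trans_lt ENNReal.ofReal_lt_top)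

lemma sum_integral_le_of_sum_lintegral_le (hg : Measurable g) (h0 : ∀ x, 0 ≤ g x) (hX : 0 ≤ X)
    (h : ∑ i ∈ Finset.range n, ∫⁻ x, ENNReal.ofReal (g x) ∂μ (i + 1) ≤ ENNReal.ofReal X) :
    ∑ i ∈ Finset.range n, ∫ x, g x ∂μ (i + 1) ≤ X := by
  have h1 : ∀ i, ∫ x, g x ∂μ (i + 1) = (∫⁻ x, ENNReal.ofReal (g x) ∂μ (i + 1)).toReal := fun i =>
    integral_eq_lintegral_of_nonneg_ae (ae_of_all _ h0) hg.aestronglyMeasurable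
  simp_rw [h1]
  rw [← ENNReal.toReal_sum fun i hi =>
    (lintegral_lt_top_of_sum_le h (Finset.mem_range.1 hi)).ne]
  exact ENNReal.toReal_le_of_le_ofReal hX h

end Sums

lemma integrable_of_sq {E : Type*} [MeasurableSpace E] {μ : Measure E} [IsProbabilityMeasure μ]
    {u : E → ℝ} (hu : Measurable u) (h2 : Integrable (fun x => u x ^ 2) μ) : Integrable u μ :=
  ((integrable_const (1 : ℝ)).add h2).mono' hu.aestronglyMeasurable (ae_of_all _ fun x => by
    rw [Real.norm_eq_abs, Pi.add_apply, ← sq_abs (u x)]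
    nlinarith [sq_nonneg (|u x| - 1), abs_nonneg (u x)])

lemma abs_integral_le_of_sq {E : Type*} [MeasurableSpace E] {μ : Measure E} [IsProbabilityMeasure μ]
    {u : E → ℝ} (hu : Measurable u) (h2 : Integrable (fun x => u x ^ 2) μ) {ρ : ℝ} (hρ : 0 < ρ) :
    |∫ x, u x ∂μ| ≤ (ρ + ρ⁻¹ * ∫ x, u x ^ 2 ∂μ) / 2 := by
  have hi := integrable_of_sq hu h2
  calc |∫ x, u x ∂μ| ≤ ∫ x, |u x| ∂μ := abs_integral_le_integral_abs
    _ ≤ ∫ x, (ρ + ρ⁻¹ * u x ^ 2) / 2 ∂μ := by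
      refine integral_mono hi.abs (((integrable_const ρ).add (h2.const_mul ρ⁻¹)).div_const 2)
        fun x => ?_
      have h3 : ρ * ρ⁻¹ = 1 := mul_inv_cancel₀ hρ.ne'
      have h4 : 0 ≤ ρ⁻¹ * (|u x| - ρ) ^ 2 := by positivity
      have h5 : ρ⁻¹ * (|u x| - ρ) ^ 2 = ρ⁻¹ * u x ^ 2 - 2 * |u x| + ρ := by
        rw [sub_sq, sq_abs]; linear_combination (-2 * |u x| + ρ) * h3
      linarith
    _ = _ := by
      rw [integral_div, integral_add (integrable_const ρ) (h2.const_mul ρ⁻¹), integral_const_mul]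
      simp

namespace SmoothlyApproximable

variable {η : ℕ → Measure Circle} {F : Circle → ℝ}

lemma integrable_pow (h : SmoothlyApproximable η F) (p i : ℕ) :
    Integrable (fun w => |F w| ^ p) (η (i + 1)) := by
  obtain ⟨C, hC⟩ := h.moment_le p
  have := h.measurable
  exact integrable_of_lintegral_ofReal_lt_top (by fun_prop) (fun w => by positivity)
    (lintegral_lt_top_of_sum_le (hC (i + 1)) (Nat.lt_succ_self i))

lemma integrable (h : SmoothlyApproximable η F) (i : ℕ) : Integrable F (η (i + 1)) := by
  have := h.integrable_pow 1 i
  simp only [pow_one] at this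
  exact (integrable_norm_iff h.measurable.aestronglyMeasurable).1 this

lemma integrable_pow_uniform (h : SmoothlyApproximable η F) (p : ℕ) :
    Integrable (fun w => |F w| ^ p) uniformCircle := by
  have := h.measurable
  exact integrable_of_lintegral_ofReal_lt_top (by fun_prop) (fun w => by positivity)
    (h.moment_uniform p)

lemma integrable_uniform (h : SmoothlyApproximable η F) : Integrable F uniformCircle := by
  have := h.integrable_pow_uniform 1
  simp only [pow_one] at this
  exact (integrable_norm_iff h.measurable.aestronglyMeasurable).1 this

lemma exists_approx_le (h : SmoothlyApproximable η F) {δ : ℝ} (hδ : 0 < δ) :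
    ∃ (G : Circle → ℝ) (D : ℝ), HasDerivBoundOnCircle G D ∧
      ∫ w, (F w - G w) ^ 2 ∂uniformCircle ≤ δ ∧
      Integrable (fun w => (F w - G w) ^ 2) uniformCircle ∧
      (∀ i, Integrable (fun w => (F w - G w) ^ 2) (η (i + 1))) ∧
      ∀ᶠ n : ℕ in atTop, (∑ i ∈ Finset.range n, ∫ w, (F w - G w) ^ 2 ∂η (i + 1)) / n ≤ δ := by
  obtain ⟨C, q, κ, s, hC, hq, hκ, hs, hs1, happ⟩ := h.approx
  -- `ε` is chosen so that `C ε ^ κ ≤ δ / 2`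
  have ht : Tendsto (fun ε : ℝ => C * ε ^ κ) (nhdsWithin 0 (Set.Ioi 0)) (nhds 0) := by
    have h1 : Tendsto (fun ε : ℝ => ε ^ κ) (nhds 0) (nhds (0 ^ κ)) :=
      (Real.continuousAt_rpow_const 0 κ (.inr hκ.le)).tendsto
    rw [Real.zero_rpow hκ.ne'] at h1
    simpa using (h1.mono_left nhdsWithin_le_nhds).const_mul C
  obtain ⟨ε, ⟨hε, hε1⟩, hεC⟩ := (Filter.Eventually.and (Ioc_mem_nhdsGT one_pos)
    (ht.eventually_le_const (half_pos hδ))).exists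
  obtain ⟨G, hG, hGu, hGη⟩ := happ ε hε hε1
  have hm : Measurable fun w => (F w - G w) ^ 2 :=
    (h.measurable.sub hG.continuous.measurable).pow_const 2
  have hnn : ∀ w, 0 ≤ (F w - G w) ^ 2 := fun w => sq_nonneg _
  have hε' : 0 < ε := hε
  refine ⟨G, _, hG, (integral_le_of_lintegral_ofReal_le hm hnn (by positivity) hGu).trans
    (by linarith), integrable_of_lintegral_ofReal_lt_top hm hnn
    (hGu.trans_lt ENNReal.ofReal_lt_top), fun i => integrable_of_lintegral_ofReal_lt_top hm hnn
    (lintegral_lt_top_of_sum_le (hGη (i + 1)) (Nat.lt_succ_self i)), ?_⟩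
  have ht2 : Tendsto (fun n : ℕ => C * ε ^ (-q) * (n : ℝ) ^ (-s)) atTop (nhds 0) := by
    have := ((tendsto_rpow_neg_atTop hs).comp tendsto_natCast_atTop_atTop).const_mul (C * ε ^ (-q))
    simpa using this
  filter_upwards [ht2.eventually_le_const (half_pos hδ), eventually_gt_atTop 0] with n hn hn0
  have hn0' : (0 : ℝ) < n := Nat.cast_pos.2 hn0
  rw [div_le_iff₀ hn0']
  refine (sum_integral_le_of_sum_lintegral_le hm hnn (by positivity) (hGη n)).trans ?_
  have h1 : (n : ℝ) ^ (1 - s) = n * (n : ℝ) ^ (-s) := by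
    rw [sub_eq_add_neg, Real.rpow_add hn0', Real.rpow_one]
  calc C * (ε ^ κ * n + ε ^ (-q) * (n : ℝ) ^ (1 - s))
      = (C * ε ^ κ) * n + (C * ε ^ (-q) * (n : ℝ) ^ (-s)) * n := by rw [h1]; ring
    _ ≤ δ / 2 * n + δ / 2 * n := by gcongr
    _ = δ * n := by ring

/-- The means of `F` under `η 1, …, η n` are on average close to its mean under the uniform law, with
a power saving. -/
lemma exists_mean_rate [∀ m, IsProbabilityMeasure (η m)] (h : SmoothlyApproximable η F)
    {lam : ℤ → ℂ} (hη : ∀ (a : ℤ) (m : ℕ), ∫ w, ((w ^ a : Circle) : ℂ) ∂η m = lam a ^ m)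
    (hgap : HasPolynomialGap lam) :
    ∃ C s : ℝ, 0 < C ∧ 0 < s ∧ s < 1 ∧ ∀ n : ℕ,
      |∑ i ∈ Finset.range n, (∫ w, F w ∂η (i + 1) - ∫ w, F w ∂uniformCircle)|
        ≤ C * (n : ℝ) ^ (1 - s) := by
  obtain ⟨C, q, κ, s₁, hC, hq, hκ, hs₁, hs₁1, happ⟩ := h.approx
  obtain ⟨B, s₂, hB, hs₂, hs₂1, hEQ⟩ := exists_equidistribution_rate hη hgap
  set s := min s₁ s₂ with hs_def
  have hs : 0 < s := lt_min hs₁ hs₂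
  have hs1 : s < 1 := (min_le_left _ _).trans_lt hs₁1
  -- `F` is approximated to the precision `n ^ (-δ)`, with `δ` so small that the derivative of the
  -- approximation costs only half of the power saving
  set δ := s / (2 * q) with hδ
  have hδ0 : 0 < δ := by positivity
  have hqδ : q * δ = s / 2 := by rw [hδ]; field_simp
  set τ := min (κ * δ) (s / 2) with hτ
  have hτ0 : 0 < τ := lt_min (by positivity) (by positivity)
  have hτs : τ ≤ s / 2 := min_le_right _ _
  refine ⟨B * C + (1 / 2 + C) + (1 / 2 + C), τ / 2, by positivity, by positivity, by linarith,
    fun n => ?_⟩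
  rcases Nat.eq_zero_or_pos n with rfl | hn
  · simp only [Finset.range_zero, Finset.sum_empty, abs_zero]
    positivity
  have hn1 : (1 : ℝ) ≤ n := by exact_mod_cast hn
  have hn0 : (0 : ℝ) < n := by linarith
  have hmono : ∀ {a b : ℝ}, a ≤ b → (n : ℝ) ^ a ≤ (n : ℝ) ^ b := fun hab =>
    Real.rpow_le_rpow_of_exponent_le hn1 hab
  have hnmul : ∀ a : ℝ, (n : ℝ) * (n : ℝ) ^ a = (n : ℝ) ^ (1 + a) := fun a => by
    rw [Real.rpow_add hn0, Real.rpow_one]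
  set ε := (n : ℝ) ^ (-δ) with hε
  have hε0 : 0 < ε := Real.rpow_pos_of_pos hn0 _
  have hε1 : ε ≤ 1 := Real.rpow_le_one_of_one_le_of_nonpos hn1 (by linarith)
  obtain ⟨G, hG, hGu, hGη⟩ := happ ε hε0 hε1
  have hεq : ε ^ (-q) = (n : ℝ) ^ (s / 2) := by
    rw [hε, ← Real.rpow_mul hn0.le]; congr 1; linarith
  have hεκ : ε ^ κ ≤ (n : ℝ) ^ (-τ) := by
    rw [hε, ← Real.rpow_mul hn0.le]
    refine hmono ?_
    have := min_le_left (κ * δ) (s / 2)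
    rw [← hτ] at this
    linarith
  have hFm := h.measurable
  have hGm := hG.continuous.measurable
  have hum : Measurable fun w => F w - G w := hFm.sub hGm
  have hm : Measurable fun w => (F w - G w) ^ 2 := hum.pow_const 2
  have hnn : ∀ w, 0 ≤ (F w - G w) ^ 2 := fun w => sq_nonneg _
  have hiu := integrable_of_lintegral_ofReal_lt_top hm hnn (hGu.trans_lt ENNReal.ofReal_lt_top)
  have hiη : ∀ i, Integrable (fun w => (F w - G w) ^ 2) (η (i + 1)) := fun i =>
    integrable_of_lintegral_ofReal_lt_top hm hnn
      (lintegral_lt_top_of_sum_le (hGη (i + 1)) (Nat.lt_succ_self i))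
  have hGi : ∀ μ : Measure Circle, IsProbabilityMeasure μ → Integrable F μ →
      Integrable (fun w => (F w - G w) ^ 2) μ → Integrable G μ := fun μ _ h1 h2 => by
    refine (h1.sub (integrable_of_sq hum h2)).congr (ae_of_all _ fun w => ?_)
    simp
  have hdec : ∀ μ : Measure Circle, IsProbabilityMeasure μ → Integrable F μ →
      Integrable (fun w => (F w - G w) ^ 2) μ →
      ∫ w, F w ∂μ = ∫ w, G w ∂μ + ∫ w, (F w - G w) ∂μ := fun μ hμ h1 h2 => by
    rw [integral_sub h1 (hGi μ hμ h1 h2)]; ring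
  have e1 : ∑ i ∈ Finset.range n, (∫ w, F w ∂η (i + 1) - ∫ w, F w ∂uniformCircle)
      = ∑ i ∈ Finset.range n, (∫ w, G w ∂η (i + 1) - ∫ w, G w ∂uniformCircle)
        + ∑ i ∈ Finset.range n, ∫ w, (F w - G w) ∂η (i + 1)
        - n * ∫ w, (F w - G w) ∂uniformCircle := by
    rw [← Finset.sum_add_distrib, hdec uniformCircle inferInstance h.integrable_uniform hiu]
    simp_rw [fun i => hdec (η (i + 1)) inferInstance (h.integrable i) (hiη i)]
    have : (n : ℝ) * ∫ w, (F w - G w) ∂uniformCircle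
        = ∑ i ∈ Finset.range n, ∫ w, (F w - G w) ∂uniformCircle := by simp
    rw [this, ← Finset.sum_sub_distrib]
    exact Finset.sum_congr rfl fun i _ => by ring
  -- the weight in the inequality `2 |u| ≤ ρ + u ^ 2 / ρ`
  set ρ := (n : ℝ) ^ (-(τ / 2)) with hρ
  have hρ0 : 0 < ρ := Real.rpow_pos_of_pos hn0 _
  have hρi : ρ⁻¹ = (n : ℝ) ^ (τ / 2) := by rw [hρ, Real.rpow_neg hn0.le, inv_inv]
  have hnρ : (n : ℝ) * ρ = (n : ℝ) ^ (1 - τ / 2) := by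
    rw [hρ, sub_eq_add_neg, Real.rpow_add hn0, Real.rpow_one]
  have hnτ : ρ⁻¹ * ((n : ℝ) * (n : ℝ) ^ (-τ)) = (n : ℝ) ^ (1 - τ / 2) := by
    rw [hρi, hnmul, ← Real.rpow_add hn0]
    congr 1; ring
  -- the smooth part
  have b1 : |∑ i ∈ Finset.range n, (∫ w, G w ∂η (i + 1) - ∫ w, G w ∂uniformCircle)|
      ≤ B * C * (n : ℝ) ^ (1 - τ / 2) := by
    refine (hEQ G _ (by positivity) hG n).trans ?_
    rw [hεq]
    have : (n : ℝ) ^ (s / 2) * (n : ℝ) ^ (1 - s₂) ≤ (n : ℝ) ^ (1 - τ / 2) := by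
      rw [← Real.rpow_add hn0]
      refine hmono ?_
      have := min_le_right s₁ s₂
      rw [← hs_def] at this
      linarith
    calc B * (C * (n : ℝ) ^ (s / 2)) * (n : ℝ) ^ (1 - s₂)
        = B * C * ((n : ℝ) ^ (s / 2) * (n : ℝ) ^ (1 - s₂)) := by ring
      _ ≤ _ := by gcongr
  -- the errors of the approximation
  have b2 : |∑ i ∈ Finset.range n, ∫ w, (F w - G w) ∂η (i + 1)|
      ≤ (1 / 2 + C) * (n : ℝ) ^ (1 - τ / 2) := by
    refine (Finset.abs_sum_le_sum_abs _ _).trans ((Finset.sum_le_sum fun i _ =>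
      abs_integral_le_of_sq hum (hiη i) hρ0).trans ?_)
    rw [← Finset.sum_div, Finset.sum_add_distrib, ← Finset.mul_sum, Finset.sum_const,
      Finset.card_range, nsmul_eq_mul, hnρ]
    have h1 := sum_integral_le_of_sum_lintegral_le hm hnn (by positivity) (hGη n)
    have h2 : C * (ε ^ κ * n + ε ^ (-q) * (n : ℝ) ^ (1 - s₁)) ≤ 2 * C * (n * (n : ℝ) ^ (-τ)) := by
      have h3 : ε ^ κ * n ≤ n * (n : ℝ) ^ (-τ) := by rw [mul_comm]; gcongr
      have h4 : ε ^ (-q) * (n : ℝ) ^ (1 - s₁) ≤ n * (n : ℝ) ^ (-τ) := by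
        rw [hεq, hnmul, ← Real.rpow_add hn0]
        refine hmono ?_
        have := min_le_left s₁ s₂
        rw [← hs_def] at this
        linarith
      calc _ ≤ C * (n * (n : ℝ) ^ (-τ) + n * (n : ℝ) ^ (-τ)) := by gcongr
        _ = _ := by ring
    have h5 : ρ⁻¹ * ∑ i ∈ Finset.range n, ∫ w, (F w - G w) ^ 2 ∂η (i + 1)
        ≤ 2 * C * (n : ℝ) ^ (1 - τ / 2) := by
      calc _ ≤ ρ⁻¹ * (2 * C * (n * (n : ℝ) ^ (-τ))) := by gcongr; exact h1.trans h2
        _ = 2 * C * (ρ⁻¹ * (n * (n : ℝ) ^ (-τ))) := by ring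
        _ = _ := by rw [hnτ]
    linarith
  have b3 : |n * ∫ w, (F w - G w) ∂uniformCircle| ≤ (1 / 2 + C) * (n : ℝ) ^ (1 - τ / 2) := by
    rw [abs_mul, abs_of_pos hn0]
    have h1 := abs_integral_le_of_sq hum hiu hρ0
    have h2 := integral_le_of_lintegral_ofReal_le hm hnn (by positivity) hGu
    have h3 : ρ⁻¹ * (n * ∫ w, (F w - G w) ^ 2 ∂uniformCircle) ≤ C * (n : ℝ) ^ (1 - τ / 2) := by
      calc _ ≤ ρ⁻¹ * (n * (C * (n : ℝ) ^ (-τ))) := by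
            gcongr; exact h2.trans (by gcongr)
        _ = C * (ρ⁻¹ * (n * (n : ℝ) ^ (-τ))) := by ring
        _ = _ := by rw [hnτ]
    have h4 : 0 ≤ C * (n : ℝ) ^ (1 - τ / 2) := by positivity
    calc (n : ℝ) * |∫ w, (F w - G w) ∂uniformCircle|
        ≤ n * ((ρ + ρ⁻¹ * ∫ w, (F w - G w) ^ 2 ∂uniformCircle) / 2) := by gcongr
      _ = (n * ρ + ρ⁻¹ * (n * ∫ w, (F w - G w) ^ 2 ∂uniformCircle)) / 2 := by ring
      _ ≤ _ := by rw [hnρ]; linarith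
  rw [e1]
  calc _ ≤ _ := (abs_sub _ _).trans (add_le_add_left (abs_add_le _ _) _)
    _ ≤ B * C * (n : ℝ) ^ (1 - τ / 2) + (1 / 2 + C) * (n : ℝ) ^ (1 - τ / 2)
        + (1 / 2 + C) * (n : ℝ) ^ (1 - τ / 2) := add_le_add (add_le_add b1 b2) b3
    _ = _ := by ring

end SmoothlyApproximable

section Pairs

variable {E : Type*} [MeasurableSpace E] {μ : ℕ → Measure E} {lim : Measure E}

/-- `(p, q)` is equidistributed, in the mean over `m`, under the laws `μ m`: the means of the
characters converge to their means under `lim`. -/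
def PairEquidistributed (μ : ℕ → Measure E) (lim : Measure E) (p q : E → Circle) : Prop :=
  ∀ a b : ℤ, Tendsto (fun n : ℕ =>
    (∑ i ∈ Finset.range n, ∫ x, ((p x ^ a * q x ^ b : Circle) : ℂ) ∂μ (i + 1)) / n) atTop
    (nhds (∫ x, ((p x ^ a * q x ^ b : Circle) : ℂ) ∂lim))

lemma measurable_pair_character {p q : E → Circle} (hp : Measurable p) (hq : Measurable q) (a b : ℤ) :
    Measurable fun x => ((p x ^ a * q x ^ b : Circle) : ℂ) := by
  simp_rw [Circle.coe_mul]
  exact ((measurable_zpow_circle a).comp hp).mul ((measurable_zpow_circle b).comp hq)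

lemma hasSum_integral_fourier_pair {p q : E → Circle} (hp : Measurable p) (hq : Measurable q)
    (ρ : Measure E) [IsProbabilityMeasure ρ] {c c' : ℤ → ℂ} (hc : Summable fun a => ‖c a‖)
    (hc' : Summable fun a => ‖c' a‖) {G G' : Circle → ℝ}
    (hG : ∀ w : Circle, HasSum (fun a => c a * ((w ^ a : Circle) : ℂ)) (G w : ℂ))
    (hG' : ∀ w : Circle, HasSum (fun a => c' a * ((w ^ a : Circle) : ℂ)) (G' w : ℂ)) :
    HasSum (fun ab : ℤ × ℤ => c ab.1 * c' ab.2 * ∫ x, ((p x ^ ab.1 * q x ^ ab.2 : Circle) : ℂ) ∂ρ)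
      ((∫ x, G (p x) * G' (q x) ∂ρ : ℝ) : ℂ) := by
  have hn : ∀ (ab : ℤ × ℤ) (x : E),
      ‖c ab.1 * c' ab.2 * ((p x ^ ab.1 * q x ^ ab.2 : Circle) : ℂ)‖ = ‖c ab.1‖ * ‖c' ab.2‖ := by
    intro ab x
    rw [norm_mul, Circle.norm_coe, mul_one, norm_mul]
  have hsn : Summable fun ab : ℤ × ℤ => ‖c ab.1‖ * ‖c' ab.2‖ :=
    hc.mul_of_nonneg hc' (fun _ => norm_nonneg _) fun _ => norm_nonneg _
  have hpt : ∀ x, HasSum (fun ab : ℤ × ℤ => c ab.1 * c' ab.2 *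
      ((p x ^ ab.1 * q x ^ ab.2 : Circle) : ℂ)) ((G (p x) * G' (q x) : ℝ) : ℂ) := by
    intro x
    have e : ∀ ab : ℤ × ℤ, c ab.1 * c' ab.2 * ((p x ^ ab.1 * q x ^ ab.2 : Circle) : ℂ)
        = c ab.1 * ((p x ^ ab.1 : Circle) : ℂ) * (c' ab.2 * ((q x ^ ab.2 : Circle) : ℂ)) := by
      intro ab
      rw [Circle.coe_mul]; ring
    have hs : Summable fun ab : ℤ × ℤ => c ab.1 * ((p x ^ ab.1 : Circle) : ℂ) *
        (c' ab.2 * ((q x ^ ab.2 : Circle) : ℂ)) :=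
      Summable.of_norm (hsn.congr fun ab => by rw [← e, hn])
    have h := HasSum.mul (hG (p x)) (hG' (q x)) hs
    rw [← Complex.ofReal_mul] at h
    exact h.congr_fun e
  have h := hasSum_integral_of_summable_integral_norm (μ := ρ)
    (F := fun (ab : ℤ × ℤ) x => c ab.1 * c' ab.2 * ((p x ^ ab.1 * q x ^ ab.2 : Circle) : ℂ))
    (fun ab => ?_) ?_
  · simp_rw [integral_const_mul] at h
    convert! h using 1
    refine integral_ofReal.symm.trans ?_
    exact integral_congr_ae (ae_of_all _ fun x => (hpt x).tsum_eq.symm)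
  · exact (integrable_const (‖c ab.1‖ * ‖c' ab.2‖)).mono'
      ((measurable_pair_character hp hq _ _).const_mul _).aestronglyMeasurable
      (ae_of_all _ fun x => (hn ab x).le)
  · simp_rw [hn]
    simpa using hsn

/-- Equidistribution of pairs for products of continuously differentiable functions, by dominated
convergence in the double Fourier series. -/
lemma tendsto_cesaro_mul_of_hasDerivBound [∀ m, IsProbabilityMeasure (μ m)] [IsProbabilityMeasure lim]
    {p q : E → Circle} (hp : Measurable p) (hq : Measurable q) (hpq : PairEquidistributed μ lim p q)
    {G G' : Circle → ℝ} {D D' : ℝ} (hG : HasDerivBoundOnCircle G D)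
    (hG' : HasDerivBoundOnCircle G' D') :
    Tendsto (fun n : ℕ => (∑ i ∈ Finset.range n, ∫ x, G (p x) * G' (q x) ∂μ (i + 1)) / n) atTop
      (nhds (∫ x, G (p x) * G' (q x) ∂lim)) := by
  obtain ⟨c, hc, hGc, -⟩ := (hG.mono (lt_add_one D).le).exists_fourier (by linarith [hG.nonneg])
  obtain ⟨c', hc', hGc', -⟩ := (hG'.mono (lt_add_one D').le).exists_fourier (by linarith [hG'.nonneg])
  have hsn : Summable fun ab : ℤ × ℤ => ‖c ab.1‖ * ‖c' ab.2‖ :=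
    hc.mul_of_nonneg hc' (fun _ => norm_nonneg _) fun _ => norm_nonneg _
  have hS := fun ρ (hρ : IsProbabilityMeasure ρ) =>
    hasSum_integral_fourier_pair hp hq ρ hc hc' hGc hGc'
  set χ : Measure E → ℤ × ℤ → ℂ := fun ρ ab => ∫ x, ((p x ^ ab.1 * q x ^ ab.2 : Circle) : ℂ) ∂ρ
    with hχ
  have hχ1 : ∀ ρ, IsProbabilityMeasure ρ → ∀ ab, ‖χ ρ ab‖ ≤ 1 := fun ρ _ ab => by
    refine (norm_integral_le_of_norm_le_const (C := 1)
      (ae_of_all _ fun x => (Circle.norm_coe _).le)).trans ?_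
    simp
  have hn : ∀ n : ℕ, HasSum (fun ab : ℤ × ℤ => c ab.1 * c' ab.2 *
      ((∑ i ∈ Finset.range n, χ (μ (i + 1)) ab) / n))
      (((∑ i ∈ Finset.range n, ∫ x, G (p x) * G' (q x) ∂μ (i + 1)) / n : ℝ) : ℂ) := by
    intro n
    have h1 := (hasSum_sum (s := Finset.range n) fun i _ => hS (μ (i + 1)) inferInstance).div_const
      (n : ℂ)
    push_cast
    refine h1.congr_fun fun ab => ?_
    rw [← Finset.mul_sum, mul_div_assoc]
  have ht : Tendsto (fun n : ℕ => ∑' ab : ℤ × ℤ, c ab.1 * c' ab.2 *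
      ((∑ i ∈ Finset.range n, χ (μ (i + 1)) ab) / n)) atTop
      (nhds (∑' ab : ℤ × ℤ, c ab.1 * c' ab.2 * χ lim ab)) := by
    refine tendsto_tsum_of_dominated_convergence hsn (fun ab => (hpq ab.1 ab.2).const_mul _)
      (Eventually.of_forall fun n ab => ?_)
    rw [norm_mul, norm_mul]
    refine mul_le_of_le_one_right (by positivity) ?_
    rw [norm_div, Complex.norm_natCast]
    refine div_le_one_of_le₀ ((norm_sum_le _ _).trans ((Finset.sum_le_sum fun i _ =>
      hχ1 (μ (i + 1)) inferInstance ab).trans ?_)) (Nat.cast_nonneg n)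
    simp
  rw [(hS lim inferInstance).tsum_eq] at ht
  simp_rw [fun n => (hn n).tsum_eq] at ht
  have := (Complex.continuous_re.tendsto _).comp ht
  simpa [Function.comp_def] using this

end Pairs

section Square

variable {E : Type*} [MeasurableSpace E] {μ : ℕ → Measure E} {lim : Measure E}

lemma abs_sq_sub_sq_le {t : ℝ} (ht : 0 < t) (x y : ℝ) :
    |x ^ 2 - y ^ 2| ≤ t * x ^ 2 + (1 + t⁻¹) * (x - y) ^ 2 := by
  have h3 : t * t⁻¹ = 1 := mul_inv_cancel₀ ht.ne'
  have h5 : t⁻¹ * (t * x - (x - y)) ^ 2 = t * x ^ 2 - 2 * x * (x - y) + t⁻¹ * (x - y) ^ 2 := by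
    linear_combination (t * x ^ 2 - 2 * x * (x - y)) * h3
  have h6 : t⁻¹ * (t * x + (x - y)) ^ 2 = t * x ^ 2 + 2 * x * (x - y) + t⁻¹ * (x - y) ^ 2 := by
    linear_combination (t * x ^ 2 + 2 * x * (x - y)) * h3
  have h7 : 0 ≤ t⁻¹ * (t * x - (x - y)) ^ 2 := by positivity
  have h8 : 0 ≤ t⁻¹ * (t * x + (x - y)) ^ 2 := by positivity
  rw [abs_le]
  constructor <;> nlinarith [sq_nonneg (x - y)]

lemma abs_integral_sq_sub_le {ρ : Measure E} {X Y : E → ℝ} (hX : Integrable (fun x => X x ^ 2) ρ)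
    (hY : Integrable (fun x => Y x ^ 2) ρ) (hXY : Integrable (fun x => (X x - Y x) ^ 2) ρ) {t : ℝ}
    (ht : 0 < t) : |∫ x, X x ^ 2 ∂ρ - ∫ x, Y x ^ 2 ∂ρ|
      ≤ t * ∫ x, X x ^ 2 ∂ρ + (1 + t⁻¹) * ∫ x, (X x - Y x) ^ 2 ∂ρ := by
  rw [← integral_sub hX hY, ← integral_const_mul, ← integral_const_mul,
    ← integral_add (hX.const_mul _) (hXY.const_mul _)]
  exact abs_integral_le_integral_abs.trans (integral_mono (hX.sub hY).abs
    ((hX.const_mul _).add (hXY.const_mul _)) fun x => abs_sq_sub_sq_le ht _ _)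

/-- Convergence of second moments passes to mean square limits. -/
lemma tendsto_cesaro_sq_of_approx {X : E → ℝ} (hXlim : Integrable (fun x => X x ^ 2) lim)
    (hX : ∀ i, Integrable (fun x => X x ^ 2) (μ (i + 1))) {C : ℝ}
    (hC : ∀ n : ℕ, ∑ i ∈ Finset.range n, ∫ x, X x ^ 2 ∂μ (i + 1) ≤ C * n)
    (happ : ∀ δ : ℝ, 0 < δ → ∃ Y : E → ℝ, Integrable (fun x => Y x ^ 2) lim ∧
      (∀ i, Integrable (fun x => Y x ^ 2) (μ (i + 1))) ∧
      Integrable (fun x => (X x - Y x) ^ 2) lim ∧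
      (∀ i, Integrable (fun x => (X x - Y x) ^ 2) (μ (i + 1))) ∧
      ∫ x, (X x - Y x) ^ 2 ∂lim ≤ δ ∧
      (∀ᶠ n : ℕ in atTop, (∑ i ∈ Finset.range n, ∫ x, (X x - Y x) ^ 2 ∂μ (i + 1)) / n ≤ δ) ∧
      Tendsto (fun n : ℕ => (∑ i ∈ Finset.range n, ∫ x, Y x ^ 2 ∂μ (i + 1)) / n) atTop
        (nhds (∫ x, Y x ^ 2 ∂lim))) :
    Tendsto (fun n : ℕ => (∑ i ∈ Finset.range n, ∫ x, X x ^ 2 ∂μ (i + 1)) / n) atTop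
      (nhds (∫ x, X x ^ 2 ∂lim)) := by
  rw [Metric.tendsto_atTop']
  intro e he
  set A := max 0 (max C (∫ x, X x ^ 2 ∂lim)) + 1 with hA
  have hA0 : 0 < A := by positivity
  have hCA : C ≤ A := by
    have := (le_max_left C (∫ x, X x ^ 2 ∂lim)).trans (le_max_right 0 _)
    linarith
  have hlA : ∫ x, X x ^ 2 ∂lim ≤ A := by
    have := (le_max_right C (∫ x, X x ^ 2 ∂lim)).trans (le_max_right 0 _)
    linarith
  set t := e / (6 * A) with ht
  have ht0 : 0 < t := by positivity
  have htA : t * A = e / 6 := by rw [ht]; field_simp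
  set δ := e / (8 * (1 + t⁻¹)) with hδ
  have hδ0 : 0 < δ := by positivity
  have hδe : (1 + t⁻¹) * δ = e / 8 := by rw [hδ]; field_simp
  obtain ⟨Y, hYl, hY, hXYl, hXY, hd, hdn, hlim⟩ := happ δ hδ0
  obtain ⟨N, hN⟩ := eventually_atTop.1 (hdn.and ((Metric.tendsto_nhds.1 hlim (e / 8)
    (by positivity)).and (eventually_gt_atTop 0)))
  refine ⟨N, fun n hn => ?_⟩
  obtain ⟨h1, h2, h3⟩ := hN n hn.le
  have hn0 : (0 : ℝ) < n := Nat.cast_pos.2 h3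
  rw [Real.dist_eq] at h2 ⊢
  have h4 : |∫ x, X x ^ 2 ∂lim - ∫ x, Y x ^ 2 ∂lim| ≤ e / 6 + e / 8 := by
    refine (abs_integral_sq_sub_le hXlim hYl hXYl ht0).trans ?_
    rw [← htA, ← hδe]
    gcongr
  have h5 : |(∑ i ∈ Finset.range n, ∫ x, X x ^ 2 ∂μ (i + 1)) / n
      - (∑ i ∈ Finset.range n, ∫ x, Y x ^ 2 ∂μ (i + 1)) / n| ≤ e / 6 + e / 8 := by
    rw [← sub_div, ← Finset.sum_sub_distrib, abs_div, abs_of_pos hn0, div_le_iff₀ hn0]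
    refine (Finset.abs_sum_le_sum_abs _ _).trans ((Finset.sum_le_sum fun i _ =>
      abs_integral_sq_sub_le (hX i) (hY i) (hXY i) ht0).trans ?_)
    rw [Finset.sum_add_distrib, ← Finset.mul_sum, ← Finset.mul_sum, ← htA, ← hδe]
    rw [div_le_iff₀ hn0] at h1
    have h6 : ∑ i ∈ Finset.range n, ∫ x, X x ^ 2 ∂μ (i + 1) ≤ A * n :=
      (hC n).trans (by gcongr)
    calc _ ≤ t * (A * n) + (1 + t⁻¹) * (δ * n) := by gcongr
      _ = _ := by ring
  have h6 := abs_sub_comm (∫ x, X x ^ 2 ∂lim) (∫ x, Y x ^ 2 ∂lim)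
  have h7 : (∑ i ∈ Finset.range n, ∫ x, X x ^ 2 ∂μ (i + 1)) / n - ∫ x, X x ^ 2 ∂lim
      = ((∑ i ∈ Finset.range n, ∫ x, X x ^ 2 ∂μ (i + 1)) / n
        - (∑ i ∈ Finset.range n, ∫ x, Y x ^ 2 ∂μ (i + 1)) / n)
        + ((∑ i ∈ Finset.range n, ∫ x, Y x ^ 2 ∂μ (i + 1)) / n - ∫ x, Y x ^ 2 ∂lim)
        + (∫ x, Y x ^ 2 ∂lim - ∫ x, X x ^ 2 ∂lim) := by ring
  rw [h7]
  refine (abs_add_three _ _ _).trans_lt ?_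
  linarith

end Square

lemma abs_sum_pow_le {ι : Type*} [Fintype ι] (b : ι → ℝ) (k : ℕ) :
    |∑ a, b a| ^ k ≤ 1 + (Fintype.card ι : ℝ) ^ k * ∑ a, |b a| ^ k := by
  rcases isEmpty_or_nonempty ι with h | h
  · simp only [Finset.univ_eq_empty, Finset.sum_empty, abs_zero, mul_zero, add_zero]
    exact pow_le_one₀ le_rfl zero_le_one
  obtain ⟨m, -, hm⟩ := Finset.exists_max_image Finset.univ (fun a => |b a|) Finset.univ_nonempty
  have h1 : |∑ a, b a| ≤ Fintype.card ι * |b m| := by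
    refine (Finset.abs_sum_le_sum_abs _ _).trans ((Finset.sum_le_sum fun a ha => hm a ha).trans ?_)
    simp
  have h2 : |b m| ^ k ≤ ∑ a, |b a| ^ k :=
    Finset.single_le_sum (f := fun a => |b a| ^ k) (fun _ _ => by positivity) (Finset.mem_univ m)
  calc |∑ a, b a| ^ k ≤ (Fintype.card ι * |b m|) ^ k := by gcongr
    _ = (Fintype.card ι : ℝ) ^ k * |b m| ^ k := mul_pow _ _ _
    _ ≤ (Fintype.card ι : ℝ) ^ k * ∑ a, |b a| ^ k := by gcongr
    _ ≤ _ := by linarith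

section

variable {E ι : Type*} [MeasurableSpace E] [Fintype ι] {μ : ℕ → Measure E} {lim : Measure E}
  [∀ m, IsProbabilityMeasure (μ m)] [IsProbabilityMeasure lim] {p : ι → E → Circle}
  {F : ι → Circle → ℝ}

lemma integral_abs_sum_pow_le {ρ : Measure E} [IsProbabilityMeasure ρ] (hp : ∀ a, Measurable (p a))
    (hF : ∀ a, Measurable (F a)) {k : ℕ}
    (hi : ∀ a, Integrable (fun w => |F a w| ^ k) (ρ.map (p a))) (t : ι → ℝ) :
    Integrable (fun x => |∑ a, t a * F a (p a x)| ^ k) ρ ∧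
    ∫ x, |∑ a, t a * F a (p a x)| ^ k ∂ρ
      ≤ 1 + (Fintype.card ι : ℝ) ^ k * ∑ a, |t a| ^ k * ∫ w, |F a w| ^ k ∂(ρ.map (p a)) := by
  have hm : ∀ a, Measurable fun x => F a (p a x) := fun a => (hF a).comp (hp a)
  have hi' : ∀ a, Integrable (fun x => |t a| ^ k * |F a (p a x)| ^ k) ρ := fun a =>
    ((hi a).comp_measurable (hp a)).const_mul _
  have hbi : Integrable (fun x => 1 + (Fintype.card ι : ℝ) ^ k * ∑ a, |t a| ^ k * |F a (p a x)| ^ k) ρ :=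
    (integrable_const 1).add ((integrable_finsetSum _ fun a _ => hi' a).const_mul _)
  have hle : ∀ x, |∑ a, t a * F a (p a x)| ^ k
      ≤ 1 + (Fintype.card ι : ℝ) ^ k * ∑ a, |t a| ^ k * |F a (p a x)| ^ k := fun x => by
    have := abs_sum_pow_le (fun a => t a * F a (p a x)) k
    simpa only [abs_mul, mul_pow] using this
  have hX : Integrable (fun x => |∑ a, t a * F a (p a x)| ^ k) ρ := by
    refine hbi.mono' (Measurable.aestronglyMeasurable (by fun_prop)) (ae_of_all _ fun x => ?_)
    rw [Real.norm_eq_abs, abs_of_nonneg (by positivity)]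
    exact hle x
  refine ⟨hX, (integral_mono hX hbi hle).trans (le_of_eq ?_)⟩
  rw [integral_add (integrable_const 1) ((integrable_finsetSum _ fun a _ => hi' a).const_mul _),
    integral_const_mul, integral_finsetSum _ fun a _ => hi' a]
  simp_rw [integral_const_mul]
  simp only [integral_const, probReal_univ, smul_eq_mul, mul_one]
  congr 2
  refine Finset.sum_congr rfl fun a _ => ?_
  rw [integral_map (hp a).aemeasurable (Measurable.aestronglyMeasurable (by
    have := hF a; fun_prop))]

lemma integrable_sq_sum {ρ : Measure E} [IsProbabilityMeasure ρ] (hp : ∀ a, Measurable (p a))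
    (hF : ∀ a, Measurable (F a)) (hi : ∀ a, Integrable (fun w => F a w ^ 2) (ρ.map (p a)))
    (t : ι → ℝ) :
    Integrable (fun x => (∑ a, t a * F a (p a x)) ^ 2) ρ ∧
    ∫ x, (∑ a, t a * F a (p a x)) ^ 2 ∂ρ
      ≤ Fintype.card ι * ∑ a, t a ^ 2 * ∫ w, F a w ^ 2 ∂(ρ.map (p a)) := by
  have hm : ∀ a, Measurable fun x => F a (p a x) := fun a => (hF a).comp (hp a)
  have hi' : ∀ a, Integrable (fun x => t a ^ 2 * F a (p a x) ^ 2) ρ := fun a =>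
    ((hi a).comp_measurable (hp a)).const_mul _
  have hbi : Integrable (fun x => (Fintype.card ι : ℝ) * ∑ a, t a ^ 2 * F a (p a x) ^ 2) ρ :=
    (integrable_finsetSum _ fun a _ => hi' a).const_mul _
  have hle : ∀ x, (∑ a, t a * F a (p a x)) ^ 2
      ≤ (Fintype.card ι : ℝ) * ∑ a, t a ^ 2 * F a (p a x) ^ 2 := fun x => by
    have := sq_sum_le_card_mul_sum_sq (s := Finset.univ) (f := fun a => t a * F a (p a x))
    simpa only [mul_pow, Finset.card_univ] using this
  have hX : Integrable (fun x => (∑ a, t a * F a (p a x)) ^ 2) ρ := by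
    refine hbi.mono' (Measurable.aestronglyMeasurable (by fun_prop)) (ae_of_all _ fun x => ?_)
    rw [Real.norm_eq_abs, abs_of_nonneg (by positivity)]
    exact hle x
  refine ⟨hX, (integral_mono hX hbi hle).trans (le_of_eq ?_)⟩
  rw [integral_const_mul, integral_finsetSum _ fun a _ => hi' a]
  simp_rw [integral_const_mul]
  congr 1
  refine Finset.sum_congr rfl fun a _ => ?_
  rw [integral_map (hp a).aemeasurable (Measurable.aestronglyMeasurable (by
    have := hF a; fun_prop))]

lemma tendsto_cesaro_sq_of_hasDerivBound (hp : ∀ a, Measurable (p a))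
    (hpair : ∀ a b, PairEquidistributed μ lim (p a) (p b)) {G : ι → Circle → ℝ} {D : ι → ℝ}
    (hG : ∀ a, HasDerivBoundOnCircle (G a) (D a)) (t : ι → ℝ) :
    Tendsto (fun n : ℕ => (∑ i ∈ Finset.range n, ∫ x, (∑ a, t a * G a (p a x)) ^ 2 ∂μ (i + 1)) / n)
      atTop (nhds (∫ x, (∑ a, t a * G a (p a x)) ^ 2 ∂lim)) := by
  have hb : ∀ a, ∃ M, ∀ w, |G a w| ≤ M := fun a => by
    obtain ⟨M, hM⟩ := (isCompact_range (hG a).continuous).isBounded.exists_norm_le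
    exact ⟨M, fun w => hM _ (Set.mem_range_self w)⟩
  choose M hM using hb
  have hint : ∀ (ρ : Measure E), IsProbabilityMeasure ρ → ∀ a b,
      Integrable (fun x => G a (p a x) * G b (p b x)) ρ := fun ρ _ a b => by
    have h1 := (hG a).continuous.measurable.comp (hp a)
    have h2 := (hG b).continuous.measurable.comp (hp b)
    refine (integrable_const (M a * M b)).mono' (h1.mul h2).aestronglyMeasurable
      (ae_of_all _ fun x => ?_)
    rw [Real.norm_eq_abs, abs_mul]
    exact mul_le_mul (hM a _) (hM b _) (abs_nonneg _) ((abs_nonneg _).trans (hM a 1))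
  have he : ∀ (ρ : Measure E), IsProbabilityMeasure ρ →
      ∫ x, (∑ a, t a * G a (p a x)) ^ 2 ∂ρ
        = ∑ a, ∑ b, t a * t b * ∫ x, G a (p a x) * G b (p b x) ∂ρ := fun ρ hρ => by
    have e : ∀ x, (∑ a, t a * G a (p a x)) ^ 2
        = ∑ a, ∑ b, t a * t b * (G a (p a x) * G b (p b x)) := fun x => by
      rw [sq, Finset.sum_mul_sum]
      exact Finset.sum_congr rfl fun a _ => Finset.sum_congr rfl fun b _ => by ring
    simp_rw [e]
    rw [integral_finsetSum _ fun a _ => integrable_finsetSum _ fun b _ => (hint ρ hρ a b).const_mul _]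
    refine Finset.sum_congr rfl fun a _ => ?_
    rw [integral_finsetSum _ fun b _ => (hint ρ hρ a b).const_mul _]
    simp_rw [integral_const_mul]
  rw [he lim inferInstance]
  have h : Tendsto (fun n : ℕ => ∑ a, ∑ b, t a * t b *
      ((∑ i ∈ Finset.range n, ∫ x, G a (p a x) * G b (p b x) ∂μ (i + 1)) / n)) atTop
      (nhds (∑ a, ∑ b, t a * t b * ∫ x, G a (p a x) * G b (p b x) ∂lim)) :=
    tendsto_finsetSum _ fun a _ => tendsto_finsetSum _ fun b _ =>
      (tendsto_cesaro_mul_of_hasDerivBound (hp a) (hp b) (hpair a b) (hG a) (hG b)).const_mul _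
  refine h.congr fun n => ?_
  simp_rw [fun i : ℕ => he (μ (i + 1)) inferInstance]
  symm
  rw [Finset.sum_comm, Finset.sum_div]
  refine Finset.sum_congr rfl fun a _ => ?_
  rw [Finset.sum_comm, Finset.sum_div]
  refine Finset.sum_congr rfl fun b _ => ?_
  rw [← Finset.mul_sum, mul_div_assoc]

/-- Linear combinations of functions of equidistributed points have the moments required by the
central limit theorem. -/
theorem cesaroMoments_sum (hp : ∀ a, Measurable (p a))
    (hF : ∀ a, SmoothlyApproximable (fun m => (μ m).map (p a)) (F a)) {lam : ι → ℤ → ℂ}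
    (hlam : ∀ a (k : ℤ) (m : ℕ), ∫ w, ((w ^ k : Circle) : ℂ) ∂((μ m).map (p a)) = lam a k ^ m)
    (hgap : ∀ a, HasPolynomialGap (lam a)) (hlim : ∀ a, lim.map (p a) = uniformCircle)
    (hpair : ∀ a b, PairEquidistributed μ lim (p a) (p b)) (t : ι → ℝ) :
    CesaroMoments μ (fun x => ∑ a, t a * F a (p a x)) (∑ a, t a * ∫ w, F a w ∂uniformCircle)
      (∫ x, (∑ a, t a * F a (p a x)) ^ 2 ∂lim) := by
  have hpr : ∀ a m, IsProbabilityMeasure ((μ m).map (p a)) := fun a m =>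
    Measure.isProbabilityMeasure_map (hp a).aemeasurable
  have hFm := fun a => (hF a).measurable
  have hm : ∀ a, Measurable fun x => F a (p a x) := fun a => (hFm a).comp (hp a)
  have hmom : ∀ k : ℕ, ∃ C : ℝ, ∀ n : ℕ, ∑ i ∈ Finset.range n,
      ∫ x, |∑ a, t a * F a (p a x)| ^ k ∂μ (i + 1) ≤ C * n := by
    intro k
    have h1 : ∀ a, ∃ C : ℝ, 0 ≤ C ∧ ∀ n : ℕ,
        ∑ i ∈ Finset.range n, ∫ w, |F a w| ^ k ∂((μ (i + 1)).map (p a)) ≤ C * n := fun a => by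
      obtain ⟨C, hC⟩ := (hF a).moment_le k
      have hFa := hFm a
      refine ⟨max C 0, le_max_right _ _, fun n => ?_⟩
      refine sum_integral_le_of_sum_lintegral_le (μ := fun m => (μ m).map (p a)) (by fun_prop)
        (fun w => by positivity) (by positivity)
        ((hC n).trans (ENNReal.ofReal_le_ofReal (by gcongr; exact le_max_left _ _)))
    choose C hC0 hC using h1
    refine ⟨1 + (Fintype.card ι : ℝ) ^ k * ∑ a, |t a| ^ k * C a, fun n => ?_⟩
    refine (Finset.sum_le_sum fun i _ => (integral_abs_sum_pow_le hp hFm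
      (fun a => (hF a).integrable_pow k i) t).2).trans ?_
    rw [Finset.sum_add_distrib, ← Finset.mul_sum, Finset.sum_comm]
    simp_rw [← Finset.mul_sum]
    have h2 : ∑ a, |t a| ^ k * ∑ i ∈ Finset.range n, ∫ w, |F a w| ^ k ∂((μ (i + 1)).map (p a))
        ≤ ∑ a, |t a| ^ k * (C a * n) := by
      gcongr with a; exact hC a n
    simp only [Finset.sum_const, Finset.card_range, nsmul_eq_mul, mul_one]
    calc _ ≤ (n : ℝ) + (Fintype.card ι : ℝ) ^ k * ∑ a, |t a| ^ k * (C a * n) := by gcongr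
      _ = _ := by
        simp_rw [← mul_assoc, ← Finset.sum_mul]; ring
  refine ⟨by fun_prop, fun k i => (integral_abs_sum_pow_le hp hFm
    (fun a => (hF a).integrable_pow k i) t).1, hmom, ?_, ?_⟩
  · have h1 := fun a => (hF a).exists_mean_rate (hlam a) (hgap a)
    choose C s hC hs hs1 hle using h1
    obtain ⟨s₀, hs₀, hs₀1, hs₀le⟩ : ∃ s₀ : ℝ, 0 < s₀ ∧ s₀ < 1 ∧ ∀ a, s₀ ≤ s a := by
      rcases isEmpty_or_nonempty ι with h | h
      · exact ⟨1 / 2, by norm_num, by norm_num, fun a => h.elim a⟩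
      · obtain ⟨a, ha⟩ := Finite.exists_min s
        exact ⟨s a, hs a, hs1 a, ha⟩
    refine ⟨∑ a, |t a| * C a, s₀, hs₀, hs₀1, fun n => ?_⟩
    rcases Nat.eq_zero_or_pos n with rfl | hn
    · simp only [Finset.range_zero, Finset.sum_empty, abs_zero]
      exact mul_nonneg (Finset.sum_nonneg fun a _ => mul_nonneg (abs_nonneg _) (hC a).le)
        (by positivity)
    have hn1 : (1 : ℝ) ≤ n := by exact_mod_cast hn
    have e : ∀ i : ℕ, ∫ x, ∑ a, t a * F a (p a x) ∂μ (i + 1) - ∑ a, t a * ∫ w, F a w ∂uniformCircle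
        = ∑ a, t a * (∫ w, F a w ∂((μ (i + 1)).map (p a)) - ∫ w, F a w ∂uniformCircle) := fun i => by
      have hi : ∀ a, Integrable (fun x => t a * F a (p a x)) (μ (i + 1)) := fun a =>
        (((hF a).integrable i).comp_measurable (hp a)).const_mul _
      rw [integral_finsetSum _ fun a _ => hi a, ← Finset.sum_sub_distrib]
      refine Finset.sum_congr rfl fun a _ => ?_
      rw [integral_const_mul, integral_map (hp a).aemeasurable (hFm a).aestronglyMeasurable, mul_sub]
    simp_rw [e]
    rw [Finset.sum_comm, Finset.sum_mul]
    refine (Finset.abs_sum_le_sum_abs _ _).trans (Finset.sum_le_sum fun a _ => ?_)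
    rw [← Finset.mul_sum, abs_mul, mul_assoc]
    refine mul_le_mul_of_nonneg_left ((hle a n).trans ?_) (abs_nonneg _)
    have := hC a
    gcongr
    exact hs₀le a
  · obtain ⟨C, hC⟩ := hmom 2
    simp only [sq_abs] at hC
    have hsqi : ∀ a i, Integrable (fun w => F a w ^ 2) ((μ (i + 1)).map (p a)) := fun a i => by
      simpa only [sq_abs] using (hF a).integrable_pow 2 i
    have hsql : ∀ a, Integrable (fun w => F a w ^ 2) (lim.map (p a)) := fun a => by
      rw [hlim]
      simpa only [sq_abs] using (hF a).integrable_pow_uniform 2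
    refine tendsto_cesaro_sq_of_approx (integrable_sq_sum hp hFm hsql t).1
      (fun i => (integrable_sq_sum hp hFm (fun a => hsqi a i) t).1) hC fun δ hδ => ?_
    set A := (Fintype.card ι : ℝ) * ∑ a, t a ^ 2 with hA
    have hA0 : 0 ≤ A := by positivity
    set δ' := δ / (A + 1) with hδ'
    have hδ'0 : 0 < δ' := by positivity
    have hAδ : A * δ' ≤ δ := by
      rw [hδ', mul_div_assoc', div_le_iff₀ (by positivity)]
      nlinarith
    -- the smooth functions are chosen so close to the `F a` that the errors of the linear combination
    -- stay below `δ`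
    choose G D hG hGu hGui hGi hGn using fun a => (hF a).exists_approx_le hδ'0
    have hGm := fun a => (hG a).continuous.measurable
    have hsub : ∀ x, ∑ a, t a * F a (p a x) - ∑ a, t a * G a (p a x)
        = ∑ a, t a * (F a (p a x) - G a (p a x)) := fun x => by
      rw [← Finset.sum_sub_distrib]
      exact Finset.sum_congr rfl fun a _ => by ring
    have hGsq : ∀ (ρ : Measure Circle), IsProbabilityMeasure ρ → ∀ a,
        Integrable (fun w => G a w ^ 2) ρ := fun ρ _ a => by
      obtain ⟨M, hM⟩ := (isCompact_range (hG a).continuous).isBounded.exists_norm_le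
      refine (integrable_const (M ^ 2)).mono' ((hGm a).pow_const 2).aestronglyMeasurable
        (ae_of_all _ fun w => ?_)
      rw [Real.norm_eq_abs, abs_of_nonneg (sq_nonneg _), ← sq_abs]
      exact pow_le_pow_left₀ (abs_nonneg _) (hM _ (Set.mem_range_self w)) 2
    have hdm : ∀ a, Measurable fun w => F a w - G a w := fun a => (hFm a).sub (hGm a)
    have hl := integrable_sq_sum (ρ := lim) (F := fun a w => F a w - G a w) hp hdm
      (fun a => by rw [hlim]; exact hGui a) t
    have hi := fun i => integrable_sq_sum (ρ := μ (i + 1)) (F := fun a w => F a w - G a w) hp hdm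
      (fun a => hGi a i) t
    refine ⟨fun x => ∑ a, t a * G a (p a x), (integrable_sq_sum hp hGm (fun a => hGsq _
      (by rw [hlim]; infer_instance) a) t).1, fun i => (integrable_sq_sum hp hGm (fun a => hGsq _
      (hpr a (i + 1)) a) t).1, ?_, ?_, ?_, ?_, tendsto_cesaro_sq_of_hasDerivBound hp hpair hG t⟩
    · simp_rw [hsub]; exact hl.1
    · simp_rw [hsub]; exact fun i => (hi i).1
    · simp_rw [hsub]
      refine hl.2.trans (le_trans ?_ hAδ)
      rw [hA, mul_assoc, Finset.sum_mul]
      gcongr with a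
      rw [hlim]
      exact hGu a
    · simp_rw [hsub]
      filter_upwards [eventually_all.2 hGn, eventually_gt_atTop 0] with n hn hn0
      have hn0' : (0 : ℝ) < n := Nat.cast_pos.2 hn0
      refine le_trans ?_ hAδ
      rw [div_le_iff₀ hn0']
      refine (Finset.sum_le_sum fun i _ => (hi i).2).trans ?_
      rw [← Finset.mul_sum, Finset.sum_comm, hA, mul_assoc, mul_assoc, Finset.sum_mul]
      gcongr with a
      rw [← Finset.mul_sum]
      gcongr
      exact (div_le_iff₀ hn0').1 (hn a)

end

/-! ### The second moments of the limit -/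

section Torus

variable {d : ℕ}

/-- The uniform distribution on the torus. -/
def uniformTorus (d : ℕ) : Measure (Fin d → Circle) := Measure.pi fun _ => uniformCircle

instance : IsProbabilityMeasure (uniformTorus d) := by unfold uniformTorus; infer_instance

lemma map_eval_uniformTorus (j : Fin d) : (uniformTorus d).map (fun w => w j) = uniformCircle :=
  (measurePreserving_eval (fun _ : Fin d => uniformCircle) j).map_eq

lemma integral_uniformTorus_mul {𝕜 : Type*} [RCLike 𝕜] {j l : Fin d} (hjl : j ≠ l)
    {F G : Circle → 𝕜} (hF : Measurable F) (hG : Measurable G) :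
    ∫ w, F (w j) * G (w l) ∂uniformTorus d
      = (∫ w, F w ∂uniformCircle) * ∫ w, G w ∂uniformCircle := by
  have hind : iIndepFun (fun (i : Fin d) (w : Fin d → Circle) => w i) (uniformTorus d) :=
    iIndepFun_pi (μ := fun _ : Fin d => uniformCircle) (X := fun _ w => w) fun _ => aemeasurable_id
  have h1 := ((hind.indepFun hjl).comp hF hG).integral_fun_mul_eq_mul_integral (𝕜 := 𝕜)
    (hF.comp (measurable_pi_apply j)).aestronglyMeasurable
    (hG.comp (measurable_pi_apply l)).aestronglyMeasurable
  have h2 : ∀ (i : Fin d) {H : Circle → 𝕜}, Measurable H →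
      ∫ w, H (w i) ∂uniformTorus d = ∫ w, H w ∂uniformCircle := fun i H hH => by
    rw [← map_eval_uniformTorus i, integral_map (measurable_pi_apply i).aemeasurable
      hH.aestronglyMeasurable]
  rw [← h2 j hF, ← h2 l hG]
  exact h1

/-- The character `w ↦ w_j ^ a * w_l ^ b` of the torus. -/
def pairCharacter (j l : Fin d) (a b : ℤ) : (Fin d → Circle) →* Circle where
  toFun w := w j ^ a * w l ^ b
  map_one' := by simp
  map_mul' w w' := by
    simp only [Pi.mul_apply, mul_zpow]
    exact mul_mul_mul_comm _ _ _ _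

lemma measurable_pairCharacter (j l : Fin d) (a b : ℤ) : Measurable (pairCharacter j l a b) := by
  have h1 : Continuous fun w : Fin d → Circle => w j ^ a := (continuous_apply j).zpow a
  have h2 : Continuous fun w : Fin d → Circle => w l ^ b := (continuous_apply l).zpow b
  exact (h1.mul h2).measurable

/-- The factor `x_j ^ a x_l ^ b E[z_j ^ a z_l ^ b]` by which the characters of `x^m T^{(m)}` are
multiplied when `m` increases by one. -/
def characterFactor (φ : Fin d → ℝ) (ν : Measure (Fin d → Circle)) (j l : Fin d) (a b : ℤ) : ℂ :=
  ((circlePoint (φ j) ^ a * circlePoint (φ l) ^ b : Circle) : ℂ) *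
    ∫ w, ((w j ^ a * w l ^ b : Circle) : ℂ) ∂ν

variable {φ : Fin d → ℝ} {ν : Measure (Fin d → Circle)} [IsProbabilityMeasure ν]

lemma integral_pairCharacter_rotatedLaw (j l : Fin d) (a b : ℤ) (m : ℕ) :
    ∫ w, ((w j ^ a * w l ^ b : Circle) : ℂ) ∂rotatedLaw φ ν m = characterFactor φ ν j l a b ^ m :=
  integral_rotatedLaw_eq_pow φ ν (pairCharacter j l a b) (measurable_pairCharacter j l a b) m

lemma norm_characterFactor_le (j l : Fin d) (a b : ℤ) : ‖characterFactor φ ν j l a b‖ ≤ 1 := by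
  rw [characterFactor, norm_mul, Circle.norm_coe, one_mul]
  refine (norm_integral_le_of_norm_le_const (C := 1)
    (ae_of_all _ fun w => (Circle.norm_coe _).le)).trans ?_
  simp

/-- Pairs of coordinates are jointly equidistributed unless a nontrivial character has factor
`1`. -/
lemma pairEquidistributed_of_ne_one {j l : Fin d} (hjl : j ≠ l)
    (h : ∀ a b : ℤ, a ≠ 0 ∨ b ≠ 0 → characterFactor φ ν j l a b ≠ 1) :
    PairEquidistributed (rotatedLaw φ ν) (uniformTorus d) (fun w => w j) (fun w => w l) := by
  intro a b
  simp_rw [integral_pairCharacter_rotatedLaw]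
  by_cases hab : a ≠ 0 ∨ b ≠ 0
  · have h0 : ∫ w, ((w j ^ a * w l ^ b : Circle) : ℂ) ∂uniformTorus d = 0 := by
      have h1 := integral_uniformTorus_mul (𝕜 := ℂ) hjl (measurable_zpow_circle a)
        (measurable_zpow_circle b)
      refine Eq.trans ?_ (h1.trans ?_)
      · exact integral_congr_ae (ae_of_all _ fun w => Circle.coe_mul _ _)
      · rcases hab with ha | hb
        · rw [integral_zpow_uniformCircle ha, zero_mul]
        · rw [integral_zpow_uniformCircle hb, mul_zero]
    rw [h0]
    exact tendsto_cesaro_pow_succ (norm_characterFactor_le j l a b) (h a b hab)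
  · push Not at hab
    obtain ⟨rfl, rfl⟩ := hab
    have h1 : characterFactor φ ν j l 0 0 = 1 := by simp [characterFactor]
    simp only [h1, one_pow, Finset.sum_const, Finset.card_range, nsmul_eq_mul, mul_one, zpow_zero,
      Circle.coe_one, integral_const, probReal_univ, one_smul]
    refine tendsto_const_nhds.congr' ?_
    filter_upwards [eventually_gt_atTop 0] with n hn
    rw [div_self (by exact_mod_cast hn.ne')]

lemma pairEquidistributed_self {j : Fin d} (h : ∀ a : ℤ, a ≠ 0 → characterFactor φ ν j j a 0 ≠ 1) :
    PairEquidistributed (rotatedLaw φ ν) (uniformTorus d) (fun w => w j) (fun w => w j) := by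
  intro a b
  have he : ∀ w : Fin d → Circle, w j ^ a * w j ^ b = w j ^ (a + b) * w j ^ (0 : ℤ) := fun w => by
    rw [← zpow_add, ← zpow_add, add_zero]
  simp_rw [he, integral_pairCharacter_rotatedLaw]
  by_cases hab : a + b ≠ 0
  · have h0 : ∫ w, ((w j ^ (a + b) * w j ^ (0 : ℤ) : Circle) : ℂ) ∂uniformTorus d = 0 := by
      simp_rw [zpow_zero, mul_one]
      rw [← integral_zpow_uniformCircle hab, ← map_eval_uniformTorus j,
        integral_map (measurable_pi_apply j).aemeasurable
        (measurable_zpow_circle _).aestronglyMeasurable]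
    rw [h0]
    exact tendsto_cesaro_pow_succ (norm_characterFactor_le j j _ 0) (h _ hab)
  · push Not at hab
    have h1 : characterFactor φ ν j j 0 0 = 1 := by simp [characterFactor]
    simp only [hab, h1, one_pow, Finset.sum_const, Finset.card_range, nsmul_eq_mul, mul_one,
      zpow_zero, Circle.coe_one, integral_const, probReal_univ, one_smul]
    refine tendsto_const_nhds.congr' ?_
    filter_upwards [eventually_gt_atTop 0] with n hn
    rw [div_self (by exact_mod_cast hn.ne')]

end Torus

section Covariances

variable {d : ℕ} {f : Fin d → Circle → ℂ}

/-- The matrix of second moments of the real and imaginary parts of the `log f_j` at independent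
uniform points. -/
def secondMoments (f : Fin d → Circle → ℂ) : Matrix (Fin d × Fin 2) (Fin d × Fin 2) ℝ := fun a b =>
  ∫ w, logPart (f a.1) a.2 (w a.1) * logPart (f b.1) b.2 (w b.1) ∂uniformTorus d

lemma integrable_logPart_mul (hf : ∀ j, Measurable (f j))
    (hsq : ∀ a : Fin d × Fin 2, Integrable (fun w => logPart (f a.1) a.2 w ^ 2) uniformCircle)
    (a b : Fin d × Fin 2) : Integrable (fun w : Fin d → Circle =>
      logPart (f a.1) a.2 (w a.1) * logPart (f b.1) b.2 (w b.1)) (uniformTorus d) := by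
  have hm : ∀ a : Fin d × Fin 2, Measurable fun w : Fin d → Circle => logPart (f a.1) a.2 (w a.1) :=
    fun a => (measurable_logPart (hf a.1) a.2).comp (measurable_pi_apply a.1)
  have hi : ∀ a : Fin d × Fin 2, Integrable (fun w : Fin d → Circle =>
      logPart (f a.1) a.2 (w a.1) ^ 2) (uniformTorus d) := fun a =>
    Integrable.comp_measurable (g := fun w => logPart (f a.1) a.2 w ^ 2) (by
      rw [map_eval_uniformTorus]; exact hsq a) (measurable_pi_apply a.1)
  refine ((hi a).add (hi b)).mono' ((hm a).mul (hm b)).aestronglyMeasurable (ae_of_all _ fun w => ?_)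
  rw [Real.norm_eq_abs, Pi.add_apply, abs_le]
  constructor <;> nlinarith [sq_nonneg (logPart (f a.1) a.2 (w a.1) + logPart (f b.1) b.2 (w b.1)),
    sq_nonneg (logPart (f a.1) a.2 (w a.1) - logPart (f b.1) b.2 (w b.1)),
    sq_nonneg (logPart (f a.1) a.2 (w a.1)), sq_nonneg (logPart (f b.1) b.2 (w b.1))]

lemma integral_logCombination_sq (hf : ∀ j, Measurable (f j))
    (hsq : ∀ a : Fin d × Fin 2, Integrable (fun w => logPart (f a.1) a.2 w ^ 2) uniformCircle)
    (t : Fin d × Fin 2 → ℝ) :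
    ∫ w, logCombination f t w ^ 2 ∂uniformTorus d = dotProduct t ((secondMoments f).mulVec t) := by
  have hi := integrable_logPart_mul hf hsq
  have e : ∀ w, logCombination f t w ^ 2 = ∑ a, ∑ b, t a * t b *
      (logPart (f a.1) a.2 (w a.1) * logPart (f b.1) b.2 (w b.1)) := fun w => by
    rw [logCombination, sq, Finset.sum_mul_sum]
    exact Finset.sum_congr rfl fun a _ => Finset.sum_congr rfl fun b _ => by ring
  simp_rw [e]
  rw [integral_finsetSum _ fun a _ => integrable_finsetSum _ fun b _ => (hi a b).const_mul _]
  simp only [dotProduct, Matrix.mulVec, secondMoments]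
  refine Finset.sum_congr rfl fun a _ => ?_
  rw [integral_finsetSum _ fun b _ => (hi a b).const_mul _, Finset.mul_sum]
  refine Finset.sum_congr rfl fun b _ => ?_
  rw [integral_const_mul]
  ring

lemma posSemidef_secondMoments (hf : ∀ j, Measurable (f j))
    (hsq : ∀ a : Fin d × Fin 2, Integrable (fun w => logPart (f a.1) a.2 w ^ 2) uniformCircle) :
    (secondMoments f).PosSemidef := by
  refine Matrix.PosSemidef.of_dotProduct_mulVec_nonneg ?_ fun t => ?_
  · ext a b
    simp only [Matrix.conjTranspose_apply, secondMoments, star_trivial]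
    simp_rw [mul_comm]
  · rw [star_trivial, ← integral_logCombination_sq hf hsq t]
    exact integral_nonneg fun w => sq_nonneg _

lemma secondMoments_apply_of_ne (hf : ∀ j, Measurable (f j)) {a b : Fin d × Fin 2} (hab : a.1 ≠ b.1) :
    secondMoments f a b = (∫ u in (0 : ℝ)..1, logPart (f a.1) a.2 (circlePoint u)) *
      ∫ v in (0 : ℝ)..1, logPart (f b.1) b.2 (circlePoint v) := by
  have ha := measurable_logPart (hf a.1) a.2
  have hb := measurable_logPart (hf b.1) b.2
  rw [secondMoments, integral_uniformTorus_mul hab ha hb,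
    integral_uniformCircle ha.aestronglyMeasurable, integral_uniformCircle hb.aestronglyMeasurable]

lemma secondMoments_apply_same (hf : ∀ j, Measurable (f j)) (j : Fin d) (k k' : Fin 2) :
    secondMoments f (j, k) (j, k') = ∫ u in (0 : ℝ)..1,
      logPart (f j) k (circlePoint u) * logPart (f j) k' (circlePoint u) := by
  have h := (measurable_logPart (hf j) k).mul (measurable_logPart (hf j) k')
  have h2 := integral_uniformCircle h.aestronglyMeasurable
  rw [← map_eval_uniformTorus j, integral_map (measurable_pi_apply j).aemeasurable
      h.aestronglyMeasurable] at h2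
  exact h2

lemma meanLog_re_im {g : Circle → ℂ} (hg : Measurable g)
    (hi : ∀ k, Integrable (logPart g k) uniformCircle) :
    (meanLog g).re = ∫ w, logPart g 0 w ∂uniformCircle ∧
      (meanLog g).im = ∫ w, logPart g 1 w ∂uniformCircle := by
  have hm : Measurable fun w => Complex.log (g w) := Complex.measurable_log.comp hg
  have h1 : meanLog g = ∫ w, Complex.log (g w) ∂uniformCircle :=
    (integral_uniformCircle hm.aestronglyMeasurable).symm
  have hint : Integrable (fun w => Complex.log (g w)) uniformCircle := by
    refine ((hi 0).abs.add (hi 1).abs).mono' hm.aestronglyMeasurable (ae_of_all _ fun w => ?_)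
    refine (Complex.norm_le_abs_re_add_abs_im _).trans (le_of_eq ?_)
    simp [logPart, Complex.log_re, Complex.log_im]
  rw [h1]
  constructor
  · refine (Complex.reCLM.integral_comp_comm hint).symm.trans ?_
    simp [logPart, Complex.log_re]
  · refine (Complex.imCLM.integral_comp_comm hint).symm.trans ?_
    simp [logPart, Complex.log_im]

end Covariances

/-- The arithmetic input of the central limit theorem: equidistribution of the pairs of coordinates,
with a rate for the single coordinates, and control of the visits to the zeros of the `f_j`. -/
structure EquidistributionHypotheses {d : ℕ} (f : Fin d → Circle → ℂ) (φ : Fin d → ℝ)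
    (ν : Measure (Fin d → Circle)) : Prop where
  ne_one : ∀ j l, j ≠ l → ∀ a b : ℤ, a ≠ 0 ∨ b ≠ 0 → characterFactor φ ν j l a b ≠ 1
  gap : ∀ j, HasPolynomialGap fun a => characterFactor φ ν j j a 0
  negativeMoments : ∀ j, HasNegativeMoments (fun m => (rotatedLaw φ ν m).map fun w => w j) (f j)

section Assembly

variable {d : ℕ} {f : Fin d → Circle → ℂ} {φ : Fin d → ℝ} {ν : Measure (Fin d → Circle)}
  [IsProbabilityMeasure ν]

lemma IsRealAnalyticOnCircle.continuous {g : Circle → ℂ} (hg : IsRealAnalyticOnCircle g) :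
    Continuous g :=
  continuous_of_comp_circlePoint (continuous_iff_continuousAt.2 fun t => (hg t).continuousAt)

lemma integral_zpow_map_eval (j : Fin d) (a : ℤ) (m : ℕ) :
    ∫ w, ((w ^ a : Circle) : ℂ) ∂((rotatedLaw φ ν m).map fun w => w j)
      = characterFactor φ ν j j a 0 ^ m := by
  rw [← integral_pairCharacter_rotatedLaw, integral_map (measurable_pi_apply j).aemeasurable
    (measurable_zpow_circle _).aestronglyMeasurable]
  simp_rw [zpow_zero, mul_one]

namespace EquidistributionHypotheses

lemma smoothlyApproximable (H : EquidistributionHypotheses f φ ν)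
    (hf : ∀ j, IsRealAnalyticOnCircle (f j)) (hf0 : ∀ j, f j ≠ 0) (a : Fin d × Fin 2) :
    SmoothlyApproximable (fun m => (rotatedLaw φ ν m).map fun w => w a.1) (logPart (f a.1) a.2) := by
  have : ∀ m, IsProbabilityMeasure ((rotatedLaw φ ν m).map fun w => w a.1) := fun m =>
    Measure.isProbabilityMeasure_map (measurable_pi_apply a.1).aemeasurable
  exact smoothlyApproximable_logPart (hf a.1) (hf0 a.1) (integral_zpow_map_eval a.1) (H.gap a.1)
    (H.negativeMoments a.1) a.2

lemma cesaroMoments (H : EquidistributionHypotheses f φ ν)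
    (hf : ∀ j, IsRealAnalyticOnCircle (f j)) (hf0 : ∀ j, f j ≠ 0) (t : Fin d × Fin 2 → ℝ) :
    CesaroMoments (rotatedLaw φ ν) (logCombination f t)
      (∑ j, (t (j, 0) * (meanLog (f j)).re + t (j, 1) * (meanLog (f j)).im))
      (dotProduct t ((secondMoments f).mulVec t)) := by
  have hF := H.smoothlyApproximable hf hf0
  have hfm : ∀ j, Measurable (f j) := fun j => (hf j).continuous.measurable
  have hne : ∀ j (a : ℤ), a ≠ 0 → characterFactor φ ν j j a 0 ≠ 1 := fun j a ha h1 => by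
    obtain ⟨c, γ, hc, -, hcγ⟩ := H.gap j
    have h2 := hcγ a ha
    simp only [h1, sub_self, norm_zero] at h2
    have : 0 < |(a : ℝ)| := abs_pos.2 (Int.cast_ne_zero.2 ha)
    have : 0 < c * |(a : ℝ)| ^ (-γ) := by positivity
    linarith
  have h := cesaroMoments_sum (μ := rotatedLaw φ ν) (lim := uniformTorus d)
    (p := fun (a : Fin d × Fin 2) w => w a.1) (fun a => measurable_pi_apply a.1) hF
    (lam := fun a k => characterFactor φ ν a.1 a.1 k 0)
    (fun a k m => integral_zpow_map_eval a.1 k m) (fun a => H.gap a.1)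
    (fun a => map_eval_uniformTorus a.1) (fun a b => ?_) t
  · have e1 : ∑ a : Fin d × Fin 2, t a * ∫ w, logPart (f a.1) a.2 w ∂uniformCircle
        = ∑ j, (t (j, 0) * (meanLog (f j)).re + t (j, 1) * (meanLog (f j)).im) := by
      rw [Fintype.sum_prod_type]
      refine Finset.sum_congr rfl fun j _ => ?_
      obtain ⟨h1, h2⟩ := meanLog_re_im (hfm j) fun k => (hF (j, k)).integrable_uniform
      rw [Fin.sum_univ_two, h1, h2]
    rw [e1] at h
    rw [← integral_logCombination_sq hfm (fun a => by
      simpa only [sq_abs] using (hF a).integrable_pow_uniform 2) t]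
    exact h
  · by_cases hab : a.1 = b.1
    · rw [hab]
      exact pairEquidistributed_self (hne b.1)
    · exact pairEquidistributed_of_ne_one hab (H.ne_one _ _ hab)

lemma posSemidef (H : EquidistributionHypotheses f φ ν)
    (hf : ∀ j, IsRealAnalyticOnCircle (f j)) (hf0 : ∀ j, f j ≠ 0) : (secondMoments f).PosSemidef :=
  posSemidef_secondMoments (fun j => (hf j).continuous.measurable) fun a => by
    simpa only [sq_abs] using (H.smoothlyApproximable hf hf0 a).integrable_pow_uniform 2

end EquidistributionHypotheses

end Assembly

/-! ### Laws with bounded marginal densities -/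

/-- A circle-valued random variable whose mean has modulus `1` is almost surely constant. -/
lemma ae_eq_const_of_norm_integral_eq_one {Ω : Type*} [MeasurableSpace Ω] {μ : Measure Ω}
    [IsProbabilityMeasure μ] {X : Ω → Circle} (h : ‖∫ ω, (X ω : ℂ) ∂μ‖ = 1) :
    ∃ u : Circle, (u : ℂ) = ∫ ω, (X ω : ℂ) ∂μ ∧ ∀ᵐ ω ∂μ, X ω = u := by
  let u : Circle := ⟨∫ ω, (X ω : ℂ) ∂μ, mem_sphere_zero_iff_norm.2 h⟩
  refine ⟨u, rfl, ?_⟩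
  rcases ae_eq_const_or_norm_integral_lt_of_norm_le_const (μ := μ) (f := fun ω => (X ω : ℂ))
    (C := 1) (ae_of_all _ fun ω => (Circle.norm_coe _).le) with h1 | h1
  · filter_upwards [h1] with ω hω
    refine Circle.ext (hω.trans ?_)
    rw [average_eq_integral]
    rfl
  · rw [h, probReal_univ, mul_one] at h1
    exact absurd h1 (lt_irrefl _)

lemma norm_integral_circle_le {Ω : Type*} [MeasurableSpace Ω] {μ : Measure Ω}
    [IsProbabilityMeasure μ] (X : Ω → Circle) : ‖∫ ω, (X ω : ℂ) ∂μ‖ ≤ 1 :=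
  (norm_integral_le_of_norm_le_const (C := 1)
    (ae_of_all _ fun ω => (Circle.norm_coe _).le)).trans (by simp)

/-- If the means of the powers `X ^ k` tend to `0`, then `X` is not constant, so that its mean is
smaller than `1`. -/
lemma norm_integral_lt_one_of_tendsto {Ω : Type*} [MeasurableSpace Ω] {μ : Measure Ω}
    [IsProbabilityMeasure μ] {X : Ω → Circle}
    (h : Tendsto (fun k : ℕ => ‖∫ ω, ((X ω ^ k : Circle) : ℂ) ∂μ‖) atTop (nhds 0)) :
    ‖∫ ω, (X ω : ℂ) ∂μ‖ < 1 := by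
  refine lt_of_le_of_ne (norm_integral_circle_le X) fun h1 => ?_
  obtain ⟨u, -, hu⟩ := ae_eq_const_of_norm_integral_eq_one h1
  have h2 : ∀ k : ℕ, ‖∫ ω, ((X ω ^ k : Circle) : ℂ) ∂μ‖ = 1 := fun k => by
    have h3 : ∫ ω, ((X ω ^ k : Circle) : ℂ) ∂μ = ∫ _, ((u ^ k : Circle) : ℂ) ∂μ :=
      integral_congr_ae (hu.mono fun ω hω => by simp only [hω])
    rw [h3, integral_const, probReal_univ, one_smul]
    exact Circle.norm_coe _
  simp_rw [h2] at h
  exact one_ne_zero (tendsto_nhds_unique tendsto_const_nhds h)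

/-- Only finitely many of the `lam a` have modulus at least `1 / 2`, so that the distances to `1`
are even bounded below. -/
lemma HasPolynomialGap.of_tendsto {lam : ℤ → ℂ} (h1 : ∀ a, a ≠ 0 → ‖lam a‖ < 1)
    (h2 : Tendsto (fun a => ‖lam a‖) cofinite (nhds 0)) : HasPolynomialGap lam := by
  have hfin : {a : ℤ | ¬ ‖lam a‖ < 1 / 2}.Finite :=
    h2.eventually (gt_mem_nhds (by norm_num : (0 : ℝ) < 1 / 2))
  have key : ∀ S : Finset ℤ, ∃ δ : ℝ, 0 < δ ∧ ∀ a ∈ S, a ≠ 0 → δ ≤ 1 - ‖lam a‖ := by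
    intro S
    induction S using Finset.induction_on with
    | empty => exact ⟨1, one_pos, by simp⟩
    | insert b S _ ih =>
      obtain ⟨δ, hδ, h⟩ := ih
      by_cases hb : b = 0
      · refine ⟨δ, hδ, fun a ha ha0 => ?_⟩
        rcases Finset.mem_insert.1 ha with rfl | ha
        · exact absurd hb ha0
        · exact h a ha ha0
      · refine ⟨min δ (1 - ‖lam b‖), lt_min hδ (by linarith [h1 b hb]), fun a ha ha0 => ?_⟩
        rcases Finset.mem_insert.1 ha with rfl | ha
        · exact min_le_right _ _
        · exact (min_le_left _ _).trans (h a ha ha0)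
  obtain ⟨δ, hδ, h⟩ := key hfin.toFinset
  refine ⟨min δ (1 / 2), 1, by positivity, le_rfl, fun a ha => ?_⟩
  have h3 : min δ (1 / 2) ≤ 1 - ‖lam a‖ := by
    by_cases hm : ‖lam a‖ < 1 / 2
    · exact (min_le_right _ _).trans (by linarith)
    · exact (min_le_left _ _).trans (h a (hfin.mem_toFinset.2 hm) ha)
  have h4 : 1 - ‖lam a‖ ≤ ‖1 - lam a‖ := by
    simpa using norm_sub_norm_le (1 : ℂ) (lam a)
  have h5 : |(a : ℝ)| ^ (-1 : ℝ) ≤ 1 :=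
    Real.rpow_le_one_of_one_le_of_nonpos (by exact_mod_cast Int.one_le_abs ha) (by norm_num)
  calc min δ (1 / 2) * |(a : ℝ)| ^ (-1 : ℝ) ≤ min δ (1 / 2) * 1 := by gcongr
    _ ≤ _ := by linarith

section Dominated

variable {d : ℕ} {f : Fin d → Circle → ℂ} {φ : Fin d → ℝ} {ν : Measure (Fin d → Circle)}
  [IsProbabilityMeasure ν]

/-- A bound for the density of the `j`-th coordinate under `ν` is inherited by the products, because
the uniform distribution is invariant under rotations. -/
lemma lintegral_rotatedLaw_succ_le {j : Fin d} {B : ENNReal}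
    (hB : ν.map (fun w => w j) ≤ B • uniformCircle) {G : Circle → ENNReal} (hG : Measurable G)
    (i : ℕ) : ∫⁻ w, G (w j) ∂rotatedLaw φ ν (i + 1) ≤ B * ∫⁻ w, G w ∂uniformCircle := by
  have hGj : Measurable fun w : Fin d → Circle => G (w j) := hG.comp (measurable_pi_apply j)
  have hinner : ∀ c : Circle, ∫⁻ w, G (c * w j) ∂ν ≤ B * ∫⁻ w, G w ∂uniformCircle := fun c => by
    have hc : Measurable fun w : Circle => c * w := (continuous_const.mul continuous_id).measurable
    have h1 : ∫⁻ w, G (c * w j) ∂ν = ∫⁻ w, G (c * w) ∂ν.map (fun w => w j) :=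
      (lintegral_map (hG.comp hc) (measurable_pi_apply j)).symm
    have h2 : ∫⁻ w, G (c * w) ∂uniformCircle = ∫⁻ w, G w ∂uniformCircle := by
      conv_rhs => rw [← map_mul_left_uniformCircle c]
      exact (lintegral_map hG hc).symm
    rw [h1]
    refine (lintegral_mono' hB le_rfl).trans ?_
    rw [lintegral_smul_measure, h2, smul_eq_mul]
  have hm := (measurePreserving_piFinSuccAbove (fun _ : Fin (i + 1) => ν) 0)
  let F : (Fin d → Circle) × (Fin i → Fin d → Circle) → ENNReal := fun p =>
    G (circlePoint (φ j) ^ (i + 1) * (∏ k, p.2 k j) * p.1 j)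
  have hF : Measurable F := by
    refine hG.comp (Continuous.measurable ?_)
    fun_prop
  rw [rotatedLaw, lintegral_map hGj (measurable_rotate φ _), productLaw,
    lintegral_map (f := fun w => G (circlePoint (φ j) ^ (i + 1) * w j))
      (hGj.comp (measurable_rotate φ _)) measurable_prodCircle]
  calc _ = ∫⁻ y, F (MeasurableEquiv.piFinSuccAbove (fun _ => Fin d → Circle) 0 y)
        ∂Measure.pi (fun _ : Fin (i + 1) => ν) := by
        refine lintegral_congr fun y => ?_
        simp only [F]
        congr 1
        rw [Fin.prod_univ_succ, mul_comm (y 0 j), mul_assoc]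
        rfl
    _ = ∫⁻ p, F p ∂(ν.prod (Measure.pi fun _ : Fin i => ν)) := hm.lintegral_comp hF
    _ = ∫⁻ y, ∫⁻ x, F (x, y) ∂ν ∂(Measure.pi fun _ : Fin i => ν) := lintegral_prod_symm' F hF
    _ ≤ ∫⁻ y, B * ∫⁻ w, G w ∂uniformCircle ∂(Measure.pi fun _ : Fin i => ν) :=
        lintegral_mono fun y => hinner (circlePoint (φ j) ^ (i + 1) * ∏ k, y k j)
    _ = _ := by simp

lemma hasNegativeMoments_of_le {j : Fin d} {B : ENNReal} (hBt : B ≠ ⊤)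
    (hB : ν.map (fun w => w j) ≤ B • uniformCircle) {g : Circle → ℂ}
    (hg : IsRealAnalyticOnCircle g) (hg0 : g ≠ 0) :
    HasNegativeMoments (fun m => (rotatedLaw φ ν m).map fun w => w j) g := by
  obtain ⟨κ₀, hκ₀, h⟩ := exists_lintegral_uniformCircle_lt_top hg hg0
  refine ⟨κ₀, hκ₀, fun κ hκ hκ' => ?_⟩
  have hm : Measurable fun w => ‖g w‖ₑ ^ (-κ) := hg.continuous.measurable.enorm.pow_const _
  set D := B * ∫⁻ w, ‖g w‖ₑ ^ (-κ) ∂uniformCircle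
  have hD : D ≠ ⊤ := ENNReal.mul_ne_top hBt (h κ hκ hκ').ne
  refine ⟨D.toReal + 1, by positivity, fun n => ?_⟩
  calc ∑ i ∈ Finset.range n, ∫⁻ w, ‖g w‖ₑ ^ (-κ) ∂((rotatedLaw φ ν (i + 1)).map fun w => w j)
      ≤ ∑ _i ∈ Finset.range n, D := Finset.sum_le_sum fun i _ => by
        rw [lintegral_map hm (measurable_pi_apply j)]
        exact lintegral_rotatedLaw_succ_le hB hm i
    _ = ENNReal.ofReal (D.toReal * n) := by
        rw [Finset.sum_const, Finset.card_range, nsmul_eq_mul, mul_comm,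
          ENNReal.ofReal_mul ENNReal.toReal_nonneg, ENNReal.ofReal_toReal hD, ENNReal.ofReal_natCast]
    _ ≤ _ := ENNReal.ofReal_le_ofReal (by gcongr; linarith)

/-- Bounded marginal densities and summable Fourier coefficients suffice, whatever the rotation. -/
lemma EquidistributionHypotheses.of_summable (hf : ∀ j, IsRealAnalyticOnCircle (f j))
    (hf0 : ∀ j, f j ≠ 0)
    (hB : ∀ j, ∃ B : ENNReal, B ≠ ⊤ ∧ ν.map (fun w => w j) ≤ B • uniformCircle)
    (h1 : ∀ j, Summable fun a : ℤ => ‖∫ w, ((w j ^ a : Circle) : ℂ) ∂ν‖)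
    (h2 : ∀ j l, j ≠ l → Summable fun q : ℤ × ℤ =>
      ‖∫ w, ((w j ^ q.1 * w l ^ q.2 : Circle) : ℂ) ∂ν‖) :
    EquidistributionHypotheses f φ ν where
  ne_one j l hjl a b hab h := by
    have hinj : Function.Injective fun k : ℕ => ((k * a, k * b) : ℤ × ℤ) := by
      intro k k' hk
      simp only [Prod.mk.injEq, mul_eq_mul_right_iff, Nat.cast_inj] at hk
      tauto
    have h3 : ‖∫ w, ((w j ^ a * w l ^ b : Circle) : ℂ) ∂ν‖ < 1 := by
      refine norm_integral_lt_one_of_tendsto ?_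
      refine (((h2 j l hjl).comp_injective hinj).tendsto_atTop_zero).congr fun k => ?_
      simp only [Function.comp_apply]
      simp_rw [mul_comm (k : ℤ), zpow_mul, zpow_natCast, ← mul_pow]
    have h4 := congrArg norm h
    rw [characterFactor, norm_mul, Circle.norm_coe, one_mul, norm_one] at h4
    exact h3.ne h4
  gap j := by
    have he : ∀ a : ℤ, ‖characterFactor φ ν j j a 0‖ = ‖∫ w, ((w j ^ a : Circle) : ℂ) ∂ν‖ :=
      fun a => by
        rw [characterFactor, norm_mul, Circle.norm_coe, one_mul]
        simp_rw [zpow_zero, mul_one]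
    refine HasPolynomialGap.of_tendsto (fun a ha => ?_) ?_
    · have hinj : Function.Injective fun k : ℕ => (k * a : ℤ) := by
        intro k k' hk
        simp only [mul_eq_mul_right_iff, Nat.cast_inj] at hk
        tauto
      rw [he]
      refine norm_integral_lt_one_of_tendsto ?_
      refine (((h1 j).comp_injective hinj).tendsto_atTop_zero).congr fun k => ?_
      simp only [Function.comp_apply]
      simp_rw [mul_comm (k : ℤ), zpow_mul, zpow_natCast]
    · simp_rw [he]
      exact (h1 j).tendsto_cofinite_zero
  negativeMoments j := by
    obtain ⟨B, hBt, hB⟩ := hB j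
    exact hasNegativeMoments_of_le hBt hB (hf j) (hf0 j)

end Dominated

section Conditions

variable {d : ℕ} {f : Fin d → Circle → ℂ} {φ : Fin d → ℝ} {Ω₀ : Type*} [MeasurableSpace Ω₀]
  {Q : Measure Ω₀} [IsProbabilityMeasure Q] {z : Ω₀ → Fin d → Circle}

/-- The nontrivial Fourier coefficients of the pairs vanish. -/
lemma EquidistributionHypotheses.of_independentUniform (hf : ∀ j, IsRealAnalyticOnCircle (f j))
    (hf0 : ∀ j, f j ≠ 0) (hz : Measurable z) (h : IndependentUniform Q z) :
    EquidistributionHypotheses f φ (Q.map z) := by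
  have : IsProbabilityMeasure (Q.map z) := Measure.isProbabilityMeasure_map hz.aemeasurable
  have hmap : ∀ j, (Q.map z).map (fun w => w j) = uniformCircle := fun j => by
    rw [Measure.map_map (measurable_pi_apply j) hz]
    exact (h.1 j).map_eq
  have h1 : ∀ j (a : ℤ), a ≠ 0 → ∫ ω, ((z ω j ^ a : Circle) : ℂ) ∂Q = 0 := fun j a ha => by
    rw [← integral_zpow_uniformCircle ha, ← (h.1 j).map_eq,
      integral_map (h.1 j).aemeasurable (measurable_zpow_circle a).aestronglyMeasurable]
  have hmp : ∀ j l (a b : ℤ), ∫ w, ((w j ^ a * w l ^ b : Circle) : ℂ) ∂(Q.map z)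
      = ∫ ω, ((z ω j ^ a * z ω l ^ b : Circle) : ℂ) ∂Q := fun j l a b => by
    have hχ := measurable_pairCharacter j l a b
    exact integral_map hz.aemeasurable
      (f := fun w => ((pairCharacter j l a b w : Circle) : ℂ))
      (Measurable.comp (g := fun c : Circle => (c : ℂ)) (by fun_prop) hχ).aestronglyMeasurable
  refine .of_summable hf hf0 (fun j => ⟨1, ENNReal.one_ne_top, by rw [hmap, one_smul]⟩)
    (fun j => ?_) fun j l hjl => ?_
  · refine summable_of_ne_finset_zero (s := {0}) fun a ha => ?_
    have h2 := hmp j j a 0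
    simp_rw [zpow_zero, mul_one] at h2
    rw [h2, h1 j a (by simpa using ha), norm_zero]
  · refine summable_of_ne_finset_zero (s := {0}) fun q hq => ?_
    rw [hmp, norm_eq_zero]
    have h3 := ((h.2.indepFun hjl).comp (measurable_zpow_circle q.1)
      (measurable_zpow_circle q.2)).integral_fun_mul_eq_mul_integral
      (((measurable_zpow_circle q.1).comp ((measurable_pi_apply j).comp hz)).aestronglyMeasurable)
      (((measurable_zpow_circle q.2).comp ((measurable_pi_apply l).comp hz)).aestronglyMeasurable)
    refine Eq.trans ?_ (h3.trans ?_)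
    · exact integral_congr_ae (ae_of_all _ fun w => Circle.coe_mul _ _)
    · by_cases hq1 : q.1 = 0
      · have hq2 : q.2 ≠ 0 := fun hq2 => hq (Finset.mem_singleton.2 (Prod.ext hq1 hq2))
        exact mul_eq_zero_of_right _ (h1 l _ hq2)
      · exact mul_eq_zero_of_left (h1 j _ hq1) _

end Conditions

section SummableDensity

variable {d : ℕ} {f : Fin d → Circle → ℂ} {φ : Fin d → ℝ} {Ω₀ : Type*} [MeasurableSpace Ω₀]
  {Q : Measure Ω₀} {z : Ω₀ → Fin d → Circle}

lemma map_circlePoint_square :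
    (volume.restrict (Set.Icc (0 : ℝ) 1 ×ˢ Set.Icc (0 : ℝ) 1)).map
      (fun p : ℝ × ℝ => (circlePoint p.1, circlePoint p.2)) = uniformCircle.prod uniformCircle := by
  rw [Measure.volume_eq_prod, ← Measure.prod_restrict, uniformCircle]
  exact (Measure.map_prod_map _ _ continuous_circlePoint.measurable
    continuous_circlePoint.measurable).symm

lemma integral_prod_zpow (a b : ℤ) :
    ∫ w, ((w.1 ^ a * w.2 ^ b : Circle) : ℂ) ∂(uniformCircle.prod uniformCircle)
      = if a = 0 ∧ b = 0 then 1 else 0 := by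
  have h := integral_prod_mul (μ := uniformCircle) (ν := uniformCircle)
    (fun w => ((w ^ a : Circle) : ℂ)) (fun w => ((w ^ b : Circle) : ℂ))
  refine Eq.trans ?_ (h.trans ?_)
  · exact integral_congr_ae (ae_of_all _ fun w => Circle.coe_mul _ _)
  · split_ifs with hab
    · obtain ⟨rfl, rfl⟩ := hab
      simp
    · by_cases ha : a = 0
      · rw [integral_zpow_uniformCircle fun hb => hab ⟨ha, hb⟩, mul_zero]
      · rw [integral_zpow_uniformCircle ha, zero_mul]

/-- The Fourier coefficients of a density with an absolutely convergent Fourier series are those of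
the series. -/
lemma integral_zpow_withDensity {c : ℤ × ℤ → ℂ} (hc : Summable fun q => ‖c q‖)
    {g : Circle × Circle → NNReal} (hgm : Measurable g)
    (hg : ∀ w, ((g w : ℝ) : ℂ) = ∑' q, c q * ((w.1 ^ q.1 * w.2 ^ q.2 : Circle) : ℂ)) (a b : ℤ) :
    ∫ w, ((w.1 ^ a * w.2 ^ b : Circle) : ℂ)
      ∂((uniformCircle.prod uniformCircle).withDensity fun w => (g w : ENNReal)) = c (-a, -b) := by
  set μ := uniformCircle.prod uniformCircle
  have hχ : ∀ a b : ℤ, Measurable fun w : Circle × Circle => ((w.1 ^ a * w.2 ^ b : Circle) : ℂ) :=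
    fun a b => by
      have h1 : Continuous fun w : Circle × Circle => w.1 ^ a * w.2 ^ b :=
        (continuous_fst.zpow a).mul (continuous_snd.zpow b)
      exact Measurable.comp (g := fun c : Circle => (c : ℂ)) (by fun_prop) h1.measurable
  have hint : ∀ a b : ℤ, Integrable (fun w : Circle × Circle => ((w.1 ^ a * w.2 ^ b : Circle) : ℂ)) μ :=
    fun a b => Integrable.of_bound (hχ a b).aestronglyMeasurable 1
      (ae_of_all _ fun w => (Circle.norm_coe _).le)
  rw [integral_withDensity_eq_integral_smul hgm]
  let F : ℤ × ℤ → Circle × Circle → ℂ := fun q w =>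
    c q * ((w.1 ^ (q.1 + a) * w.2 ^ (q.2 + b) : Circle) : ℂ)
  have hF : ∀ w, g w • ((w.1 ^ a * w.2 ^ b : Circle) : ℂ) = ∑' q, F q w := fun w => by
    rw [NNReal.smul_def, Complex.real_smul, hg, ← tsum_mul_right]
    refine tsum_congr fun q => ?_
    rw [mul_assoc, ← Circle.coe_mul, mul_mul_mul_comm, ← zpow_add, ← zpow_add]
  have hFi : ∀ q, Integrable (F q) μ := fun q => (hint _ _).const_mul _
  have hFn : ∀ q, ∫ w, ‖F q w‖ ∂μ = ‖c q‖ := fun q => by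
    have : ∀ w, ‖F q w‖ = ‖c q‖ := fun w => by
      simp only [F]
      rw [norm_mul, Circle.norm_coe, mul_one]
    simp_rw [this]
    simp
  have h1 := hasSum_integral_of_summable_integral_norm hFi (by simpa only [hFn] using hc)
  have h2 : ∀ q, ∫ w, F q w ∂μ = if q = (-a, -b) then c (-a, -b) else 0 := fun q => by
    have : ∫ w, F q w ∂μ = c q * _ := integral_const_mul _ _
    rw [this, integral_prod_zpow]
    by_cases hq : q = (-a, -b)
    · subst hq; simp
    · rw [if_neg hq, if_neg, mul_zero]
      rintro ⟨h3, h4⟩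
      exact hq (Prod.ext (by simp; omega) (by simp; omega))
  simp_rw [h2] at h1
  rw [integral_congr_ae (ae_of_all _ hF)]
  exact h1.unique (hasSum_ite_eq _ _)

/-- The density of condition `PairwiseSummableDensity` as a function on the torus. -/
lemma exists_density_torus {μ : Measure (Circle × Circle)} {g : ℝ × ℝ → NNReal} {c : ℤ × ℤ → ℂ}
    (hc : Summable fun q => ‖c q‖)
    (hg : ∀ u v : ℝ, ((g (u, v) : ℝ) : ℂ) =
      ∑' q : ℤ × ℤ, c q * Complex.exp (2 * π * Complex.I * (q.1 * u + q.2 * v)))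
    (hμ : μ = ((volume.restrict (Set.Icc (0 : ℝ) 1 ×ˢ Set.Icc (0 : ℝ) 1)).withDensity
        (fun p => (g p : ENNReal))).map (fun p => (circlePoint p.1, circlePoint p.2))) :
    ∃ G : Circle × Circle → NNReal, Measurable G ∧ (∀ w, (G w : ℝ) ≤ ∑' q, ‖c q‖) ∧
      (∀ w, ((G w : ℝ) : ℂ) = ∑' q, c q * ((w.1 ^ q.1 * w.2 ^ q.2 : Circle) : ℂ)) ∧
      μ = (uniformCircle.prod uniformCircle).withDensity fun w => (G w : ENNReal) := by
  let S : Circle × Circle → ℂ := fun w => ∑' q, c q * ((w.1 ^ q.1 * w.2 ^ q.2 : Circle) : ℂ)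
  have hSn : ∀ q (w : Circle × Circle), ‖c q * ((w.1 ^ q.1 * w.2 ^ q.2 : Circle) : ℂ)‖ ≤ ‖c q‖ :=
    fun q w => by rw [norm_mul, Circle.norm_coe, mul_one]
  have hSc : Continuous S := by
    refine continuous_tsum (fun q => ?_) hc hSn
    have h1 : Continuous fun w : Circle × Circle => w.1 ^ q.1 * w.2 ^ q.2 :=
      (continuous_fst.zpow _).mul (continuous_snd.zpow _)
    exact continuous_const.mul (continuous_subtype_val.comp h1)
  have hSg : ∀ p : ℝ × ℝ, S (circlePoint p.1, circlePoint p.2) = ((g p : ℝ) : ℂ) := fun p => by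
    rw [show g p = g (p.1, p.2) from rfl, hg]
    refine tsum_congr fun q => ?_
    simp only
    rw [circlePoint_zpow, circlePoint_zpow, ← circlePoint_add, coe_circlePoint]
    push_cast
    rfl
  have hS : ∀ w, ∃ x : NNReal, S w = ((x : ℝ) : ℂ) := fun w => by
    obtain ⟨u, hu⟩ := exists_circlePoint_eq w.1
    obtain ⟨v, hv⟩ := exists_circlePoint_eq w.2
    refine ⟨g (u, v), ?_⟩
    rw [← hSg (u, v), hu, hv]
  have hG : ∀ w, (((S w).re.toNNReal : ℝ) : ℂ) = S w := fun w => by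
    obtain ⟨x, hx⟩ := hS w
    rw [hx]; simp
  have hGm : Measurable fun w => (S w).re.toNNReal :=
    (Complex.continuous_re.comp hSc).measurable.real_toNNReal
  refine ⟨fun w => (S w).re.toNNReal, hGm, fun w => ?_, hG, ?_⟩
  · calc (((S w).re.toNNReal : NNReal) : ℝ) ≤ ‖S w‖ := by
          rw [← hG w, Complex.norm_real]
          simp only [Complex.ofReal_re, Real.toNNReal_coe]
          exact le_abs_self _
      _ ≤ _ := tsum_of_norm_bounded hc.hasSum fun q => hSn q w
  · have hcp : Measurable fun p : ℝ × ℝ => (circlePoint p.1, circlePoint p.2) :=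
      (continuous_circlePoint.measurable.comp measurable_fst).prodMk
        (continuous_circlePoint.measurable.comp measurable_snd)
    have hgS : ∀ p : ℝ × ℝ, g p = (S (circlePoint p.1, circlePoint p.2)).re.toNNReal := fun p => by
      rw [hSg]; simp
    rw [hμ, ← map_circlePoint_square]
    ext s hs
    rw [Measure.map_apply hcp hs, withDensity_apply _ (hcp hs), withDensity_apply _ hs,
      setLIntegral_map hs hGm.coe_nnreal_ennreal hcp]
    simp_rw [hgS]

lemma integral_map_eval_pair (hz : Measurable z) (j l : Fin d) {F : Circle × Circle → ℂ}
    (hF : Measurable F) :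
    ∫ w, F (w j, w l) ∂(Q.map z) = ∫ p, F p ∂(Q.map fun ω => (z ω j, z ω l)) := by
  have hjl : Measurable fun w : Fin d → Circle => (w j, w l) :=
    (measurable_pi_apply j).prodMk (measurable_pi_apply l)
  have h1 : Q.map (fun ω => (z ω j, z ω l)) = (Q.map z).map fun w => (w j, w l) :=
    (Measure.map_map hjl hz).symm
  rw [h1, integral_map hjl.aemeasurable hF.aestronglyMeasurable]

/-- The density is bounded by the sum of the absolute values of its Fourier coefficients. -/
lemma EquidistributionHypotheses.of_pairwiseSummableDensity [IsProbabilityMeasure Q]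
    (hf : ∀ j, IsRealAnalyticOnCircle (f j)) (hf0 : ∀ j, f j ≠ 0) (hz : Measurable z) (hd : 2 ≤ d)
    (h : PairwiseSummableDensity Q z) : EquidistributionHypotheses f φ (Q.map z) := by
  have : IsProbabilityMeasure (Q.map z) := Measure.isProbabilityMeasure_map hz.aemeasurable
  have hpair : ∀ j l, j ≠ l → ∃ (B : ENNReal) (c : ℤ × ℤ → ℂ), B ≠ ⊤ ∧
      (Q.map z).map (fun w => w j) ≤ B • uniformCircle ∧ (Summable fun q => ‖c q‖) ∧
      ∀ a b : ℤ, ∫ w, ((w j ^ a * w l ^ b : Circle) : ℂ) ∂(Q.map z) = c (-a, -b) := by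
    intro j l hjl
    obtain ⟨g, c, hc, hg, hμ⟩ := h j l hjl
    obtain ⟨G, hGm, hGb, hG, hμ⟩ := exists_density_torus hc hg hμ
    have hzjl : Measurable fun ω => (z ω j, z ω l) :=
      ((measurable_pi_apply j).comp hz).prodMk ((measurable_pi_apply l).comp hz)
    refine ⟨ENNReal.ofReal (∑' q, ‖c q‖), c, ENNReal.ofReal_ne_top, ?_, hc, fun a b => ?_⟩
    · have h1 : (Q.map z).map (fun w => w j) = (Q.map fun ω => (z ω j, z ω l)).map Prod.fst := by
        rw [Measure.map_map (measurable_pi_apply j) hz, Measure.map_map measurable_fst hzjl]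
        rfl
      have h2 : ((uniformCircle.prod uniformCircle).withDensity fun w => (G w : ENNReal))
          ≤ ENNReal.ofReal (∑' q, ‖c q‖) • uniformCircle.prod uniformCircle := by
        rw [← withDensity_const]
        refine withDensity_mono (ae_of_all _ fun w => ?_)
        simp only [← ENNReal.ofReal_coe_nnreal]
        exact ENNReal.ofReal_le_ofReal (hGb w)
      rw [h1, hμ]
      refine (Measure.map_mono h2 measurable_fst).trans (le_of_eq ?_)
      rw [Measure.map_smul, Measure.map_fst_prod, measure_univ, one_smul]
    · rw [← integral_zpow_withDensity hc hGm hG a b, ← hμ]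
      have h1 : Continuous fun w : Circle × Circle => w.1 ^ a * w.2 ^ b :=
        (continuous_fst.zpow a).mul (continuous_snd.zpow b)
      have h2 : Measurable fun w : Circle × Circle => ((w.1 ^ a * w.2 ^ b : Circle) : ℂ) :=
        Measurable.comp (g := fun c : Circle => (c : ℂ)) (by fun_prop) h1.measurable
      exact integral_map_eval_pair hz j l h2
  have hne : ∀ j : Fin d, ∃ l, j ≠ l := fun j => by
    have : Nontrivial (Fin d) := Fin.nontrivial_iff_two_le.2 hd
    obtain ⟨l, hl⟩ := exists_ne j
    exact ⟨l, hl.symm⟩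
  refine .of_summable hf hf0 (fun j => ?_) (fun j => ?_) fun j l hjl => ?_
  · obtain ⟨l, hjl⟩ := hne j
    obtain ⟨B, -, hB, hB', -⟩ := hpair j l hjl
    exact ⟨B, hB, hB'⟩
  · obtain ⟨l, hjl⟩ := hne j
    obtain ⟨-, c, -, -, hc, h1⟩ := hpair j l hjl
    have hinj : Function.Injective fun a : ℤ => ((-a, -0) : ℤ × ℤ) := fun a b hab => by
      simpa using hab
    refine (hc.comp_injective hinj).congr fun a => ?_
    have h2 := h1 a 0
    simp_rw [zpow_zero, mul_one] at h2
    rw [h2]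
    rfl
  · obtain ⟨-, c, -, -, hc, h1⟩ := hpair j l hjl
    have hinj : Function.Injective fun q : ℤ × ℤ => ((-q.1, -q.2) : ℤ × ℤ) := fun q q' hq => by
      simpa [Prod.ext_iff] using hq
    refine (hc.comp_injective hinj).congr fun q => ?_
    rw [h1]
    rfl

end SummableDensity

/-! ### Points of finite type -/

section FiniteType

lemma norm_one_sub_circlePoint (t : ℝ) : ‖1 - (circlePoint t : ℂ)‖ = 2 * |sin (π * t)| := by
  have h := Complex.norm_exp_I_mul_ofReal_sub_one (2 * π * t)
  rw [norm_sub_rev, coe_circlePoint]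
  rw [show (2 * π * Complex.I * t : ℂ) = Complex.I * ((2 * π * t : ℝ) : ℂ) by push_cast; ring, h,
    Real.norm_eq_abs, abs_mul, abs_two]
  congr 3
  ring

lemma norm_one_sub_circlePoint_eq (t : ℝ) :
    ‖1 - (circlePoint t : ℂ)‖ = 2 * |sin (π * (t - round t))| := by
  rw [norm_one_sub_circlePoint, mul_sub, mul_comm π (round t : ℝ), Real.sin_sub_int_mul_pi, abs_mul,
    abs_zpow, abs_neg, abs_one, one_zpow, one_mul]

lemma four_mul_abs_sub_round_le (t : ℝ) : 4 * |t - round t| ≤ ‖1 - (circlePoint t : ℂ)‖ := by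
  rw [norm_one_sub_circlePoint_eq]
  have h1 := abs_sub_round t
  have h2 : |π * (t - round t)| ≤ π / 2 := by
    rw [abs_mul, abs_of_pos Real.pi_pos]
    nlinarith [Real.pi_pos]
  have h3 := Real.mul_abs_le_abs_sin h2
  rw [abs_mul, abs_of_pos Real.pi_pos, ← mul_assoc, div_mul_cancel₀ _ Real.pi_ne_zero] at h3
  linarith

/-- `φ` is of finite type in dimension one, with an explicit constant and exponent. -/
def IsDiophantine (K γ φ : ℝ) : Prop :=
  ∀ q : ℤ, q ≠ 0 → K * |(q : ℝ)| ^ (-γ) ≤ |q * φ - round (q * φ)|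

lemma IsFiniteType.isDiophantine {φ₁ φ₂ : ℝ} (h : IsFiniteType ![φ₁, φ₂]) :
    ∃ K γ : ℝ, 0 < K ∧ 1 ≤ γ ∧ IsDiophantine K γ φ₁ := by
  obtain ⟨K, hK, γ, hγ, h⟩ := h
  refine ⟨K, γ, hK, hγ, fun q hq => ?_⟩
  have h1 := h ![q, 0] fun h0 => hq (by simpa using congrFun h0 0)
  have h2 : ‖(![q, 0] : Fin 2 → ℤ)‖ = |(q : ℝ)| := by
    refine le_antisymm ((pi_norm_le_iff_of_nonneg (abs_nonneg _)).2 fun i => ?_) ?_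
    · fin_cases i <;> simp [Int.norm_eq_abs]
    · simpa [Int.norm_eq_abs] using norm_le_pi_norm (![q, 0] : Fin 2 → ℤ) 0
  rw [h2, div_eq_mul_inv, ← Real.rpow_neg (abs_nonneg _)] at h1
  simpa using h1

lemma IsDiophantine.int_mul {K γ φ : ℝ} (h : IsDiophantine K γ φ) {N : ℤ} (hN : N ≠ 0) :
    IsDiophantine (K * |(N : ℝ)| ^ (-γ)) γ (N * φ) := by
  intro q hq
  have h1 := h (q * N) (mul_ne_zero hq hN)
  push_cast at h1
  rw [abs_mul, Real.mul_rpow (abs_nonneg _) (abs_nonneg _), mul_assoc (q : ℝ)] at h1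
  refine le_trans (le_of_eq ?_) h1
  ring

/-- Natural numbers up to `n`, at least `g` and with gaps at least `g`, number at most `n / g`. -/
lemma card_mul_le_of_gaps {g : ℝ} (A : Finset ℕ) (hA : ∀ a ∈ A, g ≤ a)
    (hgap : ∀ a ∈ A, ∀ b ∈ A, a < b → g ≤ (b : ℝ) - a) {n : ℕ} (hn : ∀ a ∈ A, a ≤ n) :
    A.card * g ≤ n := by
  induction A using Finset.induction_on_max generalizing n with
  | empty => simp
  | insert b A hlt ih =>
    have hb : b ∉ A := fun h => lt_irrefl _ (hlt b h)
    rw [Finset.card_insert_of_notMem hb]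
    have hbn : (b : ℝ) ≤ n := by exact_mod_cast hn b (Finset.mem_insert_self _ _)
    rcases A.eq_empty_or_nonempty with rfl | hne
    · have := hA b (Finset.mem_insert_self _ _)
      simp only [Finset.card_empty, zero_add, Nat.cast_one, one_mul]
      linarith
    · have h1 := ih (fun a ha => hA a (Finset.mem_insert_of_mem ha))
        (fun a ha c hc => hgap a (Finset.mem_insert_of_mem ha) c (Finset.mem_insert_of_mem hc))
        (n := A.max' hne) fun a ha => A.le_max' a ha
      have h2 := hgap _ (Finset.mem_insert_of_mem (A.max'_mem hne)) b (Finset.mem_insert_self _ _)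
        (hlt _ (A.max'_mem hne))
      push_cast
      linarith

/-- The number of `m ≤ n` for which `m ψ` is within `δ` of an integer: the gaps between such `m` are
at least `(2 δ / K) ^ (-1 / γ)`. -/
lemma IsDiophantine.card_le {K γ ψ : ℝ} (hK : 0 < K) (hγ : 1 ≤ γ) (h : IsDiophantine K γ ψ) {δ : ℝ}
    (hδ : 0 < δ) (n : ℕ) :
    (((Finset.Icc 1 n).filter fun m : ℕ => |m * ψ - round (m * ψ)| ≤ δ).card : ℝ)
      ≤ n * (2 * δ / K) ^ γ⁻¹ := by
  have hγ0 : 0 < γ := by linarith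
  set g : ℝ := (2 * δ / K) ^ (-γ⁻¹) with hg
  have hgpos : 0 < g := by positivity
  -- a multiple of `ψ` within `2 δ` of an integer has index at least `g`
  have key : ∀ q : ℤ, 0 < q → ∀ k : ℤ, |q * ψ - k| ≤ 2 * δ → g ≤ q := by
    intro q hq k hk
    have hq' : (0 : ℝ) < q := by exact_mod_cast hq
    have h1 := (h q hq.ne').trans ((round_le (q * ψ) k).trans hk)
    rw [abs_of_pos hq'] at h1
    have h2 : (q : ℝ) ^ (-γ) ≤ 2 * δ / K := by rw [le_div_iff₀ hK]; linarith
    have h3 : (2 * δ / K) ^ (-γ⁻¹) ≤ ((q : ℝ) ^ (-γ)) ^ (-γ⁻¹) :=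
      Real.rpow_le_rpow_of_nonpos (by positivity) h2 (by simp [hγ0.le])
    rwa [← Real.rpow_mul hq'.le, neg_mul_neg, mul_inv_cancel₀ hγ0.ne', Real.rpow_one] at h3
  have h1 := card_mul_le_of_gaps (g := g)
    ((Finset.Icc 1 n).filter fun m : ℕ => |m * ψ - round (m * ψ)| ≤ δ) (fun a ha => ?_)
    (fun a ha b hb hab => ?_) (n := n) fun a ha => (Finset.mem_Icc.1 (Finset.mem_filter.1 ha).1).2
  · have h2 : (2 * δ / K) ^ γ⁻¹ = g⁻¹ := by rw [hg, Real.rpow_neg (by positivity), inv_inv]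
    rw [h2, ← div_eq_mul_inv, le_div_iff₀ hgpos]
    exact h1
  · obtain ⟨h1, h2⟩ := Finset.mem_filter.1 ha
    have := key a (by exact_mod_cast (Finset.mem_Icc.1 h1).1) _ (by push_cast; linarith)
    exact_mod_cast this
  · have h3 := (Finset.mem_filter.1 ha).2
    have h4 := (Finset.mem_filter.1 hb).2
    have := key ((b : ℤ) - a) (by omega) (round (b * ψ) - round (a * ψ)) (by
      push_cast
      calc |((b : ℝ) - a) * ψ - (round (b * ψ) - round (a * ψ))|
          = |(b * ψ - round (b * ψ)) - (a * ψ - round (a * ψ))| := by congr 1; ring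
        _ ≤ |b * ψ - round (b * ψ)| + |a * ψ - round (a * ψ)| := abs_sub _ _
        _ ≤ 2 * δ := by linarith)
    exact_mod_cast this

end FiniteType

section NegativeMoments

/-- The negative powers of small order of the distances from `m ψ` to the integers have bounded
means: the number of `m ≤ n` at distance at most `2 ^ (-k)` is `O(n 2 ^ (-k / γ))`, and one sums over
the dyadic scales `k`. -/
lemma IsDiophantine.exists_sum_rpow_le {K γ ψ : ℝ} (hK : 0 < K) (hγ : 1 ≤ γ)
    (h : IsDiophantine K γ ψ) {τ : ℝ} (hτ : 0 ≤ τ) (hτγ : τ < γ⁻¹) :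
    ∃ C : ℝ, 0 < C ∧ ∀ n : ℕ,
      ∑ m ∈ Finset.Icc 1 n, |m * ψ - round (m * ψ)| ^ (-τ) ≤ C * n := by
  set b : ℝ := 2 ^ τ with hb
  have hb0 : 0 < b := by positivity
  set s : ℝ := (1 / 2) ^ γ⁻¹ with hs
  have hs0 : 0 < s := by positivity
  have hr : b * s < 1 := by
    rw [hb, hs, one_div, Real.inv_rpow zero_le_two, ← div_eq_mul_inv, div_lt_one (by positivity)]
    exact Real.rpow_lt_rpow_of_exponent_lt one_lt_two hτγ
  set D : ℝ := b * (2 / K) ^ γ⁻¹ with hD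
  have hD0 : 0 < D := by positivity
  refine ⟨D * (1 - b * s)⁻¹, mul_pos hD0 (inv_pos.2 (by linarith)), fun n => ?_⟩
  rcases Nat.eq_zero_or_pos n with rfl | hn
  · simp
  have hn' : (0 : ℝ) < n := by exact_mod_cast hn
  have hlow : ∀ m ∈ Finset.Icc 1 n, K * (n : ℝ) ^ (-γ) ≤ |m * ψ - round (m * ψ)| := fun m hm => by
    obtain ⟨h1, h2⟩ := Finset.mem_Icc.1 hm
    have h3 := h m (by omega)
    have h1' : (0 : ℝ) < m := by exact_mod_cast h1
    simp only [Int.cast_natCast, abs_of_pos h1'] at h3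
    refine le_trans ?_ h3
    gcongr K * ?_
    exact Real.rpow_le_rpow_of_nonpos h1' (by exact_mod_cast h2) (by linarith)
  obtain ⟨N, hN⟩ := exists_pow_lt_of_lt_one (show 0 < K * (n : ℝ) ^ (-γ) by positivity)
    (show (1 / 2 : ℝ) < 1 by norm_num)
  have hterm : ∀ m ∈ Finset.Icc 1 n, |m * ψ - round (m * ψ)| ^ (-τ) ≤
      ∑ k ∈ Finset.range N, if |m * ψ - round (m * ψ)| ≤ (1 / 2) ^ k then b ^ (k + 1) else 0 := by
    intro m hm
    set u := |m * ψ - round (m * ψ)|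
    have hu : (1 / 2) ^ N < u := hN.trans_le (hlow m hm)
    have hu0 : 0 < u := lt_trans (by positivity) hu
    obtain ⟨k, hk1, hk2⟩ := exists_nat_pow_near_of_lt_one hu0
      ((abs_sub_round _).trans (by norm_num)) (show (0 : ℝ) < 1 / 2 by norm_num) (by norm_num)
    have hkN : k < N :=
      (pow_lt_pow_iff_right_of_lt_one₀ (by norm_num) (by norm_num)).1 (hu.trans_le hk2)
    have h1 : u ^ (-τ) ≤ b ^ (k + 1) := by
      calc u ^ (-τ) ≤ ((1 / 2 : ℝ) ^ (k + 1)) ^ (-τ) :=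
            Real.rpow_le_rpow_of_nonpos (by positivity) hk1.le (by linarith)
        _ = b ^ (k + 1) := by
            rw [Real.rpow_neg (by positivity), one_div, inv_pow, Real.inv_rpow (by positivity),
              inv_inv, hb, ← Real.rpow_natCast, ← Real.rpow_mul zero_le_two,
              ← Real.rpow_natCast, ← Real.rpow_mul zero_le_two, mul_comm]
    refine h1.trans ?_
    have h2 := Finset.single_le_sum (f := fun k => if u ≤ (1 / 2) ^ k then b ^ (k + 1) else 0)
      (fun k _ => by split_ifs <;> positivity) (Finset.mem_range.2 hkN)
    simpa only [if_pos hk2] using h2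
  calc ∑ m ∈ Finset.Icc 1 n, |m * ψ - round (m * ψ)| ^ (-τ)
      ≤ ∑ m ∈ Finset.Icc 1 n, ∑ k ∈ Finset.range N,
        if |m * ψ - round (m * ψ)| ≤ (1 / 2) ^ k then b ^ (k + 1) else 0 :=
        Finset.sum_le_sum hterm
    _ = ∑ k ∈ Finset.range N, (((Finset.Icc 1 n).filter
          fun m : ℕ => |m * ψ - round (m * ψ)| ≤ (1 / 2) ^ k).card : ℝ) * b ^ (k + 1) := by
        rw [Finset.sum_comm]
        refine Finset.sum_congr rfl fun k _ => ?_
        rw [← Finset.sum_filter, Finset.sum_const, nsmul_eq_mul]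
    _ ≤ ∑ k ∈ Finset.range N, n * D * (b * s) ^ k := by
        refine Finset.sum_le_sum fun k _ => ?_
        refine (mul_le_mul_of_nonneg_right (h.card_le hK hγ (δ := (1 / 2) ^ k) (by positivity) n)
          (by positivity)).trans (le_of_eq ?_)
        have h3 : (2 * (1 / 2 : ℝ) ^ k / K) ^ γ⁻¹ = (2 / K) ^ γ⁻¹ * s ^ k := by
          rw [mul_div_right_comm, Real.mul_rpow (by positivity) (by positivity), hs,
            ← Real.rpow_natCast, ← Real.rpow_mul (by positivity), ← Real.rpow_natCast,
            ← Real.rpow_mul (by positivity), mul_comm (k : ℝ)]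
        rw [h3, hD, mul_pow]
        ring
    _ ≤ n * D * (1 - b * s)⁻¹ := by
        rw [← Finset.mul_sum]
        gcongr
        rw [← tsum_geometric_of_lt_one (by positivity) hr]
        exact (summable_geometric_of_lt_one (by positivity) hr).sum_le_tsum _
          fun k _ => by positivity
    _ = _ := by ring

lemma norm_one_sub_pow_le (w : Circle) (n : ℕ) :
    ‖1 - ((w ^ n : Circle) : ℂ)‖ ≤ n * ‖1 - (w : ℂ)‖ := by
  induction n with
  | zero => simp
  | succ n ih =>
    have h : 1 - ((w ^ (n + 1) : Circle) : ℂ)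
        = (1 - ((w ^ n : Circle) : ℂ)) + ((w ^ n : Circle) : ℂ) * (1 - (w : ℂ)) := by
      rw [pow_succ, Circle.coe_mul]; ring
    rw [h]
    refine (norm_add_le _ _).trans ?_
    rw [norm_mul, Circle.norm_coe, one_mul, Nat.cast_add_one, add_mul, one_mul]
    linarith

lemma norm_one_sub_circle_le (w : Circle) : ‖1 - (w : ℂ)‖ ≤ 2 := by
  refine (norm_sub_le _ _).trans ?_
  rw [Circle.norm_coe, norm_one]
  norm_num

/-- A nonzero real analytic function whose zeros are roots of unity is bounded below by a power of
`|1 - w ^ R|`. -/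
lemma exists_mul_norm_one_sub_pow_le {g : Circle → ℂ} (hg : IsRealAnalyticOnCircle g) (hg0 : g ≠ 0)
    (hz : ZerosAreRootsOfUnity g) :
    ∃ (R k : ℕ) (c : ℝ), 0 < R ∧ 0 < c ∧
      ∀ w : Circle, c * (‖1 - ((w ^ R : Circle) : ℂ)‖ / 2) ^ k ≤ ‖g w‖ := by
  let p : Set ℝ → Prop := fun s => ∃ (R k : ℕ) (c : ℝ), 0 < R ∧ 0 < c ∧ ∀ t ∈ s,
    c * (‖1 - ((circlePoint t ^ R : Circle) : ℂ)‖ / 2) ^ k ≤ ‖g (circlePoint t)‖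
  -- the exponents from finitely many neighbourhoods are combined by compactness, with `R` a common
  -- multiple
  have hp : p (Set.Icc 0 1) := by
    refine isCompact_Icc.induction_on ⟨1, 0, 1, one_pos, one_pos, by simp⟩ ?_ ?_ ?_
    · rintro s t hst ⟨R, k, c, hR, hc, h⟩
      exact ⟨R, k, c, hR, hc, fun x hx => h x (hst hx)⟩
    · rintro s t ⟨R₁, k₁, c₁, hR₁, hc₁, h₁⟩ ⟨R₂, k₂, c₂, hR₂, hc₂, h₂⟩
      have hstep : ∀ (R R' k k' : ℕ) (c : ℝ) (w : Circle), 0 < R' → 0 < c →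
          min (c₁ / R₂ ^ k₁) (c₂ / R₁ ^ k₂) ≤ c / R' ^ k →
          c * (‖1 - ((w ^ R : Circle) : ℂ)‖ / 2) ^ k ≤ ‖g w‖ →
          min (c₁ / R₂ ^ k₁) (c₂ / R₁ ^ k₂) * (‖1 - ((w ^ (R * R') : Circle) : ℂ)‖ / 2) ^ (k + k')
            ≤ ‖g w‖ := by
        intro R R' k k' c w hR' hc hmin hw
        set y := ‖1 - ((w ^ (R * R') : Circle) : ℂ)‖ / 2
        have hy0 : 0 ≤ y := by positivity
        have hy1 : y ≤ 1 := by
          have := norm_one_sub_circle_le (w ^ (R * R'))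
          simp only [y]; linarith
        have hy2 : y / R' ≤ ‖1 - ((w ^ R : Circle) : ℂ)‖ / 2 := by
          have := norm_one_sub_pow_le (w ^ R) R'
          rw [← pow_mul] at this
          rw [div_le_iff₀ (by exact_mod_cast hR')]
          simp only [y]; linarith
        calc _ ≤ c / R' ^ k * y ^ (k + k') := by gcongr
          _ ≤ c / R' ^ k * y ^ k := by
              gcongr ?_ * ?_
              exact pow_le_pow_of_le_one hy0 hy1 (Nat.le_add_right _ _)
          _ = c * (y / R') ^ k := by rw [div_pow y, div_mul_eq_mul_div, mul_div_assoc]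
          _ ≤ c * (‖1 - ((w ^ R : Circle) : ℂ)‖ / 2) ^ k := by gcongr
          _ ≤ _ := hw
      refine ⟨R₁ * R₂, k₁ + k₂, min (c₁ / R₂ ^ k₁) (c₂ / R₁ ^ k₂), by positivity,
        by positivity, fun x hx => ?_⟩
      rcases hx with hx | hx
      · exact hstep R₁ R₂ k₁ k₂ c₁ _ hR₂ hc₁ (min_le_left _ _) (h₁ x hx)
      · rw [mul_comm R₁, add_comm k₁]
        exact hstep R₂ R₁ k₂ k₁ c₂ _ hR₁ hc₂ (min_le_right _ _) (h₂ x hx)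
    · intro t₀ _
      by_cases h0 : g (circlePoint t₀) = 0
      · obtain ⟨R, hR, hwR⟩ := hz _ h0
        have hh0 : (fun s => g (circlePoint s)) ≠ 0 := fun h => hg0 (funext fun w => by
          obtain ⟨t, rfl⟩ := exists_circlePoint_eq w
          exact congrFun h t)
        obtain ⟨k, c, hc, h⟩ := exists_mul_abs_sub_pow_le hg hh0 t₀
        refine ⟨_, mem_nhdsWithin_of_mem_nhds h, R, k, c / (π * R) ^ k, hR, by positivity,
          fun t ht => le_trans ?_ ht⟩
        have h1 : circlePoint t ^ R = circlePoint (R * (t - t₀)) := by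
          have h2 : circlePoint t = circlePoint (t - t₀) * circlePoint t₀ := by
            rw [← circlePoint_add, sub_add_cancel]
          rw [h2, mul_pow, hwR, mul_one, circlePoint_pow]
        have h2 : ‖1 - ((circlePoint t ^ R : Circle) : ℂ)‖ / 2 ≤ π * R * |t - t₀| := by
          rw [h1, norm_one_sub_circlePoint, mul_div_cancel_left₀ _ two_ne_zero]
          refine Real.abs_sin_le_abs.trans (le_of_eq ?_)
          rw [abs_mul, abs_mul, abs_of_pos Real.pi_pos, Nat.abs_cast, mul_assoc]
        calc c / (π * R) ^ k * (‖1 - ((circlePoint t ^ R : Circle) : ℂ)‖ / 2) ^ k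
            ≤ c / (π * R) ^ k * (π * R * |t - t₀|) ^ k := by gcongr
          _ = c * |t - t₀| ^ k := by
              rw [mul_pow (π * R)]
              field_simp
      · have h1 : ∀ᶠ t in nhds t₀, ‖g (circlePoint t₀)‖ / 2 < ‖g (circlePoint t)‖ :=
          ((hg t₀).continuousAt.norm).eventually (lt_mem_nhds (half_lt_self (norm_pos_iff.2 h0)))
        refine ⟨_, mem_nhdsWithin_of_mem_nhds h1, 1, 0, ‖g (circlePoint t₀)‖ / 2, one_pos,
          half_pos (norm_pos_iff.2 h0), fun t ht => ?_⟩
        rw [pow_zero, mul_one]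
        exact le_of_lt ht
  obtain ⟨R, k, c, hR, hc, h⟩ := hp
  refine ⟨R, k, c, hR, hc, fun w => ?_⟩
  obtain ⟨t, rfl⟩ := exists_circlePoint_eq w
  have h1 : circlePoint t = circlePoint (Int.fract t) := by
    have h2 : circlePoint (⌊t⌋ : ℝ) = 1 := by
      rw [← mul_one (⌊t⌋ : ℝ), ← circlePoint_zpow, circlePoint_one, one_zpow]
    rw [← Int.floor_add_fract t, circlePoint_add, h2, one_mul, Int.floor_add_fract]
  rw [h1]
  exact h _ ⟨Int.fract_nonneg t, (Int.fract_lt_one t).le⟩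

end NegativeMoments

/-! ### Laws on roots of unity and rotations of finite type -/

section RootsOfUnity

/-- If a power of `X` is almost surely equal to `v ≠ 1`, then the mean of `X` is bounded away from
`1`: the real part of `1 - X` is `|1 - X| ^ 2 / 2`. -/
lemma norm_one_sub_integral_ge {Ω : Type*} [MeasurableSpace Ω] {μ : Measure Ω}
    [IsProbabilityMeasure μ] {X : Ω → Circle} (hX : Measurable X) {N : ℕ} (hN : 0 < N) {v : Circle}
    (h : ∀ᵐ ω ∂μ, X ω ^ N = v) :
    (‖1 - (v : ℂ)‖ / N) ^ 2 / 2 ≤ ‖1 - ∫ ω, (X ω : ℂ) ∂μ‖ := by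
  have hN' : (0 : ℝ) < N := by exact_mod_cast hN
  have hint : Integrable (fun ω => (X ω : ℂ)) μ :=
    Integrable.of_bound (Measurable.comp (g := fun c : Circle => (c : ℂ)) (by fun_prop)
      hX).aestronglyMeasurable 1 (ae_of_all _ fun ω => (Circle.norm_coe _).le)
  have hint1 : Integrable (fun ω => 1 - (X ω : ℂ)) μ := (integrable_const 1).sub hint
  have h1 : 1 - ∫ ω, (X ω : ℂ) ∂μ = ∫ ω, (1 - (X ω : ℂ)) ∂μ := by
    rw [integral_sub (integrable_const 1) hint]
    simp
  have hre : ∀ w : Circle, (1 - (w : ℂ)).re = ‖1 - (w : ℂ)‖ ^ 2 / 2 := fun w => by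
    have h2 : Complex.normSq (w : ℂ) = 1 := Circle.normSq_coe w
    rw [← Complex.normSq_eq_norm_sq, Complex.normSq_sub, h2]
    simp
    ring
  have h3 : (∫ ω, (1 - (X ω : ℂ)) ∂μ).re = ∫ ω, (1 - (X ω : ℂ)).re ∂μ :=
    (Complex.reCLM.integral_comp_comm hint1).symm
  have h4 : ∫ _, (‖1 - (v : ℂ)‖ / N) ^ 2 / 2 ∂μ ≤ ∫ ω, (1 - (X ω : ℂ)).re ∂μ := by
    refine integral_mono_ae (integrable_const _) hint1.re ?_
    filter_upwards [h] with ω hω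
    have h5 := norm_one_sub_pow_le (X ω) N
    rw [hω] at h5
    simp only [hre]
    gcongr
    rwa [div_le_iff₀' hN']
  rw [integral_const, probReal_univ, one_smul, ← h3, ← h1] at h4
  exact h4.trans (Complex.re_le_norm _)

variable {d : ℕ} {φ : Fin d → ℝ} {ν : Measure (Fin d → Circle)} [IsProbabilityMeasure ν]

/-- The products of roots of unity are roots of unity, so that the power `w_j ^ r` is deterministic
under the rotated laws. -/
lemma ae_rotatedLaw_pow_eq {j : Fin d} {r : ℕ} (h : ∀ᵐ w ∂ν, w j ^ r = 1) (m : ℕ) :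
    ∀ᵐ w ∂rotatedLaw φ ν m, w j ^ r = circlePoint (φ j) ^ (m * r) := by
  have hpow : ∀ x : Circle, MeasurableSet {w : Fin d → Circle | w j ^ r = x} := fun x =>
    (isClosed_singleton.preimage ((continuous_apply j).pow r)).measurableSet
  have hrot : MeasurableSet {t : Fin d → Circle |
      (circlePoint (φ j) ^ m * t j) ^ r = circlePoint (φ j) ^ (m * r)} :=
    (isClosed_singleton.preimage
      ((continuous_const.mul (continuous_apply j)).pow r)).measurableSet
  rw [rotatedLaw, ae_map_iff (measurable_rotate φ m).aemeasurable (hpow _), productLaw,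
    ae_map_iff measurable_prodCircle.aemeasurable hrot]
  have h1 : ∀ i : Fin m, ∀ᵐ y ∂Measure.pi (fun _ : Fin m => ν), y i j ^ r = 1 := fun i =>
    (measurePreserving_eval (fun _ : Fin m => ν) i).quasiMeasurePreserving.ae h
  filter_upwards [ae_all_iff.2 h1] with y hy
  rw [mul_pow, ← pow_mul, ← Finset.prod_pow, Finset.prod_congr rfl fun i _ => hy i,
    Finset.prod_const_one, mul_one]

/-- If `w_j ^ r = 1` almost surely, then `w_j ^ (r R)` is the deterministic point `e^{2πimψ}`,
`ψ = r R φ_j`, under the law with index `m`, and `|g|` is bounded below by a power of the distance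
from `m ψ` to the integers. -/
lemma hasNegativeMoments_of_pow_eq_one {j : Fin d} {r : ℕ} (hr : 0 < r)
    (h : ∀ᵐ w ∂ν, w j ^ r = 1) {K γ : ℝ} (hK : 0 < K) (hγ : 1 ≤ γ) (hφ : IsDiophantine K γ (φ j))
    {g : Circle → ℂ} (hg : IsRealAnalyticOnCircle g) (hg0 : g ≠ 0) (hz : ZerosAreRootsOfUnity g) :
    HasNegativeMoments (fun m => (rotatedLaw φ ν m).map fun w => w j) g := by
  have hγ0 : 0 < γ := by linarith
  obtain ⟨R, k, c, hR, hc, hgc⟩ := exists_mul_norm_one_sub_pow_le hg hg0 hz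
  have hr' : (0 : ℝ) < r := by exact_mod_cast hr
  set N : ℤ := ((r * R : ℕ) : ℤ) with hN
  have hN0 : N ≠ 0 := by positivity
  set ψ : ℝ := N * φ j with hψ
  have hψD : IsDiophantine (K * |(N : ℝ)| ^ (-γ)) γ ψ := hφ.int_mul hN0
  have hN' : 0 < |(N : ℝ)| := abs_pos.2 (Int.cast_ne_zero.2 hN0)
  have hK' : 0 < K * |(N : ℝ)| ^ (-γ) := by positivity
  set c' : ℝ := c / r ^ k with hc'
  have hc'0 : 0 < c' := by positivity
  -- lower bound for `|g|` on the support of the law with index `m`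
  have hlow : ∀ m : ℕ, ∀ᵐ w ∂rotatedLaw φ ν m, c' * |m * ψ - round (m * ψ)| ^ k ≤ ‖g (w j)‖ := by
    intro m
    filter_upwards [ae_rotatedLaw_pow_eq (φ := φ) h m] with w hw
    refine le_trans ?_ (hgc (w j))
    have h1 : (w j ^ R) ^ r = circlePoint (m * ψ) := by
      rw [← pow_mul, mul_comm R, pow_mul, hw, ← pow_mul, circlePoint_pow, hψ, hN]
      congr 1
      push_cast
      ring
    have h2 := norm_one_sub_pow_le (w j ^ R) r
    rw [h1] at h2
    have h3 := four_mul_abs_sub_round_le (m * ψ)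
    have h4 : |m * ψ - round (m * ψ)| / r ≤ ‖1 - ((w j ^ R : Circle) : ℂ)‖ / 2 := by
      rw [div_le_div_iff₀ hr' two_pos]
      have := abs_nonneg (m * ψ - round (m * ψ))
      linarith
    calc c' * |m * ψ - round (m * ψ)| ^ k = c * (|m * ψ - round (m * ψ)| / r) ^ k := by
          rw [hc', div_pow, div_mul_eq_mul_div, mul_div_assoc]
      _ ≤ _ := by gcongr
  -- this choice gives `k κ < 1 / γ`
  refine ⟨(γ * (k + 1))⁻¹, by positivity, fun κ hκ hκ' => ?_⟩
  have hτ : k * κ < γ⁻¹ := by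
    have h1 : ((k : ℝ) + 1) * κ ≤ γ⁻¹ := by
      calc ((k : ℝ) + 1) * κ ≤ (k + 1) * (γ * (k + 1))⁻¹ := by gcongr
        _ = γ⁻¹ := by rw [mul_inv]; field_simp
    linarith
  obtain ⟨C, hC, hsum⟩ := hψD.exists_sum_rpow_le hK' hγ (τ := k * κ) (by positivity) hτ
  refine ⟨c' ^ (-κ) * C, by positivity, fun n => ?_⟩
  have hm : Measurable fun w => ‖g w‖ₑ ^ (-κ) := hg.continuous.measurable.enorm.pow_const _
  have hterm : ∀ i : ℕ, ∫⁻ w, ‖g w‖ₑ ^ (-κ) ∂((rotatedLaw φ ν (i + 1)).map fun w => w j) ≤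
      ENNReal.ofReal (c' ^ (-κ) *
        |((i + 1 : ℕ) : ℝ) * ψ - round (((i + 1 : ℕ) : ℝ) * ψ)| ^ (-(k * κ))) := by
    intro i
    set u := |((i + 1 : ℕ) : ℝ) * ψ - round (((i + 1 : ℕ) : ℝ) * ψ)| with hu
    have hu0 : 0 < u := by
      have h1 := hψD ((i + 1 : ℕ) : ℤ) (by positivity)
      rw [Int.cast_natCast] at h1
      refine lt_of_lt_of_le ?_ h1
      have : 0 < |((i + 1 : ℕ) : ℝ)| := by positivity
      positivity
    rw [lintegral_map hm (measurable_pi_apply j)]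
    calc ∫⁻ w, ‖g (w j)‖ₑ ^ (-κ) ∂rotatedLaw φ ν (i + 1)
        ≤ ∫⁻ _, ENNReal.ofReal ((c' * u ^ k) ^ (-κ)) ∂rotatedLaw φ ν (i + 1) :=
          lintegral_mono_ae ((hlow (i + 1)).mono fun w hw =>
            enorm_rpow_neg_le hκ (by positivity) hw)
      _ = ENNReal.ofReal (c' ^ (-κ) * u ^ (-(k * κ))) := by
          rw [lintegral_const, measure_univ, mul_one, Real.mul_rpow hc'0.le (by positivity),
            ← Real.rpow_natCast, ← Real.rpow_mul hu0.le, mul_neg]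
  calc _ ≤ ∑ i ∈ Finset.range n, ENNReal.ofReal (c' ^ (-κ) *
        |((i + 1 : ℕ) : ℝ) * ψ - round (((i + 1 : ℕ) : ℝ) * ψ)| ^ (-(k * κ))) :=
        Finset.sum_le_sum fun i _ => hterm i
    _ = ENNReal.ofReal (c' ^ (-κ) *
        ∑ m ∈ Finset.Icc 1 n, |m * ψ - round (m * ψ)| ^ (-(k * κ))) := by
        rw [← ENNReal.ofReal_sum_of_nonneg fun i _ => by positivity, ← Finset.mul_sum]
        congr 2
        rw [Finset.range_eq_Ico, Finset.sum_Ico_add' (fun m : ℕ => |m * ψ - round (m * ψ)| ^ (-(k * κ))) 0 n 1]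
        rfl
    _ ≤ _ := by
        refine ENNReal.ofReal_le_ofReal ?_
        rw [mul_assoc]
        gcongr
        exact hsum n

/-- When the `z_j` are roots of unity, the equidistribution comes from the rotation: the `R`-th power
of a character of `x z`, `R = r_j r_l`, is that of `x`, which the finite type condition keeps away
from `1`. -/
lemma EquidistributionHypotheses.of_pow_eq_one {f : Fin d → Circle → ℂ} (hd : 2 ≤ d)
    (hf : ∀ j, IsRealAnalyticOnCircle (f j)) (hf0 : ∀ j, f j ≠ 0)
    (hz : ∀ j, ZerosAreRootsOfUnity (f j)) (hφ : PairwiseFiniteType φ) {r : Fin d → ℕ}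
    (hr : ∀ j, 0 < r j) (h : ∀ j, ∀ᵐ w ∂ν, w j ^ r j = 1) : EquidistributionHypotheses f φ ν := by
  have hD : ∀ j, ∃ K γ : ℝ, 0 < K ∧ 1 ≤ γ ∧ IsDiophantine K γ (φ j) := fun j => by
    have : Nontrivial (Fin d) := Fin.nontrivial_iff_two_le.2 hd
    obtain ⟨l, hl⟩ := exists_ne j
    exact (hφ j l hl.symm).isDiophantine
  have hfactor : ∀ (j l : Fin d) (a b : ℤ),
      (‖1 - (circlePoint ((r j * r l : ℕ) * (a * φ j + b * φ l)) : ℂ)‖ / (r j * r l : ℕ)) ^ 2 / 2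
        ≤ ‖1 - characterFactor φ ν j l a b‖ := by
    intro j l a b
    have h1 : characterFactor φ ν j l a b = ∫ w, ((circlePoint (φ j) ^ a * circlePoint (φ l) ^ b *
        pairCharacter j l a b w : Circle) : ℂ) ∂ν := by
      rw [characterFactor, ← integral_const_mul]
      refine integral_congr_ae (ae_of_all _ fun w => ?_)
      exact (Circle.coe_mul _ _).symm
    rw [h1]
    refine norm_one_sub_integral_ge (measurable_const.mul (measurable_pairCharacter j l a b))
      (Nat.mul_pos (hr j) (hr l)) ?_
    filter_upwards [h j, h l] with w hj hl
    have h2 : pairCharacter j l a b w ^ (r j * r l) = 1 := by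
      have e1 : (w j ^ a) ^ (r j * r l) = 1 := by
        rw [← zpow_natCast, ← zpow_mul, mul_comm a, zpow_mul, zpow_natCast, pow_mul, hj, one_pow,
          one_zpow]
      have e2 : (w l ^ b) ^ (r j * r l) = 1 := by
        rw [← zpow_natCast, ← zpow_mul, mul_comm b, zpow_mul, zpow_natCast, mul_comm (r j), pow_mul,
          hl, one_pow, one_zpow]
      change (w j ^ a * w l ^ b) ^ (r j * r l) = 1
      rw [mul_pow, e1, e2, one_mul]
    rw [Pi.mul_apply, mul_pow, h2, mul_one, circlePoint_zpow, circlePoint_zpow, ← circlePoint_add,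
      circlePoint_pow]
  refine ⟨fun j l hjl a b hab h1 => ?_, fun j => ?_, fun j => ?_⟩
  · have h2 := hfactor j l a b
    set R : ℕ := r j * r l with hR
    have hR0 : 0 < R := Nat.mul_pos (hr j) (hr l)
    have hR' : (0 : ℝ) < R := by exact_mod_cast hR0
    rw [h1, sub_self, norm_zero] at h2
    have h3 := four_mul_abs_sub_round_le (R * (a * φ j + b * φ l))
    obtain ⟨K, hK, γ, hγ, h4⟩ := hφ j l hjl
    have hq : ![R * a, R * b] ≠ (0 : Fin 2 → ℤ) := fun h0 => by
      have e1 : (R : ℤ) * a = 0 := by simpa using congrFun h0 0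
      have e2 : (R : ℤ) * b = 0 := by simpa using congrFun h0 1
      have hR1 : (R : ℤ) ≠ 0 := by exact_mod_cast hR0.ne'
      rcases hab with ha | hb
      · exact mul_ne_zero hR1 ha e1
      · exact mul_ne_zero hR1 hb e2
    have h5 := h4 _ hq
    have h6 : ∑ i, (((![R * a, R * b] : Fin 2 → ℤ) i : ℤ) : ℝ) * (![φ j, φ l] : Fin 2 → ℝ) i
        = R * (a * φ j + b * φ l) := by
      simp [Fin.sum_univ_two]
      ring
    rw [h6] at h5
    have h7 : 0 < K / ‖(![R * a, R * b] : Fin 2 → ℤ)‖ ^ γ := by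
      have := norm_pos_iff.2 hq
      positivity
    have h8 : 0 < ‖1 - (circlePoint (R * (a * φ j + b * φ l)) : ℂ)‖ := by linarith
    have h9 : 0 < (‖1 - (circlePoint (R * (a * φ j + b * φ l)) : ℂ)‖ / R) ^ 2 / 2 := by positivity
    linarith
  · obtain ⟨K, γ, hK, hγ, hφj⟩ := hD j
    set R : ℕ := r j * r j with hR
    have hR0 : 0 < R := Nat.mul_pos (hr j) (hr j)
    have hR' : (0 : ℝ) < R := by exact_mod_cast hR0
    have hψ := hφj.int_mul (N := (R : ℤ)) (by exact_mod_cast hR0.ne')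
    set K' : ℝ := K * |((R : ℤ) : ℝ)| ^ (-γ) with hK'
    have hK'0 : 0 < K' := by
      have : 0 < |((R : ℤ) : ℝ)| := abs_pos.2 (by exact_mod_cast hR0.ne')
      positivity
    refine ⟨(4 * K' / R) ^ 2 / 2, 2 * γ, by positivity, by linarith, fun a ha => ?_⟩
    refine le_trans ?_ (hfactor j j a 0)
    have h1 := four_mul_abs_sub_round_le (a * (((R : ℤ) : ℝ) * φ j))
    have h2 := hψ a ha
    have h3 : ((R : ℕ) : ℝ) * (a * φ j + ((0 : ℤ) : ℝ) * φ j) = a * (((R : ℤ) : ℝ) * φ j) := by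
      push_cast
      ring
    have ha' : 0 < |(a : ℝ)| := abs_pos.2 (Int.cast_ne_zero.2 ha)
    have h4 : |(a : ℝ)| ^ (-(2 * γ)) = (|(a : ℝ)| ^ (-γ)) ^ 2 := by
      rw [← Real.rpow_natCast, ← Real.rpow_mul ha'.le]
      congr 1
      push_cast
      ring
    rw [h3, h4]
    calc (4 * K' / R) ^ 2 / 2 * (|(a : ℝ)| ^ (-γ)) ^ 2
        = (4 * (K' * |(a : ℝ)| ^ (-γ)) / R) ^ 2 / 2 := by ring
      _ ≤ _ := by
        gcongr
        linarith
  · obtain ⟨K, γ, hK, hγ, hφj⟩ := hD j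
    exact hasNegativeMoments_of_pow_eq_one (hr j) (h j) hK hγ hφj (hf j) (hf0 j) (hz j)

end RootsOfUnity

lemma EquidistributionHypotheses.of_cltCondition {d : ℕ} {f : Fin d → Circle → ℂ} {φ : Fin d → ℝ}
    {Ω₀ : Type*} [MeasurableSpace Ω₀] {Q : Measure Ω₀} [IsProbabilityMeasure Q]
    {z : Ω₀ → Fin d → Circle} (hf : ∀ j, IsRealAnalyticOnCircle (f j)) (hf0 : ∀ j, f j ≠ 0)
    (hz : Measurable z) (h : CLTCondition Q z f φ) :
    EquidistributionHypotheses f φ (Q.map z) := by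
  have : IsProbabilityMeasure (Q.map z) := Measure.isProbabilityMeasure_map hz.aemeasurable
  have hae : ∀ (j : Fin d) (r : ℕ), (∀ᵐ ω ∂Q, z ω j ^ r = 1) → ∀ᵐ w ∂(Q.map z), w j ^ r = 1 :=
    fun j r hr => (ae_map_iff hz.aemeasurable
      (isClosed_singleton.preimage ((continuous_apply j).pow r)).measurableSet).2 hr
  rcases h with h | ⟨hd, h⟩ | ⟨hd, h1, hzero, hφ⟩ | ⟨hd, ⟨r, hr, h1, -⟩, hzero, hφ⟩
  · exact .of_independentUniform hf hf0 hz h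
  · exact .of_pairwiseSummableDensity hf hf0 hz hd h
  · exact .of_pow_eq_one hd hf hf0 hzero hφ (r := fun _ => 1) (fun _ => one_pos) fun j =>
      hae j 1 (by simpa only [pow_one] using h1 j)
  · exact .of_pow_eq_one hd hf hf0 hzero hφ hr fun j => hae j _ (h1 j)

end

theorem mainTheorem1 {d : ℕ} (θ : ℝ) (hθ : 0 < θ)
    -- nonzero real analytic functions on the circle
    (f : Fin d → Circle → ℂ) (hf : ∀ j, IsRealAnalyticOnCircle (f j)) (hf0 : ∀ j, f j ≠ 0)
    -- the points `x_j = e^{2πiφ_j}`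
    (φ : Fin d → ℝ) (hφ : LinearIndependent ℤ (Fin.cons 1 φ : Fin (d + 1) → ℝ))
    -- the random vector `z = (z_1, …, z_d)`
    {Ω₀ : Type*} [MeasurableSpace Ω₀] (Q : Measure Ω₀) [IsProbabilityMeasure Q]
    (z : Ω₀ → Fin d → Circle) (hz : Measurable z)
    (hcond : CLTCondition Q z f φ)
    -- for every `n`: an Ewens permutation `σ` of `n` letters, and independent vectors `T^{(m,k)}`,
    -- independent of `σ`, each `T^{(m,k)}` being distributed as a product of `m` i.i.d. copies of `z`
    {Ω : ℕ → Type*} [∀ n, MeasurableSpace (Ω n)] (P : ∀ n, Measure (Ω n))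
    [∀ n, IsProbabilityMeasure (P n)]
    (σ : ∀ n, Ω n → Equiv.Perm (Fin n)) (T : ∀ n, ℕ → ℕ → Ω n → Fin d → Circle)
    (hσ : ∀ n, HasLaw (σ n) (ewensMeasure θ n) (P n))
    (hT : ∀ n m k, HasLaw (T n m k) (productLaw (Q.map z) m) (P n))
    (hTindep : ∀ n, iIndepFun (fun (p : ℕ × ℕ) => T n p.1 p.2) (P n))
    (hTσ : ∀ n, IndepFun (σ n) (fun ω (p : ℕ × ℕ) => T n p.1 p.2 ω) (P n)) :
    ∃ N : ProbabilityMeasure (Fin d → ℂ), IsLimitLaw θ f (N : Measure (Fin d → ℂ)) ∧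
      TendstoInDistribution
        (fun (n : ℕ) (ω : Ω n) (j : Fin d) =>
          w2 (f j) (circlePoint (φ j)) (σ n ω) (fun m k => T n m k ω j) / (√(Real.log n) : ℂ)
            - θ * √(Real.log n) * meanLog (f j))
        atTop (fun y => y) P (N : Measure (Fin d → ℂ)) := by
  have hprob : IsProbabilityMeasure (Q.map z) := Measure.isProbabilityMeasure_map hz.aemeasurable
  have H := EquidistributionHypotheses.of_cltCondition hf hf0 hz hcond
  have hfm : ∀ j, Measurable (f j) := fun j => (hf j).continuous.measurable
  have hS := H.posSemidef hf hf0
  have hN : IsProbabilityMeasure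
      ((multivariateGaussian 0 (θ • secondMoments f)).map (toComplexVector d)) :=
    Measure.isProbabilityMeasure_map (toComplexVector d).measurable.aemeasurable
  refine ⟨⟨_, hN⟩, ?_, ?_⟩
  · refine isLimitLaw_map_multivariateGaussian (hS.smul hθ.le) (fun a b hab => ?_) fun j k k' => ?_
    · rw [Matrix.smul_apply, smul_eq_mul, secondMoments_apply_of_ne hfm hab]
    · rw [Matrix.smul_apply, smul_eq_mul, secondMoments_apply_same hfm]
  · exact tendstoInDistribution_w2 hθ hfm φ (Q.map z) hS (H.cesaroMoments hf hf0) P σ T hσ hT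
      hTindep hTσ
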